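/- **Setting.** $\mathcal J^1(S^1)=\{(x,y,z): x\in S^1=[0,1]/(0\sim1)\}$ carries the contact structure $\ker(dz-y\,dx)$; Legendrian links are given by their fronts ($xz$-projections). *Rational tangles.* Let $a_1,\dots,a_n$, $v_1,\dots,v_{n-1}$, $p_1,\dots,p_{n-1}$ be non-negative integers, $n\ge 1$, $p_i\le a_i$. The two-strand Legendrian tangle $(a_n,v_{n-1},a_{n-1}^{p_{n-1}},\dots,v_1,a_1^{p_1})$ is defined by its front, recursively. $(a_n)$ is a row of $a_n$ crossings of two strands. Given the tangle $T=(a_n,\dots,a_{i+1}^{p_{i+1}})$, first add $v_i$ vertical crossings below it: the two lower ends of $T$ enter, through cusps, a vertical column of $v_i$ crossings below $T$ (consecutive crossings of the column being joined by a left and a right cusp, so that $v_i$ left cusps and $v_i$ right cusps are added), and the two ends at the bottom of the column become the new lower ends. Then add a row of $a_i$ crossings on the right, and finally do $p_i$ horizontal flypes, each of which rotates the tangle to the left of this row by $180^\circ$ about a horizontal axis ($z\mapsto -z$ in the front) and transfers one crossing of the row from the right of that tangle to its left. The same symbol denotes the link obtained by identifying the left and right ends. For two such links, $L_1\# L_2$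 is the closure of the tangle of $L_1$ followed, on its right, by the tangle of $L_2$. *DGA and polynomials.* The resolved diagram of a front with $n$ strands at $x=0\sim1$ is obtained by appending at the right end the tangle $T_n$ in which, for $q=2,\dots,n$ in turn, the $q$-th strand from the bottom descends across all lower strands and comes back up, always as the overstrand. Its vertices are the crossings and the right cusps; the ascending crossings of $T_n$ are called special, all other crossings (at which the strand of lesser slope is the overstrand) normal. The DGA is the free unital non-commutative $\mathbb Z/2$-algebra on the vertices with the Chekanov–Eliashberg differential: $\partial a$ is the sum, over the immersed disks in the resolved diagram (right cusps being resolved into a crossing followed by a small loop) with convex corners whose only positive corner is at $a$, of the words of their negative corners in counterclockwise order. The degree of a right cusp is $1$, and that of a crossing is $c(\gamma^u)-c(\gamma^o)$, minus $1$ if it is special. Here $\gamma^o,\gamma^u$ are paths along the link from the crossing, starting on the over- and the understrand, to base points, and $c$ counts the cusps passed upwards minus those passed downwards. For a knot of rotation number $0$ there is one, arbitrary, base point; for a two-component link $(2h_n,\dots,2h_1^{p_1})$ as below the base points are the leftmost points of the two components. An augmentation of a knot is an algebra map $\varepsilon$ from its DGA to $\mathbb Z/2$ with $\varepsilon\circ\partial=0$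 that vanishes on elements of non-zero degree; an augmentation of a link consists of augmentations of its components, extended by $0$ to the crossings between different components. Let $\partial^1_\varepsilon$ be the first-order part of $\partial$ after the substitution $a\mapsto a+\varepsilon(a)$, acting on the graded $\mathbb Z/2$-vector space $V$ generated by the vertices, and $\chi_\varepsilon(\lambda)=\sum_k\dim H_k(V,\partial^1_\varepsilon)\lambda^k$ the Poincaré–Chekanov polynomial. For a two-component link $(\Lambda_1,\Lambda_2)$, with $\Lambda_1$ the component through the lower and $\Lambda_2$ the one through the upper point at $x=0$, let $\chi^+_\varepsilon$ (resp. $\chi^-_\varepsilon$) be the same polynomial for the subcomplex generated by the crossings with overstrand in $\Lambda_1$ and understrand in $\Lambda_2$ (resp. overstrand in $\Lambda_2$ and understrand in $\Lambda_1$). If there is an augmentation and the polynomial is the same for all augmentations, the subscript $\varepsilon$ is omitted. **Theorem.** Consider the Legendrian link and the Legendrian knot $$L_1=(2h_n,v_{n-1},2h_{n-1}^{p_{n-1}},\dots,v_1,2h_1^{p_1}),\qquad L_2=(2k_m,u_{m-1},2k_{m-1}^{w_{m-1}},\dots,u_1,(2k_1-1)^{w_1}),$$ where $n,m\ge1$;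 $h_1\ge 0$, $h_i\ge1$ for $2\le i\le n$, $v_i\ge 1$ and $0\le p_i\le 2h_i$ for $1\le i<n$; $k_i\ge1$ for $1\le i\le m$, $u_i\ge1$ for $1\le i<m$, and $0\le w_1\le 2k_1-1$ (if $m>1$), $0\le w_i\le 2k_i$ for $1<i<m$. Then $L_1$, $L_2$ and the knot $L_1\# L_2$ have augmentations, the polynomials $\chi^\pm(\lambda)[L_1]$, $\chi(\lambda)[L_2]$ and $\chi(\lambda)[L_1\# L_2]$ do not depend on the augmentation, and $$\chi(\lambda)[L_1\# L_2]=\begin{cases}\chi^+(\lambda)[L_1]+\chi^-(\lambda)[L_1]+\chi(\lambda)[L_2], & h_1\ge1,\\ \chi^+(\lambda)[L_1]+\chi^-(\lambda)[L_1]-(\lambda^{-1}+1)+\chi(\lambda)[L_2], & h_1=0.\end{cases}$$ -/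

import Mathlib

open scoped LaurentPolynomial

noncomputable section

namespace SolidTorus

/-! ### Fronts in the cylinder and Legendrian rational tangles

A front in `S¹ × ℝ` is read from left to right along `S¹ = [0,1]/(0∼1)`.  On a generic vertical line
the strands are numbered `0, 1, 2, …` from bottom to top. -/

/-- The singularities of a generic front. `cross k`: strands `k` and `k+1` cross. `lcusp k`: a left
cusp creates two strands, which become strands `k` and `k+1`. `rcusp k`: strands `k` and `k+1`
merge in a right cusp. -/
inductive FrontEvent where
  | cross (k : ℕ)
  | lcusp (k : ℕ)
  | rcusp (k : ℕ)

namespace FrontEvent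

/-- Move a singularity up past `c` new strands inserted below it. -/
def raise (c : ℕ) : FrontEvent → FrontEvent
  | cross k => cross (k + c)
  | lcusp k => lcusp (k + c)
  | rcusp k => rcusp (k + c)

end FrontEvent

/-- The singularities of a front tangle, from left to right. -/
abbrev FrontWord := List FrontEvent

/-- The front tangle rotated by `180°` about a horizontal axis (`z ↦ -z` in the front), where `w`
is the number of strands at the left end. -/
def flip : ℕ → FrontWord → FrontWord
  | _, [] => []
  | w, .cross k :: T => .cross (w - 2 - k) :: flip w T
  | w, .lcusp k :: T => .lcusp (w - k) :: flip (w + 2) T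
  | w, .rcusp k :: T => .rcusp (w - 2 - k) :: flip (w - 2) T

/-- A row of `a` horizontal crossings of two strands. -/
def horizontal (a : ℕ) : FrontWord := List.replicate a (.cross 0)

/-- Vertical addition of `v` crossings below the two-strand tangle `T`: the two lower ends of `T`
enter, through cusps, a vertical column of `v` crossings below `T`, and the two ends at the bottom of
the column are the new lower ends. Altogether `v` left cusps, `v` crossings and `v` right cusps are
added. -/
def vertical (v : ℕ) (T : FrontWord) : FrontWord :=
  List.replicate v (.lcusp 1) ++ (List.range v).map (fun i => .cross (2 * i)) ++
    T.map (FrontEvent.raise (2 * v)) ++ List.replicate v (.rcusp 1)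

/-- Vertical addition of `v` crossings, then horizontal addition of `a` crossings on the right, then
`p` successive horizontal flypes: each one rotates the tangle by `180°` about a horizontal axis
and transfers one of the crossings from its right to its left. -/
def addLevel (v a p : ℕ) (T : FrontWord) : FrontWord :=
  horizontal p ++ (flip 2)^[p] (vertical v T) ++ horizontal (a - p)

/-- The tangle `(a_{i+l}, v_{i+l-1}, a_{i+l-1}^{p_{i+l-1}}, …, v_i, a_i^{p_i})`. -/
def tangleFrom (a v p : ℕ → ℕ) : (i l : ℕ) → FrontWord
  | i, 0 => horizontal (a i)
  | i, l + 1 => addLevel (v i) (a i) (p i) (tangleFrom a v p (i + 1) l)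

/-- The flyped Legendrian rational tangle `(a_n, v_{n-1}, a_{n-1}^{p_{n-1}}, …, v_1, a_1^{p_1})`,
for `n ≥ 1`. -/
def rationalTangle (n : ℕ) (a v p : ℕ → ℕ) : FrontWord := tangleFrom a v p 1 (n - 1)

/-! ### Resolution -/

/-- The singularities of the `xy`-projection with respect to `x`. `cross s k`: strands `k` and `k+1`
cross; the crossing is *normal* (the overstrand is the one of lesser slope) if `s = false` and
*special* (the overstrand is the one of greater slope) if `s = true`. `cup k`: a point with vertical
tangent at which two strands, then `k` and `k+1`, start. `cap k`: a point with vertical tangent at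
which strands `k` and `k+1` end. -/
inductive Event where
  | cross (special : Bool) (k : ℕ)
  | cup (k : ℕ)
  | cap (k : ℕ)

/-- An `xy`-diagram in the cylinder: the number of strands on the line `x = 0 ∼ 1` and the
singularities from left to right. -/
structure Diagram where
  strands : ℕ
  events : List Event

/-- Resolution of a front singularity: crossings become normal crossings, left cusps are smoothed,
and a right cusp becomes a normal crossing followed by a cap. -/
def FrontEvent.resolve : FrontEvent → List Event
  | .cross k => [.cross false k]
  | .lcusp k => [.cup k]
  | .rcusp k => [.cross false k, .cap k]

/-- The transition tangle `T_n`: for `q = 2, …, n` in turn, the `q`-th strand from the bottom goes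
down across all strands below it (normal crossings) and comes back up (special crossings). -/
def transition (n : ℕ) : List Event :=
  (List.range n).flatMap fun q =>
    (List.range q).reverse.map (Event.cross false) ++ (List.range q).map (Event.cross true)

/-- The resolved diagram of the closure in the cylinder of a front tangle with `n` strands at either
end. -/
def resolution (n : ℕ) (F : FrontWord) : Diagram :=
  ⟨n, F.flatMap FrontEvent.resolve ++ transition n⟩

/-- The resolved diagram of the closure of the flyped rational tangle
`(a_n, v_{n-1}, a_{n-1}^{p_{n-1}}, …, v_1, a_1^{p_1})`. -/
def rational (n : ℕ) (a v p : ℕ → ℕ) : Diagram := resolution 2 (rationalTangle n a v p)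

/-- The resolved diagram of the connect sum: the closure of one two-strand tangle followed by
another. -/
def connectSum (F G : FrontWord) : Diagram := resolution 2 (F ++ G)

/-! ### Strands, components, Maslov potentials -/

/-- The effect of a crossing of strands `k`, `k+1` on the numbering of the strands. -/
def swap (k i : ℕ) : ℕ := if i = k then k + 1 else if i = k + 1 then k else i

/-- The effect of the birth of strands `k`, `k+1` on the numbering of the other strands. -/
def shift (k i : ℕ) : ℕ := if i < k then i else i + 2

/-- The two horizontal directions. -/
inductive Side where
  | left
  | right

/-- The opposite direction. -/
def Side.opp : Side → Side
  | .left => .right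
  | .right => .left

/-- An event as it is met by a point that moves in a given direction: a crossing, a place where
strands `k`, `k+1` start, or a place where they end. -/
inductive View where
  | cross (special : Bool) (k : ℕ)
  | birth (k : ℕ)
  | death (k : ℕ)

/-- How an event looks from a given direction of travel. -/
def Event.view : Event → Side → View
  | .cross b k, _ => .cross b k
  | .cup k, .right => .birth k
  | .cup k, .left => .death k
  | .cap k, .right => .death k
  | .cap k, .left => .birth k

namespace Diagram

variable (D : Diagram)

/-- The vertical line numbered `e` lies directly to the left of event `e`; the line directly to its
right is number `e + 1`, read cyclically. -/
def lineAfter (e : ℕ) : ℕ := (e + 1) % D.events.length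

/-- A segment of the diagram: `(t, i)` is the `i`-th strand on the vertical line number `t`. -/
abbrev Seg := ℕ × ℕ

/-- `Joined s s' c`: the segments `s` and `s'` are adjacent on the link, and `c` is the number of
cusps of the front passed upwards, minus those passed downwards, on the way from `s` to `s'`.
At a cap, which together with the crossing before it represents a right cusp, strand `k`
belongs to the upper branch of that cusp. -/
inductive Joined : Seg → Seg → ℤ → Prop
  | cross {e k : ℕ} {b : Bool} (i : ℕ) (h : D.events[e]? = some (.cross b k)) :
      Joined (e, i) (D.lineAfter e, swap k i) 0
  | cup {e k : ℕ} (i : ℕ) (h : D.events[e]? = some (.cup k)) :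
      Joined (e, i) (D.lineAfter e, shift k i) 0
  | cap {e k : ℕ} (i : ℕ) (h : D.events[e]? = some (.cap k)) :
      Joined (e, shift k i) (D.lineAfter e, i) 0
  | leftCusp {e k : ℕ} (h : D.events[e]? = some (.cup k)) :
      Joined (D.lineAfter e, k) (D.lineAfter e, k + 1) 1
  | rightCusp {e k : ℕ} (h : D.events[e]? = some (.cap k)) :
      Joined (e, k + 1) (e, k) 1

/-- Two segments lie on the same component of the link. -/
def SameComponent : Seg → Seg → Prop := Relation.EqvGen fun s s' => ∃ c, D.Joined s s' c

/-- The component through the `i`-th strand from the bottom on the line `x = 0`. -/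
def component (i : ℕ) : Set Seg := {s | D.SameComponent (0, i) s}

/-- A Maslov potential: along the link it goes up by one at each cusp passed upwards and down by
one at each cusp passed downwards, so that its differences are the cusp counts of paths. -/
def IsMaslov (μ : Seg → ℤ) : Prop := ∀ s s' c, D.Joined s s' c → μ s' = μ s + c

/-! ### Vertices, immersed disks and the differential graded algebra -/

/-- The vertices: all crossings, that is the crossings of the front, the crossings that
represent right cusps, and the crossings of the transition tangle. -/
def Vertex : Type := {e : ℕ // ∃ b k, D.events[e]? = some (.cross b k)}

variable {D}

/-- The vertex is a special crossing. -/
def Vertex.IsSpecial (a : D.Vertex) : Prop := ∃ k, D.events[a.1]? = some (.cross true k)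

/-- The vertex is a crossing of strands `k` and `k + 1`. -/
def Vertex.pos (a : D.Vertex) : ℕ := a.2.choose_spec.choose

open Classical in
/-- The overstrand directly to the left of the vertex: the descending one at a normal crossing, the
ascending one at a special crossing. -/
def Vertex.over (a : D.Vertex) : Seg := (a.1, if a.IsSpecial then a.pos else a.pos + 1)

open Classical in
/-- The understrand directly to the left of the vertex. -/
def Vertex.under (a : D.Vertex) : Seg := (a.1, if a.IsSpecial then a.pos + 1 else a.pos)

open Classical in
/-- The degree of a vertex: with `γᵒ`, `γᵘ` paths from the vertex along the over- and understrand
to points where `μ` has the same value, `c(γᵘ) - c(γᵒ)`, and `1` less at a special crossing. -/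
def Vertex.deg (μ : Seg → ℤ) (a : D.Vertex) : ℤ :=
  μ a.over - μ a.under - if a.IsSpecial then 1 else 0

variable (D)

/-- From the line `t` in direction `s`, the next event is number `e`, it looks like `V`, and the line
behind it is `t'`. -/
structure Ahead (s : Side) (t e t' : ℕ) (V : View) : Prop where
  event : ∃ E, D.events[e]? = some E ∧ E.view s = V
  lines : match s with
    | .right => t = e ∧ t' = D.lineAfter e
    | .left => t = D.lineAfter e ∧ t' = e

/-- Cut an admissible immersed disk along the preimages of all the vertical lines. These are arcs, each
mapped to the segment between two strands `i < j` of some line `t`. The pieces are disks glued along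
such arcs, in the pattern of a tree, and each piece is determined by what its boundary does at one
event. `SubDisk s t i j` is the type of all disks bounded by an arc over `(t, i, j)` and a path
in the link, which lie in direction `s` of that arc, are immersed, and all of whose corners are convex
and negative. Negative are the upper and lower quadrants of a normal crossing and the left and right
quadrants of a special one. The constructors list the possible pieces next to the arc. -/
inductive SubDisk : Side → ℕ → ℕ → ℕ → Type
  /-- the disk ends in a corner at a special crossing -/
  | corner {s t i j e t' k} (h : D.Ahead s t e t' (.cross true k)) (hi : i = k) (hj : j = k + 1) :
      SubDisk s t i j
  /-- the disk passes a crossing without a corner -/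
  | pass {s t i j e t' b k} (h : D.Ahead s t e t' (.cross b k)) (hij : i < j)
      (d : SubDisk s t' (swap k i) (swap k j)) : SubDisk s t i j
  /-- the lower boundary has a corner in the upper quadrant of a normal crossing -/
  | lowerCorner {s t i j e t' k} (h : D.Ahead s t e t' (.cross false k)) (hi : i = k + 1)
      (d : SubDisk s t' i j) : SubDisk s t i j
  /-- the upper boundary has a corner in the lower quadrant of a normal crossing -/
  | upperCorner {s t i j e t' k} (h : D.Ahead s t e t' (.cross false k)) (hj : j = k)
      (d : SubDisk s t' i j) : SubDisk s t i j
  /-- the disk ends at a vertical tangent -/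
  | close {s t i j e t' k} (h : D.Ahead s t e t' (.death k)) (hi : i = k) (hj : j = k + 1) :
      SubDisk s t i j
  /-- the boundary does not meet the end of strands `k`, `k+1` -/
  | passDeath {s t i j e t' k i' j'} (h : D.Ahead s t e t' (.death k)) (hi : i = shift k i')
      (hj : j = shift k j') (d : SubDisk s t' i' j') : SubDisk s t i j
  /-- the upper boundary turns back around the end of strands `k`, `k+1`, with the disk outside -/
  | turnUpper {s t i j e t' k j'} (h : D.Ahead s t e t' (.death k)) (hj : j = k) (hi : i < k)
      (hj' : k ≤ j') (d : SubDisk s t' i j') (d' : SubDisk s.opp t (k + 1) (j' + 2)) :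
      SubDisk s t i j
  /-- the lower boundary turns back around the end of strands `k`, `k+1`, with the disk outside -/
  | turnLower {s t i j e t' k i' j'} (h : D.Ahead s t e t' (.death k)) (hi : i = k + 1)
      (hj : j = j' + 2) (hj' : k ≤ j') (hi' : i' < k)
      (d : SubDisk s t' i' j') (d' : SubDisk s.opp t i' k) : SubDisk s t i j
  /-- the boundary does not meet the start of strands `k`, `k+1` -/
  | passBirth {s t i j e t' k} (h : D.Ahead s t e t' (.birth k))
      (d : SubDisk s t' (shift k i) (shift k j)) : SubDisk s t i j
  /-- the disk is split in two by the start of strands `k`, `k+1` -/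
  | split {s t i j e t' k} (h : D.Ahead s t e t' (.birth k)) (hi : i < k) (hj : k ≤ j)
      (upper : SubDisk s t' (k + 1) (j + 2)) (lower : SubDisk s t' i k) : SubDisk s t i j

variable {D}

theorem Ahead.isVertex {s : Side} {t e t' k : ℕ} {b : Bool} (h : D.Ahead s t e t' (.cross b k)) :
    ∃ b k, D.events[e]? = some (.cross b k) := by
  obtain ⟨E, hE, hV⟩ := h.event
  cases E with
  | cross b' k' => exact ⟨b', k', hE⟩
  | cup k' => cases s <;> simp [Event.view] at hV
  | cap k' => cases s <;> simp [Event.view] at hV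

/-- The corners of the disk in the order along its boundary path in the link from the upper to the
lower end of the arc. For a disk to the left of the arc this is the counterclockwise order, for a disk
to the right it is the clockwise order. -/
def SubDisk.word : {s : Side} → {t i j : ℕ} → D.SubDisk s t i j → List D.Vertex
  | _, _, _, _, .corner h _ _ => [⟨_, h.isVertex⟩]
  | _, _, _, _, .pass _ _ d => d.word
  | _, _, _, _, .lowerCorner h _ d => d.word ++ [⟨_, h.isVertex⟩]
  | _, _, _, _, .upperCorner h _ d => ⟨_, h.isVertex⟩ :: d.word
  | _, _, _, _, .close _ _ _ => []
  | _, _, _, _, .passDeath _ _ _ d => d.word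
  | _, _, _, _, .turnUpper _ _ _ _ d d' => d'.word.reverse ++ d.word
  | _, _, _, _, .turnLower _ _ _ _ _ d d' => d.word ++ d'.word.reverse
  | _, _, _, _, .passBirth _ d => d.word
  | _, _, _, _, .split _ _ _ d d' => d.word ++ d'.word

/-- The admissible disks with initial vertex (the only positive corner) `a`. Positive are the left
and right quadrants of a normal crossing and the upper and lower quadrants of a special one. The disk
that fills the loop of the resolved right cusp is one of them; it is the term `1` in the
differential of a right cusp. -/
inductive Disk (a : D.Vertex) : Type
  | left {k : ℕ} (h : D.events[a.1]? = some (.cross false k))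
      (d : D.SubDisk .left a.1 k (k + 1)) : Disk a
  | right {k : ℕ} (h : D.events[a.1]? = some (.cross false k))
      (d : D.SubDisk .right (D.lineAfter a.1) k (k + 1)) : Disk a
  | upper {k j : ℕ} (h : D.events[a.1]? = some (.cross true k)) (hj : k + 1 < j)
      (d : D.SubDisk .right (D.lineAfter a.1) (k + 1) j) (d' : D.SubDisk .left a.1 (k + 1) j) :
      Disk a
  | lower {k i : ℕ} (h : D.events[a.1]? = some (.cross true k)) (hi : i < k)
      (d : D.SubDisk .left a.1 i k) (d' : D.SubDisk .right (D.lineAfter a.1) i k) : Disk a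

/-- The negative corners of the disk in counterclockwise order, from just after the initial vertex
on. -/
def Disk.word {a : D.Vertex} : Disk a → List D.Vertex
  | .left _ d => d.word
  | .right _ d => d.word.reverse
  | .upper _ _ d d' => d.word.reverse ++ d'.word
  | .lower _ _ d d' => d.word ++ d'.word.reverse

variable (D)

/-- The free unital noncommutative algebra over `ℤ/2` generated by the vertices. -/
abbrev Alg : Type := FreeAlgebra (ZMod 2) D.Vertex

variable {D}

/-- The generator of the algebra that corresponds to a vertex. -/
def Vertex.gen (a : D.Vertex) : D.Alg := FreeAlgebra.ι (ZMod 2) a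

/-- The differential of a generator: the sum of the words of all (finitely many) disks with initial
vertex `a`. -/
def Vertex.bdry (a : D.Vertex) : D.Alg := ∑ᶠ d : Disk a, (d.word.map Vertex.gen).prod

variable (D)

/-- The differential, extended to the algebra by the Leibniz rule: `x ↦ x + (∂x) ε` is the algebra
map into the dual numbers over the algebra that has the given values on generators. -/
def differential : D.Alg →ₗ[ZMod 2] D.Alg :=
  ((TrivSqZeroExt.sndHom D.Alg D.Alg).restrictScalars (ZMod 2)) ∘ₗ
    (FreeAlgebra.lift (ZMod 2) fun a : D.Vertex =>
      (TrivSqZeroExt.inl a.gen + TrivSqZeroExt.inr a.bdry : TrivSqZeroExt D.Alg D.Alg)).toLinearMap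

/-! ### Augmentations and Poincaré–Chekanov polynomials -/

/-- An augmentation with respect to the grading given by `μ`. For a link it is required to vanish on
the crossings between different components; a disk all of whose corners are self-crossings
of one component has its boundary on that component, so this is the same as a collection of
augmentations of the individual components. -/
structure IsAugmentation (μ : Seg → ℤ) (ε : D.Alg →ₐ[ZMod 2] ZMod 2) : Prop where
  comp_differential : ∀ x, ε (D.differential x) = 0
  degree : ∀ a : D.Vertex, a.deg μ ≠ 0 → ε a.gen = 0
  mixed : ∀ a : D.Vertex, ¬ D.SameComponent a.over a.under → ε a.gen = 0

/-- The vector space over `ℤ/2` generated by the vertices. -/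
abbrev Space : Type := D.Vertex →₀ ZMod 2

/-- The part of `V` spanned by the vertices of degree `k` with overstrand in `A` and understrand
in `B`. -/
def piece (μ : Seg → ℤ) (A B : Set Seg) (k : ℤ) : Submodule (ZMod 2) D.Space :=
  Submodule.span (ZMod 2)
    ((fun a => Finsupp.single a 1) '' {a : D.Vertex | a.deg μ = k ∧ a.over ∈ A ∧ a.under ∈ B})

/-- The first-order part of an element of the free algebra. -/
def firstOrder : D.Alg →ₗ[ZMod 2] D.Space :=
  (TrivSqZeroExt.sndHom (ZMod 2) D.Space) ∘ₗ
    (FreeAlgebra.lift (ZMod 2) fun a : D.Vertex =>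
      (TrivSqZeroExt.inr (Finsupp.single a 1) : TrivSqZeroExt (ZMod 2) D.Space)).toLinearMap

/-- The substitution `a ↦ a + ε(a)`. -/
def substitution (ε : D.Alg →ₐ[ZMod 2] ZMod 2) : D.Alg →ₐ[ZMod 2] D.Alg :=
  FreeAlgebra.lift (ZMod 2) fun a : D.Vertex => a.gen + algebraMap (ZMod 2) D.Alg (ε a.gen)

/-- The linearized differential `∂¹_ε`. -/
def linDiff (ε : D.Alg →ₐ[ZMod 2] ZMod 2) : D.Space →ₗ[ZMod 2] D.Space :=
  Finsupp.linearCombination (ZMod 2) fun a : D.Vertex =>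
    D.firstOrder (D.substitution ε (D.differential a.gen))

/-- The dimension of `Z / I` for subspaces `I ⊆ Z` of a vector space. -/
def quotientDim {K V : Type} [Field K] [AddCommGroup V] [Module K V] (Z I : Submodule K V) : ℕ :=
  Module.finrank K (Z ⧸ I.comap Z.subtype)

/-- The dimension of the `k`-th linearized homology of the part `(A, B)`. -/
def betti (μ : Seg → ℤ) (ε : D.Alg →ₐ[ZMod 2] ZMod 2) (A B : Set Seg) (k : ℤ) : ℕ :=
  quotientDim (D.piece μ A B k ⊓ LinearMap.ker (D.linDiff ε))
    ((D.piece μ A B (k + 1)).map (D.linDiff ε))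

/-- The first-order Poincaré–Chekanov polynomial of the part `(A, B)`. -/
def chekanovPoly (μ : Seg → ℤ) (ε : D.Alg →ₐ[ZMod 2] ZMod 2) (A B : Set Seg) : ℤ[T;T⁻¹] :=
  ∑ᶠ k : ℤ, (D.betti μ ε A B k : ℤ[T;T⁻¹]) * LaurentPolynomial.T k

/-- The set of Poincaré–Chekanov polynomials of a knot (of rotation number `0`) for all
augmentations. The grading does not depend on the choice of the potential. -/
def knotPolys : Set ℤ[T;T⁻¹] :=
  {P | ∃ μ ε, D.IsMaslov μ ∧ D.IsAugmentation μ ε ∧ P = D.chekanovPoly μ ε Set.univ Set.univ}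

/-- The set of split Poincaré–Chekanov polynomials, for all augmentations, of a link whose components
meet the line `x = 0` in one point each: `splitPolys i j` belongs to the vertices with overstrand in
the component through the `i`-th and understrand in the component through the `j`-th of these points,
counted from the bottom. The base points for the grading are the leftmost points of the components. -/
def splitPolys (i j : ℕ) : Set ℤ[T;T⁻¹] :=
  {P | ∃ μ ε, D.IsMaslov μ ∧ (∀ l < D.strands, μ (0, l) = 0) ∧ D.IsAugmentation μ ε ∧
    P = D.chekanovPoly μ ε (D.component i) (D.component j)}

end Diagram

/-- `χ⁺ = χ^{12}`, where the first component is the one that is at the bottom at `x = 0`. -/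
def chiPlus (D : Diagram) : Set ℤ[T;T⁻¹] := D.splitPolys 0 1

/-- `χ⁻ = χ^{21}`. -/
def chiMinus (D : Diagram) : Set ℤ[T;T⁻¹] := D.splitPolys 1 0

end SolidTorus

end

/-!
The differential is computed by matrices. In a resolved diagram with two strands at `x = 0`, the
only immersed disks that lie to the right of an arc are the loops of the resolved right cusps
(`right_subDisk`): going to the right, a disk could end only at a cap, just before which its
boundary crosses itself. All other disks lie to the left of their positive corner. The disks to the
left of a vertical line are counted by a strictly upper triangular matrix `N`, with an entry for
each pair of strands, which changes by `crossStep`, `cupStep` and `capStep` at the events of the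
diagram (`Resolved.wordSum_left`). The differential of a crossing of strands `k`, `k + 1` is the
entry `N k (k + 1)`, and one more at a right cusp. The linearization of `N` satisfies `∂N = N²` on
each line (`sqMat_linMat`), which gives `∂² = 0` for the linearized differential.

An augmentation `ε` makes the entries of `N` elements of the dual numbers `ℤ/2 ⊕ V`, through the
substitution `a ↦ ε(a) + a` up to first order. Right cusps have degree one, so `ε` vanishes on them.
Divide `V` by the subspace `U` that is spanned by the crossings `c` of the right cusps and by their
differentials. Modulo `U`, these crossings have weight zero and their entries `N k (k + 1)` are one,
so that a right cusp is a step of Gaussian elimination (`elimStep`). With such steps a rational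
tangle acts on its two strands through a `2 × 2` matrix of determinant one (`Tang.act`): a row
crossing of weight `x` through `(x 1; 1 0)`, and in a vertical sum the pivot condition determines
the weight `x` of the new column crossing from the matrix of the tangle above it, and the sum acts
through `(x 0; 0 x)` (`actAt_vert`). If the entry between the two strands vanishes at the left end,
then all entries at crossings vanish, and the weights of the column crossings are determined by
those of the row crossings. Since there are as many column crossings as right cusps, `V` has a basis
that consists of the right cusps, their differentials, the row crossings, and the special and the
normal crossing `s`, `t` of the transition tangle, and `∂` maps the row crossings to `U`, up to `s`.

It remains to see `∂t`, which is the entry at the right end, plus `s`. If the last level of the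
tangle has a row crossing, the entry is zero there and remains so; then `∂t = s` modulo `U`, and the
homology is that of the row crossings (`Word.chekanovPoly_of_row`). If the last level has none, the
entry is `s` at both ends of the tangle, `∂t = 0`, and both `s` and `t` survive, in degrees `-1` and
`0` (`Word.chekanovPoly_of_vertical`). In both of them the overstrand belongs to the upper and the
understrand to the lower component, so that they contribute to `χ⁻`.

So every polynomial is a sum of powers given by the degrees of the row crossings. The Maslov
potential along a tangle is determined by its values on the two strands at one end, and so is the
partition of the strands into components (`Tang.line_labels`). Hence the sum over the row crossings
of a tangle, `Tang.rowPoly`, is the same in all closures in which the two strands start with the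
same potential, and it is additive for the connect sum. For a knot it is the whole polynomial. In a
link with two components each row crossing is a crossing of different components, so that the sum is
that of `χ⁺` and `χ⁻`, up to the term `λ⁻¹ + 1` for `s` and `t`. Finally, the column crossings have
degree zero and join a component to itself, and the algebra map that is `1` on them and `0`
elsewhere is an augmentation (`Word.standardAug`).
-/

namespace SolidTorus

/-! ### The matrix of a vertical line -/

variable {R : Type*} [CommRing R]

/-- Exchange of the positions `k`, `k + 1`. -/
def swapZ (k i : ℤ) : ℤ := if i = k then k + 1 else if i = k + 1 then k else i

/-- Position of the `i`-th strand after two strands have been inserted at `k`, `k + 1`. -/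
def shiftZ (k i : ℤ) : ℤ := if i < k then i else i + 2

/-- Inverse of `shiftZ k`, with junk values at `k` and `k + 1`. -/
def unshiftZ (k i : ℤ) : ℤ := if i < k then i else i - 2

/-- Matrices with rows and columns indexed by the positions of strands. The entry `(i, j)` at a vertical
line is the sum of the weights of the disks to the left of the line that are bounded by an arc from
strand `i` to strand `j`. Indices range over `ℤ`, so that strands can be renumbered freely. -/
abbrev Mat (R : Type*) := ℤ → ℤ → R

/-- Strictly upper triangular matrices. -/
def StrictUpper (N : Mat R) : Prop := ∀ i j, j ≤ i → N i j = 0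

/-- The matrix to the right of a crossing of strands `k`, `k + 1` with weight `x`, computed from the
matrix `N` to its left. A disk passes the crossing without a corner, or has a corner at it: in the
upper quadrant, with its lower boundary, or in the lower quadrant, with its upper boundary. -/
def crossStep (k : ℤ) (x : R) (N : Mat R) : Mat R := fun i j =>
  if i < j then N (swapZ k i) (swapZ k j) + (if i = k + 1 then N i j * x else 0) +
    (if j = k then x * N i j else 0) else 0

/-- The matrix after the birth of strands `k`, `k + 1`: they bound one disk, with no corners, and no
other disk has a boundary on one of them. -/
def cupStep (k : ℤ) (N : Mat R) : Mat R := fun i j =>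
  if i = k ∧ j = k + 1 then 1
  else if i = k ∨ i = k + 1 ∨ j = k ∨ j = k + 1 then 0
  else N (unshiftZ k i) (unshiftZ k j)

/-- The matrix after the death of strands `k`, `k + 1`: a disk whose arc separates the two strands
is split by the cap into a disk above and a disk below it. -/
def capStep (k : ℤ) (N : Mat R) : Mat R := fun i j =>
  N (shiftZ k i) (shiftZ k j) + if i < k ∧ k ≤ j then N (k + 1) (j + 2) * N i k else 0

/-- The matrix after a crossing of strands `k`, `k + 1` of weight `0` followed by their death, see
`capStep_crossStep_zero`. If `N k (k + 1) = 1`, this is a step of Gaussian elimination (in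
characteristic two). -/
def elimStep (k : ℤ) (N : Mat R) : Mat R := fun i j =>
  N (shiftZ k i) (shiftZ k j) + if i < k ∧ k ≤ j then N k (j + 2) * N i (k + 1) else 0

theorem StrictUpper.crossStep {N : Mat R} (k : ℤ) (x : R) : StrictUpper (crossStep k x N) := by
  intro i j hij
  simp [SolidTorus.crossStep, not_lt.2 hij]

theorem StrictUpper.cupStep {N : Mat R} (hN : StrictUpper N) (k : ℤ) :
    StrictUpper (cupStep k N) := by
  intro i j hij
  unfold SolidTorus.cupStep
  split_ifs with h1 h2
  · omega
  · rfl
  · apply hN; unfold unshiftZ; split_ifs <;> omega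

theorem StrictUpper.elimStep {N : Mat R} (hN : StrictUpper N) (k : ℤ) :
    StrictUpper (elimStep k N) := by
  intro i j hij
  unfold SolidTorus.elimStep
  rw [if_neg (by omega), hN, add_zero]
  unfold shiftZ; split_ifs <;> omega

theorem StrictUpper.capStep {N : Mat R} (hN : StrictUpper N) (k : ℤ) :
    StrictUpper (capStep k N) := by
  intro i j hij
  unfold SolidTorus.capStep
  rw [if_neg (by omega), hN, add_zero]
  unfold shiftZ; split_ifs <;> omega

/-- A right cusp whose vertex has weight `0` exchanges the two strands before it caps them. -/
theorem capStep_crossStep_zero {N : Mat R} (hN : StrictUpper N) (k : ℤ) :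
    capStep k (crossStep k 0 N) = elimStep k N := by
  have hs : ∀ i, swapZ k (shiftZ k i) = shiftZ k i := by
    intro i; unfold swapZ shiftZ; split_ifs <;> omega
  have hlt : ∀ i j, shiftZ k i < shiftZ k j ↔ i < j := by
    intro i j; unfold shiftZ; split_ifs <;> omega
  funext i j
  unfold capStep elimStep
  congr 1
  · unfold crossStep
    simp only [hs, hlt, mul_zero, zero_mul, ite_self, add_zero]
    split_ifs with h
    · rfl
    · rw [hN]; have := hlt j i; rw [← not_lt, hlt]; exact h
  · split_ifs with h
    · have e1 : swapZ k (j + 2) = j + 2 := by unfold swapZ; split_ifs <;> omega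
      have e2 : swapZ k i = i := by unfold swapZ; split_ifs <;> omega
      have e3 : swapZ k (k + 1) = k := by simp [swapZ]
      have e4 : swapZ k k = k + 1 := by simp [swapZ]
      simp [crossStep, e1, e2, e3, e4, h.1, show k + 1 < j + 2 by omega]
    · rfl

/-! ### Tangles with weights -/

/-- The singularities of a front tangle, each with a payload in `α`: a crossing of strands `k`, `k +
1` in a horizontal row (`row`) or in a vertical column (`col`), a left cusp (`cup`), or a right cusp
(`cusp`). The payload of a crossing or right cusp is the weight of its vertex or the label of a
strand; the payload of a left cusp is the label of its lower branch. -/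
inductive Ev (α : Type*) where
  | row (k : ℤ) (a : α)
  | col (k : ℤ) (a : α)
  | cup (k : ℤ) (a : α)
  | cusp (k : ℤ) (a : α)

namespace Ev
variable {α β : Type*}

/-- Move a singularity up past `c` new strands inserted below it. -/
def raise (c : ℤ) : Ev α → Ev α
  | row k a => row (k + c) a
  | col k a => col (k + c) a
  | cup k a => cup (k + c) a
  | cusp k a => cusp (k + c) a

/-- Apply a map to the payload. -/
def map (f : α → β) : Ev α → Ev β
  | row k a => row k (f a)
  | col k a => col k (f a)
  | cup k a => cup k (f a)
  | cusp k a => cusp k (f a)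

/-- Change in the number of strands. -/
def gain : Ev α → ℤ
  | row _ _ => 0
  | col _ _ => 0
  | cup _ _ => 2
  | cusp _ _ => -2

/-- The image of a singularity under `z ↦ -z`, if there are `w` strands to its left. -/
def reflect (w : ℤ) : Ev α → Ev α
  | row k a => row (w - 2 - k) a
  | col k a => col (w - 2 - k) a
  | cup k a => cup (w - k) a
  | cusp k a => cusp (w - 2 - k) a

/-- The effect of a singularity on the matrix of the vertical line, if the vertices of all right
cusps have weight `0`. -/
def matStep : Ev R → Mat R → Mat R
  | row k x, N => crossStep k x N
  | col k x, N => crossStep k x N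
  | cup k _, N => cupStep k N
  | cusp k _, N => elimStep k N

/-- The matrix to the left of a right cusp has the entry `1` at the two strands that merge. -/
def Pivot : Ev R → Mat R → Prop
  | cusp k _, N => N k (k + 1) = 1
  | _, _ => True

/-- The matrix to the left of a crossing has the entry `0` at the two strands that cross. This entry
is the linearized differential of the crossing. -/
def Entry : Ev R → Mat R → Prop
  | row k _, N => N k (k + 1) = 0
  | col k _, N => N k (k + 1) = 0
  | _, _ => True

/-- The payload of a horizontal crossing satisfies `P`. -/
def rowWeight (P : α → Prop) : Ev α → Prop
  | row _ a => P a
  | _ => True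

/-- The payload of a column crossing satisfies `P`. -/
def colWeight (P : α → Prop) : Ev α → Prop
  | col _ a => P a
  | _ => True

theorem matStep_strictUpper {N : Mat R} (hN : StrictUpper N) (e : Ev R) :
    StrictUpper (e.matStep N) := by
  cases e
  · exact StrictUpper.crossStep _ _
  · exact StrictUpper.crossStep _ _
  · exact hN.cupStep _
  · exact hN.elimStep _

@[simp] theorem reflect_gain (w : ℤ) (e : Ev α) : (e.reflect w).gain = e.gain := by cases e <;> rfl

@[simp] theorem reflect_reflect (w : ℤ) (e : Ev α) : (e.reflect w).reflect w = e := by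
  cases e <;> simp [reflect]

@[simp] theorem raise_raise (c d : ℤ) (e : Ev α) : (e.raise c).raise d = e.raise (c + d) := by
  cases e <;> simp [raise, add_assoc]

@[simp] theorem raise_zero (e : Ev α) : e.raise 0 = e := by cases e <;> simp [raise]

theorem map_raise (f : α → β) (c : ℤ) (e : Ev α) : (e.raise c).map f = (e.map f).raise c := by
  cases e <;> rfl

theorem map_reflect (f : α → β) (w : ℤ) (e : Ev α) :
    (e.reflect w).map f = (e.map f).reflect w := by
  cases e <;> rfl

@[simp] theorem gain_map (f : α → β) (e : Ev α) : (e.map f).gain = e.gain := by cases e <;> rfl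
@[simp] theorem gain_raise (c : ℤ) (e : Ev α) : (e.raise c).gain = e.gain := by cases e <;> rfl

end Ev

/-- The singularities of a front tangle with payloads, from left to right. -/
abbrev Word (α : Type*) := List (Ev α)

namespace Word
variable {α β : Type*}

/-- Forget the payloads. -/
def erase (W : Word α) : Word Unit := W.map (Ev.map fun _ => ())

/-- Move a tangle up past `c` new strands inserted below it. -/
def raise (c : ℤ) (W : Word α) : Word α := W.map (Ev.raise c)

/-- The number of strands at the right end minus that at the left end. -/
def gain (W : Word α) : ℤ := (W.map Ev.gain).sum

/-- The image of a tangle with `w` strands at its left end under `z ↦ -z`. -/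
def reflect : ℤ → Word α → Word α
  | _, [] => []
  | w, e :: W => e.reflect w :: reflect (w + e.gain) W

/-- The matrix at the right end of a tangle, computed from the matrix at its left end. -/
def run : Word R → Mat R → Mat R
  | [], N => N
  | e :: W, N => run W (e.matStep N)

/-- The pivot condition holds at all right cusps. -/
def Pivots : Word R → Mat R → Prop
  | [], _ => True
  | e :: W, N => e.Pivot N ∧ Pivots W (e.matStep N)

/-- The entries at all crossings vanish. -/
def Entries : Word R → Mat R → Prop
  | [], _ => True
  | e :: W, N => e.Entry N ∧ Entries W (e.matStep N)

/-- The payloads of all horizontal crossings satisfy `P`. -/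
def RowWeights (P : α → Prop) (W : Word α) : Prop := ∀ e ∈ W, e.rowWeight P

/-- The payloads of all column crossings satisfy `P`. -/
def ColWeights (P : α → Prop) (W : Word α) : Prop := ∀ e ∈ W, e.colWeight P

theorem run_append (W W' : Word R) (N : Mat R) : run (W ++ W') N = run W' (run W N) := by
  induction W generalizing N with
  | nil => rfl
  | cons e W ih => simp [run, ih]

theorem pivots_append (W W' : Word R) (N : Mat R) :
    Pivots (W ++ W') N ↔ Pivots W N ∧ Pivots W' (run W N) := by
  induction W generalizing N with
  | nil => simp [Pivots, run]
  | cons e W ih => simp [Pivots, run, ih, and_assoc]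

theorem entries_append (W W' : Word R) (N : Mat R) :
    Entries (W ++ W') N ↔ Entries W N ∧ Entries W' (run W N) := by
  induction W generalizing N with
  | nil => simp [Entries, run]
  | cons e W ih => simp [Entries, run, ih, and_assoc]

theorem rowWeights_append {P : α → Prop} (W W' : Word α) :
    RowWeights P (W ++ W') ↔ RowWeights P W ∧ RowWeights P W' := by
  simp only [RowWeights, List.mem_append]
  exact ⟨fun h => ⟨fun e he => h e (.inl he), fun e he => h e (.inr he)⟩,
    fun h e he => he.elim (h.1 e) (h.2 e)⟩

theorem colWeights_append {P : α → Prop} (W W' : Word α) :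
    ColWeights P (W ++ W') ↔ ColWeights P W ∧ ColWeights P W' := by
  simp only [ColWeights, List.mem_append]
  exact ⟨fun h => ⟨fun e he => h e (.inl he), fun e he => h e (.inr he)⟩,
    fun h e he => he.elim (h.1 e) (h.2 e)⟩

theorem rowWeights_cons {P : α → Prop} (e : Ev α) (W : Word α) :
    RowWeights P (e :: W) ↔ e.rowWeight P ∧ RowWeights P W := by
  simp [RowWeights]

theorem colWeights_cons {P : α → Prop} (e : Ev α) (W : Word α) :
    ColWeights P (e :: W) ↔ e.colWeight P ∧ ColWeights P W := by
  simp [ColWeights]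

theorem run_strictUpper {N : Mat R} (hN : StrictUpper N) (W : Word R) :
    StrictUpper (run W N) := by
  induction W generalizing N with
  | nil => exact hN
  | cons e W ih => exact ih (Ev.matStep_strictUpper hN e)

theorem reflect_reflect (w : ℤ) (W : Word α) : reflect w (reflect w W) = W := by
  induction W generalizing w with
  | nil => rfl
  | cons e W ih => simp [reflect, ih]

theorem erase_append (W W' : Word α) : erase (W ++ W') = erase W ++ erase W' := by simp [erase]

theorem erase_reflect (w : ℤ) (W : Word α) : erase (reflect w W) = reflect w (erase W) := by
  induction W generalizing w with
  | nil => rfl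
  | cons e W ih =>
    have := ih (w + e.gain)
    simp only [erase] at this
    simp [erase, reflect, Ev.map_reflect, this]

theorem erase_raise (c : ℤ) (W : Word α) : erase (raise c W) = raise c (erase W) := by
  simp [erase, raise, Ev.map_raise]

theorem rowWeights_reflect {P : α → Prop} (w : ℤ) (W : Word α) :
    RowWeights P (reflect w W) ↔ RowWeights P W := by
  induction W generalizing w with
  | nil => rfl
  | cons e W ih => simp only [reflect, rowWeights_cons, ih]; cases e <;> rfl

theorem colWeights_reflect {P : α → Prop} (w : ℤ) (W : Word α) :
    ColWeights P (reflect w W) ↔ ColWeights P W := by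
  induction W generalizing w with
  | nil => rfl
  | cons e W ih => simp only [reflect, colWeights_cons, ih]; cases e <;> rfl

theorem rowWeights_raise {P : α → Prop} (c : ℤ) (W : Word α) :
    RowWeights P (raise c W) ↔ RowWeights P W := by
  induction W with
  | nil => rfl
  | cons e W ih =>
    rw [show raise c (e :: W) = e.raise c :: raise c W from rfl]
    simp only [rowWeights_cons, ih]; cases e <;> rfl

theorem colWeights_raise {P : α → Prop} (c : ℤ) (W : Word α) :
    ColWeights P (raise c W) ↔ ColWeights P W := by
  induction W with
  | nil => rfl
  | cons e W ih =>
    rw [show raise c (e :: W) = e.raise c :: raise c W from rfl]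
    simp only [colWeights_cons, ih]; cases e <;> rfl

end Word

/-! ### Reflection and translation -/

/-- The image of a matrix under the reflection `z ↦ -z` of `w` strands. -/
def reflectMat (w : ℤ) (N : Mat R) : Mat R := fun i j => N (w - 1 - j) (w - 1 - i)

theorem reflectMat_reflectMat {R : Type*} (w : ℤ) (N : Mat R) : reflectMat w (reflectMat w N) = N := by
  funext i j; simp [reflectMat]

theorem StrictUpper.reflectMat {N : Mat R} (hN : StrictUpper N) (w : ℤ) :
    StrictUpper (reflectMat w N) := fun i j h => hN _ _ (by omega)

theorem crossStep_reflect (w k : ℤ) (x : R) (N : Mat R) :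
    crossStep (w - 2 - k) x (reflectMat w N) = reflectMat w (crossStep k x N) := by
  have hs : ∀ i, w - 1 - swapZ (w - 2 - k) i = swapZ k (w - 1 - i) := by
    intro i; unfold swapZ; split_ifs <;> omega
  funext i j
  simp only [crossStep, reflectMat, hs]
  have h1 : (w - 1 - j < w - 1 - i) ↔ i < j := by omega
  have h2 : (w - 1 - j = k + 1) ↔ j = w - 2 - k := by omega
  have h3 : (w - 1 - i = k) ↔ i = w - 2 - k + 1 := by omega
  simp only [h1, h2, h3, mul_comm x]
  split_ifs <;> ring

theorem cupStep_reflect (w k : ℤ) (N : Mat R) :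
    cupStep (w - k) (reflectMat w N) = reflectMat (w + 2) (cupStep k N) := by
  funext i j
  unfold cupStep reflectMat
  have h1 : (w + 2 - 1 - j = k ∧ w + 2 - 1 - i = k + 1) ↔ (i = w - k ∧ j = w - k + 1) := by omega
  have h2 : (w + 2 - 1 - j = k ∨ w + 2 - 1 - j = k + 1 ∨ w + 2 - 1 - i = k ∨ w + 2 - 1 - i = k + 1)
     ↔ (i = w - k ∨ i = w - k + 1 ∨ j = w - k ∨ j = w - k + 1) := by omega
  simp only [h1, h2]
  split_ifs with a b
  · rfl
  · rfl
  · have e : ∀ i, i ≠ w - k → i ≠ w - k + 1 →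
        w - 1 - unshiftZ (w - k) i = unshiftZ k (w + 2 - 1 - i) := by
      intro i _ _; unfold unshiftZ; split_ifs <;> omega
    rw [e i (by tauto) (by tauto), e j (by tauto) (by tauto)]

theorem elimStep_reflect (w k : ℤ) (N : Mat R) :
    elimStep (w - 2 - k) (reflectMat w N) = reflectMat (w - 2) (elimStep k N) := by
  have hs : ∀ i, w - 1 - shiftZ (w - 2 - k) i = shiftZ k (w - 2 - 1 - i) := by
    intro i; unfold shiftZ; split_ifs <;> omega
  funext i j
  unfold elimStep reflectMat
  simp only [hs]
  have h1 : (w - 2 - 1 - j < k ∧ k ≤ w - 2 - 1 - i) ↔ (i < w - 2 - k ∧ w - 2 - k ≤ j) := by omega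
  simp only [h1]
  congr 1
  split_ifs
  · rw [mul_comm]; congr 2 <;> omega
  · rfl

theorem Ev.matStep_reflect (w : ℤ) (e : Ev R) (N : Mat R) :
    (e.reflect w).matStep (reflectMat w N) = reflectMat (w + e.gain) (e.matStep N) := by
  cases e with
  | row k x => simpa [Ev.reflect, Ev.matStep, Ev.gain] using crossStep_reflect w k x N
  | col k x => simpa [Ev.reflect, Ev.matStep, Ev.gain] using crossStep_reflect w k x N
  | cup k x => exact cupStep_reflect w k N
  | cusp k x => exact elimStep_reflect w k N

theorem Ev.pivot_reflect (w : ℤ) (e : Ev R) (N : Mat R) :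
    (e.reflect w).Pivot (reflectMat w N) ↔ e.Pivot N := by
  cases e with
  | cusp k x =>
    simp only [Ev.reflect, Ev.Pivot, reflectMat]
    rw [show w - 1 - (w - 2 - k + 1) = k by ring, show w - 1 - (w - 2 - k) = k + 1 by ring]
  | _ => rfl

theorem Ev.entry_reflect (w : ℤ) (e : Ev R) (N : Mat R) :
    (e.reflect w).Entry (reflectMat w N) ↔ e.Entry N := by
  cases e with
  | row k x | col k x =>
    simp only [Ev.reflect, Ev.Entry, reflectMat]
    rw [show w - 1 - (w - 2 - k + 1) = k by ring, show w - 1 - (w - 2 - k) = k + 1 by ring]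
  | _ => rfl

namespace Word

theorem run_reflect (w : ℤ) (W : Word R) (N : Mat R) :
    run (reflect w W) (reflectMat w N) = reflectMat (w + gain W) (run W N) := by
  induction W generalizing w N with
  | nil => simp [reflect, run, gain]
  | cons e W ih => simp [reflect, run, gain, Ev.matStep_reflect, ih, add_assoc]

theorem pivots_reflect (w : ℤ) (W : Word R) (N : Mat R) :
    Pivots (reflect w W) (reflectMat w N) ↔ Pivots W N := by
  induction W generalizing w N with
  | nil => rfl
  | cons e W ih => simp [reflect, Pivots, Ev.matStep_reflect, Ev.pivot_reflect, ih]

theorem entries_reflect (w : ℤ) (W : Word R) (N : Mat R) :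
    Entries (reflect w W) (reflectMat w N) ↔ Entries W N := by
  induction W generalizing w N with
  | nil => rfl
  | cons e W ih => simp [reflect, Entries, Ev.matStep_reflect, Ev.entry_reflect, ih]

end Word

/-- The matrix in the numbering of the strands that starts at strand `c`. -/
def lowerMat (c : ℤ) (N : Mat R) : Mat R := fun i j => N (i + c) (j + c)

theorem StrictUpper.lowerMat {N : Mat R} (hN : StrictUpper N) (c : ℤ) :
    StrictUpper (lowerMat c N) := fun i j h => hN _ _ (by omega)

theorem Ev.matStep_lower (c : ℤ) (e : Ev R) (N : Mat R) :
    e.matStep (lowerMat c N) = lowerMat c ((e.raise c).matStep N) := by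
  have h1 : ∀ k i : ℤ, swapZ k i + c = swapZ (k + c) (i + c) := by
    intro k i; unfold swapZ; split_ifs <;> omega
  have h2 : ∀ k i : ℤ, shiftZ k i + c = shiftZ (k + c) (i + c) := by
    intro k i; unfold shiftZ; split_ifs <;> omega
  have h3 : ∀ k i : ℤ, unshiftZ k i + c = unshiftZ (k + c) (i + c) := by
    intro k i; unfold unshiftZ; split_ifs <;> omega
  have h4 : ∀ i k : ℤ, i + c = k + c + 1 ↔ i = k + 1 := by intros; omega
  have h5 : ∀ k : ℤ, k + 1 + c = k + c + 1 := by intros; omega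
  have h6 : ∀ k : ℤ, k + 2 + c = k + c + 2 := by intros; omega
  cases e <;> funext i j <;>
    simp [Ev.matStep, Ev.raise, crossStep, cupStep, elimStep, SolidTorus.lowerMat, h1, h2, h3, h4, h5, h6]

theorem Ev.pivot_lower (c : ℤ) (e : Ev R) (N : Mat R) :
    e.Pivot (lowerMat c N) ↔ (e.raise c).Pivot N := by
  cases e <;> simp [Ev.Pivot, Ev.raise, SolidTorus.lowerMat, add_right_comm]

theorem Ev.entry_lower (c : ℤ) (e : Ev R) (N : Mat R) :
    e.Entry (lowerMat c N) ↔ (e.raise c).Entry N := by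
  cases e <;> simp [Ev.Entry, Ev.raise, SolidTorus.lowerMat, add_right_comm]

namespace Word

theorem run_lower (c : ℤ) (W : Word R) (N : Mat R) :
    run W (lowerMat c N) = lowerMat c (run (raise c W) N) := by
  induction W generalizing N with
  | nil => rfl
  | cons e W ih => simpa [raise, run, Ev.matStep_lower] using ih _

theorem pivots_lower (c : ℤ) (W : Word R) (N : Mat R) :
    Pivots W (lowerMat c N) ↔ Pivots (raise c W) N := by
  induction W generalizing N with
  | nil => rfl
  | cons e W ih =>
    have := ih ((e.raise c).matStep N)
    simp only [raise] at this
    simp [raise, Pivots, Ev.matStep_lower, Ev.pivot_lower, this]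

theorem entries_lower (c : ℤ) (W : Word R) (N : Mat R) :
    Entries W (lowerMat c N) ↔ Entries (raise c W) N := by
  induction W generalizing N with
  | nil => rfl
  | cons e W ih =>
    have := ih ((e.raise c).matStep N)
    simp only [raise] at this
    simp [raise, Entries, Ev.matStep_lower, Ev.entry_lower, this]

end Word
end SolidTorus

namespace SolidTorus

/-! ### Two-strand tangles -/

variable {R : Type*} [CommRing R]

/-- Planar isotopies that change the order of neighbouring singularities: a left cusp moves past the
crossing at the bottom of a column, and two nested left or right cusps are exchanged. -/
inductive Slide : Word Unit → Word Unit → Prop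
  | colCup (P Q) : Slide (P ++ .col 0 () :: .cup 3 () :: Q) (P ++ .cup 3 () :: .col 0 () :: Q)
  | cupCup (P Q) : Slide (P ++ .cup 1 () :: .cup 3 () :: Q) (P ++ .cup 1 () :: .cup 1 () :: Q)
  | cuspCusp (P Q) : Slide (P ++ .cusp 3 () :: .cusp 1 () :: Q) (P ++ .cusp 1 () :: .cusp 1 () :: Q)

/-- The vertical addition of one crossing below a two-strand tangle: a left cusp, the crossing, the
tangle two strands further up, and a right cusp. -/
def vertSum (W : Word Unit) : Word Unit :=
  .cup 1 () :: .col 0 () :: (Word.raise 2 W ++ [.cusp 1 ()])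

/-- The two-strand tangles built from single crossings by horizontal composition, vertical addition
of one crossing, reflection and slides; all the rational tangles are of this kind. The Boolean tells
whether the strand that starts at the bottom ends at the top. -/
inductive Tang : Bool → Word Unit → Prop
  | nil : Tang false []
  | row : Tang true [.row 0 ()]
  | append {p q W W'} : Tang p W → Tang q W' → Tang (xor p q) (W ++ W')
  | vert {W} : Tang false W → Tang false (vertSum W)
  | reflect {p W} : Tang p W → Tang p (Word.reflect 2 W)
  | slide {p W W'} : Tang p W → Slide W W' → Tang p W'

namespace Word
variable {α : Type*}

theorem gain_append (W W' : Word α) : gain (W ++ W') = gain W + gain W' := by simp [gain]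
theorem gain_cons (e : Ev α) (W : Word α) : gain (e :: W) = e.gain + gain W := by simp [gain]

theorem gain_reflect (w : ℤ) (W : Word α) : gain (reflect w W) = gain W := by
  induction W generalizing w with
  | nil => rfl
  | cons e W ih => simp [reflect, gain_cons, ih]

theorem gain_raise (c : ℤ) (W : Word α) : gain (raise c W) = gain W := by
  induction W with
  | nil => rfl
  | cons e W ih => simpa [raise, gain] using ih

theorem gain_erase (W : Word α) : gain (erase W) = gain W := by
  induction W with
  | nil => rfl
  | cons e W ih => simpa [erase, gain] using ih

end Word

theorem Tang.gain_eq_zero {p : Bool} {W : Word Unit} (h : Tang p W) : Word.gain W = 0 := by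
  induction h with
  | nil => rfl
  | row => rfl
  | append _ _ h1 h2 => simp [Word.gain_append, h1, h2]
  | vert _ h => simp [vertSum, Word.gain_cons, Word.gain_append, Word.gain_raise, h]; simp [Ev.gain, Word.gain]
  | reflect _ h => simpa [Word.gain_reflect] using h
  | slide _ hs h =>
    cases hs <;> simpa [Word.gain_cons, Word.gain_append, Ev.gain, add_comm, add_left_comm] using h

/-! ### Weights on a given tangle -/

namespace Word
variable {α : Type*}

theorem erase_eq_append {W : Word α} {P Q : Word Unit} (h : erase W = P ++ Q) :
    ∃ P' Q', W = P' ++ Q' ∧ erase P' = P ∧ erase Q' = Q := by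
  obtain ⟨P', Q', h1, h2, h3⟩ := List.map_eq_append_iff.1 h
  exact ⟨P', Q', h1, h2, h3⟩

theorem erase_eq_cons {W : Word α} {e : Ev Unit} {Q : Word Unit} (h : erase W = e :: Q) :
    ∃ e' Q', W = e' :: Q' ∧ e'.map (fun _ => ()) = e ∧ erase Q' = Q := by
  obtain ⟨e', Q', h1, h2, h3⟩ := List.map_eq_cons_iff.1 h
  exact ⟨e', Q', h1, h2, h3⟩

theorem erase_eq_nil {W : Word α} (h : erase W = []) : W = [] := List.map_eq_nil_iff.1 h

theorem erase_eq_reflect {W : Word α} {w : ℤ} {V : Word Unit} (h : erase W = reflect w V) :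
    ∃ W', W = reflect w W' ∧ erase W' = V :=
  ⟨reflect w W, (reflect_reflect w W).symm, by rw [erase_reflect, h, reflect_reflect]⟩

theorem raise_raise (c d : ℤ) (W : Word α) : raise c (raise d W) = raise (d + c) W := by
  simp [raise, Function.comp_def]

theorem raise_zero (W : Word α) : raise 0 W = W :=
  (List.map_congr_left fun e _ => e.raise_zero).trans (List.map_id _)

theorem erase_eq_raise {W : Word α} {c : ℤ} {V : Word Unit} (h : erase W = raise c V) :
    ∃ W', W = raise c W' ∧ erase W' = V :=
  ⟨raise (-c) W, by simp [raise_raise, raise_zero], by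
    rw [erase_raise, h, raise_raise, add_neg_cancel, raise_zero]⟩

end Word

namespace Ev
variable {α : Type*}
theorem map_eq_row {e : Ev α} {k : ℤ} (h : e.map (fun _ => ()) = .row k ()) : ∃ a, e = .row k a := by
  cases e <;> simp_all [Ev.map]
theorem map_eq_col {e : Ev α} {k : ℤ} (h : e.map (fun _ => ()) = .col k ()) : ∃ a, e = .col k a := by
  cases e <;> simp_all [Ev.map]
theorem map_eq_cup {e : Ev α} {k : ℤ} (h : e.map (fun _ => ()) = .cup k ()) : ∃ a, e = .cup k a := by
  cases e <;> simp_all [Ev.map]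
theorem map_eq_cusp {e : Ev α} {k : ℤ} (h : e.map (fun _ => ()) = .cusp k ()) :
    ∃ a, e = .cusp k a := by
  cases e <;> simp_all [Ev.map]
end Ev

namespace Word
variable {α : Type*}

theorem erase_eq_row {W : Word α} {k : ℤ} (h : erase W = [.row k ()]) : ∃ x, W = [.row k x] := by
  obtain ⟨e, W', rfl, he, hW'⟩ := erase_eq_cons h
  obtain ⟨x, rfl⟩ := Ev.map_eq_row he
  exact ⟨x, by rw [erase_eq_nil hW']⟩

theorem erase_eq_vert {W : Word α} {V : Word Unit}
    (h : erase W = vertSum V) :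
    ∃ u x T c, W = .cup 1 u :: .col 0 x :: (raise 2 T ++ [.cusp 1 c]) ∧ erase T = V := by
  obtain ⟨e1, W1, rfl, he1, h1⟩ := erase_eq_cons h
  obtain ⟨u, rfl⟩ := Ev.map_eq_cup he1
  obtain ⟨e2, W2, rfl, he2, h2⟩ := erase_eq_cons h1
  obtain ⟨x, rfl⟩ := Ev.map_eq_col he2
  obtain ⟨T, E, rfl, hT, hE⟩ := erase_eq_append h2
  obtain ⟨T', rfl, hT'⟩ := erase_eq_raise hT
  obtain ⟨e3, E', rfl, he3, h3⟩ := erase_eq_cons hE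
  obtain rfl := erase_eq_nil h3
  obtain ⟨c, rfl⟩ := Ev.map_eq_cusp he3
  exact ⟨u, x, T', c, rfl, hT'⟩

theorem erase_eq_pair {W : Word α} {P Q : Word Unit} {e e' : Ev Unit}
    (h : erase W = P ++ e :: e' :: Q) :
    ∃ P' f f' Q', W = P' ++ f :: f' :: Q' ∧ erase P' = P ∧ f.map (fun _ => ()) = e ∧
      f'.map (fun _ => ()) = e' ∧ erase Q' = Q := by
  obtain ⟨P', W1, rfl, hP, h1⟩ := erase_eq_append h
  obtain ⟨f, W2, rfl, hf, h2⟩ := erase_eq_cons h1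
  obtain ⟨f', Q', rfl, hf', hQ⟩ := erase_eq_cons h2
  exact ⟨P', f, f', Q', rfl, hP, hf, hf', hQ⟩

end Word

/-! ### Invariance under slides -/

theorem crossStep_cupStep_comm (x : R) (N : Mat R) :
    cupStep 3 (crossStep 0 x N) = crossStep 0 x (cupStep 3 N) := by
  funext i j
  have hs : ∀ i, i ≠ 3 → i ≠ 4 → swapZ 0 (unshiftZ 3 i) = unshiftZ 3 (swapZ 0 i) := by
    intro i _ _; unfold swapZ unshiftZ; split_ifs <;> omega
  have hs3 : swapZ 0 3 = 3 := by simp [swapZ]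
  have hs4 : swapZ 0 4 = 4 := by simp [swapZ]
  have h3 : ∀ i, swapZ 0 i = 3 ↔ i = 3 := by intro i; unfold swapZ; split_ifs <;> omega
  have h4 : ∀ i, swapZ 0 i = 4 ↔ i = 4 := by intro i; unfold swapZ; split_ifs <;> omega
  have h5 : ∀ i, i ≠ 3 → i ≠ 4 → (unshiftZ 3 i = 0 ↔ i = 0) := by
    intro i _ _; unfold unshiftZ; split_ifs <;> omega
  have h6 : ∀ i, i ≠ 3 → i ≠ 4 → (unshiftZ 3 i = 1 ↔ i = 1) := by
    intro i _ _; unfold unshiftZ; split_ifs <;> omega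
  have h7 : ∀ i j, i ≠ 3 → i ≠ 4 → j ≠ 3 → j ≠ 4 → (unshiftZ 3 i < unshiftZ 3 j ↔ i < j) := by
    intro i j _ _ _ _; unfold unshiftZ; split_ifs <;> omega
  unfold cupStep crossStep
  simp only [h3, h4, show (3 : ℤ) + 1 = 4 by norm_num, zero_add]
  by_cases a : i = 3 ∧ j = 4
  · obtain ⟨rfl, rfl⟩ := a; norm_num
  by_cases b : i = 3 ∨ i = 4 ∨ j = 3 ∨ j = 4
  · rw [if_neg a, if_pos b, if_neg a, if_pos b]; simp [if_neg a, if_pos b]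
  · have b' := b
    simp only [not_or] at b'
    obtain ⟨b1, b2, b3, b4⟩ := b'
    rw [if_neg a, if_neg b, if_neg a, if_neg b]
    simp only [if_neg a, if_neg b, hs i b1 b2, hs j b3 b4, h5 j b3 b4, h6 i b1 b2,
      h7 i j b1 b2 b3 b4]

theorem cupStep_cupStep_comm (N : Mat R) : cupStep 3 (cupStep 1 N) = cupStep 1 (cupStep 1 N) := by
  funext i j
  have hu : ∀ i, i ≠ 1 → i ≠ 2 → i ≠ 3 → i ≠ 4 →
      unshiftZ 1 (unshiftZ 3 i) = unshiftZ 1 (unshiftZ 1 i) := by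
    intro i _ _ _ _; unfold unshiftZ; split_ifs <;> omega
  unfold cupStep
  by_cases hi : i = 1 ∨ i = 2 ∨ i = 3 ∨ i = 4 <;> by_cases hj : j = 1 ∨ j = 2 ∨ j = 3 ∨ j = 4
  · rcases hi with rfl | rfl | rfl | rfl <;> rcases hj with rfl | rfl | rfl | rfl <;>
      simp [unshiftZ]
  · simp only [not_or] at hj
    rcases hi with rfl | rfl | rfl | rfl <;> simp [unshiftZ, hj] <;>
      (intro h; exfalso; split_ifs at h <;> omega)
  · simp only [not_or] at hi
    rcases hj with rfl | rfl | rfl | rfl <;> simp [unshiftZ, hi] <;>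
      (intro h; exfalso; split_ifs at h <;> omega)
  · simp only [not_or] at hi hj
    have e1 : ∀ i, i ≠ 1 → i ≠ 2 → i ≠ 3 → i ≠ 4 → unshiftZ 1 i ≠ 1 ∧ unshiftZ 1 i ≠ 2 := by
      intro i _ _ _ _; unfold unshiftZ; split_ifs <;> omega
    have e3 : ∀ i, i ≠ 1 → i ≠ 2 → i ≠ 3 → i ≠ 4 → unshiftZ 3 i ≠ 1 ∧ unshiftZ 3 i ≠ 2 := by
      intro i _ _ _ _; unfold unshiftZ; split_ifs <;> omega
    obtain ⟨i1, i2, i3, i4⟩ := hi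
    obtain ⟨j1, j2, j3, j4⟩ := hj
    simp [i1, i2, i3, i4, j1, j2, j3, j4, e1 i i1 i2 i3 i4, e1 j j1 j2 j3 j4, e3 i i1 i2 i3 i4,
      e3 j j1 j2 j3 j4, hu i i1 i2 i3 i4, hu j j1 j2 j3 j4]

theorem elimStep_elimStep_comm (N : Mat R) :
    elimStep 1 (elimStep 3 N) = elimStep 1 (elimStep 1 N) := by
  funext i j
  have hs : ∀ i, shiftZ 3 (shiftZ 1 i) = shiftZ 1 (shiftZ 1 i) := by
    intro i; unfold shiftZ; split_ifs <;> omega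
  unfold elimStep
  rw [hs, hs]
  by_cases h : i < 1 ∧ 1 ≤ j
  · have a1 : shiftZ 1 i = i := by unfold shiftZ; split_ifs <;> omega
    have a2 : shiftZ 1 j = j + 2 := by unfold shiftZ; split_ifs <;> omega
    have a3 : shiftZ 3 i = i := by unfold shiftZ; split_ifs <;> omega
    have a4 : shiftZ 1 (j + 2) = j + 2 + 2 := by unfold shiftZ; split_ifs <;> omega
    have a5 : shiftZ 3 (j + 2) = j + 2 + 2 := by unfold shiftZ; split_ifs <;> omega
    simp only [h, a1, a2, a3, a4, a5, and_self, if_true, if_pos (show i < 3 ∧ 3 ≤ j + 2 by omega),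
      if_pos (show (1 : ℤ) < 3 ∧ 3 ≤ j + 2 by omega)]
    norm_num [shiftZ, h.1, show 1 ≤ j + 2 by omega]
    ring_nf
  · have b1 : ¬ (shiftZ 1 i < 3 ∧ 3 ≤ shiftZ 1 j) := by unfold shiftZ; split_ifs <;> omega
    have b2 : ¬ (shiftZ 1 i < 1 ∧ 1 ≤ shiftZ 1 j) := by unfold shiftZ; split_ifs <;> omega
    simp only [if_neg h, if_neg b1, if_neg b2]

/-! ### Tangles acting through matrices of determinant one -/

/-- The matrix `N'` arises from `N` by a tangle on the strands `c`, `c + 1` that acts through a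
matrix `(A B; C D)` of determinant one: the row vectors `(N i c, N i (c + 1))` are multiplied by it,
the column vectors `(N c j, N (c + 1) j)` by its inverse (in characteristic two), the entry at the
two strands vanishes to the right of the tangle, and an entry whose arc crosses both strands changes
by a bilinear expression in these vectors. -/
structure ActAt (c : ℤ) (A B C D : R) (N N' : Mat R) : Prop where
  det : A * D + B * C = 1
  mid : N' c (c + 1) = 0
  low0 : ∀ i < c, N' i c = N i c * A + N i (c + 1) * C
  low1 : ∀ i < c, N' i (c + 1) = N i c * B + N i (c + 1) * D
  high0 : ∀ j, c + 1 < j → N' c j = D * N c j + B * N (c + 1) j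
  high1 : ∀ j, c + 1 < j → N' (c + 1) j = C * N c j + A * N (c + 1) j
  low : ∀ i < c, ∀ j < c, N' i j = N i j
  high : ∀ i, c + 1 < i → ∀ j, c + 1 < j → N' i j = N i j
  cross : ∃ q00 q01 q10 q11 : R, ∀ i < c, ∀ j, c + 1 < j → N' i j = N i j +
    (N i c * q00 + N i (c + 1) * q10) * N c j + (N i c * q01 + N i (c + 1) * q11) * N (c + 1) j

theorem ActAt.lower {c : ℤ} {A B C D : R} {N N' : Mat R}
    (h : ActAt 0 A B C D (lowerMat c N) (lowerMat c N')) : ActAt c A B C D N N' := by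
  obtain ⟨q00, q01, q10, q11, hq⟩ := h.cross
  simp only [lowerMat] at hq
  have low0 := h.low0; have low1 := h.low1; have high0 := h.high0; have high1 := h.high1
  have low := h.low; have high := h.high; have mid := h.mid
  simp only [lowerMat, zero_add] at low0 low1 high0 high1 low high mid
  have e : ∀ i, i - c + c = i := fun i => by ring
  refine ⟨h.det, ?_, ?_, ?_, ?_, ?_, ?_, ?_, ⟨q00, q01, q10, q11, ?_⟩⟩
  · simpa [add_comm] using mid
  · intro i hi; simpa [e, add_comm] using low0 (i - c) (by omega)
  · intro i hi; simpa [e, add_comm] using low1 (i - c) (by omega)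
  · intro i hi; simpa [e, add_comm] using high0 (i - c) (by omega)
  · intro i hi; simpa [e, add_comm] using high1 (i - c) (by omega)
  · intro i hi j hj; simpa [e] using low (i - c) (by omega) (j - c) (by omega)
  · intro i hi j hj; simpa [e] using high (i - c) (by omega) (j - c) (by omega)
  · intro i hi j hj
    have := hq (i - c) (by omega) (j - c) (by omega)
    simp only [e, zero_add] at this
    rw [add_comm 1 c] at this
    exact this

theorem ActAt.refl {N : Mat R} (h : N 0 1 = 0) : ActAt 0 1 0 0 1 N N := by
  refine ⟨?_, ?_, ?_, ?_, ?_, ?_, ?_, ?_, ⟨0, 0, 0, 0, ?_⟩⟩ <;> simp [h]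

/-- The matrix of a composition is the product of the matrices. -/
theorem ActAt.trans {A B C D A' B' C' D' : R} {N N' N'' : Mat R} (h2 : ∀ r : R, r + r = 0)
    (h : ActAt 0 A B C D N N') (h' : ActAt 0 A' B' C' D' N' N'') :
    ActAt 0 (A * A' + B * C') (A * B' + B * D') (C * A' + D * C') (C * B' + D * D') N N'' := by
  obtain ⟨q00, q01, q10, q11, hq⟩ := h.cross
  obtain ⟨r00, r01, r10, r11, hr⟩ := h'.cross
  -- with `M` the matrix of the first tangle, `q` and `r` the two bilinear corrections, the
  -- correction of the composition is `q + M r M⁻¹`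
  refine ⟨?_, h'.mid, ?_, ?_, ?_, ?_, ?_, ?_, ⟨
    q00 + (A * r00 + B * r10) * D + (A * r01 + B * r11) * C,
    q01 + (A * r00 + B * r10) * B + (A * r01 + B * r11) * A,
    q10 + (C * r00 + D * r10) * D + (C * r01 + D * r11) * C,
    q11 + (C * r00 + D * r10) * B + (C * r01 + D * r11) * A, ?_⟩⟩
  · have e1 := h.det
    have e2 := h'.det
    linear_combination e1 * (A' * D' + B' * C') + e2 + h2 (A * A' * C * B') + h2 (B * C' * D * D')
  · intro i hi; rw [h'.low0 i hi, h.low0 i hi, h.low1 i hi]; ring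
  · intro i hi; rw [h'.low1 i hi, h.low0 i hi, h.low1 i hi]; ring
  · intro i hi; rw [h'.high0 i hi, h.high0 i hi, h.high1 i hi]; ring
  · intro i hi; rw [h'.high1 i hi, h.high0 i hi, h.high1 i hi]; ring
  · intro i hi j hj; rw [h'.low i hi j hj, h.low i hi j hj]
  · intro i hi j hj; rw [h'.high i hi j hj, h.high i hi j hj]
  · intro i hi j hj
    have a1 := h.low0 i hi; have a2 := h.low1 i hi
    have a3 := h.high0 j hj; have a4 := h.high1 j hj
    rw [zero_add] at a2 a3 a4
    rw [hr i hi j hj, hq i hi j hj]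
    simp only [zero_add]
    rw [a1, a2, a3, a4]; ring_nf

theorem ActAt.reflect {A B C D : R} {N N' : Mat R} (h : ActAt 0 A B C D N N') :
    ActAt 0 A B C D (reflectMat 2 N) (reflectMat 2 N') := by
  obtain ⟨q00, q01, q10, q11, hq⟩ := h.cross
  have low0 := h.low0; have low1 := h.low1; have high0 := h.high0; have high1 := h.high1
  have low := h.low; have high := h.high; have mid := h.mid
  simp only [zero_add] at low0 low1 high0 high1 low high mid hq
  refine ⟨h.det, ?_, ?_, ?_, ?_, ?_, ?_, ?_, ⟨q11, q01, q10, q00, ?_⟩⟩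
  · simpa [reflectMat] using mid
  · intro i hi; norm_num [reflectMat, high1 (1 - i) (by omega)]; ring
  · intro i hi; norm_num [reflectMat, high0 (1 - i) (by omega)]; ring
  · intro i hi; norm_num [reflectMat, low1 (1 - i) (by omega)]; ring
  · intro i hi; norm_num [reflectMat, low0 (1 - i) (by omega)]; ring
  · intro i hi j hj; norm_num [reflectMat, high (1 - j) (by omega) (1 - i) (by omega)]
  · intro i hi j hj; norm_num [reflectMat, low (1 - j) (by omega) (1 - i) (by omega)]
  · intro i hi j hj
    norm_num [reflectMat, hq (1 - j) (by omega) (1 - i) (by omega)]; ring_nf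

/-- A crossing of weight `x` acts through `(x 1; 1 0)`. -/
theorem actAt_crossStep {N : Mat R} (hN : StrictUpper N) (x : R) :
    ActAt 0 x 1 1 0 N (crossStep 0 x N) := by
  refine ⟨by ring, ?_, ?_, ?_, ?_, ?_, ?_, ?_, ⟨0, 0, 0, 0, ?_⟩⟩
  · simp [crossStep, swapZ, hN 1 0]
  · intro i hi
    simp [crossStep, swapZ, hi, hi.ne, show i ≠ 1 by omega]; ring
  · intro i hi
    simp [crossStep, swapZ, hi.ne, show i ≠ 1 by omega, show i < 1 by omega]
  · intro i hi
    simp [crossStep, swapZ, show i ≠ 1 by omega, show i ≠ 0 by omega, show 0 < i by omega]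
  · intro i hi
    simp [crossStep, swapZ, show i ≠ 1 by omega, show i ≠ 0 by omega, show 1 < i by omega]; ring
  · intro i hi j hj
    simp only [crossStep, swapZ, if_neg hi.ne, if_neg hj.ne, if_neg (show i ≠ 0 + 1 by omega),
      if_neg (show j ≠ 0 + 1 by omega), add_zero]
    split_ifs with h
    · rfl
    · exact (hN i j (by omega)).symm
  · intro i hi j hj
    simp only [crossStep, swapZ, if_neg (show i ≠ 0 by omega), if_neg (show j ≠ 0 by omega), if_neg (show i ≠ 0 + 1 by omega),
      if_neg (show j ≠ 0 + 1 by omega), add_zero]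
    split_ifs with h
    · rfl
    · exact (hN i j (by omega)).symm
  · intro i hi j hj
    simp [crossStep, swapZ, hi.ne, show i ≠ 1 by omega, show j ≠ 1 by omega, show j ≠ 0 by omega,
      show i < j by omega]

end SolidTorus

namespace SolidTorus

/-! ### Vertical addition -/

variable {R : Type*} [CommRing R]

/-- The matrix `N'` to the right of the left cusp and the crossing, of weight `x`, with which a
vertical addition starts. The new strands and the crossing occupy the positions `0`, `1`, `2`; the
strands that were `0` and `1` are now `1` and `3`. -/
structure VertStart (x : R) (N N' : Mat R) : Prop where
  e01 : N' 0 1 = 0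
  e02 : N' 0 2 = 1
  e03 : N' 0 3 = 0
  e12 : N' 1 2 = x
  e13 : N' 1 3 = N 0 1
  e23 : N' 2 3 = 0
  i0 : ∀ i < 0, N' i 0 = x * N i 0
  i1 : ∀ i < 0, N' i 1 = N i 0
  i2 : ∀ i < 0, N' i 2 = 0
  i3 : ∀ i < 0, N' i 3 = N i 1
  j0 : ∀ j, 1 < j → N' 0 (j + 2) = 0
  j1 : ∀ j, 1 < j → N' 1 (j + 2) = N 0 j
  j2 : ∀ j, 1 < j → N' 2 (j + 2) = 0
  j3 : ∀ j, 1 < j → N' 3 (j + 2) = N 1 j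
  low : ∀ i < 0, ∀ j < 0, N' i j = N i j
  high : ∀ i, 1 < i → ∀ j, 1 < j → N' (i + 2) (j + 2) = N i j
  cross : ∀ i < 0, ∀ j, 1 < j → N' i (j + 2) = N i j

theorem vertStart {N : Mat R} (hN : StrictUpper N) (x : R) :
    VertStart x N (crossStep 0 x (cupStep 1 N)) := by
  constructor
  case high =>
    intro i hi j hj
    by_cases h : i < j
    · simp [crossStep, cupStep, swapZ, unshiftZ, show i + 2 ≠ 0 by omega, show i + 2 ≠ 1 by omega,
        show i + 2 ≠ 2 by omega, show j + 2 ≠ 0 by omega, show j + 2 ≠ 1 by omega,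
        show j + 2 ≠ 2 by omega, h,
        show ¬ i + 2 < 1 by omega, show ¬ j + 2 < 1 by omega]
    · rw [StrictUpper.crossStep _ _ _ _ (by omega), hN _ _ (by omega)]
  case low =>
    intro i hi j hj
    by_cases h : i < j
    · simp [crossStep, cupStep, swapZ, unshiftZ, show i ≠ 0 by omega, show i ≠ 1 by omega,
        show i ≠ 2 by omega, show j ≠ 0 by omega, show j ≠ 1 by omega,
        show j ≠ 2 by omega, h, show i < 1 by omega, show j < 1 by omega]
    · rw [StrictUpper.crossStep _ _ _ _ (by omega), hN _ _ (by omega)]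
  case cross =>
    intro i hi j hj
    simp [crossStep, cupStep, swapZ, unshiftZ, show i ≠ 0 by omega, show i ≠ 1 by omega,
        show i ≠ 2 by omega, show j + 2 ≠ 0 by omega, show j + 2 ≠ 1 by omega,
        show j ≠ 0 by omega, show i < j + 2 by omega, show i < 1 by omega,
        show ¬ j + 2 < 1 by omega]
  case i0 | i1 | i2 | i3 =>
    intro i hi
    simp [crossStep, cupStep, swapZ, unshiftZ, show i ≠ 0 by omega, show i ≠ 1 by omega,
        show i ≠ 2 by omega, show i < 0 by omega, show i < 1 by omega, show i < 2 by omega,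
        show i < 3 by omega]
  case j0 | j1 | j2 | j3 =>
    intro j hj
    simp [crossStep, cupStep, swapZ, unshiftZ, show j + 2 ≠ 0 by omega, show j + 2 ≠ 1 by omega,
        show j ≠ 0 by omega, show 0 < j + 2 by omega, show 1 < j + 2 by omega,
        show 2 < j + 2 by omega, show 3 < j + 2 by omega,
        show ¬ j + 2 < 1 by omega]
  all_goals norm_num [crossStep, cupStep, swapZ, unshiftZ]

/-- The vertical addition of a crossing of weight `x` to a tangle that acts through `(A B; C D)` on
the strands `2`, `3`. If the pivot of the closing right cusp is `1`, the entry at the two strands is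
the same on both sides; if that entry is `0`, the pivot condition reads `x A = 1`, which determines
the weight `x = A = A⁻¹`, and the result acts through `(x 0; 0 x)`. -/
theorem actAt_vert (h2 : ∀ r : R, r + r = 0) (hu : ∀ a b : R, a * b = 1 → a = b)
    {x A B C D : R} {N N2 N3 : Mat R}
    (hs : VertStart x N N2)
    (h : ActAt 2 A B C D N2 N3) (hp : N3 1 2 = 1) :
    elimStep 1 N3 0 1 = N 0 1 ∧ (N 0 1 = 0 → x = A ∧ ActAt 0 x 0 0 x N (elimStep 1 N3)) := by
  have low0 := h.low0; have low1 := h.low1; have high0 := h.high0; have high1 := h.high1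
  have low := h.low; have high := h.high; have mid := h.mid; have det := h.det
  obtain ⟨q00, q01, q10, q11, hq⟩ := h.cross
  norm_num at low0 low1 high0 high1 low high mid hq
  have p02 : N3 0 2 = A := by rw [low0 0 (by norm_num), hs.e02, hs.e03]; ring
  have p03 : N3 0 3 = B := by rw [low1 0 (by norm_num), hs.e02, hs.e03]; ring
  have p12 : N3 1 2 = x * A + N 0 1 * C := by rw [low0 1 (by norm_num), hs.e12, hs.e13]
  have p13 : N3 1 3 = x * B + N 0 1 * D := by rw [low1 1 (by norm_num), hs.e12, hs.e13]
  have hxA : x * A + N 0 1 * C = 1 := by rw [← p12, hp]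
  constructor
  · norm_num [elimStep, shiftZ]
    rw [p03, p13, p02]
    linear_combination B * hxA + N 0 1 * det + (h2 B - h2 (N 0 1 * B * C))
  · intro hy
    rw [hy] at hxA p13
    have hxA' : x * A = 1 := by simpa using hxA
    have hx : x = A := hu _ _ hxA'
    have hxx : x * x = 1 := by rw [← hx] at hxA'; exact hxA'
    refine ⟨hx, ?_, ?_, ?_, ?_, ?_, ?_, ?_, ?_, ⟨0, 0, C, q11 + x * q01 * C, ?_⟩⟩
    · linear_combination hxx
    · norm_num [elimStep, shiftZ]
      rw [p03, p13, p02]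
      linear_combination B * hxA' + h2 B
    · intro i hi
      simp [elimStep, shiftZ, show i < 1 by omega]
      rw [low i (by omega) 0 (by omega), hs.i0 i hi]; ring
    · intro i hi
      norm_num [elimStep, shiftZ, show i < 1 by omega]
      rw [low1 i (by omega), low0 i (by omega), p13, hs.i2 i hi, hs.i3 i hi]
      linear_combination N i 1 * x * det - N i 1 * D * hxA'
    · intro j hj
      norm_num [elimStep, shiftZ, show ¬ j < 1 by omega, show 1 ≤ j by omega]
      rw [hq 0 (by norm_num) _ (by omega), hq 1 (by norm_num) _ (by omega), p02, hs.j0 j hj,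
        hs.j1 j hj, hs.j2 j hj, hs.j3 j hj, hs.e02, hs.e03, hs.e12, hs.e13, hy, ← hx]
      linear_combination q01 * N 1 j * hxx + h2 (q01 * N 1 j)
    · intro j hj
      norm_num [elimStep, shiftZ, show ¬ j < 1 by omega, show 1 ≤ j by omega]
      rw [high1 _ (by omega), hs.j2 j hj, hs.j3 j hj, ← hx]; ring
    · intro i hi j hj
      simp only [elimStep, shiftZ, if_pos (show i < 1 by omega), if_pos (show j < 1 by omega),
        if_neg (show ¬ (i < 1 ∧ 1 ≤ j) by omega), add_zero]
      rw [low _ (by omega) _ (by omega), hs.low i hi j hj]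
    · intro i hi j hj
      simp only [elimStep, shiftZ, if_neg (show ¬ i < 1 by omega), if_neg (show ¬ j < 1 by omega),
        if_neg (show ¬ (i < 1 ∧ 1 ≤ j) by omega), add_zero]
      rw [high _ (by omega) _ (by omega), hs.high i (by omega) j (by omega)]
    · intro i hi j hj
      norm_num at hj
      norm_num [elimStep, shiftZ, show i < 1 by omega, show ¬ j < 1 by omega, show 1 ≤ j by omega]
      rw [hq i (by omega) _ (by omega), hq 1 (by norm_num) _ (by omega), low0 i (by omega),
        hs.cross i hi j hj, hs.j1 j hj, hs.j2 j hj, hs.j3 j hj, hs.i2 i hi, hs.i3 i hi,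
        hs.e12, hs.e13, hy]
      ring

/-! ### The action of a two-strand tangle -/

namespace Word

/-- The weights of the standard augmentation: `1` on the crossings of the vertical columns. -/
def Standard (W : Word R) : Prop := RowWeights (· = 0) W ∧ ColWeights (· = 1) W

theorem standard_append (W W' : Word R) : Standard (W ++ W') ↔ Standard W ∧ Standard W' := by
  simp only [Standard, rowWeights_append, colWeights_append]; tauto

end Word

/-- Two tangles, with the same strands at their ends, have the same effect on matrices, the same
pivot and entry conditions, and the same weights. -/
structure SameEffect (W W' : Word R) : Prop where
  run {N : Mat R} : StrictUpper N → W.run N = W'.run N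
  pivots {N : Mat R} : StrictUpper N → (W.Pivots N ↔ W'.Pivots N)
  entries {N : Mat R} : StrictUpper N → (W.Entries N ↔ W'.Entries N)
  rowWeights (P : R → Prop) : W.RowWeights P ↔ W'.RowWeights P
  colWeights (P : R → Prop) : W.ColWeights P ↔ W'.ColWeights P

theorem SameEffect.standard {W W' : Word R} (h : SameEffect W W') : W.Standard ↔ W'.Standard := by
  rw [Word.Standard, h.rowWeights, h.colWeights, Word.Standard]

theorem SameEffect.trans {W W' W'' : Word R} (h : SameEffect W W') (h' : SameEffect W' W'') :
    SameEffect W W'' :=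
  ⟨fun hN => (h.run hN).trans (h'.run hN), fun hN => (h.pivots hN).trans (h'.pivots hN),
    fun hN => (h.entries hN).trans (h'.entries hN),
    fun P => (h.rowWeights P).trans (h'.rowWeights P),
    fun P => (h.colWeights P).trans (h'.colWeights P)⟩

theorem SameEffect.append {W W' : Word R} (h : SameEffect W W') (P Q : Word R) :
    SameEffect (P ++ (W ++ Q)) (P ++ (W' ++ Q)) := by
  constructor
  · intro N hN
    simp only [Word.run_append, h.run (Word.run_strictUpper hN P)]
  · intro N hN
    have hN' := Word.run_strictUpper hN P
    simp only [Word.pivots_append, h.run hN', h.pivots hN']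
  · intro N hN
    have hN' := Word.run_strictUpper hN P
    simp only [Word.entries_append, h.run hN', h.entries hN']
  · intro P
    simp only [Word.rowWeights_append, h.rowWeights]
  · intro P
    simp only [Word.colWeights_append, h.colWeights]

/-- Slides can be lifted to tangles with weights; they do not change the effect on matrices. -/
theorem Slide.lift {V V' : Word Unit} (h : Slide V V') {W' : Word R} (hW' : W'.erase = V') :
    ∃ W : Word R, W.erase = V ∧ SameEffect W W' := by
  cases h with
  | colCup P Q =>
    obtain ⟨P, e1, e2, Q, rfl, rfl, he1, he2, rfl⟩ := Word.erase_eq_pair hW'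
    obtain ⟨u, rfl⟩ := Ev.map_eq_cup he1
    obtain ⟨x, rfl⟩ := Ev.map_eq_col he2
    refine ⟨P ++ ([.col 0 x, .cup 3 u] ++ Q), by rw [Word.erase_append]; rfl,
      SameEffect.append (W' := [.cup 3 u, .col 0 x]) ⟨fun {N} _ => ?_, fun _ => ?_,
        fun {N} _ => ?_, fun _ => ?_, fun _ => ?_⟩ P Q⟩
    · exact crossStep_cupStep_comm x N
    · simp [Word.Pivots, Ev.Pivot]
    · have hE : cupStep 3 N 0 1 = N 0 1 := by norm_num [cupStep, unshiftZ]
      simp [Word.Entries, Ev.Entry, Ev.matStep, hE]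
    · simp [Word.RowWeights, Ev.rowWeight]
    · simp [Word.ColWeights, Ev.colWeight]
  | cupCup P Q =>
    obtain ⟨P, e1, e2, Q, rfl, rfl, he1, he2, rfl⟩ := Word.erase_eq_pair hW'
    obtain ⟨u, rfl⟩ := Ev.map_eq_cup he1
    obtain ⟨x, rfl⟩ := Ev.map_eq_cup he2
    refine ⟨P ++ ([.cup 1 x, .cup 3 u] ++ Q), by rw [Word.erase_append]; rfl,
      SameEffect.append (W' := [.cup 1 u, .cup 1 x]) ⟨fun {N} _ => ?_, fun _ => ?_,
        fun {N} _ => ?_, fun _ => ?_, fun _ => ?_⟩ P Q⟩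
    · exact cupStep_cupStep_comm N
    · simp [Word.Pivots, Ev.Pivot]
    · simp [Word.Entries, Ev.Entry]
    · simp [Word.RowWeights, Ev.rowWeight]
    · simp [Word.ColWeights, Ev.colWeight]
  | cuspCusp P Q =>
    obtain ⟨P, e1, e2, Q, rfl, rfl, he1, he2, rfl⟩ := Word.erase_eq_pair hW'
    obtain ⟨u, rfl⟩ := Ev.map_eq_cusp he1
    obtain ⟨x, rfl⟩ := Ev.map_eq_cusp he2
    refine ⟨P ++ ([.cusp 3 x, .cusp 1 u] ++ Q), by rw [Word.erase_append]; rfl,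
      SameEffect.append (W' := [.cusp 1 u, .cusp 1 x]) ⟨fun {N} _ => ?_, fun {N} _ => ?_,
        fun {N} _ => ?_, fun _ => ?_, fun _ => ?_⟩ P Q⟩
    · exact elimStep_elimStep_comm N
    · have hE1 : elimStep 1 N 1 (1 + 1) = N 3 (3 + 1) := by norm_num [elimStep, shiftZ]
      have hE2 : elimStep 3 N 1 (1 + 1) = N 1 (1 + 1) := by norm_num [elimStep, shiftZ]
      simp only [Word.Pivots, Ev.Pivot, Ev.matStep, hE1, hE2]
      tauto
    · simp [Word.Entries, Ev.Entry]
    · simp [Word.RowWeights, Ev.rowWeight]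
    · simp [Word.ColWeights, Ev.colWeight]

theorem Slide.lift_trans {V V' : Word Unit} (h : Relation.ReflTransGen Slide V V') {W' : Word R}
    (hW' : W'.erase = V') : ∃ W : Word R, W.erase = V ∧ SameEffect W W' := by
  induction h using Relation.ReflTransGen.head_induction_on with
  | refl => exact ⟨W', hW', fun _ => rfl, fun _ => Iff.rfl, fun _ => Iff.rfl, fun _ => Iff.rfl,
      fun _ => Iff.rfl⟩
  | head h _ ih =>
    obtain ⟨W, hW, e⟩ := ih
    obtain ⟨W1, hW1, e1⟩ := h.lift hW
    exact ⟨W1, hW1, e1.trans e⟩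

/-- A two-strand tangle acts through a matrix of determinant one with entries in the subring `S`:
the pivots are `1`, the entries at all crossings vanish, and the weights of the column crossings lie
in `S`. For the standard weights the matrix is that of the permutation of the strands. -/
def TangAct (S : Subring R) (p : Bool) (W : Word R) (N : Mat R) : Prop :=
  W.Pivots N ∧ W.Entries N ∧ W.ColWeights (· ∈ S) ∧
    ∃ A B C D : R, ActAt 0 A B C D N (W.run N) ∧ (A ∈ S ∧ B ∈ S ∧ C ∈ S ∧ D ∈ S) ∧
      (W.Standard → A = (if p then 0 else 1) ∧ B = (if p then 1 else 0) ∧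
        C = (if p then 1 else 0) ∧ D = (if p then 0 else 1))

/-- The weights of the row crossings determine the action of a tangle: if the entry at its two
strands vanishes at the left end and either all pivots are `1` or the weights are standard, it acts
through a matrix of determinant one, and the column weights and the matrix lie in every subring that
contains the row weights. The pivot conditions determine the column weights one after the other. -/
theorem Tang.act (h2 : ∀ r : R, r + r = 0) (hu : ∀ a b : R, a * b = 1 → a = b) (S : Subring R)
    {p : Bool} {W₀ : Word Unit} (h : Tang p W₀) :
    ∀ W : Word R, W.erase = W₀ → ∀ N : Mat R, StrictUpper N → N 0 1 = 0 →
      W.RowWeights (· ∈ S) → (W.Standard ∨ W.Pivots N) → TangAct S p W N := by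
  induction h with
  | nil =>
    intro W hW N hN hy _ _
    obtain rfl := Word.erase_eq_nil hW
    exact ⟨trivial, trivial, fun _ h => absurd h List.not_mem_nil, 1, 0, 0, 1, ActAt.refl hy,
      ⟨S.one_mem, S.zero_mem, S.zero_mem, S.one_mem⟩, by simp⟩
  | row =>
    intro W hW N hN hy hr _
    obtain ⟨x, rfl⟩ := Word.erase_eq_row hW
    refine ⟨⟨trivial, trivial⟩, ⟨by simpa [Ev.Entry] using hy, trivial⟩, ?_, x, 1, 1, 0,
      actAt_crossStep hN x, ⟨hr _ (List.mem_singleton.2 rfl), S.one_mem, S.one_mem, S.zero_mem⟩, ?_⟩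
    · intro e he
      obtain rfl := List.mem_singleton.1 he
      trivial
    · intro hs
      have : x = 0 := hs.1 _ (List.mem_singleton.2 rfl)
      simp [this]
  | @append p q V V' _ _ ih1 ih2 =>
    intro W hW N hN hy hr hc
    obtain ⟨P, Q, rfl, hP, hQ⟩ := Word.erase_eq_append hW
    rw [Word.rowWeights_append] at hr
    rw [Word.standard_append, Word.pivots_append] at hc
    obtain ⟨a1, a2, a3, A, B, C, D, a4, ⟨sA, sB, sC, sD⟩, a6⟩ :=
      ih1 P hP N hN hy hr.1 (hc.imp And.left And.left)
    obtain ⟨b1, b2, b3, A', B', C', D', b4, ⟨tA, tB, tC, tD⟩, b6⟩ := ih2 Q hQ _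
      (Word.run_strictUpper hN P) (by simpa using a4.mid) hr.2 (hc.imp And.right And.right)
    refine ⟨(Word.pivots_append _ _ _).2 ⟨a1, b1⟩, (Word.entries_append _ _ _).2 ⟨a2, b2⟩,
      (Word.colWeights_append _ _).2 ⟨a3, b3⟩, _, _, _, _, by
        rw [Word.run_append]; exact a4.trans h2 b4, ⟨?_, ?_, ?_, ?_⟩, ?_⟩
    · exact S.add_mem (S.mul_mem sA tA) (S.mul_mem sB tC)
    · exact S.add_mem (S.mul_mem sA tB) (S.mul_mem sB tD)
    · exact S.add_mem (S.mul_mem sC tA) (S.mul_mem sD tC)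
    · exact S.add_mem (S.mul_mem sC tB) (S.mul_mem sD tD)
    · intro hs
      rw [Word.standard_append] at hs
      obtain ⟨rfl, rfl, rfl, rfl⟩ := a6 hs.1
      obtain ⟨rfl, rfl, rfl, rfl⟩ := b6 hs.2
      cases p <;> cases q <;> simp
  | @vert V _ ih =>
    intro W hW N hN hy hr hc
    obtain ⟨u, x, T, c, rfl, hT⟩ := Word.erase_eq_vert hW
    have hs := vertStart hN x
    set N2 := crossStep 0 x (cupStep 1 N) with hN2
    have hN2u : StrictUpper N2 := StrictUpper.crossStep _ _
    have hrun : ∀ W' : Word R, Word.run (.cup 1 u :: .col 0 x :: W') N = Word.run W' N2 :=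
      fun _ => rfl
    have hpiv : ∀ W' : Word R, Word.Pivots (.cup 1 u :: .col 0 x :: W') N ↔ Word.Pivots W' N2 :=
      fun _ => by simp [Word.Pivots, Ev.Pivot, Ev.matStep, hN2]
    have hst : Word.Standard (.cup 1 u :: .col 0 x :: (Word.raise 2 T ++ [.cusp 1 c])) →
        x = 1 ∧ T.Standard := by
      rintro ⟨s1, s2⟩
      rw [Word.rowWeights_cons, Word.rowWeights_cons, Word.rowWeights_append,
        Word.rowWeights_raise] at s1
      rw [Word.colWeights_cons, Word.colWeights_cons, Word.colWeights_append,
        Word.colWeights_raise] at s2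
      exact ⟨s2.2.1, s1.2.2.1, s2.2.2.1⟩
    rw [hpiv, Word.pivots_append, ← Word.pivots_lower] at hc
    rw [Word.rowWeights_cons, Word.rowWeights_cons, Word.rowWeights_append,
        Word.rowWeights_raise] at hr
    obtain ⟨a1, a2, a3, A, B, C, D, a4, ⟨sA, sB, sC, sD⟩, a6⟩ := ih T hT (lowerMat 2 N2)
      (hN2u.lowerMat 2) (by simpa [lowerMat] using hs.e23) hr.2.2.1
      (hc.imp (fun h => (hst h).2) (fun h => h.1))
    rw [Word.run_lower] at a4
    have a4' := a4.lower
    have hN3 : StrictUpper (Word.run (Word.raise 2 T) N2) := Word.run_strictUpper hN2u _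
    set N3 := Word.run (Word.raise 2 T) N2 with hN3d
    -- the pivot is `1` by assumption, or because for the standard weights the column crossing has
    -- weight `1` and the inner tangle acts as the identity
    have hp : N3 1 2 = 1 := by
      rcases hc with hc | hc
      · obtain ⟨rfl, hT'⟩ := hst hc
        obtain ⟨rfl, rfl, rfl, rfl⟩ := a6 hT'
        have := a4'.low0 1 (by norm_num)
        norm_num [hs.e12, hs.e13] at this
        exact this
      · have := hc.2.1
        simpa [Ev.Pivot] using this
    have hv := (actAt_vert h2 hu hs a4' hp).2 hy
    refine ⟨?_, ?_, ?_, x, 0, 0, x, ?_, ?_, ?_⟩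
    · rw [hpiv, Word.pivots_append, ← Word.pivots_lower]
      exact ⟨a1, by simpa [Ev.Pivot] using hp, trivial⟩
    · refine ⟨trivial, ?_, (Word.entries_append _ _ _).2 ⟨(Word.entries_lower _ _ _).1 a2,
        trivial, trivial⟩⟩
      norm_num [Ev.Entry, Ev.matStep, cupStep]
    · rw [Word.colWeights_cons, Word.colWeights_cons, Word.colWeights_append,
        Word.colWeights_raise]
      refine ⟨trivial, ?_, a3, ?_⟩
      · change x ∈ S
        rw [hv.1]; exact sA
      · intro e he
        obtain rfl := List.mem_singleton.1 he
        trivial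
    · rw [hrun, Word.run_append]; exact hv.2
    · rw [hv.1]; exact ⟨sA, S.zero_mem, S.zero_mem, sA⟩
    · intro h
      simp [(hst h).1]
  | @reflect p V hV ih =>
    intro W hW N hN hy hr hc
    obtain ⟨W, rfl, hW'⟩ := Word.erase_eq_reflect hW
    obtain ⟨N, rfl⟩ : ∃ N', N = reflectMat 2 N' := ⟨_, (reflectMat_reflectMat 2 N).symm⟩
    have hN' : StrictUpper N := by simpa [reflectMat_reflectMat] using hN.reflectMat 2
    have hst : Word.Standard (Word.reflect 2 W) ↔ W.Standard := by
      simp [Word.Standard, Word.rowWeights_reflect, Word.colWeights_reflect]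
    have hg : Word.gain W = 0 := by rw [← Word.gain_erase, hW', hV.gain_eq_zero]
    rw [hst, Word.pivots_reflect] at hc
    rw [Word.rowWeights_reflect] at hr
    obtain ⟨a1, a2, a3, A, B, C, D, a4, a5, a6⟩ := ih W hW' N hN'
      (by simpa [reflectMat] using hy) hr hc
    refine ⟨(Word.pivots_reflect _ _ _).2 a1, (Word.entries_reflect _ _ _).2 a2,
      (Word.colWeights_reflect _ _).2 a3, A, B, C, D, ?_, a5, fun h => a6 (hst.1 h)⟩
    rw [Word.run_reflect, hg, add_zero]
    exact a4.reflect
  | @slide p V V' _ hs ih =>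
    intro W hW N hN hy hr hc
    obtain ⟨W', hW', e⟩ := hs.lift hW
    have key := ih W' hW' N hN hy ((e.rowWeights _).2 hr)
      (hc.imp e.standard.2 (e.pivots hN).2)
    rwa [TangAct, e.pivots hN, e.entries hN, e.colWeights, e.run hN, e.standard] at key

/-- If a tangle that ends in a vertical addition meets the pivot conditions, then the entries at its
crossings vanish, and the entry at its two strands is the same at both ends, whatever its value. -/
theorem Tang.act_vertSum (h2 : ∀ r : R, r + r = 0) (hu : ∀ a b : R, a * b = 1 → a = b)
    {V W₀ : Word Unit} (h : Tang false V) (hs : Relation.ReflTransGen Slide (vertSum V) W₀)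
    {W : Word R} (hW : W.erase = W₀) {N : Mat R} (hN : StrictUpper N) (hp : W.Pivots N) :
    W.Entries N ∧ W.run N 0 1 = N 0 1 := by
  obtain ⟨W', hW', e⟩ := Slide.lift_trans hs hW
  rw [← e.pivots hN] at hp
  rw [← e.entries hN, ← e.run hN]
  obtain ⟨u, x, T, c, rfl, hT⟩ := Word.erase_eq_vert hW'
  have hs := vertStart hN x
  set N2 := crossStep 0 x (cupStep 1 N) with hN2
  have hN2u : StrictUpper N2 := StrictUpper.crossStep _ _
  have hrun : ∀ W' : Word R, Word.run (.cup 1 u :: .col 0 x :: W') N = Word.run W' N2 :=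
    fun _ => rfl
  have hpiv : ∀ W' : Word R, Word.Pivots (.cup 1 u :: .col 0 x :: W') N ↔ Word.Pivots W' N2 :=
    fun _ => by simp [Word.Pivots, Ev.Pivot, Ev.matStep, hN2]
  rw [hpiv, Word.pivots_append, ← Word.pivots_lower] at hp
  obtain ⟨a1, a2, a3, A, B, C, D, a4, -⟩ := h.act h2 hu ⊤ T hT (lowerMat 2 N2)
    (hN2u.lowerMat 2) (by simpa [lowerMat] using hs.e23)
    (fun e _ => by cases e <;> simp [Ev.rowWeight]) (.inr hp.1)
  rw [Word.run_lower] at a4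
  have hp' := hp.2.1
  rw [Ev.Pivot] at hp'
  have hv := (actAt_vert h2 hu hs a4.lower (by simpa using hp')).1
  refine ⟨⟨trivial, ?_, (Word.entries_append _ _ _).2 ⟨(Word.entries_lower _ _ _).1 a2,
        trivial, trivial⟩⟩, ?_⟩
  · norm_num [Ev.Entry, Ev.matStep, cupStep]
  · rw [hrun, Word.run_append]; exact hv

end SolidTorus

namespace SolidTorus

/-! ### Labels of the strands of a tangle -/

variable {X : Type*}

namespace Ev

/-- The effect of a singularity on the labels of the strands of a vertical line. The label of the
upper branch of a cusp is the image under `σ` of the label of the lower branch: for a Maslov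
potential `σ` adds `1`, for a coloring of the components it is the identity. -/
def labStep (σ : Equiv.Perm X) : Ev X → (ℤ → X) → ℤ → X
  | row k _, l => fun i => l (swapZ k i)
  | col k _, l => fun i => l (swapZ k i)
  | cup k a, l => fun i => if i = k then a else if i = k + 1 then σ a else l (unshiftZ k i)
  | cusp k _, l => fun i => l (shiftZ k i)

/-- The labels of the branches of a right cusp are related by `σ`. -/
def LabOk (σ : Equiv.Perm X) : Ev X → (ℤ → X) → Prop
  | cusp k _, l => l (k + 1) = σ (l k)
  | _, _ => True

/-- The labels of the two strands to the left of a row crossing. -/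
def labRec : Ev X → (ℤ → X) → List (X × X)
  | row k _, l => [(l k, l (k + 1))]
  | _, _ => []

/-- The two strands of a column crossing have the same label. -/
def ColEq : Ev X → (ℤ → X) → Prop
  | col k _, l => l k = l (k + 1)
  | _, _ => True

end Ev

namespace Word

/-- The labels at the right end of a tangle. -/
def labRun (σ : Equiv.Perm X) : Word X → (ℤ → X) → ℤ → X
  | [], l => l
  | e :: W, l => labRun σ W (e.labStep σ l)

/-- The labels satisfy the conditions at all right cusps. -/
def LabOk (σ : Equiv.Perm X) : Word X → (ℤ → X) → Prop
  | [], _ => True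
  | e :: W, l => e.LabOk σ l ∧ LabOk σ W (e.labStep σ l)

/-- The pairs of labels at the row crossings, from left to right. -/
def labRec (σ : Equiv.Perm X) : Word X → (ℤ → X) → List (X × X)
  | [], _ => []
  | e :: W, l => e.labRec l ++ labRec σ W (e.labStep σ l)

/-- The two labels at every column crossing agree. -/
def ColEq (σ : Equiv.Perm X) : Word X → (ℤ → X) → Prop
  | [], _ => True
  | e :: W, l => e.ColEq l ∧ ColEq σ W (e.labStep σ l)

variable (σ : Equiv.Perm X)

theorem labRun_append (W W' : Word X) (l : ℤ → X) :
    labRun σ (W ++ W') l = labRun σ W' (labRun σ W l) := by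
  induction W generalizing l with
  | nil => rfl
  | cons e W ih => simp [labRun, ih]

theorem labOk_append (W W' : Word X) (l : ℤ → X) :
    LabOk σ (W ++ W') l ↔ LabOk σ W l ∧ LabOk σ W' (labRun σ W l) := by
  induction W generalizing l with
  | nil => simp [LabOk, labRun]
  | cons e W ih => simp [LabOk, labRun, ih, and_assoc]

theorem labRec_append (W W' : Word X) (l : ℤ → X) :
    labRec σ (W ++ W') l = labRec σ W l ++ labRec σ W' (labRun σ W l) := by
  induction W generalizing l with
  | nil => simp [labRec, labRun]
  | cons e W ih => simp [labRec, labRun, ih]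

theorem colEq_append (W W' : Word X) (l : ℤ → X) :
    ColEq σ (W ++ W') l ↔ ColEq σ W l ∧ ColEq σ W' (labRun σ W l) := by
  induction W generalizing l with
  | nil => simp [ColEq, labRun]
  | cons e W ih => simp [ColEq, labRun, ih, and_assoc]

end Word

/-! ### Reflection and translation of labels -/

theorem Ev.labStep_lower (σ : Equiv.Perm X) (c : ℤ) (e : Ev X) (l : ℤ → X) :
    e.labStep σ (fun i => l (i + c)) = fun i => (e.raise c).labStep σ l (i + c) := by
  have h1 : ∀ k i : ℤ, swapZ k i + c = swapZ (k + c) (i + c) := by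
    intro k i; unfold swapZ; split_ifs <;> omega
  have h2 : ∀ k i : ℤ, shiftZ k i + c = shiftZ (k + c) (i + c) := by
    intro k i; unfold shiftZ; split_ifs <;> omega
  have h3 : ∀ k i : ℤ, unshiftZ k i + c = unshiftZ (k + c) (i + c) := by
    intro k i; unfold unshiftZ; split_ifs <;> omega
  have h4 : ∀ i k : ℤ, i + c = k + c + 1 ↔ i = k + 1 := by intros; omega
  cases e <;> funext i <;> simp [labStep, raise, h1, h2, h3, h4]

theorem Ev.labOk_lower (σ : Equiv.Perm X) (c : ℤ) (e : Ev X) (l : ℤ → X) :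
    e.LabOk σ (fun i => l (i + c)) ↔ (e.raise c).LabOk σ l := by
  cases e <;> simp [LabOk, raise, add_right_comm]

theorem Ev.labRec_lower (c : ℤ) (e : Ev X) (l : ℤ → X) :
    e.labRec (fun i => l (i + c)) = (e.raise c).labRec l := by
  cases e <;> simp [labRec, raise, add_right_comm]

theorem Ev.colEq_lower (c : ℤ) (e : Ev X) (l : ℤ → X) :
    e.ColEq (fun i => l (i + c)) ↔ (e.raise c).ColEq l := by
  cases e <;> simp [ColEq, raise, add_right_comm]

namespace Word
variable (σ : Equiv.Perm X)

theorem raise_cons {α : Type*} (c : ℤ) (e : Ev α) (W : Word α) :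
    raise c (e :: W) = e.raise c :: raise c W := rfl

theorem labRun_lower (c : ℤ) (W : Word X) (l : ℤ → X) :
    labRun σ W (fun i => l (i + c)) = fun i => labRun σ (raise c W) l (i + c) := by
  induction W generalizing l with
  | nil => rfl
  | cons e W ih => rw [raise_cons, labRun, labRun, Ev.labStep_lower, ih]

theorem labOk_lower (c : ℤ) (W : Word X) (l : ℤ → X) :
    LabOk σ W (fun i => l (i + c)) ↔ LabOk σ (raise c W) l := by
  induction W generalizing l with
  | nil => rfl
  | cons e W ih => rw [raise_cons, LabOk, LabOk, Ev.labStep_lower, ih, Ev.labOk_lower]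

theorem labRec_lower (c : ℤ) (W : Word X) (l : ℤ → X) :
    labRec σ W (fun i => l (i + c)) = labRec σ (raise c W) l := by
  induction W generalizing l with
  | nil => rfl
  | cons e W ih => rw [raise_cons, labRec, labRec, Ev.labStep_lower, ih, Ev.labRec_lower]

theorem colEq_lower (c : ℤ) (W : Word X) (l : ℤ → X) :
    ColEq σ W (fun i => l (i + c)) ↔ ColEq σ (raise c W) l := by
  induction W generalizing l with
  | nil => rfl
  | cons e W ih => rw [raise_cons, ColEq, ColEq, Ev.labStep_lower, ih, Ev.colEq_lower]

end Word

/-- The labels of `w` strands after the reflection `z ↦ -z`. -/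
def reflectLab (w : ℤ) (l : ℤ → X) : ℤ → X := fun i => l (w - 1 - i)

/-- The reflection of a labeled singularity. It exchanges the branches of a cusp, so `σ` is replaced
by its inverse: the label of the new lower branch is the image of the old label under `σ⁻¹`. -/
def Ev.reflectLab (σ : Equiv.Perm X) (w : ℤ) (e : Ev X) : Ev X := (e.map ⇑σ.symm).reflect w

theorem Ev.labStep_reflect (σ : Equiv.Perm X) (w : ℤ) (e : Ev X) (l : ℤ → X) :
    (e.reflectLab σ w).labStep σ (SolidTorus.reflectLab w l) =
      SolidTorus.reflectLab (w + e.gain) (e.labStep σ.symm l) := by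
  cases e with
  | row k x | col k x =>
    funext i
    have hs : w - 1 - swapZ (w - 2 - k) i = swapZ k (w - 1 - i) := by
      unfold swapZ; split_ifs <;> omega
    simp [labStep, Ev.reflectLab, Ev.map, Ev.reflect, Ev.gain, SolidTorus.reflectLab, hs]
  | cup k a =>
    funext i
    rw [show (cup k a).gain = 2 from rfl]
    simp only [labStep, Ev.reflectLab, Ev.map, Ev.reflect, SolidTorus.reflectLab]
    by_cases h1 : i = w - k
    · subst h1
      rw [if_pos rfl, if_neg (by omega), if_pos (by omega)]
    by_cases h2 : i = w - k + 1
    · subst h2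
      rw [if_neg (by omega), if_pos rfl, if_pos (by omega)]; simp
    · rw [if_neg h1, if_neg h2, if_neg (by omega), if_neg (by omega)]
      congr 1; unfold unshiftZ; split_ifs <;> omega
  | cusp k a =>
    funext i
    have hs : w - 1 - shiftZ (w - 2 - k) i = shiftZ k (w + -2 - 1 - i) := by
      unfold shiftZ; split_ifs <;> omega
    simp [labStep, Ev.reflectLab, Ev.map, Ev.reflect, Ev.gain, SolidTorus.reflectLab, hs]

theorem Ev.labOk_reflect (σ : Equiv.Perm X) (w : ℤ) (e : Ev X) (l : ℤ → X) :
    (e.reflectLab σ w).LabOk σ (SolidTorus.reflectLab w l) ↔ e.LabOk σ.symm l := by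
  cases e with
  | cusp k a =>
    simp only [LabOk, Ev.reflectLab, Ev.map, Ev.reflect, SolidTorus.reflectLab]
    rw [show w - 1 - (w - 2 - k + 1) = k by ring, show w - 1 - (w - 2 - k) = k + 1 by ring,
      Equiv.eq_symm_apply, eq_comm]
  | _ => rfl

theorem Ev.labRec_reflect (σ : Equiv.Perm X) (w : ℤ) (e : Ev X) (l : ℤ → X) :
    (e.reflectLab σ w).labRec (SolidTorus.reflectLab w l) = (e.labRec l).map Prod.swap := by
  cases e with
  | row k a =>
    simp only [labRec, Ev.reflectLab, Ev.map, Ev.reflect, SolidTorus.reflectLab]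
    rw [show w - 1 - (w - 2 - k + 1) = k by ring, show w - 1 - (w - 2 - k) = k + 1 by ring]
    rfl
  | _ => rfl

theorem Ev.colEq_reflect (σ : Equiv.Perm X) (w : ℤ) (e : Ev X) (l : ℤ → X) :
    (e.reflectLab σ w).ColEq (SolidTorus.reflectLab w l) ↔ e.ColEq l := by
  cases e with
  | col k a =>
    simp only [ColEq, Ev.reflectLab, Ev.map, Ev.reflect, SolidTorus.reflectLab]
    rw [show w - 1 - (w - 2 - k + 1) = k by ring, show w - 1 - (w - 2 - k) = k + 1 by ring,
      eq_comm]
  | _ => rfl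

namespace Word
variable (σ : Equiv.Perm X)

/-- The reflection of a labeled tangle with `w` strands at its left end. -/
def reflectLab (w : ℤ) (W : Word X) : Word X := reflect w (List.map (Ev.map ⇑σ.symm) W)

theorem reflectLab_cons (w : ℤ) (e : Ev X) (W : Word X) :
    reflectLab σ w (e :: W) = e.reflectLab σ w :: reflectLab σ (w + e.gain) W := by
  simp [reflectLab, reflect, Ev.reflectLab]

theorem erase_map {α β : Type*} (f : α → β) (W : Word α) : erase (List.map (Ev.map f) W) = erase W := by
  simp only [erase, List.map_map]
  exact List.map_congr_left fun e _ => by cases e <;> rfl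

theorem erase_reflectLab (w : ℤ) (W : Word X) : erase (reflectLab σ w W) = reflect w (erase W) := by
  rw [reflectLab, erase_reflect, erase_map]

theorem erase_eq_reflectLab {W : Word X} {w : ℤ} {V : Word Unit} (h : erase W = reflect w V) :
    ∃ W', W = reflectLab σ w W' ∧ erase W' = V := by
  obtain ⟨W1, rfl, h1⟩ := erase_eq_reflect h
  refine ⟨List.map (Ev.map ⇑σ) W1, ?_, by rw [erase_map, h1]⟩
  rw [reflectLab, List.map_map]
  congr 1
  refine ((List.map_congr_left fun e _ => ?_).trans (List.map_id _)).symm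
  cases e <;> simp [Ev.map]

theorem labRun_reflect (w : ℤ) (W : Word X) (l : ℤ → X) :
    labRun σ (reflectLab σ w W) (SolidTorus.reflectLab w l) =
      SolidTorus.reflectLab (w + gain W) (labRun σ.symm W l) := by
  induction W generalizing w l with
  | nil => simp [reflectLab, reflect, labRun, gain]
  | cons e W ih => rw [reflectLab_cons, labRun, labRun, Ev.labStep_reflect, ih, gain_cons, add_assoc]

theorem labOk_reflect (w : ℤ) (W : Word X) (l : ℤ → X) :
    LabOk σ (reflectLab σ w W) (SolidTorus.reflectLab w l) ↔ LabOk σ.symm W l := by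
  induction W generalizing w l with
  | nil => rfl
  | cons e W ih => rw [reflectLab_cons, LabOk, LabOk, Ev.labStep_reflect, ih, Ev.labOk_reflect]

theorem labRec_reflect (w : ℤ) (W : Word X) (l : ℤ → X) :
    labRec σ (reflectLab σ w W) (SolidTorus.reflectLab w l) =
      (labRec σ.symm W l).map Prod.swap := by
  induction W generalizing w l with
  | nil => rfl
  | cons e W ih =>
    rw [reflectLab_cons, labRec, labRec, Ev.labStep_reflect, ih, Ev.labRec_reflect, List.map_append]

theorem colEq_reflect (w : ℤ) (W : Word X) (l : ℤ → X) :
    ColEq σ (reflectLab σ w W) (SolidTorus.reflectLab w l) ↔ ColEq σ.symm W l := by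
  induction W generalizing w l with
  | nil => rfl
  | cons e W ih => rw [reflectLab_cons, ColEq, ColEq, Ev.labStep_reflect, ih, Ev.colEq_reflect]

end Word

/-! ### Labels under slides -/

/-- Two labeled tangles impose the same conditions on the labels, have the same labels at the right
end, and record the same pairs. -/
structure SameLabels (σ : Equiv.Perm X) (W W' : Word X) : Prop where
  run (l : ℤ → X) : W.labRun σ l = W'.labRun σ l
  ok (l : ℤ → X) : W.LabOk σ l ↔ W'.LabOk σ l
  record (l : ℤ → X) : W.labRec σ l = W'.labRec σ l
  colEq (l : ℤ → X) : W.ColEq σ l ↔ W'.ColEq σ l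

theorem SameLabels.append {σ : Equiv.Perm X} {W W' : Word X} (h : SameLabels σ W W')
    (P Q : Word X) : SameLabels σ (P ++ (W ++ Q)) (P ++ (W' ++ Q)) := by
  constructor <;> intro l
  · simp only [Word.labRun_append, h.run]
  · simp only [Word.labOk_append, h.run, h.ok]
  · simp only [Word.labRec_append, h.run, h.record]
  · simp only [Word.colEq_append, h.run, h.colEq]

theorem sameLabels_colCup (σ : Equiv.Perm X) (u x : X) :
    SameLabels σ [.col 0 x, .cup 3 u] [.cup 3 u, .col 0 x] := by
  constructor <;> intro l
  · funext i
    simp only [Word.labRun, Ev.labStep, unshiftZ, swapZ]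
    split_ifs <;> first | rfl | omega
  · simp [Word.LabOk, Ev.LabOk]
  · simp [Word.labRec, Ev.labRec]
  · norm_num [Word.ColEq, Ev.ColEq, Ev.labStep, unshiftZ]

theorem sameLabels_cupCup (σ : Equiv.Perm X) (u x : X) :
    SameLabels σ [.cup 1 x, .cup 3 u] [.cup 1 u, .cup 1 x] := by
  constructor <;> intro l
  · funext i
    simp only [Word.labRun, Ev.labStep, unshiftZ]
    split_ifs <;> first | rfl | omega
  · simp [Word.LabOk, Ev.LabOk]
  · simp [Word.labRec, Ev.labRec]
  · norm_num [Word.ColEq, Ev.ColEq]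

theorem sameLabels_cuspCusp (σ : Equiv.Perm X) (u x : X) :
    SameLabels σ [.cusp 3 x, .cusp 1 u] [.cusp 1 u, .cusp 1 x] := by
  constructor <;> intro l
  · funext i
    simp only [Word.labRun, Ev.labStep, shiftZ]
    split_ifs <;> first | rfl | omega
  · norm_num [Word.LabOk, Ev.LabOk, Ev.labStep, shiftZ]
    tauto
  · simp [Word.labRec, Ev.labRec]
  · norm_num [Word.ColEq, Ev.ColEq]

/-- Slides can be lifted to labeled tangles, in both directions. -/
theorem Slide.labels {V V' : Word Unit} (h : Slide V V') (σ : Equiv.Perm X) :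
    (∀ W' : Word X, W'.erase = V' → ∃ W : Word X, W.erase = V ∧ SameLabels σ W W') ∧
    (∀ W : Word X, W.erase = V → ∃ W' : Word X, W'.erase = V' ∧ SameLabels σ W W') := by
  cases h with
  | colCup P Q =>
    constructor
    · intro W hW
      obtain ⟨P, e1, e2, Q, rfl, rfl, he1, he2, rfl⟩ := Word.erase_eq_pair hW
      obtain ⟨u, rfl⟩ := Ev.map_eq_cup he1
      obtain ⟨x, rfl⟩ := Ev.map_eq_col he2
      exact ⟨P ++ ([.col 0 x, .cup 3 u] ++ Q), by rw [Word.erase_append]; rfl,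
        (sameLabels_colCup σ u x).append P Q⟩
    · intro W hW
      obtain ⟨P, e1, e2, Q, rfl, rfl, he1, he2, rfl⟩ := Word.erase_eq_pair hW
      obtain ⟨x, rfl⟩ := Ev.map_eq_col he1
      obtain ⟨u, rfl⟩ := Ev.map_eq_cup he2
      refine ⟨P ++ ([Ev.cup 3 u, Ev.col 0 x] ++ Q), ?_, ?_⟩
      · rw [Word.erase_append]; rfl
      · exact (sameLabels_colCup σ u x).append P Q
  | cupCup P Q =>
    constructor
    · intro W hW
      obtain ⟨P, e1, e2, Q, rfl, rfl, he1, he2, rfl⟩ := Word.erase_eq_pair hW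
      obtain ⟨u, rfl⟩ := Ev.map_eq_cup he1
      obtain ⟨x, rfl⟩ := Ev.map_eq_cup he2
      exact ⟨P ++ ([.cup 1 x, .cup 3 u] ++ Q), by rw [Word.erase_append]; rfl,
        (sameLabels_cupCup σ u x).append P Q⟩
    · intro W hW
      obtain ⟨P, e1, e2, Q, rfl, rfl, he1, he2, rfl⟩ := Word.erase_eq_pair hW
      obtain ⟨x, rfl⟩ := Ev.map_eq_cup he1
      obtain ⟨u, rfl⟩ := Ev.map_eq_cup he2
      refine ⟨P ++ ([Ev.cup 1 u, Ev.cup 1 x] ++ Q), ?_, ?_⟩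
      · rw [Word.erase_append]; rfl
      · exact (sameLabels_cupCup σ u x).append P Q
  | cuspCusp P Q =>
    constructor
    · intro W hW
      obtain ⟨P, e1, e2, Q, rfl, rfl, he1, he2, rfl⟩ := Word.erase_eq_pair hW
      obtain ⟨u, rfl⟩ := Ev.map_eq_cusp he1
      obtain ⟨x, rfl⟩ := Ev.map_eq_cusp he2
      exact ⟨P ++ ([.cusp 3 x, .cusp 1 u] ++ Q), by rw [Word.erase_append]; rfl,
        (sameLabels_cuspCusp σ u x).append P Q⟩
    · intro W hW
      obtain ⟨P, e1, e2, Q, rfl, rfl, he1, he2, rfl⟩ := Word.erase_eq_pair hW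
      obtain ⟨x, rfl⟩ := Ev.map_eq_cusp he1
      obtain ⟨u, rfl⟩ := Ev.map_eq_cusp he2
      refine ⟨P ++ ([Ev.cusp 1 u, Ev.cusp 1 x] ++ Q), ?_, ?_⟩
      · rw [Word.erase_append]; rfl
      · exact (sameLabels_cuspCusp σ u x).append P Q

/-- Up to order, `r` consists of an element of the `σ`-orbit of `a` and an element of the `σ`-orbit
of `b`. -/
def Translates (σ : Equiv.Perm X) (a b : X) (r : X × X) : Prop :=
  ∃ n m : ℤ, r = ((σ ^ n) a, (σ ^ m) b) ∨ r = ((σ ^ n) b, (σ ^ m) a)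

theorem Translates.symm {σ : Equiv.Perm X} {a b : X} {r : X × X} (h : Translates σ a b r) :
    Translates σ b a r := by
  obtain ⟨n, m, h | h⟩ := h
  · exact ⟨n, m, .inr h⟩
  · exact ⟨n, m, .inl h⟩

/-- The labels of a two-strand tangle are determined by the labels `a`, `b` at its left end: there
is a labeling, the labels at every row crossing are determined, the two labels at a column crossing
agree, and the labels at the right end are those at the left end, exchanged if the strands are. At a
vertical addition, the label of the new left cusp is forced by the right cusp that closes it. -/
theorem Tang.labels {p : Bool} {V : Word Unit} (h : Tang p V) :
    ∀ (σ : Equiv.Perm X) (a b : X), ∃ rec : List (X × X), (∀ r ∈ rec, Translates σ a b r) ∧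
      ∀ l : ℤ → X, l 0 = a → l 1 = b →
        (∃ W : Word X, W.erase = V ∧ W.LabOk σ l) ∧
        ∀ W : Word X, W.erase = V → W.LabOk σ l → W.labRec σ l = rec ∧ W.ColEq σ l ∧
          W.labRun σ l = fun i => l (if p then swapZ 0 i else i) := by
  induction h with
  | nil =>
    intro σ a b
    refine ⟨[], by simp, fun l _ _ => ⟨⟨[], rfl, trivial⟩, fun W hW _ => ?_⟩⟩
    obtain rfl := Word.erase_eq_nil hW
    exact ⟨rfl, trivial, rfl⟩
  | row =>
    intro σ a b
    refine ⟨[(a, b)], ?_, fun l ha hb => ⟨⟨[.row 0 a], rfl, trivial, trivial⟩, fun W hW _ => ?_⟩⟩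
    · rintro r hr
      rw [List.mem_singleton.1 hr]
      exact ⟨0, 0, .inl rfl⟩
    · obtain ⟨x, rfl⟩ := Word.erase_eq_row hW
      refine ⟨?_, ⟨trivial, trivial⟩, rfl⟩
      rw [← ha, ← hb]; rfl
  | @append p q V V' _ _ ih1 ih2 =>
    intro σ a b
    obtain ⟨r1, t1, h1⟩ := ih1 σ a b
    obtain ⟨r2, t2, h2⟩ := ih2 σ (if p then b else a) (if p then a else b)
    have hl : ∀ l : ℤ → X, l 0 = a → l 1 = b →
        (fun i => l (if p then swapZ 0 i else i)) 0 = (if p then b else a) ∧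
        (fun i => l (if p then swapZ 0 i else i)) 1 = (if p then a else b) := by
      intro l ha hb
      cases p <;> simp [swapZ, ha, hb]
    refine ⟨r1 ++ r2, ?_, fun l ha hb => ⟨?_, ?_⟩⟩
    · intro r hr
      rcases List.mem_append.1 hr with hr | hr
      · exact t1 r hr
      · have := t2 r hr
        cases p
        · exact this
        · exact this.symm
    · obtain ⟨⟨W1, e1, o1⟩, u1⟩ := h1 l ha hb
      obtain ⟨⟨W2, e2, o2⟩, -⟩ := h2 (fun i => l (if p then swapZ 0 i else i)) (hl l ha hb).1 (hl l ha hb).2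
      exact ⟨W1 ++ W2, by rw [Word.erase_append, e1, e2],
        (Word.labOk_append _ _ _ _).2 ⟨o1, by rw [(u1 W1 e1 o1).2.2]; exact o2⟩⟩
    · intro W hW ho
      obtain ⟨W1, W2, rfl, e1, e2⟩ := Word.erase_eq_append hW
      rw [Word.labOk_append] at ho
      obtain ⟨a1, a2, a3⟩ := (h1 l ha hb).2 W1 e1 ho.1
      rw [a3] at ho
      obtain ⟨b1, b2, b3⟩ := (h2 (fun i => l (if p then swapZ 0 i else i)) (hl l ha hb).1 (hl l ha hb).2).2 W2 e2 ho.2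
      refine ⟨by rw [Word.labRec_append, a1, a3, b1],
        (Word.colEq_append _ _ _ _).2 ⟨a2, by rw [a3]; exact b2⟩, ?_⟩
      rw [Word.labRun_append, a3, b3]
      have hss : ∀ i, swapZ 0 (swapZ 0 i) = i := by intro i; unfold swapZ; split_ifs <;> omega
      funext i
      cases p <;> cases q <;> simp [hss]
  | @vert V _ ih =>
    intro σ a b
    obtain ⟨rec, t, h⟩ := ih σ (σ a) b
    -- the labels to the left of the inner tangle, if the left cusp has the label `u`
    let start : (ℤ → X) → X → ℤ → X := fun l u =>
      (Ev.col 0 a : Ev X).labStep σ ((Ev.cup 1 u : Ev X).labStep σ l)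
    have s0 : ∀ l u, start l u 0 = u := by intro l u; simp [start, Ev.labStep, swapZ]
    have s1 : ∀ l u, start l u 1 = l 0 := by intro l u; simp [start, Ev.labStep, swapZ, unshiftZ]
    have s2 : ∀ l u, start l u 2 = σ u := by intro l u; simp [start, Ev.labStep, swapZ]
    have s3 : ∀ l u, start l u 3 = l 1 := by
      intro l u; norm_num [start, Ev.labStep, swapZ, unshiftZ]
    have s2' : ∀ l u, start l u (0 + 2) = σ u := fun l u => by rw [zero_add]; exact s2 l u
    have s3' : ∀ l u, start l u (1 + 2) = l 1 := fun l u => by norm_num; exact s3 l u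
    refine ⟨rec, ?_, fun l ha hb => ⟨?_, ?_⟩⟩
    · intro r hr
      obtain ⟨n, m, h | h⟩ := t r hr
      · exact ⟨n + 1, m, .inl (by rw [h, zpow_add, zpow_one]; rfl)⟩
      · exact ⟨n, m + 1, .inr (by rw [h, zpow_add, zpow_one]; rfl)⟩
    · obtain ⟨⟨T, hT, ho⟩, hu⟩ := h (fun i => start l a (i + 2)) (s2' l a) ((s3' l a).trans hb)
      refine ⟨.cup 1 a :: .col 0 a :: (Word.raise 2 T ++ [.cusp 1 a]), ?_, ?_⟩
      · simp [vertSum, ← hT, ← Word.erase_raise]; simp [Word.erase, Ev.map]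
      · have hrun := (hu T hT ho).2.2
        rw [Word.labRun_lower] at hrun
        refine ⟨trivial, trivial, (Word.labOk_append _ _ _ _).2 ⟨(Word.labOk_lower _ _ _ _).1 ho,
          ?_, trivial⟩⟩
        have e1 := congrFun hrun 0
        have e2 := congrFun hrun (-1)
        norm_num at e1 e2
        change Word.labRun σ (Word.raise 2 T) (start l a) (1 + 1) =
          σ (Word.labRun σ (Word.raise 2 T) (start l a) 1)
        norm_num
        rw [e1, e2, s1, s2, ha]
    · intro W hW ho
      obtain ⟨u, x, T, c, rfl, hT⟩ := Word.erase_eq_vert hW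
      obtain ⟨-, -, ho⟩ := ho
      rw [Word.labOk_append] at ho
      change Word.LabOk σ (Word.raise 2 T) (start l u) ∧
        Word.LabOk σ [.cusp 1 c] (Word.labRun σ (Word.raise 2 T) (start l u)) at ho
      rw [← Word.labOk_lower] at ho
      -- the labels of the inner tangle are determined once those of its left ends are; it returns
      -- them unchanged, so the condition at the right cusp reads `σ u = σ a`
      obtain ⟨r', -, h'⟩ := ih σ (σ u) b
      obtain ⟨-, -, hrun⟩ := (h' (fun i => start l u (i + 2)) (s2' l u) ((s3' l u).trans hb)).2 T hT ho.1
      rw [Word.labRun_lower] at hrun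
      have hrun' : Word.labRun σ (Word.raise 2 T) (start l u) = start l u := by
        funext i
        have := congrFun hrun (i - 2)
        simpa using this
      have hc : start l u (1 + 1) = σ (start l u 1) := by
        have := ho.2.1
        rwa [hrun'] at this
      norm_num at hc
      rw [s1, s2, ha] at hc
      obtain rfl : u = a := σ.injective hc
      obtain ⟨a1, a2, -⟩ := (h (fun i => start l u (i + 2)) (s2' l u) ((s3' l u).trans hb)).2 T hT ho.1
      rw [Word.labRec_lower] at a1
      rw [Word.colEq_lower] at a2
      refine ⟨?_, ⟨trivial, ?_, (Word.colEq_append _ _ _ _).2 ⟨a2, trivial, trivial⟩⟩, ?_⟩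
      · change Word.labRec σ (Word.raise 2 T ++ [.cusp 1 c]) (start l u) = rec
        rw [Word.labRec_append, a1]
        simp [Word.labRec, Ev.labRec]
      · simp [Ev.ColEq, Ev.labStep, unshiftZ, ha]
      · change Word.labRun σ (Word.raise 2 T ++ [.cusp 1 c]) (start l u) = _
        rw [Word.labRun_append, hrun']
        funext i
        simp only [Word.labRun, Ev.labStep, start, shiftZ, swapZ, unshiftZ]
        split_ifs <;> first | omega | (congr 1; omega) | simp_all
  | @reflect p V hV ih =>
    intro σ a b
    obtain ⟨rec, t, h⟩ := ih σ.symm b a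
    refine ⟨rec.map Prod.swap, ?_, ?_⟩
    · intro r hr
      obtain ⟨r, hr', rfl⟩ := List.mem_map.1 hr
      have hz : ∀ (n : ℤ) (y : X), ((σ.symm) ^ n) y = (σ ^ (-n)) y := by
        intro n y
        rw [zpow_neg, ← inv_zpow]; rfl
      obtain ⟨n, m, rfl | rfl⟩ := t r hr'
      · exact ⟨-m, -n, .inl (by simp [hz])⟩
      · exact ⟨-m, -n, .inr (by simp [hz])⟩
    · intro l ha hb
      obtain ⟨l, rfl⟩ : ∃ l', l = reflectLab 2 l' := ⟨reflectLab 2 l, by funext i; simp [reflectLab]⟩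
      obtain ⟨⟨W, hW, ho⟩, hu⟩ := h l (by simpa [reflectLab] using hb) (by simpa [reflectLab] using ha)
      refine ⟨⟨Word.reflectLab σ 2 W, by rw [Word.erase_reflectLab, hW],
        (Word.labOk_reflect _ _ _ _).2 ho⟩, ?_⟩
      intro W hW ho
      obtain ⟨W, rfl, hW'⟩ := Word.erase_eq_reflectLab σ hW
      rw [Word.labOk_reflect] at ho
      obtain ⟨a1, a2, a3⟩ := hu W hW' ho
      have hg : Word.gain W = 0 := by rw [← Word.gain_erase, hW', hV.gain_eq_zero]
      refine ⟨by rw [Word.labRec_reflect, a1], (Word.colEq_reflect _ _ _ _).2 a2, ?_⟩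
      rw [Word.labRun_reflect, hg, a3, add_zero]
      funext i
      simp only [reflectLab]
      congr 1
      cases p
      · rfl
      · simp only [if_true, swapZ]; split_ifs <;> omega
  | @slide p V V' _ hs ih =>
    intro σ a b
    obtain ⟨rec, t, h⟩ := ih σ a b
    refine ⟨rec, t, fun l ha hb => ⟨?_, ?_⟩⟩
    · obtain ⟨⟨W, hW, ho⟩, -⟩ := h l ha hb
      obtain ⟨W', hW', e⟩ := (hs.labels σ).2 W hW
      exact ⟨W', hW', (e.ok l).1 ho⟩
    · intro W' hW' ho
      obtain ⟨W, hW, e⟩ := (hs.labels σ).1 W' hW'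
      have := (h l ha hb).2 W hW ((e.ok l).2 ho)
      rwa [e.record, e.colEq, e.run] at this

end SolidTorus

namespace SolidTorus

/-! ### Disks in a resolved diagram -/

namespace Diagram

/-- The event is possible between a line with `w` and a line with `w'` strands. -/
def Event.Fits : Event → ℕ → ℕ → Prop
  | .cross _ k, w, w' => k + 1 < w ∧ w' = w
  | .cup k, w, w' => k ≤ w ∧ w' = w + 2
  | .cap k, w, w' => k + 2 ≤ w ∧ w = w' + 2

/-- A diagram like the resolution of a front with two strands at `x = 0`: events `0, …, n - 1` come
from the front, so that there are no special crossings among them and every cap is preceded by a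
crossing of the same strands; events `n` and `n + 1` are the two crossings of the transition tangle.
The number of strands on the line `t` is `wd t`. -/
structure Resolved (D : Diagram) (n : ℕ) (wd : ℕ → ℕ) : Prop where
  length : D.events.length = n + 2
  normalEnd : D.events[n]? = some (.cross false 0)
  specialEnd : D.events[n + 1]? = some (.cross true 0)
  normal : ∀ e < n, ∀ b k, D.events[e]? = some (.cross b k) → b = false
  cap : ∀ e k, D.events[e]? = some (.cap k) → ∃ e', e = e' + 1 ∧ D.events[e']? = some (.cross false k)
  fits : ∀ e E, D.events[e]? = some E → Event.Fits E (wd e) (wd (D.lineAfter e))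
  start : wd 0 = 2
  finish : wd n = 2

variable {D : Diagram}

theorem SubDisk.lt {s : Side} {t i j : ℕ} (d : D.SubDisk s t i j) : i < j := by
  induction d with
  | corner h hi hj => omega
  | pass h hij d ih => exact hij
  | lowerCorner h hi d ih => exact ih
  | upperCorner h hj d ih => exact ih
  | close h hi hj => omega
  | passDeath h hi hj d ih => subst hi hj; unfold shift; split_ifs <;> omega
  | turnUpper h hj hi hj' d d' ih ih' => omega
  | turnLower h hi hj hj' hi' d d' ih ih' => omega
  | passBirth h d ih => unfold shift at ih; split_ifs at ih <;> omega
  | split h hi hj u l ih ih' => omega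

theorem Ahead.event_cross {s : Side} {t e t' k : ℕ} {b : Bool} (h : D.Ahead s t e t' (.cross b k)) :
    D.events[e]? = some (.cross b k) := by
  obtain ⟨E, hE, hV⟩ := h.event
  cases E with
  | cross b' k' => simp only [Event.view, View.cross.injEq] at hV; rw [hE, hV.1, hV.2]
  | cup k' => cases s <;> simp [Event.view] at hV
  | cap k' => cases s <;> simp [Event.view] at hV

theorem Ahead.event_death_right {t e t' k : ℕ} (h : D.Ahead .right t e t' (.death k)) :
    D.events[e]? = some (.cap k) := by
  obtain ⟨E, hE, hV⟩ := h.event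
  cases E <;> simp_all [Event.view]

theorem Ahead.event_death_left {t e t' k : ℕ} (h : D.Ahead .left t e t' (.death k)) :
    D.events[e]? = some (.cup k) := by
  obtain ⟨E, hE, hV⟩ := h.event
  cases E <;> simp_all [Event.view]

theorem Ahead.event_birth_right {t e t' k : ℕ} (h : D.Ahead .right t e t' (.birth k)) :
    D.events[e]? = some (.cup k) := by
  obtain ⟨E, hE, hV⟩ := h.event
  cases E <;> simp_all [Event.view]

theorem Ahead.event_birth_left {t e t' k : ℕ} (h : D.Ahead .left t e t' (.birth k)) :
    D.events[e]? = some (.cap k) := by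
  obtain ⟨E, hE, hV⟩ := h.event
  cases E <;> simp_all [Event.view]

namespace Resolved
variable {n : ℕ} {wd : ℕ → ℕ} (H : D.Resolved n wd)
include H

theorem lineAfter_of_le {e : ℕ} (he : e ≤ n) : D.lineAfter e = e + 1 := by
  rw [lineAfter, H.length, Nat.mod_eq_of_lt (by omega)]

theorem lineAfter_last : D.lineAfter (n + 1) = 0 := by
  rw [lineAfter, H.length, Nat.mod_self]

theorem lt_of_event {e : ℕ} {E : Event} (h : D.events[e]? = some E) : e < n + 2 := by
  rw [← H.length]; exact (List.getElem?_eq_some_iff.1 h).1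

theorem lt_of_cup {e k : ℕ} (h : D.events[e]? = some (.cup k)) : e < n := by
  have h1 := H.lt_of_event h
  by_contra h2
  obtain rfl | rfl : e = n ∨ e = n + 1 := by omega
  · rw [H.normalEnd] at h; simp at h
  · rw [H.specialEnd] at h; simp at h

theorem lt_of_cap {e k : ℕ} (h : D.events[e]? = some (.cap k)) : e < n := by
  have h1 := H.lt_of_event h
  by_contra h2
  obtain rfl | rfl : e = n ∨ e = n + 1 := by omega
  · rw [H.normalEnd] at h; simp at h
  · rw [H.specialEnd] at h; simp at h

theorem fits_cross {s : Side} {t e t' k : ℕ} {b : Bool} (h : D.Ahead s t e t' (.cross b k)) :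
    k + 1 < wd t ∧ wd t' = wd t := by
  have hf := H.fits _ _ h.event_cross
  have hl := h.lines
  cases s <;> obtain ⟨rfl, rfl⟩ := hl
  · exact ⟨by rw [hf.2]; exact hf.1, hf.2.symm⟩
  · exact hf

theorem fits_death {s : Side} {t e t' k : ℕ} (h : D.Ahead s t e t' (.death k)) :
    k + 2 ≤ wd t ∧ wd t = wd t' + 2 := by
  have hl := h.lines
  cases s
  · have hf := H.fits _ _ h.event_death_left
    obtain ⟨rfl, rfl⟩ := hl
    simp only [Event.Fits] at hf; omega
  · have hf := H.fits _ _ h.event_death_right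
    obtain ⟨rfl, rfl⟩ := hl
    exact hf

theorem fits_birth {s : Side} {t e t' k : ℕ} (h : D.Ahead s t e t' (.birth k)) :
    k ≤ wd t ∧ wd t' = wd t + 2 := by
  have hl := h.lines
  cases s
  · have hf := H.fits _ _ h.event_birth_left
    obtain ⟨rfl, rfl⟩ := hl
    simp only [Event.Fits] at hf; omega
  · have hf := H.fits _ _ h.event_birth_right
    obtain ⟨rfl, rfl⟩ := hl
    exact hf

/-- The arc that bounds a disk ends on strands of the diagram. -/
theorem lt_strands {s : Side} {t i j : ℕ} (d : D.SubDisk s t i j) : j < wd t := by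
  induction d with
  | corner h hi hj => have := H.fits_cross h; omega
  | pass h hij d ih =>
    have := H.fits_cross h
    unfold swap at ih; split_ifs at ih <;> omega
  | lowerCorner h hi d ih => have := H.fits_cross h; omega
  | upperCorner h hj d ih => have := H.fits_cross h; omega
  | close h hi hj => have := H.fits_death h; omega
  | passDeath h hi hj d ih =>
    have := H.fits_death h
    subst hi hj; unfold shift; split_ifs <;> omega
  | turnUpper h hj hi hj' d d' ih ih' => have := H.fits_death h; omega
  | turnLower h hi hj hj' hi' d d' ih ih' => have := H.fits_death h; omega
  | passBirth h d ih =>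
    have := H.fits_birth h
    unfold shift at ih; split_ifs at ih <;> omega
  | split h hi hj u l ih ih' => have := H.fits_birth h; omega

/-- Between the lines `0` and `n`, the only disks to the right of an arc are the loops of the
resolved right cusps. Going to the right, a disk would have to end at a cap, before which its
boundary crosses itself. -/
theorem right_subDisk {t : ℕ} (ht : t ≤ n) {i j : ℕ} (d : D.SubDisk .right t i j) :
    ∃ k, D.events[t]? = some (.cap k) ∧ i = k ∧ j = k + 1 := by
  induction ht using Nat.decreasingInduction generalizing i j with
  | self =>
    have h1 := H.lt_strands d
    have h2 := d.lt
    rw [H.finish] at h1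
    obtain ⟨rfl, rfl⟩ : i = 0 ∧ j = 1 := by omega
    have hev : ∀ {E}, D.events[n]? = some E → E = .cross false 0 := by
      intro E hE; rw [H.normalEnd] at hE; exact (Option.some.inj hE).symm
    cases d with
    | corner h hi hj =>
      obtain ⟨rfl, -⟩ := h.lines; have := hev h.event_cross; simp at this
    | pass h hij d =>
      obtain ⟨rfl, -⟩ := h.lines; have := hev h.event_cross
      obtain ⟨rfl, rfl⟩ := Event.cross.inj this
      have := d.lt; simp [swap] at this
    | lowerCorner h hi d =>
      obtain ⟨rfl, -⟩ := h.lines; have := hev h.event_cross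
      simp at this; omega
    | upperCorner h hj d =>
      obtain ⟨rfl, -⟩ := h.lines; have := hev h.event_cross
      simp at this; omega
    | close h hi hj =>
      obtain ⟨rfl, -⟩ := h.lines; have := hev h.event_death_right; simp at this
    | passDeath h hi hj d =>
      obtain ⟨rfl, -⟩ := h.lines; have := hev h.event_death_right; simp at this
    | turnUpper h hj hi hj' d d' =>
      obtain ⟨rfl, -⟩ := h.lines; have := hev h.event_death_right; simp at this
    | turnLower h hi hj hj' hi' d d' =>
      obtain ⟨rfl, -⟩ := h.lines; have := hev h.event_death_right; simp at this
    | passBirth h d =>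
      obtain ⟨rfl, -⟩ := h.lines; have := hev h.event_birth_right; simp at this
    | split h hi hj u l =>
      obtain ⟨rfl, -⟩ := h.lines; have := hev h.event_birth_right; simp at this
  | of_succ t ht ih =>
    have hne : ∀ {i j} (d : D.SubDisk .right (t + 1) i j), D.events[t]? = some (.cross false i) ∧
        j = i + 1 := by
      intro i j d
      obtain ⟨k, h1, rfl, rfl⟩ := ih d
      obtain ⟨e', h2, h3⟩ := H.cap _ _ h1
      obtain rfl : t = e' := by omega
      exact ⟨h3, rfl⟩
    have hl : D.lineAfter t = t + 1 := H.lineAfter_of_le (by omega)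
    have hij := d.lt
    cases d with
    | corner h hi hj =>
      obtain ⟨rfl, -⟩ := h.lines
      have := H.normal _ ht _ _ h.event_cross; simp at this
    | pass h hij d =>
      obtain ⟨rfl, rfl⟩ := h.lines
      have h1 := h.event_cross
      rw [hl] at d
      obtain ⟨h2, h3⟩ := hne d
      rw [h1] at h2
      have h4 := (Event.cross.inj (Option.some.inj h2)).2
      unfold swap at h3 h4; split_ifs at h3 h4 <;> omega
    | lowerCorner h hi d =>
      obtain ⟨rfl, rfl⟩ := h.lines
      have h1 := h.event_cross
      rw [hl] at d
      obtain ⟨h2, h3⟩ := hne d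
      rw [h1] at h2
      have h4 := (Event.cross.inj (Option.some.inj h2)).2
      omega
    | upperCorner h hj d =>
      obtain ⟨rfl, rfl⟩ := h.lines
      have h1 := h.event_cross
      rw [hl] at d
      obtain ⟨h2, h3⟩ := hne d
      rw [h1] at h2
      have h4 := (Event.cross.inj (Option.some.inj h2)).2
      omega
    | close h hi hj =>
      obtain ⟨rfl, -⟩ := h.lines
      exact ⟨_, h.event_death_right, hi, hj⟩
    | passDeath h hi hj d =>
      obtain ⟨rfl, rfl⟩ := h.lines
      have h1 := h.event_death_right
      rw [hl] at d
      rw [(hne d).1] at h1; simp at h1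
    | turnUpper h hj hi hj' d d' =>
      obtain ⟨rfl, rfl⟩ := h.lines
      have h1 := h.event_death_right
      rw [hl] at d
      rw [(hne d).1] at h1; simp at h1
    | turnLower h hi hj hj' hi' d d' =>
      obtain ⟨rfl, rfl⟩ := h.lines
      have h1 := h.event_death_right
      rw [hl] at d
      rw [(hne d).1] at h1; simp at h1
    | passBirth h d =>
      obtain ⟨rfl, rfl⟩ := h.lines
      have h1 := h.event_birth_right
      rw [hl] at d
      rw [(hne d).1] at h1; simp at h1
    | split h hi hj u l =>
      obtain ⟨rfl, rfl⟩ := h.lines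
      have h1 := h.event_birth_right
      rw [hl] at u
      rw [(hne u).1] at h1; simp at h1

/-- There is no disk to the right of a left cusp, hence no disk turns back around one. -/
theorem isEmpty_right_of_cup {e k : ℕ} (h : D.events[e]? = some (.cup k)) (i j : ℕ) :
    IsEmpty (D.SubDisk .right (D.lineAfter e) i j) := by
  have he := H.lt_of_cup h
  constructor
  intro d
  rw [H.lineAfter_of_le he.le] at d
  obtain ⟨k, h1, -, -⟩ := H.right_subDisk he d
  obtain ⟨e', h2, h3⟩ := H.cap _ _ h1
  obtain rfl : e = e' := by omega
  rw [h] at h3; simp at h3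

theorem ahead_left_succ {t e t' : ℕ} {V : View} (h : D.Ahead .left (t + 1) e t' V) :
    e = t ∧ t' = t ∧ t ≤ n := by
  obtain ⟨E, hE, -⟩ := h.event
  obtain ⟨h1, rfl⟩ := h.lines
  have h2 := H.lt_of_event hE
  by_cases h3 : t' ≤ n
  · rw [H.lineAfter_of_le h3] at h1
    omega
  · obtain rfl : t' = n + 1 := by omega
    rw [H.lineAfter_last] at h1; omega

end Resolved
end Diagram

/-! ### Sums over finite families of words -/

section WordSum
variable {R V α β : Type*} [CommRing R] {wt : V → R}

/-- The type `α` is finite, and the weights of the words `f a` have the sum `M`. -/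
def WordSum (wt : V → R) (f : α → List V) (M : R) : Prop :=
  Finite α ∧ ∑ᶠ a, ((f a).map wt).prod = M

theorem WordSum.of_bijective {f : α → List V} {M : R} {φ : β → α} (hφ : Function.Bijective φ)
    (h : WordSum wt (f ∘ φ) M) : WordSum wt f M := by
  have := h.1
  refine ⟨Finite.of_equiv _ (Equiv.ofBijective φ hφ), ?_⟩
  rw [← h.2]
  exact (finsum_comp_equiv (Equiv.ofBijective φ hφ)).symm

theorem WordSum.of_isEmpty [IsEmpty α] (f : α → List V) : WordSum wt f 0 :=
  ⟨inferInstance, finsum_of_isEmpty _⟩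

theorem WordSum.of_unique [Unique α] (f : α → List V) :
    WordSum wt f ((f default).map wt).prod :=
  ⟨inferInstance, finsum_unique _⟩

theorem WordSum.sumElim {f : α → List V} {g : β → List V} {M M' : R} (h : WordSum wt f M)
    (h' : WordSum wt g M') : WordSum wt (Sum.elim f g) (M + M') := by
  have := h.1; have := h'.1
  have := Fintype.ofFinite α; have := Fintype.ofFinite β
  refine ⟨inferInstance, ?_⟩
  rw [← h.2, ← h'.2, finsum_eq_sum_of_fintype, finsum_eq_sum_of_fintype, finsum_eq_sum_of_fintype,
    Fintype.sum_sum_type]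
  rfl

theorem WordSum.prod {f : α → List V} {g : β → List V} {M M' : R} (h : WordSum wt f M)
    (h' : WordSum wt g M') : WordSum wt (fun x : α × β => f x.1 ++ g x.2) (M * M') := by
  have := h.1; have := h'.1
  have := Fintype.ofFinite α; have := Fintype.ofFinite β
  refine ⟨inferInstance, ?_⟩
  rw [← h.2, ← h'.2, finsum_eq_sum_of_fintype, finsum_eq_sum_of_fintype, finsum_eq_sum_of_fintype,
    Fintype.sum_prod_type, Finset.sum_mul_sum]
  simp

theorem WordSum.scale {f g : α → List V} {M c : R} (h : WordSum wt f M)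
    (hg : ∀ a, ((g a).map wt).prod = c * ((f a).map wt).prod) : WordSum wt g (c * M) := by
  have := h.1
  have := Fintype.ofFinite α
  refine ⟨inferInstance, ?_⟩
  rw [← h.2, finsum_eq_sum_of_fintype, finsum_eq_sum_of_fintype, Finset.mul_sum]
  simp [hg]

theorem WordSum.congr {f g : α → List V} {M : R} (h : WordSum wt f M)
    (hg : ∀ a, ((g a).map wt).prod = ((f a).map wt).prod) : WordSum wt g M := by
  simpa using h.scale (c := 1) (g := g) (by simpa using hg)

theorem WordSum.cond {f : α → List V} {M : R} (P : Prop) [Decidable P] (h : WordSum wt f M) :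
    WordSum wt (fun x : PLift P × α => f x.2) (if P then M else 0) := by
  split_ifs with hP
  · refine WordSum.of_bijective (φ := fun a => (⟨hP⟩, a)) ⟨fun a b h => (Prod.mk.inj h).2, ?_⟩ h
    rintro ⟨⟨_⟩, a⟩
    exact ⟨a, rfl⟩
  · have : IsEmpty (PLift P × α) := ⟨fun x => hP x.1.1⟩
    exact WordSum.of_isEmpty _

end WordSum

end SolidTorus

namespace SolidTorus

/-! ### Counting the disks to the left of a vertical line -/

namespace Diagram
variable {R : Type*} [CommRing R]

/-- The matrices of the vertical lines, from left to right: `w e` is the weight of the crossing that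
is event `e`, and `y` that of the special crossing, which is the only corner of the only disk to the
left of the line `0`. -/
def lineMat (E : List Event) (w : ℕ → R) (y : R) : ℕ → Mat R
  | 0 => fun i j => if i = 0 ∧ j = 1 then y else 0
  | t + 1 => match E[t]? with
    | some (.cross _ k) => crossStep k (w t) (lineMat E w y t)
    | some (.cup k) => cupStep k (lineMat E w y t)
    | some (.cap k) => capStep k (lineMat E w y t)
    | none => lineMat E w y t

theorem lineMat_strictUpper (E : List Event) (w : ℕ → R) (y : R) (t : ℕ) :
    StrictUpper (lineMat E w y t) := by
  induction t with
  | zero =>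
    intro i j hij
    simp only [lineMat]
    rw [if_neg (by omega)]
  | succ t ih =>
    rw [lineMat]
    split
    · exact StrictUpper.crossStep _ _
    · exact ih.cupStep _
    · exact ih.capStep _
    · exact ih

variable {D : Diagram} {n : ℕ} {wd : ℕ → ℕ}

theorem swapZ_natCast (k i : ℕ) : swapZ k i = (swap k i : ℕ) := by
  unfold swapZ swap; split_ifs <;> omega

theorem shiftZ_natCast (k i : ℕ) : shiftZ k i = (shift k i : ℕ) := by
  unfold shiftZ shift; split_ifs <;> omega

theorem exists_shift_eq {k i : ℕ} (h : i ≠ k) (h' : i ≠ k + 1) : ∃ i', i = shift k i' := by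
  by_cases hi : i < k
  · exact ⟨i, by rw [shift, if_pos hi]⟩
  · exact ⟨i - 2, by unfold shift; split_ifs <;> omega⟩

theorem shift_injective (k : ℕ) : Function.Injective (shift k) := by
  intro i j h
  unfold shift at h
  split_ifs at h <;> omega

theorem unshiftZ_natCast (k i : ℕ) : unshiftZ k (shift k i : ℕ) = i := by
  unfold unshiftZ shift; split_ifs <;> omega

theorem shift_ne (k i : ℕ) : shift k i ≠ k ∧ shift k i ≠ k + 1 := by
  unfold shift; split_ifs <;> omega

namespace Resolved

theorem ahead_left_iff (H : D.Resolved n wd) {t : ℕ} (ht : t ≤ n) {E : Event}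
    (hE : D.events[t]? = some E) {e t' : ℕ} {V : View} :
    D.Ahead .left (t + 1) e t' V ↔ e = t ∧ t' = t ∧ E.view .left = V := by
  constructor
  · intro h
    obtain ⟨rfl, rfl, -⟩ := H.ahead_left_succ h
    obtain ⟨E', hE', hV⟩ := h.event
    rw [hE] at hE'
    obtain rfl := Option.some.inj hE'
    exact ⟨rfl, rfl, hV⟩
  · rintro ⟨rfl, rfl, rfl⟩
    exact ⟨⟨E, hE, rfl⟩, (H.lineAfter_of_le ht).symm, rfl⟩

theorem ahead_left_zero (H : D.Resolved n wd) {e t' : ℕ} {V : View} (h : D.Ahead .left 0 e t' V) :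
    e = n + 1 ∧ t' = n + 1 ∧ V = .cross true 0 := by
  obtain ⟨E, hE, hV⟩ := h.event
  obtain ⟨h1, rfl⟩ := h.lines
  have h2 := H.lt_of_event hE
  have h3 : t' = n + 1 := by
    by_contra h3
    rw [H.lineAfter_of_le (by omega)] at h1; omega
  subst h3
  rw [H.specialEnd] at hE
  obtain rfl := Option.some.inj hE
  exact ⟨rfl, rfl, hV.symm⟩

variable {wt : D.Vertex → R} {w : ℕ → R}

theorem word_concat (hw : ∀ a, wt a = w a.1) (l : List D.Vertex) (a : D.Vertex) :
    ((l ++ [a]).map wt).prod = w a.1 * (l.map wt).prod := by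
  rw [List.map_append, List.prod_append, List.map_singleton, List.prod_singleton, hw, mul_comm]

theorem word_cons (hw : ∀ a, wt a = w a.1) (l : List D.Vertex) (a : D.Vertex) :
    ((a :: l).map wt).prod = w a.1 * (l.map wt).prod := by
  rw [List.map_cons, List.prod_cons, hw]

theorem wordSum_zero (H : D.Resolved n wd) (hw : ∀ a, wt a = w a.1) (i j : ℕ) :
    WordSum wt (fun d : D.SubDisk .left 0 i j => d.word)
      (lineMat D.events w (w (n + 1)) 0 i j) := by
  have key : ∀ {i j} (d : D.SubDisk .left 0 i j), i = 0 ∧ j = 1 := by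
    intro i j d
    have h1 := d.lt
    have h2 := H.lt_strands d
    rw [H.start] at h2; omega
  have hA : D.Ahead .left 0 (n + 1) (n + 1) (.cross true 0) :=
    ⟨⟨_, H.specialEnd, rfl⟩, H.lineAfter_last.symm, rfl⟩
  simp only [lineMat]
  split_ifs with h
  · obtain ⟨rfl, rfl⟩ : i = 0 ∧ j = 1 := by omega
    have : Unique (D.SubDisk .left 0 0 1) := by
      refine ⟨⟨.corner hA rfl rfl⟩, ?_⟩
      intro d
      cases d with
      | corner h hi hj => obtain ⟨rfl, rfl, hV⟩ := H.ahead_left_zero h; cases hV; rfl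
      | pass h hij d =>
        obtain ⟨rfl, rfl, hV⟩ := H.ahead_left_zero h; cases hV
        have := d.lt; simp [swap] at this
      | lowerCorner h hi d => have := (H.ahead_left_zero h).2.2; cases this
      | upperCorner h hj d => have := (H.ahead_left_zero h).2.2; cases this
      | close h hi hj => have := (H.ahead_left_zero h).2.2; cases this
      | passDeath h hi hj d => have := (H.ahead_left_zero h).2.2; cases this
      | turnUpper h hj hi hj' d d' => have := (H.ahead_left_zero h).2.2; cases this
      | turnLower h hj hi hj' d d' => have := (H.ahead_left_zero h).2.2; cases this
      | passBirth h d => have := (H.ahead_left_zero h).2.2; cases this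
      | split h hi hj u l => have := (H.ahead_left_zero h).2.2; cases this
    have h1 := WordSum.of_unique (wt := wt)
      (fun d : D.SubDisk .left 0 0 1 => d.word)
    have h2 : (default : D.SubDisk .left 0 0 1) = .corner hA rfl rfl := Subsingleton.elim _ _
    have h3 : ((SubDisk.corner hA rfl rfl).word.map wt).prod = w (n + 1) :=
      (word_cons hw [] ⟨n + 1, hA.isVertex⟩).trans (by rw [List.map_nil, List.prod_nil, mul_one])
    rwa [h2, h3] at h1
  · have : IsEmpty (D.SubDisk .left 0 i j) := ⟨fun d => h (by have := key d; omega)⟩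
    exact WordSum.of_isEmpty _

variable {t k : ℕ}

theorem wordSum_cross (H : D.Resolved n wd) (hw : ∀ a, wt a = w a.1) (ht : t < n + 1)
    (hE : D.events[t]? = some (.cross false k))
    (ih : ∀ i j : ℕ, WordSum wt
      (fun d : D.SubDisk .left t i j => d.word) (lineMat D.events w (w (n + 1)) t i j)) (i j : ℕ) :
    WordSum wt (fun d : D.SubDisk .left (t + 1) i j => d.word)
      (lineMat D.events w (w (n + 1)) (t + 1) i j) := by
  have hA {e t'} {V} := H.ahead_left_iff (by omega) hE (e := e) (t' := t') (V := V)
  have hA0 : D.Ahead .left (t + 1) t t (.cross false k) := hA.2 ⟨rfl, rfl, rfl⟩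
  have hsum := ((ih (swap k i) (swap k j)).cond (i < j)).sumElim
    ((((ih i j).scale (c := w t) (g := fun d => d.word ++ [⟨t, _, _, hE⟩])
      (fun d => word_concat hw d.word _)).cond (i = k + 1)).sumElim
      (((ih i j).scale (c := w t) (g := fun d => ⟨t, _, _, hE⟩ :: d.word)
      (fun d => word_cons hw d.word _)).cond (j = k)))
  have hval : lineMat D.events w (w (n + 1)) (t + 1) i j =
      (if i < j then lineMat D.events w (w (n + 1)) t (swap k i : ℕ) (swap k j : ℕ) else 0) +
      ((if i = k + 1 then w t * lineMat D.events w (w (n + 1)) t i j else 0) +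
       (if j = k then w t * lineMat D.events w (w (n + 1)) t i j else 0)) := by
    have hu := lineMat_strictUpper D.events w (w (n + 1)) t
    rw [lineMat, hE]
    simp only [crossStep, swapZ_natCast]
    by_cases hij : i < j
    · rw [if_pos (by exact_mod_cast hij), if_pos hij, mul_comm _ (w t), add_assoc]
      norm_cast
    · rw [if_neg (by exact_mod_cast hij), if_neg hij, hu i j (by omega)]; simp
  rw [hval]
  refine WordSum.of_bijective (φ := Sum.elim
    (fun x : PLift (i < j) × D.SubDisk .left t (swap k i) (swap k j) => .pass hA0 x.1.1 x.2)
    (Sum.elim (fun x : PLift (i = k + 1) × D.SubDisk .left t i j => .lowerCorner hA0 x.1.1 x.2)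
      (fun x : PLift (j = k) × D.SubDisk .left t i j => .upperCorner hA0 x.1.1 x.2))) ⟨?_, ?_⟩ ?_
  · rintro (⟨⟨p⟩, d⟩ | ⟨⟨p⟩, d⟩ | ⟨⟨p⟩, d⟩) (⟨⟨p'⟩, d'⟩ | ⟨⟨p'⟩, d'⟩ | ⟨⟨p'⟩, d'⟩) h <;>
      simp only [Sum.elim_inl, Sum.elim_inr] at h <;> cases h <;> rfl
  · intro d
    cases d with
    | corner h hi hj => obtain ⟨-, -, hV⟩ := hA.1 h; cases hV
    | pass h hij d => obtain ⟨rfl, rfl, hV⟩ := hA.1 h; cases hV; exact ⟨.inl ⟨⟨hij⟩, d⟩, rfl⟩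
    | lowerCorner h hi d =>
      obtain ⟨rfl, rfl, hV⟩ := hA.1 h; cases hV; exact ⟨.inr (.inl ⟨⟨hi⟩, d⟩), rfl⟩
    | upperCorner h hj d =>
      obtain ⟨rfl, rfl, hV⟩ := hA.1 h; cases hV; exact ⟨.inr (.inr ⟨⟨hj⟩, d⟩), rfl⟩
    | close h hi hj => obtain ⟨-, -, hV⟩ := hA.1 h; cases hV
    | passDeath h hi hj d => obtain ⟨-, -, hV⟩ := hA.1 h; cases hV
    | turnUpper h hj hi hj' d d' => obtain ⟨-, -, hV⟩ := hA.1 h; cases hV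
    | turnLower h hi hj hj' hi' d d' => obtain ⟨-, -, hV⟩ := hA.1 h; cases hV
    | passBirth h d => obtain ⟨-, -, hV⟩ := hA.1 h; cases hV
    | split h hi hj u l => obtain ⟨-, -, hV⟩ := hA.1 h; cases hV
  · refine hsum.congr ?_
    rintro (⟨⟨p⟩, d⟩ | ⟨⟨p⟩, d⟩ | ⟨⟨p⟩, d⟩) <;> rfl

theorem wordSum_cup (H : D.Resolved n wd) (hE : D.events[t]? = some (.cup k))
    (ih : ∀ i j : ℕ, WordSum wt
      (fun d : D.SubDisk .left t i j => d.word) (lineMat D.events w (w (n + 1)) t i j)) (i j : ℕ) :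
    WordSum wt (fun d : D.SubDisk .left (t + 1) i j => d.word)
      (lineMat D.events w (w (n + 1)) (t + 1) i j) := by
  have ht := H.lt_of_cup hE
  have hA {e t'} {V} := H.ahead_left_iff ht.le hE (e := e) (t' := t') (V := V)
  have hA0 : D.Ahead .left (t + 1) t t (.death k) := hA.2 ⟨rfl, rfl, rfl⟩
  have hR := H.isEmpty_right_of_cup hE
  rw [H.lineAfter_of_le ht.le] at hR
  have hval : lineMat D.events w (w (n + 1)) (t + 1) = cupStep k (lineMat D.events w (w (n + 1)) t) := by
    rw [lineMat, hE]
  rw [hval]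
  have inv : ∀ d : D.SubDisk .left (t + 1) i j,
      (∃ hi : i = k, ∃ hj : j = k + 1, d = .close hA0 hi hj) ∨
      (∃ i' j', ∃ hi : i = shift k i', ∃ hj : j = shift k j', ∃ d' : D.SubDisk .left t i' j',
        d = .passDeath hA0 hi hj d') := by
    intro d
    cases d with
    | corner h hi hj => obtain ⟨-, -, hV⟩ := hA.1 h; cases hV
    | pass h hij d => obtain ⟨rfl, rfl, hV⟩ := hA.1 h; cases hV
    | lowerCorner h hi d => obtain ⟨rfl, rfl, hV⟩ := hA.1 h; cases hV
    | upperCorner h hj d => obtain ⟨rfl, rfl, hV⟩ := hA.1 h; cases hV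
    | close h hi hj => obtain ⟨rfl, rfl, hV⟩ := hA.1 h; cases hV; exact .inl ⟨hi, hj, rfl⟩
    | passDeath h hi hj d =>
      obtain ⟨rfl, rfl, hV⟩ := hA.1 h; cases hV; exact .inr ⟨_, _, hi, hj, d, rfl⟩
    | turnUpper h hj hi hj' d d' => exact (hR _ _).elim d'
    | turnLower h hi hj hj' hi' d d' => exact (hR _ _).elim d'
    | passBirth h d => obtain ⟨-, -, hV⟩ := hA.1 h; cases hV
    | split h hi hj u l => obtain ⟨-, -, hV⟩ := hA.1 h; cases hV
  by_cases h1 : i = k ∧ j = k + 1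
  · obtain ⟨rfl, rfl⟩ := h1
    have : Unique (D.SubDisk .left (t + 1) i (i + 1)) := by
      refine ⟨⟨.close hA0 rfl rfl⟩, fun d => ?_⟩
      rcases inv d with ⟨_, _, rfl⟩ | ⟨i', _, hi, _⟩
      · rfl
      · exact absurd hi.symm (shift_ne _ _).1
    have h1 := WordSum.of_unique (wt := wt)
      (fun d : D.SubDisk .left (t + 1) i (i + 1) => d.word)
    have h2 : (default : D.SubDisk .left (t + 1) i (i + 1)) = .close hA0 rfl rfl :=
      Subsingleton.elim _ _
    rw [h2] at h1
    simpa [SubDisk.word, cupStep] using h1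
  by_cases h2 : i = k ∨ i = k + 1 ∨ j = k ∨ j = k + 1
  · have : IsEmpty (D.SubDisk .left (t + 1) i j) := by
      constructor
      intro d
      rcases inv d with ⟨hi, hj, _⟩ | ⟨i', j', hi, hj, _⟩
      · exact h1 ⟨hi, hj⟩
      · have := shift_ne k i'; have := shift_ne k j'; omega
    have h3 : cupStep (k : ℤ) (lineMat D.events w (w (n + 1)) t) i j = 0 := by
      unfold cupStep
      rw [if_neg (by omega), if_pos (by omega)]
    rw [h3]
    exact WordSum.of_isEmpty _
  · simp only [not_or] at h2
    obtain ⟨i', rfl⟩ := exists_shift_eq (k := k) (i := i) (by omega) (by omega)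
    obtain ⟨j', rfl⟩ := exists_shift_eq (k := k) (i := j) (by omega) (by omega)
    have h3 : cupStep (k : ℤ) (lineMat D.events w (w (n + 1)) t) (shift k i' : ℕ) (shift k j' : ℕ)
        = lineMat D.events w (w (n + 1)) t i' j' := by
      unfold cupStep
      rw [if_neg (by omega), if_neg (by omega), unshiftZ_natCast, unshiftZ_natCast]
    rw [h3]
    refine WordSum.of_bijective (φ := fun d => .passDeath hA0 rfl rfl d) ⟨?_, ?_⟩
      ((ih i' j').congr fun d => rfl)
    · intro d d' h
      simp only [SubDisk.passDeath.injEq] at h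
      exact eq_of_heq h.2.2.2.2.2
    · intro d
      rcases inv d with ⟨hi, hj, _⟩ | ⟨i'', j'', hi, hj, d', rfl⟩
      · omega
      · obtain rfl := shift_injective k hi
        obtain rfl := shift_injective k hj
        exact ⟨d', rfl⟩

theorem wordSum_cap (H : D.Resolved n wd) (hE : D.events[t]? = some (.cap k))
    (ih : ∀ i j : ℕ, WordSum wt
      (fun d : D.SubDisk .left t i j => d.word) (lineMat D.events w (w (n + 1)) t i j)) (i j : ℕ) :
    WordSum wt (fun d : D.SubDisk .left (t + 1) i j => d.word)
      (lineMat D.events w (w (n + 1)) (t + 1) i j) := by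
  have ht := H.lt_of_cap hE
  have hA {e t'} {V} := H.ahead_left_iff ht.le hE (e := e) (t' := t') (V := V)
  have hA0 : D.Ahead .left (t + 1) t t (.birth k) := hA.2 ⟨rfl, rfl, rfl⟩
  have hval : lineMat D.events w (w (n + 1)) (t + 1) = capStep k (lineMat D.events w (w (n + 1)) t) := by
    rw [lineMat, hE]
  rw [hval]
  have h3 : capStep (k : ℤ) (lineMat D.events w (w (n + 1)) t) i j =
      lineMat D.events w (w (n + 1)) t (shift k i : ℕ) (shift k j : ℕ) + 
        if i < k ∧ k ≤ j then lineMat D.events w (w (n + 1)) t (k + 1 : ℕ) (j + 2 : ℕ) *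
          lineMat D.events w (w (n + 1)) t i k else 0 := by
    simp only [capStep, shiftZ_natCast]; norm_cast
  rw [h3]
  have hsum := (ih (shift k i) (shift k j)).sumElim
    (((ih (k + 1) (j + 2)).prod (ih i k)).cond (i < k ∧ k ≤ j))
  refine WordSum.of_bijective (φ := Sum.elim (fun d => .passBirth hA0 d)
    (fun x : PLift (i < k ∧ k ≤ j) × D.SubDisk .left t (k + 1) (j + 2) × D.SubDisk .left t i k =>
      .split hA0 x.1.1.1 x.1.1.2 x.2.1 x.2.2)) ⟨?_, ?_⟩ ?_
  · rintro (d | ⟨⟨p⟩, d, e⟩) (d' | ⟨⟨p'⟩, d', e'⟩) h <;>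
      simp only [Sum.elim_inl, Sum.elim_inr] at h <;> cases h <;> rfl
  · intro d
    cases d with
    | corner h hi hj => obtain ⟨-, -, hV⟩ := hA.1 h; cases hV
    | pass h hij d => obtain ⟨-, -, hV⟩ := hA.1 h; cases hV
    | lowerCorner h hi d => obtain ⟨-, -, hV⟩ := hA.1 h; cases hV
    | upperCorner h hj d => obtain ⟨-, -, hV⟩ := hA.1 h; cases hV
    | close h hi hj => obtain ⟨-, -, hV⟩ := hA.1 h; cases hV
    | passDeath h hi hj d => obtain ⟨-, -, hV⟩ := hA.1 h; cases hV
    | turnUpper h hj hi hj' d d' => obtain ⟨-, -, hV⟩ := hA.1 h; cases hV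
    | turnLower h hi hj hj' hi' d d' => obtain ⟨-, -, hV⟩ := hA.1 h; cases hV
    | passBirth h d => obtain ⟨rfl, rfl, hV⟩ := hA.1 h; cases hV; exact ⟨.inl d, rfl⟩
    | split h hi hj u l =>
      obtain ⟨rfl, rfl, hV⟩ := hA.1 h; cases hV; exact ⟨.inr ⟨⟨hi, hj⟩, u, l⟩, rfl⟩
  · refine hsum.congr ?_
    rintro (d | ⟨⟨p⟩, d, e⟩) <;> rfl

/-- The disks to the left of a line are counted by its matrix. -/
theorem wordSum_left (H : D.Resolved n wd) (hw : ∀ a, wt a = w a.1) {t : ℕ} (ht : t ≤ n) (i j : ℕ) :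
    WordSum wt (fun d : D.SubDisk .left t i j => d.word)
      (lineMat D.events w (w (n + 1)) t i j) := by
  induction t generalizing i j with
  | zero => exact H.wordSum_zero hw i j
  | succ t ih =>
    have ih' := fun i j => ih (by omega) i j
    have hlt : t < D.events.length := by rw [H.length]; omega
    have hE : D.events[t]? = some D.events[t] := List.getElem?_eq_getElem hlt
    rcases hc : D.events[t] with ⟨b, k⟩ | ⟨k⟩ | ⟨k⟩ <;> rw [hc] at hE
    · obtain rfl := H.normal t (by omega) b k hE
      exact H.wordSum_cross hw (by omega) hE ih' i j
    · exact H.wordSum_cup hE ih' i j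
    · exact H.wordSum_cap hE ih' i j

end Resolved
end Diagram
end SolidTorus

namespace SolidTorus

/-! ### The differential of a vertex -/

namespace Diagram
variable {D : Diagram} {n : ℕ} {wd : ℕ → ℕ}

theorem Vertex.event (a : D.Vertex) {b : Bool} {k : ℕ} (h : D.events[a.1]? = some (.cross b k)) :
    a.pos = k ∧ (a.IsSpecial ↔ b = true) := by
  constructor
  · obtain ⟨b', hb⟩ : ∃ b', D.events[a.1]? = some (.cross b' a.pos) :=
      ⟨_, a.2.choose_spec.choose_spec⟩
    rw [h] at hb
    exact (Event.cross.inj (Option.some.inj hb)).2.symm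
  · constructor
    · rintro ⟨k', hk'⟩
      rw [h] at hk'
      exact (Event.cross.inj (Option.some.inj hk')).1
    · rintro rfl; exact ⟨k, h⟩

open Classical in
/-- Weights of vertices as a function of the number of the event, `0` at cups and caps. -/
noncomputable def weight {R : Type*} [Zero R] (wt : D.Vertex → R) (e : ℕ) : R :=
  if h : ∃ b k, D.events[e]? = some (.cross b k) then wt ⟨e, h⟩ else 0

theorem weight_eq {R : Type*} [Zero R] (wt : D.Vertex → R) (a : D.Vertex) : wt a = weight wt a.1 := by
  rw [weight, dif_pos a.2]; rfl

namespace Resolved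

variable {R : Type*} [CommRing R] {wt : D.Vertex → R} {w : ℕ → R}

/-- The loop of a resolved right cusp is the only disk to the right of the crossing that represents
the cusp. -/
theorem wordSum_loop {t k : ℕ} (hE : D.events[t]? = some (.cap k)) :
    WordSum wt (fun d : D.SubDisk .right t k (k + 1) => d.word) 1 := by
  have hA : D.Ahead .right t t (D.lineAfter t) (.death k) := ⟨⟨_, hE, rfl⟩, rfl, rfl⟩
  have inv : ∀ {e t' V}, D.Ahead .right t e t' V → e = t ∧ t' = D.lineAfter t ∧ V = .death k := by
    intro e t' V h
    obtain ⟨E, hE', hV⟩ := h.event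
    obtain ⟨rfl, rfl⟩ := h.lines
    rw [hE] at hE'
    obtain rfl := Option.some.inj hE'
    exact ⟨rfl, rfl, hV.symm⟩
  have : Unique (D.SubDisk .right t k (k + 1)) := by
    refine ⟨⟨.close hA rfl rfl⟩, fun d => ?_⟩
    cases d with
    | corner h hi hj => have := (inv h).2.2; cases this
    | pass h hij d => have := (inv h).2.2; cases this
    | lowerCorner h hi d => have := (inv h).2.2; cases this
    | upperCorner h hj d => have := (inv h).2.2; cases this
    | close h hi hj => obtain ⟨rfl, rfl, hV⟩ := inv h; cases hV; rfl
    | passDeath h hi hj d =>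
      obtain ⟨rfl, rfl, hV⟩ := inv h; cases hV
      exact absurd hi.symm (shift_ne _ _).1
    | turnUpper h hj hi hj' d d' => obtain ⟨rfl, rfl, hV⟩ := inv h; cases hV; omega
    | turnLower h hi hj hj' hi' d d' => obtain ⟨rfl, rfl, hV⟩ := inv h; cases hV; omega
    | passBirth h d => have := (inv h).2.2; cases this
    | split h hi hj u l => have := (inv h).2.2; cases this
  have h1 := WordSum.of_unique (wt := wt) (fun d : D.SubDisk .right t k (k + 1) => d.word)
  have h2 : (default : D.SubDisk .right t k (k + 1)) = .close hA rfl rfl := Subsingleton.elim _ _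
  rw [h2] at h1
  simpa [SubDisk.word] using h1

/-- To the right of the last normal crossing there is only the disk with its corner at the special
crossing. -/
theorem wordSum_last (H : D.Resolved n wd) (hw : ∀ a, wt a = w a.1) :
    WordSum wt (fun d : D.SubDisk .right (n + 1) 0 1 => d.word) (w (n + 1)) := by
  have hA : D.Ahead .right (n + 1) (n + 1) (D.lineAfter (n + 1)) (.cross true 0) :=
    ⟨⟨_, H.specialEnd, rfl⟩, rfl, rfl⟩
  have inv : ∀ {e t' V}, D.Ahead .right (n + 1) e t' V →
      e = n + 1 ∧ t' = D.lineAfter (n + 1) ∧ V = .cross true 0 := by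
    intro e t' V h
    obtain ⟨E, hE', hV⟩ := h.event
    obtain ⟨rfl, rfl⟩ := h.lines
    rw [H.specialEnd] at hE'
    obtain rfl := Option.some.inj hE'
    exact ⟨rfl, rfl, hV.symm⟩
  have : Unique (D.SubDisk .right (n + 1) 0 1) := by
    refine ⟨⟨.corner hA rfl rfl⟩, fun d => ?_⟩
    cases d with
    | corner h hi hj => obtain ⟨rfl, rfl, hV⟩ := inv h; cases hV; rfl
    | pass h hij d =>
      obtain ⟨rfl, rfl, hV⟩ := inv h; cases hV
      have := d.lt; simp [swap] at this
    | lowerCorner h hi d => have := (inv h).2.2; cases this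
    | upperCorner h hj d => have := (inv h).2.2; cases this
    | close h hi hj => have := (inv h).2.2; cases this
    | passDeath h hi hj d => have := (inv h).2.2; cases this
    | turnUpper h hj hi hj' d d' => have := (inv h).2.2; cases this
    | turnLower h hi hj hj' hi' d d' => have := (inv h).2.2; cases this
    | passBirth h d => have := (inv h).2.2; cases this
    | split h hi hj u l => have := (inv h).2.2; cases this
  have h1 := WordSum.of_unique (wt := wt) (fun d : D.SubDisk .right (n + 1) 0 1 => d.word)
  have h2 : (default : D.SubDisk .right (n + 1) 0 1) = .corner hA rfl rfl := Subsingleton.elim _ _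
  have h3 : ((SubDisk.corner hA rfl rfl).word.map wt).prod = w (n + 1) :=
    (word_cons hw [] ⟨n + 1, hA.isVertex⟩).trans (by rw [List.map_nil, List.prod_nil, mul_one])
  rwa [h2, h3] at h1

/-- The disks with a given normal crossing as initial vertex lie to its left or to its right. -/
theorem wordSum_normal (H : D.Resolved n wd) (hw : ∀ a, wt a = w a.1) (a : D.Vertex) {k : ℕ}
    (ha : a.1 ≤ n) (hE : D.events[a.1]? = some (.cross false k)) {M : R}
    (hr : WordSum wt (fun d : D.SubDisk .right (a.1 + 1) k (k + 1) => d.word) M) :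
    WordSum wt (fun d : Disk a => d.word) (lineMat D.events w (w (n + 1)) a.1 k (k + 1) + M) := by
  have hl := H.wordSum_left hw ha k (k + 1)
  rw [← H.lineAfter_of_le ha] at hr
  have hk : ∀ {b k'}, D.events[a.1]? = some (.cross b k') → b = false ∧ k' = k := by
    intro b k' h
    rw [hE] at h
    have := Event.cross.inj (Option.some.inj h)
    exact ⟨this.1.symm, this.2.symm⟩
  refine WordSum.of_bijective (φ := Sum.elim (fun d : D.SubDisk .left a.1 k (k + 1) => .left hE d)
    (fun d : D.SubDisk .right (D.lineAfter a.1) k (k + 1) => .right hE d)) ⟨?_, ?_⟩ ?_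
  · rintro (d | d) (d' | d') h <;> simp only [Sum.elim_inl, Sum.elim_inr] at h <;> cases h <;> rfl
  · intro d
    cases d with
    | left h d => obtain ⟨-, rfl⟩ := hk h; exact ⟨.inl d, rfl⟩
    | right h d => obtain ⟨-, rfl⟩ := hk h; exact ⟨.inr d, rfl⟩
    | upper h hj d d' => have := (hk h).1; cases this
    | lower h hi d d' => have := (hk h).1; cases this
  · refine (hl.sumElim hr).congr ?_
    rintro (d | d)
    · rfl
    · exact (((List.reverse_perm _).map _).prod_eq)

/-- No disk has the special crossing as its initial vertex: there are no strands above or below it.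
-/
theorem wordSum_special (H : D.Resolved n wd) (a : D.Vertex) (ha : a.1 = n + 1) :
    WordSum wt (fun d : Disk a => d.word) 0 := by
  have hE := H.specialEnd
  rw [← ha] at hE
  have hk : ∀ {b k'}, D.events[a.1]? = some (.cross b k') → b = true ∧ k' = 0 := by
    intro b k' h
    rw [hE] at h
    have := Event.cross.inj (Option.some.inj h)
    exact ⟨this.1.symm, this.2.symm⟩
  have : IsEmpty (Disk a) := by
    constructor
    intro d
    cases d with
    | left h d => have := (hk h).1; cases this
    | right h d => have := (hk h).1; cases this
    | upper h hj d d' =>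
      have := H.lt_strands d
      rw [ha, H.lineAfter_last, H.start] at this; omega
    | lower h hi d d' => have := (hk h).2; omega
  exact WordSum.of_isEmpty _

end Resolved

variable {R : Type*} [CommRing R] [Algebra (ZMod 2) R]

/-- The image of the differential of a vertex under a homomorphism to a commutative ring. -/
theorem map_bdry (ψ : D.Alg →ₐ[ZMod 2] R) (a : D.Vertex) {M : R}
    (h : WordSum (fun v => ψ (Vertex.gen v)) (fun d : Disk a => d.word) M) : ψ a.bdry = M := by
  have := h.1
  rw [← h.2, Vertex.bdry]
  have h1 := (ψ : D.Alg →+ R).map_finsum (f := fun d : Disk a => (d.word.map Vertex.gen).prod)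
    (Set.toFinite _)
  refine h1.trans (finsum_congr fun d => ?_)
  change ψ _ = _
  rw [map_list_prod, List.map_map]; rfl

namespace Resolved

open Classical in

/-- The image of the differential of a crossing of the front: the entry of the matrix at the two
strands that cross, and a term `1` at a right cusp. -/
theorem map_bdry_front (H : D.Resolved n wd) (ψ : D.Alg →ₐ[ZMod 2] R) (a : D.Vertex) (ha : a.1 < n) :
    ψ a.bdry = lineMat D.events (weight fun v => ψ (Vertex.gen v)) (weight (fun v => ψ (Vertex.gen v)) (n + 1))
      a.1 a.pos (a.pos + 1) + if ∃ k, D.events[a.1 + 1]? = some (.cap k) then 1 else 0 := by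
  obtain ⟨b, k, hE⟩ := a.2
  obtain rfl := H.normal _ ha _ _ hE
  rw [(a.event hE).1]
  refine map_bdry ψ a (H.wordSum_normal (weight_eq _) a ha.le hE ?_)
  split_ifs with hc
  · obtain ⟨k', hk'⟩ := hc
    obtain ⟨e', he, hE'⟩ := H.cap _ _ hk'
    obtain rfl : a.1 = e' := by omega
    rw [hE] at hE'
    obtain rfl := (Event.cross.inj (Option.some.inj hE')).2
    exact wordSum_loop hk'
  · have : IsEmpty (D.SubDisk .right (a.1 + 1) k (k + 1)) := by
      constructor
      intro d
      obtain ⟨k, hk, -⟩ := H.right_subDisk (by omega) d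
      exact hc ⟨k, hk⟩
    exact WordSum.of_isEmpty _

/-- The image of the differential of the normal crossing of the transition tangle. -/
theorem map_bdry_normalEnd (H : D.Resolved n wd) (ψ : D.Alg →ₐ[ZMod 2] R) (a : D.Vertex) (ha : a.1 = n) :
    ψ a.bdry = lineMat D.events (weight fun v => ψ (Vertex.gen v)) (weight (fun v => ψ (Vertex.gen v)) (n + 1))
      n 0 1 + weight (fun v => ψ (Vertex.gen v)) (n + 1) := by
  have hE := H.normalEnd
  subst ha
  have := map_bdry ψ a (H.wordSum_normal (weight_eq _) a le_rfl hE (H.wordSum_last (weight_eq _)))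
  simpa using this

/-- The differential of the special crossing is zero. -/
theorem map_bdry_specialEnd (H : D.Resolved n wd) (ψ : D.Alg →ₐ[ZMod 2] R) (a : D.Vertex)
    (ha : a.1 = n + 1) : ψ a.bdry = 0 :=
  map_bdry ψ a (H.wordSum_special a ha)

end Resolved
end Diagram
end SolidTorus

namespace SolidTorus

/-! ### The matrices square to their derivative -/

open Finset in

/-- The square of a strictly upper triangular matrix, as a finite sum. -/
noncomputable def sqMat {R : Type*} [CommRing R] (N : Mat R) : Mat R := fun i j => ∑ m ∈ Ioo i j, N i m * N m j

section
variable {M : Type*} [AddCommMonoid M] (f : ℤ → M)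
open Finset

theorem sum_Ioo_pair {i j k : ℤ} (hi : i < k) (hj : k + 1 < j) :
    ∑ m ∈ Ioo i j, f m = ∑ m ∈ Ioo i k, f m + (f k + f (k + 1)) + ∑ m ∈ Ioo (k + 1) j, f m := by
  have h1 : Ioo i j = (Ioo i k ∪ {k, k + 1}) ∪ Ioo (k + 1) j := by
    ext m; simp only [mem_union, mem_Ioo, mem_insert, mem_singleton]; omega
  rw [h1, sum_union, sum_union, sum_pair (by omega)]
  · rw [disjoint_left]; simp only [mem_Ioo, mem_insert, mem_singleton]; intros; omega
  · rw [disjoint_left]; simp only [mem_union, mem_Ioo, mem_insert, mem_singleton]; intros; omega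

theorem sum_Ioo_left {k j : ℤ} (hj : k + 1 < j) :
    ∑ m ∈ Ioo k j, f m = f (k + 1) + ∑ m ∈ Ioo (k + 1) j, f m := by
  have h1 : Ioo k j = insert (k + 1) (Ioo (k + 1) j) := by
    ext m; simp only [mem_Ioo, mem_insert]; omega
  rw [h1, sum_insert (by simp)]

theorem sum_Ioo_right {i k : ℤ} (hi : i < k) :
    ∑ m ∈ Ioo i (k + 1), f m = ∑ m ∈ Ioo i k, f m + f k := by
  have h1 : Ioo i (k + 1) = insert k (Ioo i k) := by
    ext m; simp only [mem_Ioo, mem_insert]; omega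
  rw [h1, sum_insert (by simp), add_comm]

theorem sum_Ioo_shift (i j : ℤ) : ∑ m ∈ Ioo (i + 2) (j + 2), f m = ∑ m ∈ Ioo i j, f (m + 2) := by
  refine (sum_nbij' (· + 2) (· - 2) ?_ ?_ ?_ ?_ ?_).symm  <;> (simp; try omega)

theorem sum_Ioo_shift_left {i k j : ℤ} (hi : i < k) (hj : k ≤ j) :
    ∑ m ∈ Ioo i j, f (if m < k then m else m + 2) =
      ∑ m ∈ Ioo i k, f m + ∑ m ∈ Ioo (k + 1) (j + 2), f m := by
  have h1 : Ioo i j = Ioo i k ∪ Ico k j := by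
    ext m; simp only [mem_union, mem_Ioo, mem_Ico]; omega
  rw [h1, sum_union]
  · congr 1
    · refine sum_congr rfl fun m hm => ?_
      rw [if_pos (mem_Ioo.1 hm).2]
    · refine sum_nbij' (· + 2) (· - 2) ?_ ?_ ?_ ?_ ?_
      · intro m; simp only [mem_Ioo, mem_Ico]; omega
      · intro m; simp only [mem_Ioo, mem_Ico]; omega
      · simp
      · simp
      · intro m hm
        rw [if_neg (not_lt.2 (mem_Ico.1 hm).1)]
  · rw [disjoint_left]; simp only [mem_Ioo, mem_Ico]; intros; omega

end

variable {R : Type*} [CommRing R]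

/-- The map is additive and satisfies the Leibniz rule. -/
structure IsDeriv (δ : R → R) : Prop where
  add : ∀ a b, δ (a + b) = δ a + δ b
  mul : ∀ a b, δ (a * b) = a * δ b + δ a * b

namespace IsDeriv
variable {δ : R → R} (hδ : IsDeriv δ)
include hδ

theorem zero : δ 0 = 0 := by simpa using hδ.add 0 0
theorem one : δ 1 = 0 := by simpa using hδ.mul 1 1
end IsDeriv

open Finset

section cross
variable {N : Mat R} (hN : StrictUpper N) (k : ℤ) (x : R)

theorem crossStep_ne {i j : ℤ} (hN : StrictUpper N) (hi : i ≠ k) (hi' : i ≠ k + 1) (hj : j ≠ k)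
    (hj' : j ≠ k + 1) : crossStep k x N i j = N i j := by
  by_cases h : i < j
  · simp [crossStep, swapZ, *]
  · rw [hN i j (by omega), StrictUpper.crossStep k x i j (by omega)]

theorem crossStep_low0 {i : ℤ} (hi : i < k) :
    crossStep k x N i k = N i (k + 1) + x * N i k := by
  simp [crossStep, swapZ, hi, hi.ne, show i ≠ k + 1 by omega]

theorem crossStep_low1 {i : ℤ} (hi : i < k) : crossStep k x N i (k + 1) = N i k := by
  simp [crossStep, swapZ, hi.ne, show i ≠ k + 1 by omega, show i < k + 1 by omega]

theorem crossStep_high0 {j : ℤ} (hj : k + 1 < j) : crossStep k x N k j = N (k + 1) j := by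
  simp [crossStep, swapZ, show j ≠ k by omega, show j ≠ k + 1 by omega, show k < j by omega]

theorem crossStep_high1 {j : ℤ} (hj : k + 1 < j) :
    crossStep k x N (k + 1) j = N k j + N (k + 1) j * x := by
  simp [crossStep, swapZ, show j ≠ k by omega, show j ≠ k + 1 by omega, hj]

theorem crossStep_pair (hN : StrictUpper N) : crossStep k x N k (k + 1) = 0 := by
  simp [crossStep, swapZ, hN (k + 1) k (by omega)]

/-- The identity `δ N = N²` is preserved at a crossing with `δ x = N k (k + 1)`. At a right cusp the
differential has an additional term `z = 1`, and the error it causes is cancelled by the cap, see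
`deriv_capStep`. -/
theorem deriv_crossStep (h2 : ∀ r : R, r + r = 0) {δ : R → R} (hδ : IsDeriv δ) (hN : StrictUpper N)
    (hsq : ∀ i j, δ (N i j) = sqMat N i j) {k : ℤ} {x z : R} (hx : δ x = N k (k + 1) + z) (i j : ℤ) :
    δ (crossStep k x N i j) = sqMat (crossStep k x N) i j +
      (if i = k + 1 then N i j * z else 0) + (if j = k then N i j * z else 0) := by
  set N' := crossStep k x N with hN'
  have hne : ∀ {i j : ℤ}, i ≠ k → i ≠ k + 1 → j ≠ k → j ≠ k + 1 → N' i j = N i j :=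
    fun a b c d => crossStep_ne k x hN a b c d
  have l0 : ∀ {i : ℤ}, i < k → N' i k = N i (k + 1) + x * N i k := fun h => crossStep_low0 k x h
  have l1 : ∀ {i : ℤ}, i < k → N' i (k + 1) = N i k := fun h => crossStep_low1 k x h
  have g0 : ∀ {j : ℤ}, k + 1 < j → N' k j = N (k + 1) j := fun h => crossStep_high0 k x h
  have g1 : ∀ {j : ℤ}, k + 1 < j → N' (k + 1) j = N k j + N (k + 1) j * x :=
    fun h => crossStep_high1 k x h
  have hp : N' k (k + 1) = 0 := crossStep_pair k x hN
  have hlt : ∀ {i j}, j ≤ i → N' i j = 0 := fun h => StrictUpper.crossStep k x _ _ h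
  rcases le_or_gt j i with hij | hij
  · rw [hlt hij, hδ.zero, hN i j hij, sqMat, Ioo_eq_empty (by omega)]; simp
  rcases lt_trichotomy i k with hi | rfl | hi
  · rcases lt_trichotomy j k with hj | rfl | hj
    · rw [hne (by omega) (by omega) (by omega) (by omega), hsq, if_neg (by omega), if_neg (by omega),
        add_zero, add_zero]
      refine sum_congr rfl fun m hm => ?_
      rw [mem_Ioo] at hm
      rw [hne (by omega) (by omega) (by omega) (by omega), hne (by omega) (by omega) (by omega) (by omega)]
    · have e1 : sqMat N' i j = sqMat N i (j + 1) + N i j * N j (j + 1) + x * sqMat N i j := by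
        unfold sqMat
        rw [sum_Ioo_right _ hij, mul_sum]
        have : ∀ m ∈ Ioo i j, N' i m * N' m j = N i m * N m (j + 1) + x * (N i m * N m j) := by
          intro m hm
          rw [mem_Ioo] at hm
          rw [hne (by omega) (by omega) (by omega) (by omega), l0 hm.2]; ring
        rw [sum_congr rfl this, sum_add_distrib]
        linear_combination -h2 (N i j * N j (j + 1))
      rw [l0 hij, hδ.add, hδ.mul, hsq, hsq, hx, e1, if_neg (by omega), if_pos rfl]; ring
    · rcases eq_or_lt_of_le (show k + 1 ≤ j by omega) with rfl | hj'
      · rw [l1 hi, hsq, if_neg (by omega), if_neg (by omega), add_zero, add_zero]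
        unfold sqMat
        rw [sum_Ioo_right _ hi, hp, mul_zero, add_zero]
        refine sum_congr rfl fun m hm => ?_
        rw [mem_Ioo] at hm
        rw [hne (by omega) (by omega) (by omega) (by omega), l1 hm.2]
      · rw [hne (by omega) (by omega) (by omega) (by omega), hsq, if_neg (by omega),
          if_neg (by omega), add_zero, add_zero]
        unfold sqMat
        rw [sum_Ioo_pair _ hi hj', sum_Ioo_pair _ hi hj', l0 hi, l1 hi, g0 hj', g1 hj']
        have a1 : ∑ m ∈ Ioo i k, N' i m * N' m j = ∑ m ∈ Ioo i k, N i m * N m j := by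
          refine sum_congr rfl fun m hm => ?_
          rw [mem_Ioo] at hm
          rw [hne (by omega) (by omega) (by omega) (by omega), hne (by omega) (by omega) (by omega) (by omega)]
        have a2 : ∑ m ∈ Ioo (k + 1) j, N' i m * N' m j = ∑ m ∈ Ioo (k + 1) j, N i m * N m j := by
          refine sum_congr rfl fun m hm => ?_
          rw [mem_Ioo] at hm
          rw [hne (by omega) (by omega) (by omega) (by omega), hne (by omega) (by omega) (by omega) (by omega)]
        rw [a1, a2]
        linear_combination -h2 (x * N i k * N (k + 1) j)
  · rcases eq_or_lt_of_le (show i + 1 ≤ j by omega) with rfl | hj'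
    · rw [hp, hδ.zero, if_neg (by omega), if_neg (by omega), sqMat, add_zero, add_zero]
      rw [show Ioo i (i + 1) = ∅ by ext m; simp]; simp
    · rw [g0 hj', hsq, if_neg (by omega), if_neg (by omega), add_zero, add_zero]
      unfold sqMat
      rw [sum_Ioo_left _ hj', hp, zero_mul, zero_add]
      refine sum_congr rfl fun m hm => ?_
      rw [mem_Ioo] at hm
      rw [g0 hm.1, hne (by omega) (by omega) (by omega) (by omega)]
  · rcases eq_or_lt_of_le (show k + 1 ≤ i by omega) with rfl | hi'
    · have e1 : sqMat N' (k + 1) j =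
          sqMat N k j + N k (k + 1) * N (k + 1) j + x * sqMat N (k + 1) j := by
        unfold sqMat
        rw [sum_Ioo_left _ hij, mul_sum]
        have : ∀ m ∈ Ioo (k + 1) j, N' (k + 1) m * N' m j =
            N k m * N m j + x * (N (k + 1) m * N m j) := by
          intro m hm
          rw [mem_Ioo] at hm
          rw [hne (i := m) (by omega) (by omega) (by omega) (by omega), g1 hm.1]; ring
        rw [sum_congr rfl this, sum_add_distrib]
        linear_combination -h2 (N k (k + 1) * N (k + 1) j)
      rw [g1 hij, hδ.add, hδ.mul, hsq, hsq, hx, e1, if_pos rfl, if_neg (by omega)]; ring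
    · rw [hne (by omega) (by omega) (by omega) (by omega), hsq, if_neg (by omega), if_neg (by omega),
        add_zero, add_zero]
      refine sum_congr rfl fun m hm => ?_
      rw [mem_Ioo] at hm
      rw [hne (by omega) (by omega) (by omega) (by omega), hne (by omega) (by omega) (by omega) (by omega)]

end cross

/-- The identity `δ N = N²` holds behind a cap, if before it it holds up to the error that is
produced by the crossing of the right cusp. -/
theorem deriv_capStep (h2 : ∀ r : R, r + r = 0) {δ : R → R} (hδ : IsDeriv δ) {N : Mat R}
    (hN : StrictUpper N) {k : ℤ}
    (hsq : ∀ i j, δ (N i j) = sqMat N i j + (if i = k + 1 then N k j else 0) +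
      (if j = k then N i (k + 1) else 0)) (i j : ℤ) :
    δ (capStep k N i j) = sqMat (capStep k N) i j := by
  set N' := capStep k N with hN'
  have hu : ∀ {i j}, j ≤ i → N' i j = 0 := fun h => hN.capStep k _ _ h
  have hlow : ∀ {i j : ℤ}, j < k → i < k → N' i j = N i j := by
    intro i j hj hi
    rw [hN', capStep, if_neg (by omega), add_zero, shiftZ, shiftZ, if_pos hi, if_pos hj]
  have hmid : ∀ {i j : ℤ}, i < k → k ≤ j → N' i j = N i (j + 2) + N (k + 1) (j + 2) * N i k := by
    intro i j hi hj
    rw [hN', capStep, if_pos ⟨hi, hj⟩, shiftZ, shiftZ, if_pos hi, if_neg (by omega)]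
  have hhigh : ∀ {i j : ℤ}, k ≤ i → k ≤ j → N' i j = N (i + 2) (j + 2) := by
    intro i j hi hj
    rw [hN', capStep, if_neg (by omega), add_zero, shiftZ, shiftZ, if_neg (by omega), if_neg (by omega)]
  rcases le_or_gt j i with hij | hij
  · rw [hu hij, hδ.zero, sqMat, Ioo_eq_empty (by omega)]; simp
  rcases lt_or_ge i k with hi | hi
  · rcases lt_or_ge j k with hj | hj
    · rw [hlow hj hi, hsq, if_neg (by omega), if_neg (by omega), add_zero, add_zero]
      refine sum_congr rfl fun m hm => ?_
      rw [mem_Ioo] at hm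
      rw [hlow (by omega) hi, hlow hj (by omega)]
    · have e1 : sqMat N' i j = (∑ m ∈ Ioo i k, N i m * N m (j + 2) +
          ∑ m ∈ Ioo (k + 1) (j + 2), N i m * N m (j + 2)) + N (k + 1) (j + 2) * sqMat N i k +
            N i k * sqMat N (k + 1) (j + 2) := by
        unfold sqMat
        rw [mul_sum, mul_sum]
        set F : ℤ → R := fun m => N i m * N m (j + 2) +
            (if m < k then N (k + 1) (j + 2) * (N i m * N m k)
              else N i k * (N (k + 1) m * N m (j + 2))) with hF
        have : ∀ m ∈ Ioo i j, N' i m * N' m j = F (if m < k then m else m + 2) := by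
          intro m hm
          rw [mem_Ioo] at hm
          rw [hF]
          by_cases h : m < k
          · simp only [if_pos h]; rw [hlow h hi, hmid h hj]; ring
          · simp only [if_neg h, if_neg (show ¬ m + 2 < k by omega)]
            rw [hmid hi (by omega), hhigh (by omega) hj]; ring
        rw [sum_congr rfl this, sum_Ioo_shift_left F hi hj, hF, sum_add_distrib, sum_add_distrib]
        have b1 : ∑ m ∈ Ioo i k, (if m < k then N (k + 1) (j + 2) * (N i m * N m k)
            else N i k * (N (k + 1) m * N m (j + 2))) =
            ∑ m ∈ Ioo i k, N (k + 1) (j + 2) * (N i m * N m k) :=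
          sum_congr rfl fun m hm => if_pos (mem_Ioo.1 hm).2
        have b2 : ∑ m ∈ Ioo (k + 1) (j + 2), (if m < k then N (k + 1) (j + 2) * (N i m * N m k)
            else N i k * (N (k + 1) m * N m (j + 2))) =
            ∑ m ∈ Ioo (k + 1) (j + 2), N i k * (N (k + 1) m * N m (j + 2)) :=
          sum_congr rfl fun m hm => if_neg (by have := (mem_Ioo.1 hm).1; omega)
        rw [b1, b2]; ring
      have e2 : sqMat N i (j + 2) = ∑ m ∈ Ioo i k, N i m * N m (j + 2) +
          (N i k * N k (j + 2) + N i (k + 1) * N (k + 1) (j + 2)) +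
            ∑ m ∈ Ioo (k + 1) (j + 2), N i m * N m (j + 2) := sum_Ioo_pair _ hi (by omega)
      rw [hmid hi hj, hδ.add, hδ.mul, hsq, hsq, hsq, e1, e2, if_neg (show ¬ i = k + 1 by omega),
        if_neg (show ¬ j + 2 = k by omega), if_pos rfl, if_neg (show ¬ j + 2 = k by omega),
        if_neg (show ¬ i = k + 1 by omega), if_pos rfl]
      linear_combination h2 (N i k * N k (j + 2)) + h2 (N i (k + 1) * N (k + 1) (j + 2))
  · rw [hhigh hi (by omega), hsq, if_neg (by omega), if_neg (by omega), add_zero, add_zero]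
    unfold sqMat
    rw [sum_Ioo_shift]
    refine sum_congr rfl fun m hm => ?_
    rw [mem_Ioo] at hm
    rw [hhigh hi (by omega), hhigh (by omega) (by omega)]

theorem deriv_cupStep {δ : R → R} (hδ : IsDeriv δ) {N : Mat R}
    (hN : StrictUpper N) {k : ℤ} (hsq : ∀ i j, δ (N i j) = sqMat N i j) (i j : ℤ) :
    δ (cupStep k N i j) = sqMat (cupStep k N) i j := by
  set N' := cupStep k N with hN'
  have hu : ∀ {i j}, j ≤ i → N' i j = 0 := fun h => hN.cupStep k _ _ h
  have z1 : ∀ {i : ℤ}, N' i k = 0 := by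
    intro i; rw [hN', cupStep, if_neg (by omega), if_pos (by omega)]
  have z2 : ∀ {j : ℤ}, N' (k + 1) j = 0 := by
    intro i; rw [hN', cupStep, if_neg (by omega), if_pos (by omega)]
  have z3 : ∀ {i : ℤ}, i ≠ k → N' i (k + 1) = 0 := by
    intro i hi; rw [hN', cupStep, if_neg (by omega), if_pos (by omega)]
  have z4 : ∀ {j : ℤ}, j ≠ k + 1 → N' k j = 0 := by
    intro i hi; rw [hN', cupStep, if_neg (by omega), if_pos (by omega)]
  have hs : ∀ {i j : ℤ}, N' (shiftZ k i) (shiftZ k j) = N i j := by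
    have a : ∀ i, shiftZ k i ≠ k ∧ shiftZ k i ≠ k + 1 ∧ unshiftZ k (shiftZ k i) = i := by
      intro i; unfold unshiftZ shiftZ; split_ifs <;> omega
    intro i j
    obtain ⟨a1, a2, a3⟩ := a i
    obtain ⟨b1, b2, b3⟩ := a j
    rw [hN', cupStep, if_neg (by omega), if_neg (by omega), a3, b3]
  have inv : ∀ i, i ≠ k → i ≠ k + 1 → ∃ i', i = shiftZ k i' := by
    intro i h1 h2
    refine ⟨unshiftZ k i, ?_⟩
    unfold unshiftZ shiftZ; split_ifs <;> omega
  rcases le_or_gt j i with hij | hij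
  · rw [hu hij, hδ.zero, sqMat, Ioo_eq_empty (by omega)]; simp
  have hzero : ∀ m, (i = k ∨ i = k + 1 ∨ j = k ∨ j = k + 1 ∨ m = k ∨ m = k + 1) → N' i m * N' m j = 0 := by
    intro m h
    rcases h with rfl | rfl | rfl | rfl | rfl | rfl
    · by_cases h : m = i + 1
      · rw [h, z2, mul_zero]
      · rw [z4 h, zero_mul]
    · rw [z2, zero_mul]
    · rw [z1, mul_zero]
    · by_cases h : m = k
      · rw [h, z1, zero_mul]
      · rw [z3 h, mul_zero]
    · rw [z1, zero_mul]
    · rw [z2, mul_zero]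
  by_cases h : i = k ∨ i = k + 1 ∨ j = k ∨ j = k + 1
  · have e1 : sqMat N' i j = 0 := sum_eq_zero fun m _ => hzero m (by tauto)
    rw [e1]
    by_cases h' : i = k ∧ j = k + 1
    · rw [hN', cupStep, if_pos h', hδ.one]
    · rw [hN', cupStep, if_neg h', if_pos h, hδ.zero]
  · simp only [not_or] at h
    obtain ⟨i, rfl⟩ := inv i (by tauto) (by tauto)
    obtain ⟨j, rfl⟩ := inv j (by tauto) (by tauto)
    rw [hs, hsq]
    have hlt : ∀ a b, shiftZ k a < shiftZ k b ↔ a < b := by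
      intro i j; unfold shiftZ; split_ifs <;> omega
    have hinj : Function.Injective (shiftZ k) := by
      intro a b hab; unfold shiftZ at hab; split_ifs at hab <;> omega
    unfold sqMat
    have e1 : ∑ m ∈ Ioo i j, N i m * N m j =
        ∑ m ∈ (Ioo i j).image (shiftZ k), N' (shiftZ k i) m * N' m (shiftZ k j) := by
      rw [sum_image (fun _ _ _ _ h => hinj h)]
      simp only [hs]
    rw [e1]
    refine sum_subset ?_ ?_
    · intro m hm
      obtain ⟨m, hm', rfl⟩ := mem_image.1 hm
      rw [mem_Ioo] at hm'
      rw [mem_Ioo, hlt, hlt]; exact hm'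
    · intro m hm hm'
      refine hzero m ?_
      by_contra hc
      simp only [not_or] at hc
      obtain ⟨m, rfl⟩ := inv m (by tauto) (by tauto)
      rw [mem_Ioo, hlt, hlt] at hm
      exact hm' (mem_image.2 ⟨m, mem_Ioo.2 hm, rfl⟩)

end SolidTorus

namespace SolidTorus

/-! ### The linearized differential -/

namespace Diagram
variable {D : Diagram} {n : ℕ} {wd : ℕ → ℕ}

/-- The homomorphism to the dual numbers `ℤ/2 ⊕ V` that maps a vertex `a` to `ε a + a`. Its second
component is the first-order part after the substitution `a ↦ a + ε a`. -/
noncomputable def linearization (ε : D.Alg →ₐ[ZMod 2] ZMod 2) :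
    D.Alg →ₐ[ZMod 2] TrivSqZeroExt (ZMod 2) D.Space :=
  FreeAlgebra.lift (ZMod 2) fun a : D.Vertex =>
    TrivSqZeroExt.inl (ε a.gen) + TrivSqZeroExt.inr (Finsupp.single a 1)

theorem linearization_gen (ε : D.Alg →ₐ[ZMod 2] ZMod 2) (a : D.Vertex) :
    linearization ε a.gen = TrivSqZeroExt.inl (ε a.gen) + TrivSqZeroExt.inr (Finsupp.single a 1) := by
  simp [linearization, Vertex.gen]

theorem fst_linearization (ε : D.Alg →ₐ[ZMod 2] ZMod 2) (x : D.Alg) : (linearization ε x).fst = ε x := by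
  have : (TrivSqZeroExt.fstHom (ZMod 2) (ZMod 2) D.Space).comp (linearization ε) = ε := by
    refine FreeAlgebra.hom_ext (funext fun a => ?_)
    have := linearization_gen ε a
    simp only [Vertex.gen] at this
    simp [this]
  exact DFunLike.congr_fun this x

theorem differential_gen (a : D.Vertex) : D.differential a.gen = a.bdry := by
  simp [differential, Vertex.gen]

theorem linDiff_single (ε : D.Alg →ₐ[ZMod 2] ZMod 2) (a : D.Vertex) :
    D.linDiff ε (Finsupp.single a 1) = (linearization ε a.bdry).snd := by
  have : (FreeAlgebra.lift (ZMod 2) fun a : D.Vertex =>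
      (TrivSqZeroExt.inr (Finsupp.single a 1) : TrivSqZeroExt (ZMod 2) D.Space)).comp
      (D.substitution ε) = linearization ε := by
    refine FreeAlgebra.hom_ext (funext fun a => ?_)
    have h1 := linearization_gen ε a
    have h2 : D.substitution ε a.gen = a.gen + algebraMap (ZMod 2) D.Alg (ε a.gen) := by
      simp [substitution, Vertex.gen]
    simp only [Vertex.gen] at h1 h2
    simp only [Function.comp_apply, AlgHom.comp_apply, h1, h2, map_add, FreeAlgebra.lift_ι_apply,
      AlgHom.commutes]
    rw [add_comm]; rfl
  rw [linDiff, Finsupp.linearCombination_single, one_smul, differential_gen, firstOrder]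
  exact congrArg TrivSqZeroExt.snd (DFunLike.congr_fun this a.bdry)

/-- On the images of the vertices, the linearized differential followed by the inclusion of `V` in
the dual numbers is the image of the differential. -/
theorem inr_linDiff {ε : D.Alg →ₐ[ZMod 2] ZMod 2} (hε : ∀ a : D.Vertex, ε a.bdry = 0) (a : D.Vertex) :
    TrivSqZeroExt.inr (D.linDiff ε (linearization ε a.gen).snd) = linearization ε a.bdry := by
  ext
  · rw [fst_linearization, hε]; rfl
  · simp [linearization_gen, linDiff_single]

/-- The condition `ε ∘ ∂ = 0` has to be checked on generators only. -/
theorem comp_differential_iff (ε : D.Alg →ₐ[ZMod 2] ZMod 2) :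
    (∀ x, ε (D.differential x) = 0) ↔ ∀ a : D.Vertex, ε a.bdry = 0 := by
  constructor
  · intro h a; rw [← differential_gen]; exact h _
  · intro h
    -- the image of `x ↦ x + (∂ x) η` in the dual numbers is determined on generators
    set Φ : D.Alg →ₐ[ZMod 2] TrivSqZeroExt D.Alg D.Alg := FreeAlgebra.lift (ZMod 2) fun a : D.Vertex =>
      (TrivSqZeroExt.inl a.gen + TrivSqZeroExt.inr a.bdry : TrivSqZeroExt D.Alg D.Alg) with hΦ
    intro x
    have hd : ∀ x, D.differential x = (Φ x).snd := fun x => rfl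
    have hf : ∀ x, (Φ x).fst = x := by
      have : (TrivSqZeroExt.fstHom (ZMod 2) D.Alg D.Alg).comp Φ = AlgHom.id _ _ := by
        refine FreeAlgebra.hom_ext (funext fun a => ?_)
        simp [hΦ, Vertex.gen]
      exact fun x => DFunLike.congr_fun this x
    rw [hd]
    induction x using FreeAlgebra.induction with
    | grade0 r =>
      rw [AlgHom.commutes]
      have : (algebraMap (ZMod 2) (TrivSqZeroExt D.Alg D.Alg) r).snd = 0 := rfl
      rw [this, map_zero]
    | grade1 a =>
      have := h a
      rw [hΦ, FreeAlgebra.lift_ι_apply]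
      simpa using this
    | mul a b ha hb =>
      rw [map_mul, TrivSqZeroExt.snd_mul, map_add, smul_eq_mul, MulOpposite.smul_eq_mul_unop, map_mul,
        map_mul, ha, hb]; simp
    | add a b ha hb => rw [map_add, TrivSqZeroExt.snd_add, map_add, ha, hb, add_zero]

/-- An endomorphism of `V` is a derivation of the dual numbers. -/
theorem isDeriv_linDiff (d : D.Space →ₗ[ZMod 2] D.Space) :
    IsDeriv fun r : TrivSqZeroExt (ZMod 2) D.Space => TrivSqZeroExt.inr (d r.snd) := by
  constructor
  · intro a b; simp
  · intro a b
    ext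
    · simp
    · simp

theorem two_eq_zero {V : Type*} [AddCommGroup V] [Module (ZMod 2) V] (r : TrivSqZeroExt (ZMod 2) V) :
    r + r = 0 := by
  have : (2 : ZMod 2) • r = 0 := by
    rw [show (2 : ZMod 2) = 0 from rfl, zero_smul]
  rw [← two_smul (ZMod 2), this]

/-- The matrices of the vertical lines with the images of the vertices in the dual numbers as
weights. -/
noncomputable abbrev linMat (ε : D.Alg →ₐ[ZMod 2] ZMod 2) (n : ℕ) : ℕ → Mat (TrivSqZeroExt (ZMod 2) D.Space) :=
  lineMat D.events (weight fun v => linearization ε v.gen)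
    (weight (fun v => linearization ε v.gen) (n + 1))

theorem lineMat_succ_cross {R : Type*} [CommRing R] {E : List Event} {w : ℕ → R} {y : R} {t : ℕ} {b k}
    (h : E[t]? = some (.cross b k)) : lineMat E w y (t + 1) = crossStep k (w t) (lineMat E w y t) := by
  rw [lineMat, h]

theorem lineMat_succ_cup {R : Type*} [CommRing R] {E : List Event} {w : ℕ → R} {y : R} {t : ℕ} {k}
    (h : E[t]? = some (.cup k)) : lineMat E w y (t + 1) = cupStep k (lineMat E w y t) := by
  rw [lineMat, h]

theorem lineMat_succ_cap {R : Type*} [CommRing R] {E : List Event} {w : ℕ → R} {y : R} {t : ℕ} {k}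
    (h : E[t]? = some (.cap k)) : lineMat E w y (t + 1) = capStep k (lineMat E w y t) := by
  rw [lineMat, h]

namespace Resolved

theorem linDiff_specialEnd (H : D.Resolved n wd) (ε : D.Alg →ₐ[ZMod 2] ZMod 2) :
    D.linDiff ε (weight (fun v => linearization ε (Vertex.gen v)) (n + 1)).snd = 0 := by
  set s : D.Vertex := ⟨n + 1, _, _, H.specialEnd⟩ with hs
  have h1 := weight_eq (fun v => linearization ε (Vertex.gen v)) s
  have h2 := H.map_bdry_specialEnd (linearization ε) s rfl
  change linearization ε s.gen = weight (fun v => linearization ε (Vertex.gen v)) (n + 1) at h1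
  rw [← h1, linearization_gen]
  simp [linDiff_single, h2]

/-- For the linearized differential `δ` and the matrix `N` of a line, `δ N = N²`, with the error
term of `deriv_crossStep` on the lines directly to the left of a cap. -/
theorem sqMat_linMat (H : D.Resolved n wd) {ε : D.Alg →ₐ[ZMod 2] ZMod 2}
    (hε : ∀ a : D.Vertex, ε a.bdry = 0) {t : ℕ} (ht : t ≤ n) :
    ((∀ k, D.events[t]? ≠ some (.cap k)) → ∀ i j,
      TrivSqZeroExt.inr (D.linDiff ε (linMat ε n t i j).snd) = sqMat (linMat ε n t) i j) ∧
    ∀ k : ℕ, D.events[t]? = some (.cap k) → ∀ i j,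
      TrivSqZeroExt.inr (D.linDiff ε (linMat ε n t i j).snd) = sqMat (linMat ε n t) i j +
        (if i = k + 1 then linMat ε n t k j else 0) +
          (if j = k then linMat ε n t i (k + 1) else 0) := by
  classical
  have hδ := isDeriv_linDiff (D.linDiff ε)
  induction t with
  | zero =>
    refine ⟨fun _ i j => ?_, fun k hk => ?_⟩
    · simp only [linMat, lineMat, sqMat]
      rw [Finset.sum_eq_zero]
      · split_ifs
        · rw [H.linDiff_specialEnd]; rfl
        · simp
      · intro m hm
        rw [Finset.mem_Ioo] at hm
        by_cases h : m = 1
        · rw [if_neg (c := m = 0 ∧ _) (by omega), mul_zero]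
        · rw [if_neg (by omega), zero_mul]
    · obtain ⟨e', h, -⟩ := H.cap _ _ hk
      omega
  | succ t ih =>
    have ih := ih (by omega)
    have hN := lineMat_strictUpper D.events (weight fun v => linearization ε (Vertex.gen v))
      (weight (fun v => linearization ε (Vertex.gen v)) (n + 1)) t
    have hlt : t < D.events.length := by rw [H.length]; omega
    have hE : D.events[t]? = some D.events[t] := List.getElem?_eq_getElem hlt
    rcases hc : D.events[t] with ⟨b, k⟩ | ⟨k⟩ | ⟨k⟩ <;> rw [hc] at hE
    · have ih' := ih.1 (by rw [hE]; simp)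
      obtain rfl := H.normal t (by omega) b k hE
      have hx : TrivSqZeroExt.inr (D.linDiff ε (weight (fun v => linearization ε (Vertex.gen v)) t).snd) =
          linMat ε n t k (k + 1) + if ∃ k, D.events[t + 1]? = some (.cap k) then 1 else 0 := by
        obtain ⟨a, rfl⟩ : ∃ a : D.Vertex, a.1 = t := ⟨⟨t, _, _, hE⟩, rfl⟩
        have hx := H.map_bdry_front (linearization ε) a ht
        rw [← inr_linDiff hε, weight_eq (fun v => linearization ε (Vertex.gen v)) a,
          (a.event hE).1] at hx
        exact hx
      have key := deriv_crossStep two_eq_zero hδ hN ih' hx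
      rw [show linMat ε n (t + 1) = _ from lineMat_succ_cross hE]
      constructor
      · intro hcap i j
        rw [key, if_neg (show ¬ ∃ k, D.events[t + 1]? = some (.cap k) from fun ⟨k, hk⟩ => hcap k hk)]
        simp
      · intro k' hcap i j
        obtain ⟨e', h1, h2⟩ := H.cap _ _ hcap
        obtain rfl : t = e' := by omega
        rw [hE] at h2
        obtain rfl := (Event.cross.inj (Option.some.inj h2)).2
        rw [key, if_pos (show ∃ k, D.events[t + 1]? = some (.cap k) from ⟨_, hcap⟩), mul_one]
        congr 1
        · congr 1
          split_ifs with hi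
          · subst hi
            rcases lt_trichotomy (k + 1 : ℤ) j with hj | rfl | hj
            · rw [crossStep_high0 _ _ hj]
            · rw [crossStep_pair _ _ hN, hN _ _ le_rfl]
            · rw [hN _ _ hj.le, StrictUpper.crossStep _ _ _ _ (by omega)]
          · rfl
        · split_ifs with hj
          · subst hj
            rcases lt_trichotomy i k with hi | rfl | hi
            · rw [crossStep_low1 _ _ hi]
            · rw [crossStep_pair _ _ hN, hN _ _ le_rfl]
            · rw [hN _ _ hi.le, StrictUpper.crossStep _ _ _ _ (by omega)]
          · rfl
    · have ih' := ih.1 (by rw [hE]; simp)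
      have key := deriv_cupStep hδ hN (k := k) ih'
      refine ⟨fun _ i j => ?_, fun k' hcap => ?_⟩
      · rw [show linMat ε n (t + 1) = _ from lineMat_succ_cup hE]; exact key i j
      · obtain ⟨e', h1, h2⟩ := H.cap _ _ hcap
        obtain rfl : t = e' := by omega
        rw [hE] at h2; simp at h2
    · have key := deriv_capStep two_eq_zero hδ hN (ih.2 k hE)
      refine ⟨fun _ i j => ?_, fun k' hcap => ?_⟩
      · rw [show linMat ε n (t + 1) = _ from lineMat_succ_cap hE]; exact key i j
      · obtain ⟨e', h1, h2⟩ := H.cap _ _ hcap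
        obtain rfl : t = e' := by omega
        rw [hE] at h2; simp at h2

theorem le_of_vertex (H : D.Resolved n wd) (a : D.Vertex) : a.1 < n ∨ a.1 = n ∨ a.1 = n + 1 := by
  obtain ⟨b, k, hE⟩ := a.2
  have := H.lt_of_event hE
  omega

/-- The linearized differential squares to zero: the differential of a crossing is an entry `N k (k
+ 1)` next to the diagonal, where `N²` vanishes. -/
theorem linDiff_linDiff (H : D.Resolved n wd) {ε : D.Alg →ₐ[ZMod 2] ZMod 2}
    (hε : ∀ a : D.Vertex, ε a.bdry = 0) (x : D.Space) : D.linDiff ε (D.linDiff ε x) = 0 := by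
  classical
  suffices h : (D.linDiff ε).comp (D.linDiff ε) = 0 from LinearMap.congr_fun h x
  refine Finsupp.lhom_ext' fun a => LinearMap.ext_ring ?_
  have hsq : ∀ t ≤ n, (∀ k, D.events[t]? ≠ some (.cap k)) → ∀ k : ℤ,
      D.linDiff ε (linMat ε n t k (k + 1)).snd = 0 := by
    intro t ht hc k
    have := (H.sqMat_linMat hε ht).1 hc k (k + 1)
    rw [sqMat, show Finset.Ioo k (k + 1) = ∅ by ext m; simp, Finset.sum_empty] at this
    exact congrArg TrivSqZeroExt.snd this
  have hc : ∀ k, D.events[a.1]? ≠ some (.cap k) := by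
    obtain ⟨b, k, hE⟩ := a.2
    rw [hE]; simp
  simp only [LinearMap.coe_comp, Function.comp_apply, Finsupp.lsingle_apply, LinearMap.zero_apply]
  rw [linDiff_single]
  rcases H.le_of_vertex a with ha | ha | ha
  · rw [H.map_bdry_front _ a ha, TrivSqZeroExt.snd_add, map_add, hsq _ ha.le hc, zero_add]
    split_ifs <;> simp
  · have := hsq _ ha.le hc 0
    rw [H.map_bdry_normalEnd _ a ha, TrivSqZeroExt.snd_add, map_add, H.linDiff_specialEnd, add_zero]
    rw [ha] at this
    exact this
  · rw [H.map_bdry_specialEnd _ a ha]; simp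

end Resolved
end Diagram
end SolidTorus

namespace SolidTorus

/-! ### Gradings and colorings -/

namespace Diagram
variable {D : Diagram} {n : ℕ} {wd : ℕ → ℕ} {κ : Type*}

/-- A function on the segments that is constant along the link. -/
def IsColoring (D : Diagram) (col : Seg → κ) : Prop := ∀ s s' c, D.Joined s s' c → col s = col s'

theorem IsColoring.eq {col : Seg → κ} (h : D.IsColoring col) {s s' : Seg} (hs : D.SameComponent s s') :
    col s = col s' := by
  induction hs with
  | rel s s' h' => obtain ⟨c, hc⟩ := h'; exact h _ _ _ hc
  | refl => rfl
  | symm _ _ _ ih => exact ih.symm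
  | trans _ _ _ _ _ ih ih' => exact ih.trans ih'

theorem isColoring_component (i : ℕ) : D.IsColoring fun s => s ∈ D.component i := by
  intro s s' c h
  have h' : D.SameComponent s s' := .rel _ _ ⟨c, h⟩
  exact propext ⟨fun hs => .trans _ _ _ hs h', fun hs => .trans _ _ _ hs (.symm _ _ h')⟩

section
variable (μ : Seg → ℤ) (col : Seg → κ)

/-- The part of `V` spanned by the vertices of degree `m` with an understrand of color `c` and an
overstrand of color `c'`. -/
noncomputable def coloredPiece (m : ℤ) (c c' : κ) : Submodule (ZMod 2) D.Space :=
  Submodule.span (ZMod 2) ((fun a => Finsupp.single a 1) ''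
    {a : D.Vertex | a.deg μ = m ∧ col a.under = c ∧ col a.over = c'})

/-- An element of the dual numbers is homogeneous of degree `m` and of type `(c, c')`, where scalars
have degree `0` and all the types `(c, c)`. -/
def Homogeneous (m : ℤ) (c c' : κ) (r : TrivSqZeroExt (ZMod 2) D.Space) : Prop :=
  (r.fst ≠ 0 → m = 0 ∧ c = c') ∧ r.snd ∈ D.coloredPiece μ col m c c'

variable {μ col} {m m' : ℤ} {c c' c'' : κ} {r r' : TrivSqZeroExt (ZMod 2) D.Space}

theorem Homogeneous.zero : Homogeneous μ col m c c' (0 : TrivSqZeroExt (ZMod 2) D.Space) :=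
  ⟨fun h => absurd rfl h, Submodule.zero_mem _⟩

theorem Homogeneous.one : Homogeneous μ col 0 c c (1 : TrivSqZeroExt (ZMod 2) D.Space) :=
  ⟨fun _ => ⟨rfl, rfl⟩, Submodule.zero_mem _⟩

theorem Homogeneous.add (h : Homogeneous μ col m c c' r) (h' : Homogeneous μ col m c c' r') :
    Homogeneous μ col m c c' (r + r') := by
  refine ⟨fun hne => ?_, Submodule.add_mem _ h.2 h'.2⟩
  by_cases h0 : r.fst = 0
  · exact h'.1 fun h1 => hne (by rw [TrivSqZeroExt.fst_add, h0, h1, add_zero])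
  · exact h.1 h0

theorem Homogeneous.mul (h : Homogeneous μ col m c c' r) (h' : Homogeneous μ col m' c' c'' r') :
    Homogeneous μ col (m + m') c c'' (r * r') := by
  constructor
  · intro hne
    rw [TrivSqZeroExt.fst_mul] at hne
    obtain ⟨rfl, rfl⟩ := h.1 (left_ne_zero_of_mul hne)
    obtain ⟨rfl, rfl⟩ := h'.1 (right_ne_zero_of_mul hne)
    exact ⟨rfl, rfl⟩
  · rw [TrivSqZeroExt.snd_mul]
    refine Submodule.add_mem _ ?_ ?_
    · by_cases h0 : r.fst = 0
      · rw [h0, zero_smul]; exact Submodule.zero_mem _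
      · obtain ⟨rfl, rfl⟩ := h.1 h0
        rw [zero_add]; exact Submodule.smul_mem _ _ h'.2
    · by_cases h0 : r'.fst = 0
      · rw [h0, MulOpposite.op_zero, zero_smul]; exact Submodule.zero_mem _
      · obtain ⟨rfl, rfl⟩ := h'.1 h0
        rw [add_zero, op_smul_eq_smul]; exact Submodule.smul_mem _ _ h.2

theorem Homogeneous.gen {ε : D.Alg →ₐ[ZMod 2] ZMod 2} (hε : D.IsAugmentation μ ε)
    (hc : D.IsColoring col) (a : D.Vertex) :
    Homogeneous μ col (a.deg μ) (col a.under) (col a.over) (linearization ε a.gen) := by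
  rw [linearization_gen]
  constructor
  · intro h
    simp only [TrivSqZeroExt.fst_add, TrivSqZeroExt.fst_inl, TrivSqZeroExt.fst_inr, add_zero] at h
    refine ⟨by_contra fun h' => h (hε.degree a h'), ?_⟩
    by_contra h'
    exact h (hε.mixed a fun hs => h' (hc.eq hs).symm)
  · simp only [TrivSqZeroExt.snd_add, TrivSqZeroExt.snd_inl, TrivSqZeroExt.snd_inr, zero_add]
    exact Submodule.subset_span ⟨a, ⟨rfl, rfl, rfl⟩, rfl⟩

end

theorem Vertex.normal (a : D.Vertex) (μ : Seg → ℤ) {k : ℕ} (h : D.events[a.1]? = some (.cross false k)) :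
    a.over = (a.1, k + 1) ∧ a.under = (a.1, k) ∧ a.deg μ = μ (a.1, k + 1) - μ (a.1, k) := by
  obtain ⟨h1, h2⟩ := a.event h
  have h3 : ¬ a.IsSpecial := by rw [h2]; simp
  have h4 : a.over = (a.1, k + 1) := by simp [Vertex.over, h1, h3]
  have h5 : a.under = (a.1, k) := by simp [Vertex.under, h1, h3]
  exact ⟨h4, h5, by simp [Vertex.deg, h3, h4, h5]⟩

theorem Vertex.special (a : D.Vertex) (μ : Seg → ℤ) {k : ℕ} (h : D.events[a.1]? = some (.cross true k)) :
    a.over = (a.1, k) ∧ a.under = (a.1, k + 1) ∧ a.deg μ = μ (a.1, k) - μ (a.1, k + 1) - 1 := by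
  obtain ⟨h1, h2⟩ := a.event h
  have h3 : a.IsSpecial := by rw [h2]
  have h4 : a.over = (a.1, k) := by simp [Vertex.over, h1, h3]
  have h5 : a.under = (a.1, k + 1) := by simp [Vertex.under, h1, h3]
  exact ⟨h4, h5, by simp [Vertex.deg, h3, h4, h5]⟩

theorem swap_swap (k i : ℕ) : swap k (swap k i) = i := by
  unfold swap; split_ifs <;> omega

namespace Resolved
variable {μ : Seg → ℤ} {col : Seg → κ}

theorem homogeneous_weight {ε : D.Alg →ₐ[ZMod 2] ZMod 2} (hε : D.IsAugmentation μ ε)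
    (hc : D.IsColoring col) {t k : ℕ} (hE : D.events[t]? = some (.cross false k)) :
    Homogeneous μ col (μ (t, k + 1) - μ (t, k)) (col (t, k)) (col (t, k + 1))
      (weight (fun v => linearization ε (Vertex.gen v)) t) := by
  obtain ⟨a, rfl⟩ : ∃ a : D.Vertex, a.1 = t := ⟨⟨t, _, _, hE⟩, rfl⟩
  have h := Homogeneous.gen hε hc a
  obtain ⟨h1, h2, h3⟩ := a.normal μ hE
  rw [h1, h2, h3] at h
  rwa [← weight_eq (fun v => linearization ε (Vertex.gen v)) a]

/-- Degree and colors of the special crossing in terms of the strands at `x = 0`. -/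
theorem specialEnd_vertex (H : D.Resolved n wd) (hμ : D.IsMaslov μ) (hc : D.IsColoring col) (a : D.Vertex)
    (ha : a.1 = n + 1) : a.deg μ = μ (0, 1) - μ (0, 0) - 1 ∧ col a.over = col (0, 1) ∧
      col a.under = col (0, 0) := by
  have hE := H.specialEnd
  rw [← ha] at hE
  obtain ⟨h1, h2, h3⟩ := a.special μ hE
  have j1 := Joined.cross 0 hE
  have j2 := Joined.cross 1 hE
  rw [show D.lineAfter a.1 = 0 by rw [ha, H.lineAfter_last]] at j1 j2
  have m1 := hμ _ _ _ j1
  have m2 := hμ _ _ _ j2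
  have c1 := hc _ _ _ j1
  have c2 := hc _ _ _ j2
  simp only [swap, if_true, zero_add, if_neg (show (1 : ℕ) ≠ 0 by omega)] at m1 m2 c1 c2
  refine ⟨by rw [h3]; simp only [zero_add]; omega, by rw [h1, c1], by rw [h2]; exact c2⟩

/-- Degree and colors of the normal crossing of the transition tangle in terms of the strands at `x
= 0`. -/
theorem normalEnd_vertex (H : D.Resolved n wd) (hμ : D.IsMaslov μ) (hc : D.IsColoring col) (a : D.Vertex)
    (ha : a.1 = n) : a.deg μ = μ (0, 1) - μ (0, 0) ∧ col a.over = col (0, 1) ∧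
      col a.under = col (0, 0) := by
  have hE := H.normalEnd
  rw [← ha] at hE
  obtain ⟨h1, h2, h3⟩ := a.normal μ hE
  have j1 := Joined.cross 0 hE
  have j2 := Joined.cross 1 hE
  rw [show D.lineAfter a.1 = n + 1 by rw [ha, H.lineAfter_of_le le_rfl]] at j1 j2
  have k1 := Joined.cross 0 H.specialEnd
  have k2 := Joined.cross 1 H.specialEnd
  rw [H.lineAfter_last] at k1 k2
  have m1 := hμ _ _ _ j1
  have m2 := hμ _ _ _ j2
  have c1 := hc _ _ _ j1
  have c2 := hc _ _ _ j2
  have m3 := hμ _ _ _ k1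
  have m4 := hμ _ _ _ k2
  have c3 := hc _ _ _ k1
  have c4 := hc _ _ _ k2
  simp only [swap, if_true, zero_add, if_neg (show (1 : ℕ) ≠ 0 by omega)] at m1 m2 c1 c2 m3 m4 c3 c4
  refine ⟨by rw [h3]; simp only [zero_add]; omega, by rw [h1]; exact c2.trans c3,
    by rw [h2]; exact c1.trans c4⟩

/-- The entry `(i, j)` of the matrix of a line is homogeneous: its degree is one less than the
difference of the potentials of the two strands, and its type is given by their colors. -/
theorem homogeneous_linMat (H : D.Resolved n wd) (hμ : D.IsMaslov μ) {ε : D.Alg →ₐ[ZMod 2] ZMod 2}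
    (hε : D.IsAugmentation μ ε) (hc : D.IsColoring col) {t : ℕ} (ht : t ≤ n) (i j : ℕ) :
    Homogeneous μ col (μ (t, j) - μ (t, i) - 1) (col (t, i)) (col (t, j)) (linMat ε n t i j) := by
  induction t generalizing i j with
  | zero =>
    simp only [linMat, lineMat]
    split_ifs with h
    · obtain ⟨rfl, rfl⟩ : i = 0 ∧ j = 1 := by omega
      obtain ⟨a, ha⟩ : ∃ a : D.Vertex, a.1 = n + 1 := ⟨⟨n + 1, _, _, H.specialEnd⟩, rfl⟩
      obtain ⟨h1, h2, h3⟩ := H.specialEnd_vertex hμ hc a ha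
      have h := Homogeneous.gen hε hc a
      rw [h1, h2, h3, weight_eq (fun v => linearization ε (Vertex.gen v)) a, ha] at h
      exact h
    · exact .zero
  | succ t ih =>
    have ih := fun i j => ih (by omega) i j
    have hl : D.lineAfter t = t + 1 := H.lineAfter_of_le (by omega)
    have hlt : t < D.events.length := by rw [H.length]; omega
    have hE : D.events[t]? = some D.events[t] := List.getElem?_eq_getElem hlt
    rcases hcase : D.events[t] with ⟨b, k⟩ | ⟨k⟩ | ⟨k⟩ <;> rw [hcase] at hE
    · obtain rfl := H.normal t (by omega) b k hE
      have hm : ∀ i, μ (t + 1, i) = μ (t, swap k i) ∧ col (t + 1, i) = col (t, swap k i) := by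
        intro i
        have j := Joined.cross (swap k i) hE
        rw [hl, swap_swap] at j
        exact ⟨by rw [hμ _ _ _ j, add_zero], (hc _ _ _ j).symm⟩
      have hx := homogeneous_weight hε hc hE
      rw [show linMat ε n (t + 1) = _ from lineMat_succ_cross hE]
      rw [(hm i).1, (hm j).1, (hm i).2, (hm j).2]
      simp only [crossStep, swapZ_natCast]
      split_ifs with h1 h2 h3 h3
      · omega
      · obtain rfl : i = k + 1 := by omega
        refine ((ih _ _).add ?_).add .zero
        have e1 : swap k j = j := by unfold swap; split_ifs <;> omega
        have e2 : swap k (k + 1) = k := by unfold swap; split_ifs <;> omega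
        rw [e1, e2, mul_comm]
        have := hx.mul (ih (k + 1) j)
        rwa [show μ (t, k + 1) - μ (t, k) + (μ (t, j) - μ (t, k + 1) - 1) = μ (t, j) - μ (t, k) - 1 by ring]
          at this
      · obtain rfl : j = k := by omega
        refine ((ih _ _).add .zero).add ?_
        have e1 : swap j i = i := by unfold swap; split_ifs <;> omega
        have e2 : swap j j = j + 1 := by unfold swap; split_ifs <;> omega
        rw [e1, e2, mul_comm]
        have := (ih i j).mul hx
        rwa [show μ (t, j) - μ (t, i) - 1 + (μ (t, j + 1) - μ (t, j)) = μ (t, j + 1) - μ (t, i) - 1 by ring]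
          at this
      · exact ((ih _ _).add .zero).add .zero
      · exact .zero
    · have hm : ∀ i, μ (t + 1, shift k i) = μ (t, i) ∧ col (t + 1, shift k i) = col (t, i) := by
        intro i
        have j := Joined.cup i hE
        rw [hl] at j
        exact ⟨by rw [hμ _ _ _ j, add_zero], (hc _ _ _ j).symm⟩
      have jc := Joined.leftCusp hE
      rw [hl] at jc
      have jm := hμ _ _ _ jc
      have jcol := hc _ _ _ jc
      rw [show linMat ε n (t + 1) = _ from lineMat_succ_cup hE]
      unfold cupStep
      split_ifs with h1 h2
      · obtain ⟨rfl, rfl⟩ : i = k ∧ j = k + 1 := by omega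
        rw [jm, jcol, add_sub_cancel_left, sub_self]
        exact .one
      · exact .zero
      · obtain ⟨i', rfl⟩ := exists_shift_eq (k := k) (i := i) (by omega) (by omega)
        obtain ⟨j', rfl⟩ := exists_shift_eq (k := k) (i := j) (by omega) (by omega)
        rw [unshiftZ_natCast, unshiftZ_natCast, (hm i').1, (hm i').2, (hm j').1, (hm j').2]
        exact ih _ _
    · have hm : ∀ i, μ (t + 1, i) = μ (t, shift k i) ∧ col (t + 1, i) = col (t, shift k i) := by
        intro i
        have j := Joined.cap i hE
        rw [hl] at j
        exact ⟨by rw [hμ _ _ _ j, add_zero], (hc _ _ _ j).symm⟩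
      have jc := Joined.rightCusp hE
      have jm := hμ _ _ _ jc
      have jcol := hc _ _ _ jc
      rw [show linMat ε n (t + 1) = _ from lineMat_succ_cap hE]
      simp only [capStep, shiftZ_natCast]
      rw [(hm i).1, (hm j).1, (hm i).2, (hm j).2]
      refine (ih _ _).add ?_
      split_ifs with h
      · have e1 : shift k i = i := by unfold shift; split_ifs <;> omega
        have e2 : shift k j = j + 2 := by unfold shift; split_ifs <;> omega
        rw [e1, e2, mul_comm]
        have h1 := ih (k + 1) (j + 2)
        rw [jcol] at h1
        have := (ih i k).mul h1
        rw [show μ (t, k) - μ (t, i) - 1 + (μ (t, j + 2) - μ (t, k + 1) - 1) =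
          μ (t, j + 2) - μ (t, i) - 1 by omega] at this
        exact_mod_cast this
      · exact .zero

/-- The linearized differential lowers degrees by one and preserves the colors. -/
theorem linDiff_mem_coloredPiece (H : D.Resolved n wd) (hμ : D.IsMaslov μ) {ε : D.Alg →ₐ[ZMod 2] ZMod 2}
    (hε : D.IsAugmentation μ ε) (hc : D.IsColoring col) (a : D.Vertex) :
    D.linDiff ε (Finsupp.single a 1) ∈
      D.coloredPiece μ col (a.deg μ - 1) (col a.under) (col a.over) := by
  classical
  rw [linDiff_single]
  rcases H.le_of_vertex a with ha | ha | ha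
  · obtain ⟨b, k, hE⟩ := a.2
    obtain rfl := H.normal _ ha b k hE
    have h := (H.homogeneous_linMat hμ hε hc ha.le k (k + 1)).2
    obtain ⟨h1, h2, h3⟩ := a.normal μ hE
    rw [H.map_bdry_front _ a ha, (a.event hE).1, TrivSqZeroExt.snd_add, h1, h2, h3]
    rw [show TrivSqZeroExt.snd (if ∃ k, D.events[a.1 + 1]? = some (.cap k) then
      (1 : TrivSqZeroExt (ZMod 2) D.Space) else 0) = 0 by split_ifs <;> simp, add_zero]
    exact_mod_cast h
  · obtain ⟨h1, h2, h3⟩ := H.normalEnd_vertex hμ hc a ha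
    rw [H.map_bdry_normalEnd _ a ha, TrivSqZeroExt.snd_add, h1, h2, h3]
    refine Submodule.add_mem _ ?_ ?_
    · have h := (H.homogeneous_linMat hμ hε hc (t := n) le_rfl 0 1).2
      have hE := H.normalEnd
      rw [← ha] at hE
      obtain ⟨k1, k2, k3⟩ := a.normal μ hE
      rw [k3] at h1
      rw [k1] at h2
      rw [k2] at h3
      rw [ha] at h1 h2 h3
      rw [zero_add] at h1 h2
      rw [h1, h2, h3] at h
      exact_mod_cast h
    · have h := H.homogeneous_linMat hμ hε hc (t := 0) (Nat.zero_le n) 0 1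
      have := h.2
      simpa [linMat, lineMat] using this
  · rw [H.map_bdry_specialEnd _ a ha]
    exact Submodule.zero_mem _

end Resolved
end Diagram
end SolidTorus

namespace SolidTorus

/-! ### Homology of a graded complex with a spanning family -/

section Homology
open Module
variable {F B G : Type} [Field F]

theorem finrank_inf_ker_add {V : Type} [AddCommGroup V] [Module F V] [FiniteDimensional F V]
    (d : V →ₗ[F] V) (P : Submodule F V) :
    finrank F (P ⊓ LinearMap.ker d : Submodule F V) + finrank F (P.map d) = finrank F P := by
  have h := LinearMap.finrank_range_add_finrank_ker (d.domRestrict P)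
  have h1 : LinearMap.range (d.domRestrict P) = P.map d := LinearMap.range_domRestrict _ _
  have h2 : finrank F (LinearMap.ker (d.domRestrict P)) =
      finrank F (P ⊓ LinearMap.ker d : Submodule F V) := by
    rw [← Submodule.finrank_map_subtype_eq, LinearMap.ker_domRestrict, Submodule.map_comap_subtype]
  rw [h1, h2] at h
  omega

theorem quotientDim_add {V : Type} [AddCommGroup V] [Module F V] [FiniteDimensional F V]
    {Z I : Submodule F V} (h : I ≤ Z) : Diagram.quotientDim Z I + finrank F I = finrank F Z := by
  have h1 := Submodule.finrank_quotient_add_finrank (I.comap Z.subtype)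
  rw [(Submodule.comapSubtypeEquivOfLe h).finrank_eq] at h1
  exact h1

/-- The span of the basis vectors of degree `γ`. -/
noncomputable def gradedPiece (g : B → G) (γ : G) : Submodule F (B →₀ F) :=
  Submodule.span F ((fun b => Finsupp.single b 1) '' {b | g b = γ})

open Classical in
/-- The projection to the part of degree `γ`. -/
noncomputable def gradedProj (g : B → G) (γ : G) : (B →₀ F) →ₗ[F] (B →₀ F) :=
  Finsupp.linearCombination F fun b => if g b = γ then Finsupp.single b 1 else 0

open Classical in
theorem gradedProj_of_mem {g : B → G} {γ γ' : G} {x : B →₀ F} (hx : x ∈ gradedPiece g γ') :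
    gradedProj g γ x = if γ' = γ then x else 0 := by
  induction hx using Submodule.span_induction with
  | mem x h =>
    obtain ⟨b, rfl, rfl⟩ := h
    simp [gradedProj]
  | zero => simp
  | add x y _ _ hx hy => rw [map_add, hx, hy]; split_ifs <;> simp
  | smul a x _ hx => rw [map_smul, hx]; split_ifs <;> simp

theorem gradedProj_comm {g : B → G} {f : Equiv.Perm G} {d : (B →₀ F) →ₗ[F] (B →₀ F)}
    (hd : ∀ b, d (Finsupp.single b 1) ∈ gradedPiece g (f (g b))) (γ : G) (x : B →₀ F) :
    gradedProj g (f γ) (d x) = d (gradedProj g γ x) := by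
  classical
  suffices h : (gradedProj g (f γ)).comp d = d.comp (gradedProj g γ) from LinearMap.congr_fun h x
  refine Finsupp.lhom_ext' fun b => LinearMap.ext_ring ?_
  simp only [LinearMap.coe_comp, Function.comp_apply, Finsupp.lsingle_apply]
  rw [gradedProj_of_mem (hd b), gradedProj, Finsupp.linearCombination_single, one_smul]
  simp only [EmbeddingLike.apply_eq_iff_eq]
  split_ifs <;> simp

/-- If homogeneous vectors span the whole space, then the ones of degree `γ` span the part of degree
`γ`. -/
theorem gradedPiece_eq_span {ι : Type} {g : B → G} {e : ι → B →₀ F} {h : ι → G}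
    (he : ∀ i, e i ∈ gradedPiece g (h i)) (hs : ⊤ ≤ Submodule.span F (Set.range e)) (γ : G) :
    gradedPiece g γ = Submodule.span F (Set.range fun i : {i // h i = γ} => e i) := by
  classical
  apply le_antisymm
  · intro x hx
    have h1 := gradedProj_of_mem (γ := γ) hx
    rw [if_pos rfl] at h1
    rw [← h1]
    have h2 : x ∈ Submodule.span F (Set.range e) := hs trivial
    clear h1 hx
    induction h2 using Submodule.span_induction with
    | mem x hx =>
      obtain ⟨i, rfl⟩ := hx
      rw [gradedProj_of_mem (he i)]
      split_ifs with hi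
      · exact Submodule.subset_span ⟨⟨i, hi⟩, rfl⟩
      · exact Submodule.zero_mem _
    | zero => simp
    | add x y _ _ hx hy => rw [map_add]; exact Submodule.add_mem _ hx hy
    | smul a x _ hx => rw [map_smul]; exact Submodule.smul_mem _ _ hx
  · rw [Submodule.span_le]
    rintro _ ⟨⟨i, rfl⟩, rfl⟩
    exact he i

/-- Let `W` and `M` be sets of basis vectors such that `W`, `d W` and `M` span the space, that `2
|W| + |M|` is at most its dimension, and that `d M` lies in the span of `W` and `d W`. Then the
homology of `d` has a basis that corresponds to `M`. The grading takes values in any type `G`, and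
`d` changes it by a permutation `f` of `G`. -/
theorem quotientDim_graded [Fintype B] {g : B → G} {f : Equiv.Perm G} {d : (B →₀ F) →ₗ[F] (B →₀ F)}
    (hd : ∀ b, d (Finsupp.single b 1) ∈ gradedPiece g (f (g b))) (hdd : ∀ x, d (d x) = 0)
    (W M : Finset B) (hcard : 2 * W.card + M.card ≤ Fintype.card B)
    (hspan : ∀ b : B, (Finsupp.single b 1 : B →₀ F) ∈
      Submodule.span F ((fun b => Finsupp.single b 1) '' (W : Set B)) ⊔
      (Submodule.span F ((fun b => Finsupp.single b 1) '' (W : Set B))).map d ⊔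
      Submodule.span F ((fun b => Finsupp.single b 1) '' (M : Set B)))
    (hM : ∀ m ∈ M, d (Finsupp.single m 1) ∈
      Submodule.span F ((fun b => Finsupp.single b 1) '' (W : Set B)) ⊔
      (Submodule.span F ((fun b => Finsupp.single b 1) '' (W : Set B))).map d) (γ : G) :
    Diagram.quotientDim (gradedPiece g (f γ) ⊓ LinearMap.ker d) ((gradedPiece g γ).map d) =
      Nat.card {m : M // g m = f γ} := by
  classical
  set sW := Submodule.span F ((fun b => (Finsupp.single b 1 : B →₀ F)) '' (W : Set B)) with hsW
  set sM := Submodule.span F ((fun b => (Finsupp.single b 1 : B →₀ F)) '' (M : Set B)) with hsM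
  let e : W ⊕ W ⊕ M → B →₀ F := Sum.elim (fun w => Finsupp.single w.1 1)
    (Sum.elim (fun w => d (Finsupp.single w.1 1)) (fun m => Finsupp.single m.1 1))
  let h : W ⊕ W ⊕ M → G := Sum.elim (fun w => g w) (Sum.elim (fun w => f (g w)) (fun m => g m))
  have he : ∀ i, e i ∈ gradedPiece g (h i) := by
    rintro (w | w | m)
    · exact Submodule.subset_span ⟨w, rfl, rfl⟩
    · exact hd w
    · exact Submodule.subset_span ⟨m, rfl, rfl⟩
  have hs : ⊤ ≤ Submodule.span F (Set.range e) := by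
    have h1 : sW ⊔ sW.map d ⊔ sM ≤ Submodule.span F (Set.range e) := by
      refine sup_le (sup_le ?_ ?_) ?_
      · rw [Submodule.span_le]
        rintro _ ⟨w, hw, rfl⟩
        exact Submodule.subset_span ⟨.inl ⟨w, hw⟩, rfl⟩
      · rw [Submodule.map_span, Submodule.span_le]
        rintro _ ⟨_, ⟨w, hw, rfl⟩, rfl⟩
        exact Submodule.subset_span ⟨.inr (.inl ⟨w, hw⟩), rfl⟩
      · rw [Submodule.span_le]
        rintro _ ⟨w, hw, rfl⟩
        exact Submodule.subset_span ⟨.inr (.inr ⟨w, hw⟩), rfl⟩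
    intro x _
    induction x using Finsupp.induction_linear with
    | zero => exact Submodule.zero_mem _
    | add x y hx hy => exact Submodule.add_mem _ (hx trivial) (hy trivial)
    | single b a =>
      have := Submodule.smul_mem _ a (h1 (hspan b))
      simpa using this
  -- the spanning family has at most as many members as the dimension, hence it is a basis
  have hli : LinearIndependent F e := by
    refine linearIndependent_of_top_le_span_of_card_eq_finrank hs (le_antisymm ?_ ?_)
    · simp only [Fintype.card_sum, Fintype.card_coe, Module.finrank_finsupp_self]; omega
    · have h1 := finrank_range_le_card (R := F) e
      rw [Set.finrank, top_le_iff.1 hs, finrank_top] at h1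
      exact h1
  have hinj : ∀ x ∈ sW, d x = 0 → x = 0 := by
    intro x hx hx0
    have hli2 : LinearIndependent F fun w : W => d (Finsupp.single w.1 1) :=
      hli.comp (fun w => .inr (.inl w)) (fun a b h => by simpa using h)
    have hx' : x ∈ Submodule.span F (Set.range fun w : W => (Finsupp.single w.1 1 : B →₀ F)) := by
      convert hx using 2
      ext; simp
    rw [← Finsupp.range_linearCombination] at hx'
    obtain ⟨l, rfl⟩ := hx'
    have h1 : d (Finsupp.linearCombination F (fun w : W => (Finsupp.single w.1 1 : B →₀ F)) l) =
        Finsupp.linearCombination F (fun w : W => d (Finsupp.single w.1 1)) l := by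
      rw [Finsupp.apply_linearCombination]; rfl
    rw [h1] at hx0
    rw [linearIndependent_iff.1 hli2 l hx0, map_zero]
  -- the homogeneous parts of an element of the span of `W` lie in that span
  have hWproj : ∀ x ∈ sW, ∀ γ, gradedProj g γ x ∈
      Submodule.span F (Set.range fun w : {w : W // g w = γ} => (Finsupp.single w.1.1 1 : B →₀ F)) := by
    intro x hx γ
    induction hx using Submodule.span_induction with
    | mem x h =>
      obtain ⟨w, hw, rfl⟩ := h
      simp only [gradedProj, Finsupp.linearCombination_single, one_smul]
      split_ifs with h'
      · exact Submodule.subset_span ⟨⟨⟨w, hw⟩, h'⟩, rfl⟩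
      · exact Submodule.zero_mem _
    | zero => simp
    | add x y _ _ hx hy => rw [map_add]; exact Submodule.add_mem _ hx hy
    | smul a x _ hx => rw [map_smul]; exact Submodule.smul_mem _ _ hx
  have hdP : ∀ γ, (gradedPiece g γ).map d =
      Submodule.span F (Set.range fun w : {w : W // g w = γ} => d (Finsupp.single w.1.1 1)) := by
    intro γ
    have hrw : Submodule.span F (Set.range fun w : {w : W // g w = γ} => d (Finsupp.single w.1.1 1)) =
      (Submodule.span F (Set.range fun w : {w : W // g w = γ} =>
        (Finsupp.single w.1.1 1 : B →₀ F))).map d := by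
      rw [Submodule.map_span, ← Set.range_comp]; rfl
    apply le_antisymm
    · rw [gradedPiece_eq_span he hs γ, Submodule.map_span, Submodule.span_le]
      rintro _ ⟨_, ⟨⟨w | w | m, hi⟩, rfl⟩, rfl⟩
      · exact Submodule.subset_span ⟨⟨w, hi⟩, rfl⟩
      · simp only [e, Sum.elim_inl, Sum.elim_inr, hdd]; exact Submodule.zero_mem _
      · obtain ⟨w1, h1, _, ⟨w2, h2, rfl⟩, h3⟩ := Submodule.mem_sup.1 (hM m.1 m.2)
        -- write `d m = w₁ + d w₂`; as `d` is injective on the span of `W` and `d (d m) = 0`, `w₁ = 0`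
        have h4 := hdd (Finsupp.single m.1 1)
        rw [← h3, map_add, hdd, add_zero] at h4
        rw [hinj w1 h1 h4, zero_add] at h3
        have h5 := gradedProj_of_mem (γ := f γ) (hd m.1)
        rw [if_pos (by rw [← hi]; rfl), ← h3, gradedProj_comm hd] at h5
        change d (Finsupp.single m.1 1) ∈ _
        rw [← h3, ← h5, hrw]
        exact Submodule.mem_map_of_mem (hWproj w2 h2 γ)
    · rw [Submodule.span_le]
      rintro _ ⟨⟨w, hw⟩, rfl⟩
      exact Submodule.mem_map_of_mem (Submodule.subset_span ⟨w.1, hw, rfl⟩)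
  have hrank : ∀ γ, finrank F ((gradedPiece g γ).map d) = Fintype.card {w : W // g w = γ} := by
    intro γ
    rw [hdP γ]
    refine finrank_span_eq_card (b := fun w : {w : W // g w = γ} => d (Finsupp.single w.1.1 1)) ?_
    exact hli.comp (fun w : {w : W // g w = γ} => .inr (.inl w.1))
      (fun a b h => Subtype.ext (Sum.inl.inj (Sum.inr.inj h)))
  have hP : finrank F (gradedPiece (F := F) g (f γ)) = Fintype.card {w : W // g w = f γ} +
      (Fintype.card {w : W // g w = γ} + Fintype.card {m : M // g m = f γ}) := by
    rw [gradedPiece_eq_span he hs (f γ)]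
    have h1 := finrank_span_eq_card (R := F) (b := fun i : {i // h i = f γ} => e i)
      (hli.comp _ Subtype.val_injective)
    rw [h1, Fintype.card_congr (Equiv.subtypeSum), Fintype.card_sum,
      Fintype.card_congr (Equiv.subtypeSum (p := fun c : W ⊕ M => h (.inr c) = f γ)), Fintype.card_sum]
    congr 2
    refine Fintype.card_congr (Equiv.subtypeEquivRight fun w => ?_)
    simp [h]
  have hle : (gradedPiece g γ).map d ≤ gradedPiece g (f γ) ⊓ LinearMap.ker d := by
    rw [hdP γ, Submodule.span_le]
    rintro _ ⟨⟨w, rfl⟩, rfl⟩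
    exact ⟨hd _, hdd _⟩
  have q1 := quotientDim_add hle
  have q2 := finrank_inf_ker_add d (gradedPiece (F := F) g (f γ))
  rw [hrank] at q1 q2
  rw [Nat.card_eq_fintype_card]
  omega

end Homology
end SolidTorus

namespace SolidTorus

/-! ### Words and the events of their resolutions -/

namespace Ev
variable {α β : Type*}

/-- The singularity is possible on a front with `w` strands on its left. -/
def InRange (w : ℤ) : Ev α → Prop
  | row k _ => 0 ≤ k ∧ k + 2 ≤ w
  | col k _ => 0 ≤ k ∧ k + 2 ≤ w
  | cup k _ => 0 ≤ k ∧ k ≤ w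
  | cusp k _ => 0 ≤ k ∧ k + 2 ≤ w

/-- The events of the resolution of a singularity. -/
def events : Ev α → List Event
  | row k _ => [.cross false k.toNat]
  | col k _ => [.cross false k.toNat]
  | cup k _ => [.cup k.toNat]
  | cusp k _ => [.cross false k.toNat, .cap k.toNat]

/-- The datum carried by a singularity. -/
def payload : Ev α → α
  | row _ a => a
  | col _ a => a
  | cup _ a => a
  | cusp _ a => a

/-- The events of the resolution of the singularity occur in `E`, from the position on that the
singularity carries. -/
def Occurs (E : List Event) : Ev ℕ → Prop
  | row k i => 0 ≤ k ∧ E[i]? = some (.cross false k.toNat)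
  | col k i => 0 ≤ k ∧ E[i]? = some (.cross false k.toNat)
  | cup k i => 0 ≤ k ∧ E[i]? = some (.cup k.toNat)
  | cusp k i => 0 ≤ k ∧ E[i]? = some (.cross false k.toNat) ∧ E[i + 1]? = some (.cap k.toNat)

@[simp] theorem payload_map (f : α → β) (e : Ev α) : (e.map f).payload = f e.payload := by
  cases e <;> rfl

theorem map_map {γ : Type*} (f : α → β) (g : β → γ) (e : Ev α) : (e.map f).map g = e.map (g ∘ f) := by
  cases e <;> rfl

@[simp] theorem events_map (f : α → β) (e : Ev α) : (e.map f).events = e.events := by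
  cases e <;> rfl

theorem inRange_map (f : α → β) (e : Ev α) (w : ℤ) : (e.map f).InRange w ↔ e.InRange w := by
  cases e <;> rfl

end Ev

namespace Word
variable {α β : Type*}

/-- The word is possible on a front with the given number of strands on its left. -/
def InRange : ℤ → Word α → Prop
  | _, [] => True
  | w, e :: W => e.InRange w ∧ InRange (w + e.gain) W

/-- The events of the resolution of a word. -/
def events (W : Word α) : List Event := W.flatMap Ev.events

/-- Every singularity of the word is marked by the position of its first event, where the first
event of the word has position `t`. -/
def number : ℕ → Word α → Word ℕ
  | _, [] => []
  | t, e :: W => e.map (fun _ => t) :: number (t + e.events.length) W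

@[simp] theorem events_cons (e : Ev α) (W : Word α) : events (e :: W) = e.events ++ events W := rfl
@[simp] theorem events_nil : events ([] : Word α) = [] := rfl

theorem events_append (W W' : Word α) : events (W ++ W') = events W ++ events W' := by
  simp [events]

theorem inRange_append {w : ℤ} (W W' : Word α) :
    InRange w (W ++ W') ↔ InRange w W ∧ InRange (w + gain W) W' := by
  induction W generalizing w with
  | nil => simp [InRange, gain]
  | cons e W ih => simp [InRange, gain_cons, ih, and_assoc, add_assoc]

theorem inRange_raise {w c : ℤ} (hc : 0 ≤ c) {W : Word α} (h : InRange w W) :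
    InRange (w + c) (raise c W) := by
  induction W generalizing w with
  | nil => trivial
  | cons e W ih =>
    refine ⟨?_, ?_⟩
    · have := h.1
      cases e <;> simp only [Ev.InRange, Ev.raise] at this ⊢ <;> omega
    · have := ih h.2
      rwa [Ev.gain_raise, add_right_comm]

theorem inRange_reflect {w : ℤ} {W : Word α} (h : InRange w W) : InRange w (reflect w W) := by
  induction W generalizing w with
  | nil => trivial
  | cons e W ih =>
    refine ⟨?_, ?_⟩
    · have := h.1
      cases e <;> simp only [Ev.InRange, Ev.reflect] at this ⊢ <;> omega
    · rw [Ev.reflect_gain]; exact ih h.2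

theorem erase_number (t : ℕ) (W : Word α) : erase (number t W) = erase W := by
  induction W generalizing t with
  | nil => rfl
  | cons e W ih =>
    have := ih (t + e.events.length)
    simp only [erase] at this ⊢
    simp [number, this, Ev.map_map, Function.comp_def]

theorem number_append (t : ℕ) (W W' : Word α) :
    number t (W ++ W') = number t W ++ number (t + (events W).length) W' := by
  induction W generalizing t with
  | nil => simp [number]
  | cons e W ih => simp [number, ih, add_assoc]

theorem le_payload {t : ℕ} {W : Word α} {e : Ev ℕ} (he : e ∈ number t W) : t ≤ e.payload := by
  induction W generalizing t with
  | nil => simp [number] at he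
  | cons f W ih =>
    rcases List.mem_cons.1 he with rfl | he
    · simp
    · have := ih he; omega

theorem length_events_pos (e : Ev α) : 0 < e.events.length := by cases e <;> simp [Ev.events]

/-- The number determines the event. -/
theorem number_inj {t : ℕ} {W : Word α} {e f : Ev ℕ} (he : e ∈ number t W) (hf : f ∈ number t W)
    (h : e.payload = f.payload) : e = f := by
  induction W generalizing t with
  | nil => simp [number] at he
  | cons g W ih =>
    have hpos := length_events_pos g
    rcases List.mem_cons.1 he with rfl | he <;> rcases List.mem_cons.1 hf with rfl | hf
    · rfl
    · have := le_payload hf; simp at h; omega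
    · have := le_payload he; simp at h; omega
    · exact ih he hf

theorem payload_pairwise (t : ℕ) (W : Word α) :
    (number t W).Pairwise fun e f => e.payload < f.payload := by
  induction W generalizing t with
  | nil => exact List.Pairwise.nil
  | cons g W ih =>
    refine List.Pairwise.cons (fun f hf => ?_) (ih _)
    have := le_payload hf
    have := length_events_pos g
    simp; omega

/-- If the events of the word `W` occur in `E` from position `t` on, then so do those of each
singularity from its own position on. -/
theorem number_spec {E E' : List Event} {t : ℕ} {W : Word α} (hE : E.drop t = events W ++ E')
    {w : ℤ} (hW : InRange w W) {e : Ev ℕ} (he : e ∈ number t W) :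
    e.payload < t + (events W).length ∧ e.Occurs E := by
  induction W generalizing t w with
  | nil => simp [number] at he
  | cons g W ih =>
    have hpos := length_events_pos g
    have hE' : E.drop (t + g.events.length) = events W ++ E' := by
      rw [← List.drop_drop, hE, events_cons, List.append_assoc, List.drop_left]
    rcases List.mem_cons.1 he with rfl | he
    · refine ⟨by simp; omega, ?_⟩
      have h0 : ∀ m, E[t + m]? = (g.events ++ (events W ++ E'))[m]? := by
        intro m
        rw [← List.getElem?_drop, hE, events_cons, List.append_assoc]
      have h1 := h0 0
      have h2 := h0 1
      have h3 := hW.1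
      cases g with
      | cusp k a => exact ⟨h3.1, by simpa [Ev.events] using h1, by simpa [Ev.events] using h2⟩
      | _ => exact ⟨h3.1, by simpa [Ev.events] using h1⟩
    · obtain ⟨h1, h2⟩ := ih hE' hW.2 he
      refine ⟨?_, h2⟩
      rw [events_cons, List.length_append]; omega

/-- Conversely, every crossing among these events is the first event of a crossing or of a right
cusp of the word, and every cap is the second event of a right cusp. -/
theorem exists_of_cross {E E' : List Event} {t : ℕ} {W : Word α} (hE : E.drop t = events W ++ E')
    {w : ℤ} (hW : InRange w W) {i : ℕ} (hi : t ≤ i) (hi' : i < t + (events W).length) :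
    (∀ b k, E[i]? = some (.cross b k) → b = false ∧ (Ev.row k i ∈ number t W ∨ Ev.col k i ∈ number t W ∨
      Ev.cusp k i ∈ number t W)) ∧
    (∀ k, E[i]? = some (.cap k) → ∃ i', i = i' + 1 ∧ Ev.cusp k i' ∈ number t W) := by
  induction W generalizing t w with
  | nil => simp at hi'; omega
  | cons g W ih =>
    have hE' : E.drop (t + g.events.length) = events W ++ E' := by
      rw [← List.drop_drop, hE, events_cons, List.append_assoc, List.drop_left]
    by_cases h : t + g.events.length ≤ i
    · rw [events_cons, List.length_append] at hi'
      obtain ⟨h1, h2⟩ := ih hE' hW.2 h (by omega)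
      refine ⟨fun b k hk => ?_, fun k hk => ?_⟩
      · obtain ⟨a, b⟩ := h1 b k hk
        exact ⟨a, b.imp (List.mem_cons_of_mem _) (Or.imp (List.mem_cons_of_mem _) (List.mem_cons_of_mem _))⟩
      · obtain ⟨i', a, b⟩ := h2 k hk
        exact ⟨i', a, List.mem_cons_of_mem _ b⟩
    · have h0 : E[i]? = g.events[i - t]? := by
        rw [show i = t + (i - t) by omega, ← List.getElem?_drop, hE, events_cons, List.append_assoc,
          List.getElem?_append_left (by omega)]
        congr 1; omega
      have h3 := hW.1
      cases g with
      | cusp k a =>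
        simp only [Ev.events, List.length_cons, List.length_nil] at h h0
        obtain h4 | h4 : i = t ∨ i = t + 1 := by omega
        · subst h4
          simp only [Nat.sub_self, List.getElem?_cons_zero] at h0
          rw [h0]
          refine ⟨?_, by simp⟩
          intro b k' hk
          simp only [Option.some.injEq, Event.cross.injEq] at hk
          refine ⟨hk.1.symm, .inr (.inr ?_)⟩
          simp only [number, Ev.map, List.mem_cons]
          left; rw [← hk.2, Int.toNat_of_nonneg h3.1]
        · subst h4
          simp at h0
          rw [h0]
          refine ⟨by simp, ?_⟩
          intro k' hk
          simp only [Option.some.injEq, Event.cap.injEq] at hk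
          refine ⟨t, rfl, ?_⟩
          simp only [number, Ev.map, List.mem_cons]
          left; rw [← hk, Int.toNat_of_nonneg h3.1]
      | cup k a =>
        simp only [Ev.events, List.length_cons, List.length_nil] at h h0
        obtain rfl : i = t := by omega
        simp only [Nat.sub_self, List.getElem?_cons_zero] at h0
        rw [h0]
        refine ⟨by simp, by simp⟩
      | row k a | col k a =>
        simp only [Ev.events, List.length_cons, List.length_nil] at h h0
        obtain rfl : i = t := by omega
        simp only [Nat.sub_self, List.getElem?_cons_zero] at h0
        rw [h0]
        refine ⟨?_, by simp⟩
        intro b k' hk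
        simp only [Option.some.injEq, Event.cross.injEq] at hk
        refine ⟨hk.1.symm, ?_⟩
        simp only [number, Ev.map, List.mem_cons]
        simp [← hk.2, Int.toNat_of_nonneg h3.1]

variable {R : Type*} [CommRing R]

open Diagram in

/-- The matrices of the lines along the events of a word, if the crossings that represent right
cusps have weight `0`: the last line is reached by the run of the word, its pivots are one when the
entries at these crossings are, and its entries vanish when those at the other crossings do. -/
theorem lineMat_word {E E' : List Event} {wt : ℕ → R} {y : R} {t : ℕ} {W : Word α}
    (hE : E.drop t = events W ++ E') {w : ℤ} (hW : InRange w W)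
    (hc : ∀ k i, Ev.cusp k i ∈ number t W → wt i = 0) :
    lineMat E wt y (t + (events W).length) =
      run ((number t W).map (Ev.map wt)) (lineMat E wt y t) ∧
    (Pivots ((number t W).map (Ev.map wt)) (lineMat E wt y t) ↔
      ∀ k i, Ev.cusp k i ∈ number t W → lineMat E wt y i k (k + 1) = 1) ∧
    (Entries ((number t W).map (Ev.map wt)) (lineMat E wt y t) ↔
      ∀ k i, (Ev.row k i ∈ number t W ∨ Ev.col k i ∈ number t W) → lineMat E wt y i k (k + 1) = 0) := by
  induction W generalizing t w with
  | nil => simp [number, run, Pivots, Entries]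
  | cons g W ih =>
    have hE' : E.drop (t + g.events.length) = events W ++ E' := by
      rw [← List.drop_drop, hE, events_cons, List.append_assoc, List.drop_left]
    have h0 : ∀ m, E[t + m]? = (g.events ++ (events W ++ E'))[m]? := by
      intro m
      rw [← List.getElem?_drop, hE, events_cons, List.append_assoc]
    have h1 := h0 0
    have h2 := h0 1
    have h3 := hW.1
    obtain ⟨ih1, ih2, ih3⟩ := ih hE' hW.2 (fun k i h => hc k i (List.mem_cons_of_mem _ h))
    have hstep : lineMat E wt y (t + g.events.length) =
        (g.map fun _ => wt t).matStep (lineMat E wt y t) := by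
      cases g with
      | cusp k a =>
        have hw : wt t = 0 := hc k t (List.mem_cons_self ..)
        simp only [Ev.events, add_zero, List.cons_append, List.nil_append, List.getElem?_cons_zero,
          List.getElem?_cons_succ] at h1 h2
        rw [Ev.events, show t + [Event.cross false k.toNat, Event.cap k.toNat].length = t + 1 + 1 from rfl,
          lineMat_succ_cap h2, lineMat_succ_cross h1, hw, Int.toNat_of_nonneg h3.1,
          capStep_crossStep_zero (lineMat_strictUpper _ _ _ _)]
        rfl
      | cup k a =>
        simp only [Ev.events, add_zero, List.cons_append, List.nil_append, List.getElem?_cons_zero] at h1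
        rw [Ev.events, show t + [Event.cup k.toNat].length = t + 1 from rfl, lineMat_succ_cup h1,
          Int.toNat_of_nonneg h3.1]
        rfl
      | row k a | col k a =>
        simp only [Ev.events, add_zero, List.cons_append, List.nil_append, List.getElem?_cons_zero] at h1
        rw [Ev.events, show t + [Event.cross false k.toNat].length = t + 1 from rfl,
          lineMat_succ_cross h1, Int.toNat_of_nonneg h3.1]
        rfl
    have hmap : (number t (g :: W)).map (Ev.map wt) =
        (g.map fun _ => wt t) :: (number (t + g.events.length) W).map (Ev.map wt) := by
      simp [number, Ev.map_map, Function.comp_def]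
    rw [hmap]
    refine ⟨?_, ?_, ?_⟩
    · rw [events_cons, List.length_append, ← add_assoc, ih1, hstep]; rfl
    · rw [Pivots, ← hstep, ih2]
      cases g with
      | cusp k a =>
        simp only [number, Ev.map, Ev.Pivot, List.mem_cons, Ev.cusp.injEq, or_imp, forall_and, and_imp,
          forall_eq_apply_imp_iff]
        exact and_congr_left fun _ => ⟨fun h k' hk => by rw [hk]; exact h, fun h => h _ rfl⟩
      | _ => simp [number, Ev.map, Ev.Pivot]
    · rw [Entries, ← hstep, ih3]
      cases g with
      | row k a | col k a =>
        simp only [number, Ev.map, Ev.Entry, List.mem_cons, Ev.row.injEq, Ev.col.injEq, reduceCtorEq, false_or]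
        constructor
        · rintro ⟨a, b⟩ k' i h
          by_cases h' : k' = k ∧ i = t
          · rw [h'.1, h'.2]; exact a
          · exact b _ _ (by tauto)
        · intro h
          exact ⟨h _ _ (by simp), fun k' i hi => h _ _ (by tauto)⟩
      | _ => simp [number, Ev.map, Ev.Entry]

end Word
end SolidTorus

namespace SolidTorus

/-! ### Closures of tangles -/

namespace Ev
variable {α : Type*}

/-- The singularity of a front. -/
def toFront : Ev α → FrontEvent
  | row k _ => .cross k.toNat
  | col k _ => .cross k.toNat
  | cup k _ => .lcusp k.toNat
  | cusp k _ => .rcusp k.toNat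

theorem resolve_toFront (e : Ev α) : e.toFront.resolve = e.events := by cases e <;> rfl

end Ev

namespace Word
variable {α : Type*}

/-- The resolved diagram of the closure of a tangle with two strands at either end. -/
def closure (W : Word α) : Diagram := resolution 2 (W.map Ev.toFront)

theorem closure_events (W : Word α) :
    W.closure.events = events W ++ [.cross false 0, .cross true 0] := by
  have h1 : (W.map Ev.toFront).flatMap FrontEvent.resolve = events W := by
    rw [List.flatMap_map]
    exact List.flatMap_congr fun e _ => e.resolve_toFront
  have h2 : transition 2 = [.cross false 0, .cross true 0] := rfl
  rw [closure, resolution, h1, h2]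

theorem drop_closure (W : Word α) :
    W.closure.events.drop 0 = events W ++ [.cross false 0, .cross true 0] := W.closure_events

end Word

/-- The number of strands on each vertical line, for two strands on the line `0`. -/
def widths (E : List Event) : ℕ → ℕ
  | 0 => 2
  | t + 1 => match E[t]? with
    | some (.cup _) => widths E t + 2
    | some (.cap _) => widths E t - 2
    | _ => widths E t

open Diagram in
/-- Along the events of a word that is possible on the first line, every event is possible between
the lines next to it. -/
theorem Word.widths_fits {α : Type*} {E E' : List Event} {t : ℕ} {W : Word α}
    (hE : E.drop t = Word.events W ++ E') {w : ℤ} (hw : w = widths E t) (hW : Word.InRange w W) :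
    (∀ e, t ≤ e → e < t + (Word.events W).length → ∀ A, E[e]? = some A →
      Event.Fits A (widths E e) (widths E (e + 1))) ∧
    (widths E (t + (Word.events W).length) : ℤ) = w + Word.gain W := by
  induction W generalizing t w with
  | nil => exact ⟨fun e h1 h2 => by simp at h2; omega, by simp [Word.gain, hw]⟩
  | cons g W ih =>
    have hE' : E.drop (t + g.events.length) = Word.events W ++ E' := by
      rw [← List.drop_drop, hE, Word.events_cons, List.append_assoc, List.drop_left]
    have h0 : ∀ m, E[t + m]? = (g.events ++ (Word.events W ++ E'))[m]? := by
      intro m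
      rw [← List.getElem?_drop, hE, Word.events_cons, List.append_assoc]
    have h1 := h0 0
    have h2 := h0 1
    have h3 := hW.1
    have hstep : (widths E (t + g.events.length) : ℤ) = w + g.gain ∧
        ∀ e, t ≤ e → e < t + g.events.length → ∀ A, E[e]? = some A →
          Event.Fits A (widths E e) (widths E (e + 1)) := by
      cases g with
      | cusp k a =>
        simp only [Ev.events, add_zero, List.cons_append, List.nil_append, List.getElem?_cons_zero,
          List.getElem?_cons_succ] at h1 h2
        simp only [Ev.InRange] at h3
        have w1 : widths E (t + 1) = widths E t := by rw [widths, h1]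
        have w2 : widths E (t + 1 + 1) = widths E t - 2 := by rw [widths, h2, w1]
        refine ⟨?_, ?_⟩
        · rw [Ev.events, show t + [Event.cross false k.toNat, Event.cap k.toNat].length = t + 1 + 1 from rfl,
            w2, Ev.gain]; omega
        · intro e he he' A hA
          simp only [Ev.events, List.length_cons, List.length_nil] at he'
          obtain rfl | rfl : e = t ∨ e = t + 1 := by omega
          · rw [h1] at hA
            obtain rfl := Option.some.inj hA
            exact ⟨by omega, w1⟩
          · rw [h2] at hA
            obtain rfl := Option.some.inj hA
            exact ⟨by omega, by omega⟩
      | cup k a =>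
        simp only [Ev.events, add_zero, List.cons_append, List.nil_append, List.getElem?_cons_zero] at h1
        simp only [Ev.InRange] at h3
        have w1 : widths E (t + 1) = widths E t + 2 := by rw [widths, h1]
        refine ⟨?_, ?_⟩
        · rw [Ev.events, show t + [Event.cup k.toNat].length = t + 1 from rfl,
            w1, Ev.gain]; omega
        · intro e he he' A hA
          simp only [Ev.events, List.length_cons, List.length_nil] at he'
          obtain rfl : e = t := by omega
          rw [h1] at hA
          obtain rfl := Option.some.inj hA
          exact ⟨by omega, w1⟩
      | row k a | col k a =>
        simp only [Ev.events, add_zero, List.cons_append, List.nil_append, List.getElem?_cons_zero] at h1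
        simp only [Ev.InRange] at h3
        have w1 : widths E (t + 1) = widths E t := by rw [widths, h1]
        refine ⟨?_, ?_⟩
        · rw [Ev.events, show t + [Event.cross false k.toNat].length = t + 1 from rfl,
            w1, Ev.gain]; omega
        · intro e he he' A hA
          simp only [Ev.events, List.length_cons, List.length_nil] at he'
          obtain rfl : e = t := by omega
          rw [h1] at hA
          obtain rfl := Option.some.inj hA
          exact ⟨by omega, w1⟩
    obtain ⟨i1, i2⟩ := ih hE' hstep.1.symm hW.2
    rw [Word.events_cons, List.length_append, ← add_assoc]
    refine ⟨fun e h4 h5 => ?_, by rw [i2, Word.gain_cons, add_assoc]⟩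
    by_cases h : e < t + g.events.length
    · exact hstep.2 e h4 h
    · exact i1 e (by omega) h5

open Diagram in
theorem Word.resolved {α : Type*} {W : Word α} (hW : Word.InRange 2 W) (hg : Word.gain W = 0) :
    W.closure.Resolved (Word.events W).length (widths W.closure.events) := by
  have hE := W.drop_closure
  have hE' := W.closure_events
  set n := (Word.events W).length with hn
  have hlen : W.closure.events.length = n + 2 := by rw [hE']; simp [hn]
  have h0 : W.closure.events[n]? = some (.cross false 0) := by
    rw [hE', List.getElem?_append_right (by omega)]; simp [hn]
  have h1 : W.closure.events[n + 1]? = some (.cross true 0) := by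
    rw [hE', List.getElem?_append_right (by omega)]; simp [hn]
  obtain ⟨f1, f2⟩ := Word.widths_fits hE rfl hW
  rw [zero_add, ← hn] at f1 f2
  have f3 : widths W.closure.events n = 2 := by
    rw [hg] at f2; simp only [widths, add_zero] at f2; omega
  have f4 : widths W.closure.events (n + 1) = 2 := by rw [widths, h0, f3]
  have ht : ∀ e A, W.closure.events[e]? = some A → e < n + 2 := by
    intro e A h
    rw [← hlen]; exact (List.getElem?_eq_some_iff.1 h).1
  refine ⟨hlen, h0, h1, ?_, ?_, ?_, rfl, f3⟩
  · intro e he b k h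
    exact ((Word.exists_of_cross hE hW (Nat.zero_le e) (by omega)).1 b k h).1
  · intro e k h
    have he := ht _ _ h
    by_cases h2 : e < n
    · obtain ⟨i, rfl, hi⟩ := (Word.exists_of_cross hE hW (Nat.zero_le e) (by omega)).2 k h
      have := (Word.number_spec hE hW hi).2.2.1
      exact ⟨i, rfl, by simpa using this⟩
    · obtain rfl | rfl : e = n ∨ e = n + 1 := by omega
      · rw [h0] at h; simp at h
      · rw [h1] at h; simp at h
  · intro e A h
    have he := ht _ _ h
    by_cases h2 : e < n
    · rw [lineAfter, hlen, Nat.mod_eq_of_lt (by omega)]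
      exact f1 e (Nat.zero_le e) h2 A h
    · obtain rfl | rfl : e = n ∨ e = n + 1 := by omega
      · rw [lineAfter, hlen, Nat.mod_eq_of_lt (by omega), f3, f4]
        rw [h0] at h
        obtain rfl := Option.some.inj h
        exact ⟨by omega, rfl⟩
      · rw [lineAfter, hlen, Nat.mod_self, f4]
        rw [h1] at h
        obtain rfl := Option.some.inj h
        exact ⟨by omega, rfl⟩

/-! ### Labels of strands along a word -/

section Labels
variable {X : Type*} (σ : Equiv.Perm X)

/-- The labels `l` and `l'` of the strands on the lines next to the event are compatible: a label is
carried along a strand, and changes by `σ` on the way from the lower to the upper strand at a left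
cusp, and from the upper to the lower one in the resolution of a right cusp, where these have
already crossed. -/
def Event.LabelStep : Event → (ℤ → X) → (ℤ → X) → Prop
  | .cross _ k, l, l' => ∀ i, l' i = l (swapZ k i)
  | .cup k, l, l' => (∀ i, l' (shiftZ k i) = l i) ∧ l' (k + 1) = σ (l' k)
  | .cap k, l, l' => (∀ i, l' i = l (shiftZ k i)) ∧ l k = σ (l (k + 1))

/-- The row crossings of a word: the lower of the two strands, and the datum carried. -/
def Word.rows {α : Type*} (W : Word α) : List (ℤ × α) :=
  W.filterMap fun e => match e with
    | .row k a => some (k, a)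
    | _ => none

variable {σ}

/-- Compatible labels on the lines along the events of a word, regarded as a labeling of the word.
-/
theorem Word.exists_labels {α : Type*} {E E' : List Event} {t : ℕ} {W : Word α}
    (hE : E.drop t = Word.events W ++ E') {w : ℤ} (hW : Word.InRange w W) (lab : ℕ → ℤ → X)
    (hlab : ∀ e, t ≤ e → e < t + (Word.events W).length → ∀ A, E[e]? = some A →
      A.LabelStep σ (lab e) (lab (e + 1))) :
    ∃ W' : Word X, W'.erase = W.erase ∧ W'.LabOk σ (lab t) ∧
      W'.labRun σ (lab t) = lab (t + (Word.events W).length) ∧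
      W'.labRec σ (lab t) = (Word.rows (Word.number t W)).map (fun r => (lab r.2 r.1, lab r.2 (r.1 + 1))) ∧
      (W'.ColEq σ (lab t) → ∀ k i, Ev.col k i ∈ Word.number t W → lab i k = lab i (k + 1)) := by
  induction W generalizing t w with
  | nil => exact ⟨[], rfl, trivial, rfl, rfl, fun _ k i h => absurd h (by simp [Word.number])⟩
  | cons g W ih =>
    have hE' : E.drop (t + g.events.length) = Word.events W ++ E' := by
      rw [← List.drop_drop, hE, Word.events_cons, List.append_assoc, List.drop_left]
    have h0 : ∀ m, E[t + m]? = (g.events ++ (Word.events W ++ E'))[m]? := by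
      intro m
      rw [← List.getElem?_drop, hE, Word.events_cons, List.append_assoc]
    have h1 := h0 0
    have h2 := h0 1
    have h3 := hW.1
    rw [Word.events_cons, List.length_append] at hlab ⊢
    obtain ⟨W', a1, a2, a3, a4, a5⟩ := ih hE' hW.2 (fun e h h' => hlab e (by omega) (by omega))
    rw [← add_assoc, ← a3]
    have herase : ∀ (g' : Ev X), g'.map (fun _ => ()) = g.map (fun _ => ()) →
        Word.erase (g' :: W') = Word.erase (g :: W) := by
      intro g' hg
      simp only [Word.erase] at a1 ⊢
      rw [List.map_cons, List.map_cons, hg, a1]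
    cases g with
    | cusp k a =>
      simp only [Ev.events, add_zero, List.cons_append, List.nil_append, List.getElem?_cons_zero,
        List.getElem?_cons_succ] at h1 h2
      have s1 := hlab t le_rfl (by simp [Ev.events]) _ h1
      have s2 := hlab (t + 1) (by omega) (by simp [Ev.events]; omega) _ h2
      have hk := Int.toNat_of_nonneg h3.1
      simp only [Event.LabelStep, hk] at s1 s2
      have hst : (Ev.cusp k (lab t k)).labStep σ (lab t) = lab (t + 1 + 1) := by
        funext i
        rw [s2.1, s1]
        simp only [Ev.labStep]
        congr 1; unfold swapZ shiftZ; split_ifs <;> omega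
      have hlen : t + (Ev.cusp k a).events.length = t + 1 + 1 := rfl
      rw [hlen] at a2 a4 a5 ⊢
      refine ⟨.cusp k (lab t k) :: W', herase _ rfl, ⟨?_, ?_⟩, ?_, ?_, ?_⟩
      · have := s2.2
        rw [s1, s1] at this
        simpa [swapZ, Ev.LabOk] using this
      · rw [hst]; exact a2
      · rw [Word.labRun, hst]
      · rw [Word.labRec, hst, a4]; rfl
      · rintro ⟨-, h⟩
        rw [hst] at h
        intro k' i hi
        refine a5 h k' i ?_
        simpa [Word.number, Ev.map, Ev.events] using hi
    | cup k a =>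
      simp only [Ev.events, add_zero, List.cons_append, List.nil_append, List.getElem?_cons_zero] at h1
      have s1 := hlab t le_rfl (by simp [Ev.events]) _ h1
      have hk := Int.toNat_of_nonneg h3.1
      simp only [Event.LabelStep, hk] at s1
      have hst : (Ev.cup k (lab (t + 1) k)).labStep σ (lab t) = lab (t + 1) := by
        funext i
        simp only [Ev.labStep]
        split_ifs with h h'
        · rw [h]
        · rw [h', s1.2]
        · rw [← s1.1]
          congr 1; unfold unshiftZ shiftZ; split_ifs <;> omega
      have hlen : t + (Ev.cup k a).events.length = t + 1 := rfl
      rw [hlen] at a2 a4 a5 ⊢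
      refine ⟨.cup k (lab (t + 1) k) :: W', herase _ rfl, ⟨trivial, ?_⟩, ?_, ?_, ?_⟩
      · rw [hst]; exact a2
      · rw [Word.labRun, hst]
      · rw [Word.labRec, hst, a4]; rfl
      · rintro ⟨-, h⟩
        rw [hst] at h
        intro k' i hi
        refine a5 h k' i ?_
        simpa [Word.number, Ev.map, Ev.events] using hi
    | row k a =>
      simp only [Ev.events, add_zero, List.cons_append, List.nil_append, List.getElem?_cons_zero] at h1
      have s1 := hlab t le_rfl (by simp [Ev.events]) _ h1
      have hk := Int.toNat_of_nonneg h3.1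
      simp only [Event.LabelStep, hk] at s1
      have hst : (Ev.row k (lab t k)).labStep σ (lab t) = lab (t + 1) := by
        funext i; rw [s1]; rfl
      have hlen : t + (Ev.row k a).events.length = t + 1 := rfl
      rw [hlen] at a2 a4 a5 ⊢
      refine ⟨.row k (lab t k) :: W', herase _ rfl, ⟨trivial, ?_⟩, ?_, ?_, ?_⟩
      · rw [hst]; exact a2
      · rw [Word.labRun, hst]
      · rw [Word.labRec, hst, a4]; rfl
      · rintro ⟨-, h⟩
        rw [hst] at h
        intro k' i hi
        refine a5 h k' i ?_
        simpa [Word.number, Ev.map, Ev.events] using hi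
    | col k a =>
      simp only [Ev.events, add_zero, List.cons_append, List.nil_append, List.getElem?_cons_zero] at h1
      have s1 := hlab t le_rfl (by simp [Ev.events]) _ h1
      have hk := Int.toNat_of_nonneg h3.1
      simp only [Event.LabelStep, hk] at s1
      have hst : (Ev.col k (lab t k)).labStep σ (lab t) = lab (t + 1) := by
        funext i; rw [s1]; rfl
      have hlen : t + (Ev.col k a).events.length = t + 1 := rfl
      rw [hlen] at a2 a4 a5 ⊢
      refine ⟨.col k (lab t k) :: W', herase _ rfl, ⟨trivial, ?_⟩, ?_, ?_, ?_⟩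
      · rw [hst]; exact a2
      · rw [Word.labRun, hst]
      · rw [Word.labRec, hst, a4]; rfl
      · rintro ⟨hc, h⟩
        rw [hst] at h
        intro k' i hi
        simp only [Word.number, Ev.map, Ev.events, List.mem_cons, Ev.col.injEq] at hi
        rcases hi with ⟨rfl, rfl⟩ | hi
        · exact hc
        · exact a5 h k' i hi

/-- A labeling of a word gives compatible labels on the lines along its events. -/
theorem Word.exists_lines {E E' : List Event} {t : ℕ} {W' : Word X}
    (hE : E.drop t = Word.events W' ++ E') {w : ℤ} (hW : Word.InRange w W') (l : ℤ → X)
    (hok : W'.LabOk σ l) :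
    ∃ lab : ℕ → ℤ → X, lab t = l ∧ lab (t + (Word.events W').length) = W'.labRun σ l ∧
      ∀ e, t ≤ e → e < t + (Word.events W').length → ∀ A, E[e]? = some A →
        A.LabelStep σ (lab e) (lab (e + 1)) := by
  induction W' generalizing t w l with
  | nil => exact ⟨fun _ => l, rfl, rfl, fun e h h' => by simp at h'; omega⟩
  | cons g W ih =>
    have hE' : E.drop (t + g.events.length) = Word.events W ++ E' := by
      rw [← List.drop_drop, hE, Word.events_cons, List.append_assoc, List.drop_left]
    have h0 : ∀ m, E[t + m]? = (g.events ++ (Word.events W ++ E'))[m]? := by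
      intro m
      rw [← List.getElem?_drop, hE, Word.events_cons, List.append_assoc]
    have h1 := h0 0
    have h2 := h0 1
    have h3 := hW.1
    rw [Word.events_cons, List.length_append, ← add_assoc]
    obtain ⟨lab, a1, a2, a3⟩ := ih hE' hW.2 _ hok.2
    have hpos := Word.length_events_pos g
    have hsingle : g.events.length = 1 → (∀ A, E[t]? = some A → A.LabelStep σ l (g.labStep σ l)) →
        ∃ lab : ℕ → ℤ → X, lab t = l ∧
          lab (t + g.events.length + (Word.events W).length) = Word.labRun σ (g :: W) l ∧
          ∀ e, t ≤ e → e < t + g.events.length + (Word.events W).length → ∀ A, E[e]? = some A →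
            A.LabelStep σ (lab e) (lab (e + 1)) := by
      intro hl hs
      refine ⟨fun e => if e = t then l else lab e, if_pos rfl, ?_, ?_⟩
      · simp only [if_neg (show ¬ t + g.events.length + (Word.events W).length = t by omega)]
        rw [a2]; rfl
      · intro e he he' A hA
        by_cases h : e = t
        · subst h
          simp only [if_true, if_neg (show ¬ e + 1 = e by omega)]
          rw [show e + 1 = e + g.events.length by omega, a1]
          exact hs A hA
        · simp only [if_neg h, if_neg (show ¬ e + 1 = t by omega)]
          exact a3 e (by omega) (by omega) A hA
    cases g with
    | cusp k a =>
      simp only [Ev.events, add_zero, List.cons_append, List.nil_append, List.getElem?_cons_zero,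
        List.getElem?_cons_succ] at h1 h2
      have hk := Int.toNat_of_nonneg h3.1
      have hlen : t + (Ev.cusp k a).events.length = t + 1 + 1 := rfl
      rw [hlen] at a1 a2 a3 ⊢
      refine ⟨fun e => if e = t then l else if e = t + 1 then fun i => l (swapZ k i) else lab e,
        if_pos rfl, ?_, ?_⟩
      · simp only [if_neg (show ¬ t + 1 + 1 + (Word.events W).length = t by omega),
          if_neg (show ¬ t + 1 + 1 + (Word.events W).length = t + 1 by omega)]
        rw [a2]; rfl
      · intro e he he' A hA
        by_cases h : e = t
        · subst h
          simp only [if_true, if_neg (show ¬ e + 1 = e by omega)]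
          rw [h1] at hA
          obtain rfl := Option.some.inj hA
          intro i; simp only [hk]
        by_cases h' : e = t + 1
        · subst h'
          simp only [if_true, if_neg h, if_neg (show ¬ t + 1 + 1 = t by omega),
            if_neg (show ¬ t + 1 + 1 = t + 1 by omega)]
          rw [h2] at hA
          obtain rfl := Option.some.inj hA
          refine ⟨fun i => ?_, ?_⟩
          · rw [a1, hk]
            simp only [Ev.labStep]
            congr 1; unfold swapZ shiftZ; split_ifs <;> omega
          · have := hok.1
            simp only [Ev.LabOk] at this
            rw [hk]
            simpa [swapZ] using this
        · simp only [if_neg h, if_neg h', if_neg (show ¬ e + 1 = t by omega),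
            if_neg (show ¬ e + 1 = t + 1 by omega)]
          exact a3 e (by omega) (by omega) A hA
    | cup k a =>
      refine hsingle rfl ?_
      simp only [Ev.events, add_zero, List.cons_append, List.nil_append, List.getElem?_cons_zero] at h1
      intro A hA
      rw [h1] at hA
      obtain rfl := Option.some.inj hA
      simp only [Event.LabelStep, Int.toNat_of_nonneg h3.1, Ev.labStep]
      refine ⟨fun i => ?_, by simp⟩
      rw [if_neg (by unfold shiftZ; split_ifs <;> omega), if_neg (by unfold shiftZ; split_ifs <;> omega)]
      congr 1; unfold unshiftZ shiftZ; split_ifs <;> omega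
    | row k a | col k a =>
      refine hsingle rfl ?_
      simp only [Ev.events, add_zero, List.cons_append, List.nil_append, List.getElem?_cons_zero] at h1
      intro A hA
      rw [h1] at hA
      obtain rfl := Option.some.inj hA
      intro i
      rw [Int.toNat_of_nonneg h3.1]; rfl

end Labels

end SolidTorus

namespace SolidTorus

/-! ### Words of rational tangles -/

namespace Word

/-- The word of a row of `a` crossings. -/
def horizontalWord (a : ℕ) : Word Unit := List.replicate a (.row 0 ())

/-- The word of `vertical v T`. -/
def verticalWord (v : ℕ) (T : Word Unit) : Word Unit :=
  List.replicate v (.cup 1 ()) ++ (List.range v).map (fun i => .col (2 * i) ()) ++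
    Word.raise (2 * v) T ++ List.replicate v (.cusp 1 ())

/-- The word of `addLevel v a p T`. -/
def addLevelWord (v a p : ℕ) (T : Word Unit) : Word Unit :=
  horizontalWord p ++ (Word.reflect 2)^[p] (verticalWord v T) ++ horizontalWord (a - p)

/-- The word of `tangleFrom a v p i l`. -/
def tangleWord (a v p : ℕ → ℕ) : (i l : ℕ) → Word Unit
  | i, 0 => horizontalWord (a i)
  | i, l + 1 => addLevelWord (v i) (a i) (p i) (tangleWord a v p (i + 1) l)

/-! ### Isotopies of columns of crossings -/

theorem slide_append {V V' : Word Unit} (h : Slide V V') (P Q : Word Unit) :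
    Slide (P ++ (V ++ Q)) (P ++ (V' ++ Q)) := by
  cases h with
  | colCup P' Q' => simpa using Slide.colCup (P ++ P') (Q' ++ Q)
  | cupCup P' Q' => simpa using Slide.cupCup (P ++ P') (Q' ++ Q)
  | cuspCusp P' Q' => simpa using Slide.cuspCusp (P ++ P') (Q' ++ Q)

theorem slides_append {V V' : Word Unit} (h : Relation.ReflTransGen Slide V V') (P Q : Word Unit) :
    Relation.ReflTransGen Slide (P ++ (V ++ Q)) (P ++ (V' ++ Q)) := by
  induction h with
  | refl => exact .refl
  | tail _ h ih => exact ih.tail (slide_append h P Q)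

theorem slides_col_cups (v : ℕ) : Relation.ReflTransGen Slide
    (.col 0 () :: List.replicate v (.cup 3 ())) (List.replicate v (.cup 3 ()) ++ [.col 0 ()]) := by
  induction v with
  | zero => exact .refl
  | succ v ih =>
    have h1 : Slide (.col 0 () :: List.replicate (v + 1) (.cup 3 ()))
        (.cup 3 () :: .col 0 () :: List.replicate v (.cup 3 ())) := Slide.colCup [] _
    have h2 := slides_append ih [.cup 3 ()] []
    simp only [List.append_nil] at h2
    exact (Relation.ReflTransGen.single h1).trans h2

theorem slides_cups (v : ℕ) : Relation.ReflTransGen Slide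
    (.cup 1 () :: List.replicate v (.cup 3 ())) (List.replicate (v + 1) (.cup 1 ())) := by
  induction v with
  | zero => exact .refl
  | succ v ih =>
    have h1 : Slide (.cup 1 () :: List.replicate (v + 1) (.cup 3 ()))
        (.cup 1 () :: .cup 1 () :: List.replicate v (.cup 3 ())) := Slide.cupCup [] _
    have h2 := slides_append ih [.cup 1 ()] []
    simp only [List.append_nil] at h2
    exact (Relation.ReflTransGen.single h1).trans h2

theorem slides_cusps (v : ℕ) : Relation.ReflTransGen Slide
    (List.replicate v (.cusp 3 ()) ++ [.cusp 1 ()]) (List.replicate (v + 1) (.cusp 1 ())) := by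
  induction v with
  | zero => exact .refl
  | succ v ih =>
    have h1 : Slide (List.replicate (v + 1) (.cusp 3 ()) ++ [.cusp 1 ()])
        (List.replicate v (.cusp 3 ()) ++ [.cusp 1 (), .cusp 1 ()]) := by
      have := Slide.cuspCusp (List.replicate v (.cusp 3 ())) []
      rw [List.replicate_succ']
      simpa using this
    have h2 := slides_append ih [] [.cusp 1 ()]
    rw [← List.replicate_succ'] at h2
    refine (Relation.ReflTransGen.single h1).trans ?_
    simpa using h2

/-- Up to planar isotopy, the column of `v + 1` crossings below `T` is a single crossing below the
tangle that has `v` crossings below `T`. -/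
theorem slides_vertical (v : ℕ) (T : Word Unit) :
    Relation.ReflTransGen Slide (vertSum (verticalWord v T)) (verticalWord (v + 1) T) := by
  have e1 : vertSum (verticalWord v T) = (.cup 1 () :: .col 0 () :: List.replicate v (.cup 3 ())) ++
      ((List.range v).map (fun i : ℕ => Ev.col (2 * (i + 1 : ℕ) : ℤ) ()) ++
        Word.raise (2 * (v + 1 : ℕ)) T ++ (List.replicate v (.cusp 3 ()) ++ [.cusp 1 ()])) := by
    rw [vertSum, verticalWord]
    have a1 : Word.raise 2 (List.replicate v (.cup 1 ())) = List.replicate v (.cup 3 ()) := by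
      simp [Word.raise, Ev.raise]
    have a2 : Word.raise 2 (List.replicate v (.cusp 1 ())) = List.replicate v (.cusp 3 ()) := by
      simp [Word.raise, Ev.raise]
    have a3 : Word.raise 2 ((List.range v).map (fun i : ℕ => Ev.col (2 * (i : ℤ)) ())) =
        (List.range v).map (fun i : ℕ => Ev.col (2 * (i + 1 : ℕ) : ℤ) ()) := by
      simp only [Word.raise, List.map_map]
      refine List.map_congr_left fun i _ => ?_
      simp only [Function.comp_apply, Ev.raise]
      congr 1
    have a4 : Word.raise 2 (Word.raise (2 * v) T) = Word.raise (2 * (v + 1 : ℕ)) T := by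
      rw [raise_raise]; congr 1
    have a5 : ∀ A B : Word Unit, Word.raise 2 (A ++ B) = Word.raise 2 A ++ Word.raise 2 B :=
      fun A B => List.map_append
    simp only [a5, a1, a2, a3, a4, List.cons_append, List.append_assoc]
  have e2 : verticalWord (v + 1) T = List.replicate (v + 1) (.cup 1 ()) ++ ([.col 0 ()] ++
      ((List.range v).map (fun i : ℕ => Ev.col (2 * (i + 1 : ℕ) : ℤ) ()) ++
        Word.raise (2 * (v + 1 : ℕ)) T)) ++ List.replicate (v + 1) (.cusp 1 ()) := by
    rw [verticalWord, List.range_succ_eq_map, List.map_cons, List.map_map]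
    simp [Function.comp_def]
  rw [e1, e2]
  set Q := (List.range v).map (fun i : ℕ => Ev.col (2 * (i + 1 : ℕ) : ℤ) ()) ++
        Word.raise (2 * (v + 1 : ℕ)) T
  have s1 := slides_append (slides_col_cups v) [.cup 1 ()] (Q ++ (List.replicate v (.cusp 3 ()) ++ [.cusp 1 ()]))
  have s2 := slides_append (slides_cups v) [] ([.col 0 ()] ++ (Q ++ (List.replicate v (.cusp 3 ()) ++ [.cusp 1 ()])))
  have s3 := slides_append (slides_cusps v) (List.replicate (v + 1) (.cup 1 ()) ++ ([.col 0 ()] ++ Q)) []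
  simp only [List.append_assoc, List.cons_append, List.nil_append, List.append_nil] at s1 s2 s3 ⊢
  exact (s1.trans s2).trans s3

end Word

theorem Tang.slides {p : Bool} {W W' : Word Unit} (h : Tang p W) (hs : Relation.ReflTransGen Slide W W') :
    Tang p W' := by
  induction hs with
  | refl => exact h
  | tail _ hs ih => exact ih.slide hs

theorem Tang.vertical {T : Word Unit} (h : Tang false T) (v : ℕ) : Tang false (Word.verticalWord v T) := by
  induction v with
  | zero => simpa [Word.verticalWord, Word.raise_zero] using h
  | succ v ih => exact (Tang.vert ih).slides (Word.slides_vertical v T)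

theorem Tang.horizontal (a : ℕ) : Tang (decide (a % 2 = 1)) (Word.horizontalWord a) := by
  induction a with
  | zero => exact .nil
  | succ a ih =>
    have h := Tang.append Tang.row ih
    have e : (xor true (decide (a % 2 = 1))) = decide ((a + 1) % 2 = 1) := by
      rw [Bool.true_xor, ← decide_not]
      congr 1
      exact propext (by omega)
    rwa [e] at h

theorem Tang.iterate_reflect {T : Word Unit} {q : Bool} (h : Tang q T) (p : ℕ) :
    Tang q ((Word.reflect 2)^[p] T) := by
  induction p with
  | zero => exact h
  | succ p ih => rw [Function.iterate_succ_apply']; exact ih.reflect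

theorem Tang.addLevel {T : Word Unit} (h : Tang false T) (v a p : ℕ) (hp : p ≤ a) :
    Tang (decide (a % 2 = 1)) (Word.addLevelWord v a p T) := by
  have h2 := ((Tang.horizontal p).append ((h.vertical v).iterate_reflect p)).append (Tang.horizontal (a - p))
  have e : (xor (xor (decide (p % 2 = 1)) false) (decide ((a - p) % 2 = 1))) = decide (a % 2 = 1) := by
    rw [Bool.xor_false]
    rcases Nat.mod_two_eq_zero_or_one p with h | h <;>
      rcases Nat.mod_two_eq_zero_or_one (a - p) with h' | h' <;>
      simp only [h, h'] <;> simp <;> omega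
  rwa [e] at h2

/-- A rational tangle is built by the moves of `Tang`. The even entries above the last level are
what the vertical sums need. -/
theorem tang_tangleWord {a v p : ℕ → ℕ} {i l : ℕ} (ha : ∀ j, i < j → j ≤ i + l → a j % 2 = 0)
    (hp : ∀ j, i ≤ j → j < i + l → p j ≤ a j) :
    Tang (decide (a i % 2 = 1)) (Word.tangleWord a v p i l) := by
  induction l generalizing i with
  | zero => exact Tang.horizontal _
  | succ l ih =>
    have h1 := ih (i := i + 1) (fun j h h' => ha j (by omega) (by omega)) (fun j h h' => hp j (by omega) (by omega))
    rw [ha (i + 1) (by omega) (by omega)] at h1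
    exact Tang.addLevel h1 _ _ _ (hp i le_rfl (by omega))

namespace Word
variable {α : Type*}

theorem gain_verticalWord (v : ℕ) {T : Word Unit} (h : gain T = 0) : gain (verticalWord v T) = 0 := by
  have h1 : gain ((List.range v).map (fun i : ℕ => Ev.col (2 * (i : ℤ)) ())) = 0 := by
    simp [gain, Function.comp_def, Ev.gain]
  simp only [verticalWord, gain_append, gain_raise, h, h1]
  simp [gain, Ev.gain]

theorem inRange_replicate {w : ℤ} {e : Ev α} (h : ∀ j : ℕ, e.InRange (w + j * e.gain)) (v : ℕ) :
    InRange w (List.replicate v e) := by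
  induction v generalizing w with
  | zero => trivial
  | succ v ih =>
    refine ⟨by simpa using h 0, ih fun j => ?_⟩
    have := h (j + 1)
    push_cast at this
    rwa [add_mul, one_mul, add_comm ((j : ℤ) * _), ← add_assoc] at this

theorem inRange_columns (v : ℕ) {w : ℤ} (h : 2 * v ≤ w) :
    InRange w ((List.range v).map (fun i : ℕ => Ev.col (2 * (i : ℤ)) ())) := by
  induction v with
  | zero => trivial
  | succ v ih =>
    have hg : gain ((List.range v).map (fun i : ℕ => Ev.col (2 * (i : ℤ)) ())) = 0 := by
      simp [gain, Function.comp_def, Ev.gain]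
    rw [List.range_succ, List.map_append, inRange_append, hg]
    push_cast at h
    refine ⟨ih (by omega), ⟨?_, trivial⟩⟩
    simp only [Ev.InRange]
    omega

theorem inRange_verticalWord (v : ℕ) {T : Word Unit} (h : InRange 2 T) (hg : gain T = 0) :
    InRange 2 (verticalWord v T) := by
  have h1 : gain ((List.range v).map (fun i : ℕ => Ev.col (2 * (i : ℤ)) ())) = 0 := by
    simp [gain, Function.comp_def, Ev.gain]
  have h2 : gain (List.replicate v (Ev.cup 1 ())) = 2 * (v : ℤ) := by
    simp [gain, Ev.gain, mul_comm]
  have h3 : InRange (2 + 2 * (v : ℤ)) (List.replicate v (Ev.cusp 1 ())) := by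
    clear h1 h2
    induction v with
    | zero => trivial
    | succ v ih =>
      refine ⟨?_, ?_⟩
      · show (0 : ℤ) ≤ 1 ∧ (1 : ℤ) + 2 ≤ _
        omega
      · simp only [Ev.gain]
        convert ih using 1
        push_cast; ring
  simp only [verticalWord, inRange_append, gain_append, gain_raise, hg, h1, h2, add_zero]
  refine ⟨⟨⟨inRange_replicate (fun j => ?_) v, inRange_columns v (by omega)⟩,
    inRange_raise (by omega) h⟩, h3⟩
  simp only [Ev.InRange, Ev.gain]; omega

theorem gain_horizontalWord (a : ℕ) : gain (horizontalWord a) = 0 := by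
  simp [horizontalWord, gain, Ev.gain]

theorem inRange_horizontalWord (a : ℕ) : InRange 2 (horizontalWord a) :=
  inRange_replicate (fun j => by simp [Ev.InRange, Ev.gain]) a

theorem gain_iterate_reflect (p : ℕ) (T : Word α) : gain ((reflect 2)^[p] T) = gain T := by
  induction p with
  | zero => rfl
  | succ p ih => rw [Function.iterate_succ_apply', gain_reflect, ih]

theorem inRange_iterate_reflect (p : ℕ) {T : Word α} (h : InRange 2 T) :
    InRange 2 ((reflect 2)^[p] T) := by
  induction p with
  | zero => exact h
  | succ p ih => rw [Function.iterate_succ_apply']; exact inRange_reflect ih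

theorem gain_tangleWord (a v p : ℕ → ℕ) (i l : ℕ) : gain (tangleWord a v p i l) = 0 := by
  induction l generalizing i with
  | zero => exact gain_horizontalWord _
  | succ l ih =>
    simp only [tangleWord, addLevelWord, gain_append, gain_horizontalWord, gain_iterate_reflect,
      gain_verticalWord _ (ih _), add_zero]

theorem inRange_tangleWord (a v p : ℕ → ℕ) (i l : ℕ) : InRange 2 (tangleWord a v p i l) := by
  induction l generalizing i with
  | zero => exact inRange_horizontalWord _
  | succ l ih =>
    simp only [tangleWord, addLevelWord, inRange_append, gain_append, gain_horizontalWord,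
      gain_iterate_reflect, gain_verticalWord _ (gain_tangleWord ..), add_zero]
    exact ⟨⟨inRange_horizontalWord _, inRange_iterate_reflect _
      (inRange_verticalWord _ (ih _) (gain_tangleWord ..))⟩, inRange_horizontalWord _⟩

/-! ### Words and fronts of rational tangles -/

theorem map_toFront_horizontalWord (a : ℕ) : (horizontalWord a).map Ev.toFront = horizontal a := by
  simp [horizontalWord, horizontal, Ev.toFront]

theorem map_toFront_reflect {w : ℕ} {W : Word α} (h : InRange w W) :
    (reflect w W).map Ev.toFront = flip w (W.map Ev.toFront) := by
  induction W generalizing w with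
  | nil => rfl
  | cons e W ih =>
    have h1 := h.1
    have h2 := h.2
    cases e with
    | row k a | col k a =>
      have h3 := ih (w := w) (by simpa [Ev.gain] using h2)
      simp only [reflect, Ev.reflect, Ev.gain, List.map_cons, Ev.toFront, flip, add_zero, h3]
      simp only [Ev.InRange] at h1
      congr 2; omega
    | cup k a =>
      have h3 := ih (w := w + 2) (by simpa [Ev.gain] using h2)
      push_cast at h3
      simp only [reflect, Ev.reflect, Ev.gain, List.map_cons, Ev.toFront, flip, h3]
      simp only [Ev.InRange] at h1
      congr 2; omega
    | cusp k a =>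
      simp only [Ev.InRange] at h1
      have e1 : ((w - 2 : ℕ) : ℤ) = w + -2 := by omega
      have h3 := ih (w := w - 2) (by rw [e1]; exact h2)
      rw [e1] at h3
      simp only [reflect, Ev.reflect, Ev.gain, List.map_cons, Ev.toFront, flip, h3]
      congr 2; omega

theorem map_toFront_raise {w : ℤ} (c : ℕ) {W : Word α} (h : InRange w W) :
    (raise c W).map Ev.toFront = (W.map Ev.toFront).map (FrontEvent.raise c) := by
  induction W generalizing w with
  | nil => rfl
  | cons e W ih =>
    have h1 := h.1
    have h3 := ih h.2
    simp only [raise] at h3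
    simp only [raise, List.map_cons, h3]
    congr 1
    cases e <;> simp only [Ev.InRange] at h1 <;> simp only [Ev.raise, Ev.toFront, FrontEvent.raise] <;>
      congr 1 <;> omega

theorem map_toFront_verticalWord (v : ℕ) {T : Word Unit} (h : InRange 2 T) :
    (verticalWord v T).map Ev.toFront = vertical v (T.map Ev.toFront) := by
  have h1 := map_toFront_raise (2 * v) h
  push_cast at h1
  simp only [verticalWord, vertical, List.map_append, h1, List.map_replicate, List.map_map,
    Ev.toFront]
  rfl

theorem map_toFront_iterate_reflect (p : ℕ) {T : Word α} (h : InRange 2 T) :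
    ((reflect 2)^[p] T).map Ev.toFront = (flip 2)^[p] (T.map Ev.toFront) := by
  induction p with
  | zero => rfl
  | succ p ih =>
    rw [Function.iterate_succ_apply', Function.iterate_succ_apply', ← ih]
    exact map_toFront_reflect (w := 2) (inRange_iterate_reflect p h)

theorem map_toFront_tangleWord (a v p : ℕ → ℕ) (i l : ℕ) :
    (tangleWord a v p i l).map Ev.toFront = tangleFrom a v p i l := by
  induction l generalizing i with
  | zero => exact map_toFront_horizontalWord _
  | succ l ih =>
    have h := inRange_tangleWord a v p (i + 1) l
    have h' := inRange_verticalWord (v i) h (gain_tangleWord ..)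
    simp only [tangleWord, addLevelWord, tangleFrom, addLevel, List.map_append,
      map_toFront_horizontalWord, map_toFront_iterate_reflect _ h', map_toFront_verticalWord _ h, ih]

/-! ### Counting the singularities of a word -/

/-- The column crossings of a word: the lower of the two strands, and the datum carried. -/
def cols (W : Word α) : List (ℤ × α) :=
  W.filterMap fun e => match e with
    | .col k a => some (k, a)
    | _ => none

/-- The right cusps of a word: the lower of the two strands, and the datum carried. -/
def cusps (W : Word α) : List (ℤ × α) :=
  W.filterMap fun e => match e with
    | .cusp k a => some (k, a)
    | _ => none

theorem mem_rows {W : Word α} {r : ℤ × α} : r ∈ rows W ↔ Ev.row r.1 r.2 ∈ W := by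
  simp only [rows, List.mem_filterMap]
  constructor
  · rintro ⟨e, he, h⟩
    cases e <;> simp at h
    obtain rfl := h; exact he
  · exact fun h => ⟨_, h, rfl⟩

theorem mem_cols {W : Word α} {r : ℤ × α} : r ∈ cols W ↔ Ev.col r.1 r.2 ∈ W := by
  simp only [cols, List.mem_filterMap]
  constructor
  · rintro ⟨e, he, h⟩
    cases e <;> simp at h
    obtain rfl := h; exact he
  · exact fun h => ⟨_, h, rfl⟩

theorem mem_cusps {W : Word α} {r : ℤ × α} : r ∈ cusps W ↔ Ev.cusp r.1 r.2 ∈ W := by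
  simp only [cusps, List.mem_filterMap]
  constructor
  · rintro ⟨e, he, h⟩
    cases e <;> simp at h
    obtain rfl := h; exact he
  · exact fun h => ⟨_, h, rfl⟩

/-- The positions of the row crossings, of the column crossings and of the right cusps. -/
def indices (W : Word ℕ) : List ℕ :=
  (rows W).map Prod.snd ++ ((cols W).map Prod.snd ++ (cusps W).map Prod.snd)

theorem pairwise_filterMap_number {f : Ev ℕ → Option (ℤ × ℕ)}
    (hf : ∀ e r, f e = some r → r.2 = e.payload) (t : ℕ) (W : Word α) :
    (((number t W).filterMap f).map Prod.snd).Nodup := by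
  rw [List.nodup_iff_pairwise_ne, List.pairwise_map, List.pairwise_filterMap]
  refine (payload_pairwise t W).imp fun {e e'} h r hr r' hr' => ?_
  rw [hf _ _ hr, hf _ _ hr']
  exact h.ne

theorem nodup_indices (t : ℕ) (W : Word α) : (indices (number t W)).Nodup := by
  have aux : ∀ {e f : Ev ℕ}, e ∈ number t W → f ∈ number t W → e ≠ f → e.payload ≠ f.payload :=
    fun he hf hne h => hne (number_inj he hf h)
  refine List.nodup_append'.2 ⟨?_, List.nodup_append'.2 ⟨?_, ?_, ?_⟩, ?_⟩
  · refine pairwise_filterMap_number (fun e r h => ?_) t W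
    cases e <;> simp at h; rw [← h]; rfl
  · refine pairwise_filterMap_number (fun e r h => ?_) t W
    cases e <;> simp at h; rw [← h]; rfl
  · refine pairwise_filterMap_number (fun e r h => ?_) t W
    cases e <;> simp at h; rw [← h]; rfl
  · rintro i hi hi'
    obtain ⟨r, hr, rfl⟩ := List.mem_map.1 hi
    obtain ⟨r', hr', h⟩ := List.mem_map.1 hi'
    exact aux (mem_cols.1 hr) (mem_cusps.1 hr') (by simp) h.symm
  · rintro i hi hi'
    obtain ⟨r, hr, rfl⟩ := List.mem_map.1 hi
    rcases List.mem_append.1 hi' with hi' | hi' <;> obtain ⟨r', hr', h⟩ := List.mem_map.1 hi'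
    · exact aux (mem_rows.1 hr) (mem_cols.1 hr') (by simp) h.symm
    · exact aux (mem_rows.1 hr) (mem_cusps.1 hr') (by simp) h.symm

theorem cols_append (W W' : Word α) : cols (W ++ W') = cols W ++ cols W' := List.filterMap_append

theorem cusps_append (W W' : Word α) : cusps (W ++ W') = cusps W ++ cusps W' :=
  List.filterMap_append

theorem length_cols_erase (W : Word α) : (cols (erase W)).length = (cols W).length := by
  induction W with
  | nil => rfl
  | cons e W ih => cases e <;> simp_all [cols, erase, Ev.map]

theorem length_cusps_erase (W : Word α) : (cusps (erase W)).length = (cusps W).length := by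
  induction W with
  | nil => rfl
  | cons e W ih => cases e <;> simp_all [cusps, erase, Ev.map]

theorem length_cols_raise (c : ℤ) (W : Word α) : (cols (raise c W)).length = (cols W).length := by
  induction W with
  | nil => rfl
  | cons e W ih => cases e <;> simp_all [cols, raise, Ev.raise]

theorem length_cusps_raise (c : ℤ) (W : Word α) : (cusps (raise c W)).length = (cusps W).length := by
  induction W with
  | nil => rfl
  | cons e W ih => cases e <;> simp_all [cusps, raise, Ev.raise]

theorem length_cols_reflect (w : ℤ) (W : Word α) : (cols (reflect w W)).length = (cols W).length := by
  induction W generalizing w with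
  | nil => rfl
  | cons e W ih => cases e <;> simp_all [cols, reflect, Ev.reflect]

theorem length_cusps_reflect (w : ℤ) (W : Word α) :
    (cusps (reflect w W)).length = (cusps W).length := by
  induction W generalizing w with
  | nil => rfl
  | cons e W ih => cases e <;> simp_all [cusps, reflect, Ev.reflect]

/-- A column crossing and a right cusp are added together. -/
theorem length_cols_eq {W : Word Unit} {p : Bool} (h : Tang p W) :
    (cols W).length = (cusps W).length := by
  induction h with
  | nil => rfl
  | row => rfl
  | append _ _ h1 h2 => simp [cols_append, cusps_append, h1, h2]
  | @vert W _ h =>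
    have h1 : cols (vertSum W) = (0, ()) :: cols (raise 2 W ++ [.cusp 1 ()]) := rfl
    have h2 : cusps (vertSum W) = cusps (raise 2 W ++ [.cusp 1 ()]) := rfl
    rw [h1, h2, cols_append, cusps_append, List.length_cons, List.length_append, List.length_append,
      length_cols_raise, length_cusps_raise, h]
    rfl
  | reflect _ h => simpa [length_cols_reflect, length_cusps_reflect] using h
  | slide _ hs h =>
    cases hs <;> simpa [cols_append, cusps_append, cols, cusps] using h

end Word
end SolidTorus

namespace SolidTorus

/-! ### Labelings of closed diagrams -/

section Labelings
variable {X : Type*}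

namespace Diagram

/-- The labels of adjacent segments differ by the power of `σ` given by the cusps between them. For
the shift of `ℤ` by one these are the Maslov potentials, for the identity the colorings of the
components. -/
def IsLabeling (D : Diagram) (σ : Equiv.Perm X) (F : Seg → X) : Prop :=
  ∀ s s' c, D.Joined s s' c → F s' = (σ ^ c) (F s)

end Diagram

/-- The labels of the strands on the line `t`. Below the lowest strand the label is the fixed value
`F (0, 0)`, which is carried along by all events. -/
def lineLabels (F : Diagram.Seg → X) (t : ℕ) (i : ℤ) : X := if 0 ≤ i then F (t, i.toNat) else F (0, 0)

theorem lineLabels_natCast (F : Diagram.Seg → X) (t i : ℕ) : lineLabels F t i = F (t, i) := by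
  simp [lineLabels]

theorem lineLabels_zero (F : Diagram.Seg → X) (t : ℕ) : lineLabels F t 0 = F (t, 0) := by
  simp [lineLabels]

theorem lineLabels_one (F : Diagram.Seg → X) (t : ℕ) : lineLabels F t 1 = F (t, 1) := by
  simp [lineLabels]

theorem lineLabels_natCast_succ (F : Diagram.Seg → X) (t i : ℕ) :
    lineLabels F t (i + 1) = F (t, i + 1) := lineLabels_natCast F t (i + 1)

theorem lineLabels_neg (F : Diagram.Seg → X) (t : ℕ) {i : ℤ} (h : i < 0) :
    lineLabels F t i = F (0, 0) := by
  simp [lineLabels, h]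

namespace Diagram
variable {D : Diagram} {n : ℕ} {wd : ℕ → ℕ} {σ : Equiv.Perm X} {F : Seg → X}

theorem IsLabeling.labelStep (hF : D.IsLabeling σ F) {e : ℕ} {A : Event} (h : D.events[e]? = some A)
    (hl : D.lineAfter e = e + 1) : A.LabelStep σ (lineLabels F e) (lineLabels F (e + 1)) := by
  cases A with
  | cross b k =>
    intro i
    rcases lt_or_ge i 0 with hi | hi
    · have : swapZ k i = i := by unfold swapZ; split_ifs <;> omega
      rw [this, lineLabels_neg F _ hi, lineLabels_neg F _ hi]
    · lift i to ℕ using hi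
      have h1 := hF _ _ _ (.cross (swap k i) h)
      rw [hl, swap_swap] at h1
      rw [swapZ_natCast, lineLabels_natCast, lineLabels_natCast, h1]
      simp
  | cup k =>
    refine ⟨fun i => ?_, ?_⟩
    · rcases lt_or_ge i 0 with hi | hi
      · have : shiftZ k i = i := by unfold shiftZ; split_ifs <;> omega
        rw [this, lineLabels_neg F _ hi, lineLabels_neg F _ hi]
      · lift i to ℕ using hi
        have h1 := hF _ _ _ (.cup i h)
        rw [hl] at h1
        rw [shiftZ_natCast, lineLabels_natCast, lineLabels_natCast, h1]
        simp
    · have h1 := hF _ _ _ (.leftCusp h)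
      rw [hl] at h1
      rw [lineLabels_natCast_succ, lineLabels_natCast, h1]
      simp
  | cap k =>
    refine ⟨fun i => ?_, ?_⟩
    · rcases lt_or_ge i 0 with hi | hi
      · have : shiftZ k i = i := by unfold shiftZ; split_ifs <;> omega
        rw [this, lineLabels_neg F _ hi, lineLabels_neg F _ hi]
      · lift i to ℕ using hi
        have h1 := hF _ _ _ (.cap i h)
        rw [hl] at h1
        rw [shiftZ_natCast, lineLabels_natCast, lineLabels_natCast, h1]
        simp
    · have h1 := hF _ _ _ (.rightCusp h)
      rw [lineLabels_natCast_succ, lineLabels_natCast, h1]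
      simp

/-- The transition tangle leaves the labels of the two strands as they are. -/
theorem Resolved.labeling_closed (H : D.Resolved n wd) (hF : D.IsLabeling σ F) (i : ℕ) :
    F (n, i) = F (0, i) := by
  have h1 := hF _ _ _ (.cross i H.normalEnd)
  have h2 := hF _ _ _ (.cross (swap 0 i) H.specialEnd)
  rw [H.lineAfter_of_le le_rfl] at h1
  rw [swap_swap, h1, Diagram.lineAfter, H.length, Nat.mod_self] at h2
  simpa using h2.symm

/-- Compatible labels on the lines of a tangle that agree at both ends give a labeling of its
closure. -/
theorem Resolved.exists_labeling (H : D.Resolved n wd) {lab : ℕ → ℤ → X} (hc : lab n = lab 0)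
    (hl : ∀ e < n, ∀ A, D.events[e]? = some A → A.LabelStep σ (lab e) (lab (e + 1))) :
    ∃ F, D.IsLabeling σ F ∧ F (0, 0) = lab 0 0 ∧ F (0, 1) = lab 0 1 := by
  obtain ⟨F, hF, hF'⟩ : ∃ F : Seg → X, (∀ i : ℕ, F (n + 1, i) = lab n (swap 0 i : ℕ)) ∧
      ∀ t ≤ n, ∀ i : ℕ, F (t, i) = lab t i :=
    ⟨fun s => if s.1 = n + 1 then lab n (swap 0 s.2 : ℕ) else lab s.1 (s.2 : ℤ), fun i => by simp,
      fun t ht i => if_neg (by simp; omega)⟩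
  refine ⟨F, ?_, by simpa using hF' 0 (Nat.zero_le n) 0, by simpa using hF' 0 (Nat.zero_le n) 1⟩
  have hlt : ∀ {e A}, D.events[e]? = some A → e < n + 2 := fun {e A} h => by
    rw [← H.length]; exact (List.getElem?_eq_some_iff.1 h).1
  have hcross : ∀ {e b k}, D.events[e]? = some (.cross b k) → e < n ∨ (e = n ∧ k = 0) ∨ (e = n + 1 ∧ k = 0) := by
    intro e b k h
    have := hlt h
    rcases lt_trichotomy e n with h1 | rfl | h1
    · exact .inl h1
    · have := H.normalEnd; rw [h] at this; simp at this; exact .inr (.inl ⟨rfl, this.2⟩)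
    · obtain rfl : e = n + 1 := by omega
      have := H.specialEnd; rw [h] at this; simp at this; exact .inr (.inr ⟨rfl, this.2⟩)
  have hcup : ∀ {e k}, D.events[e]? = some (.cup k) → e < n := by
    intro e k h
    have := hlt h
    rcases lt_trichotomy e n with h1 | rfl | h1
    · exact h1
    · have := H.normalEnd; rw [h] at this; simp at this
    · obtain rfl : e = n + 1 := by omega
      have := H.specialEnd; rw [h] at this; simp at this
  have hcap : ∀ {e k}, D.events[e]? = some (.cap k) → e < n := by
    intro e k h
    have := hlt h
    rcases lt_trichotomy e n with h1 | rfl | h1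
    · exact h1
    · have := H.normalEnd; rw [h] at this; simp at this
    · obtain rfl : e = n + 1 := by omega
      have := H.specialEnd; rw [h] at this; simp at this
  rintro _ _ _ (⟨i, h⟩ | ⟨i, h⟩ | ⟨i, h⟩ | h | h)
  · rcases hcross h with he | ⟨rfl, rfl⟩ | ⟨rfl, rfl⟩
    · rw [H.lineAfter_of_le he.le, hF' _ he, hF' _ he.le, hl _ he _ h, swapZ_natCast, swap_swap]
      simp
    · rw [H.lineAfter_of_le le_rfl, hF, hF' _ le_rfl, swap_swap]
      simp
    · rw [H.lineAfter_last, hF, hF' _ (Nat.zero_le _), hc]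
      simp
  · have he := hcup h
    have := (hl _ he _ h).1 i
    rw [shiftZ_natCast] at this
    rw [H.lineAfter_of_le he.le, hF' _ he, hF' _ he.le, this]
    simp
  · have he := hcap h
    have := (hl _ he _ h).1 i
    rw [shiftZ_natCast] at this
    rw [H.lineAfter_of_le he.le, hF' _ he, hF' _ he.le, this]
    simp
  · have he := hcup h
    have := (hl _ he _ h).2
    rw [H.lineAfter_of_le he.le, hF' _ he, hF' _ he]
    simpa using this
  · have he := hcap h
    have := (hl _ he _ h).2
    rw [hF' _ he.le, hF' _ he.le]
    simpa using this

end Diagram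

theorem Word.erase_unit (V : Word Unit) : V.erase = V :=
  (List.map_congr_left fun e _ => by cases e <;> rfl).trans (List.map_id _)

/-- The labels of the two strands at each row crossing of the tangle, if its strands have the labels
`a` and `b` at the left end. -/
noncomputable def Tang.record {p : Bool} {V : Word Unit} (h : Tang p V) (σ : Equiv.Perm X) (a b : X) :
    List (X × X) := (h.labels σ a b).choose

theorem Tang.record_translates {p : Bool} {V : Word Unit} (h : Tang p V) (σ : Equiv.Perm X) (a b : X) :
    ∀ r ∈ h.record σ a b, Translates σ a b r := (h.labels σ a b).choose_spec.1

/-- The labels along a tangle are determined by those at its left end: at the row crossings they are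
recorded in `Tang.record`, at column crossings the two strands have the same label, and at the right
end the labels are exchanged if the parity `p` is odd. -/
theorem Tang.line_labels {p : Bool} {V : Word Unit} (h : Tang p V) (hV : Word.InRange 2 V)
    {σ : Equiv.Perm X} {E E' : List Event} {t : ℕ} (hE : E.drop t = Word.events V ++ E') {lab : ℕ → ℤ → X}
    (hlab : ∀ e, t ≤ e → e < t + (Word.events V).length → ∀ A, E[e]? = some A →
      A.LabelStep σ (lab e) (lab (e + 1))) :
    (Word.rows (Word.number t V)).map (fun r => (lab r.2 r.1, lab r.2 (r.1 + 1))) =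
      h.record σ (lab t 0) (lab t 1) ∧
    (∀ k i, Ev.col k i ∈ Word.number t V → lab i k = lab i (k + 1)) ∧
    lab (t + (Word.events V).length) = fun i => lab t (if p then swapZ 0 i else i) := by
  obtain ⟨W', h1, h2, h3, h4, h5⟩ := Word.exists_labels hE hV lab hlab
  have hs := ((h.labels σ (lab t 0) (lab t 1)).choose_spec.2 (lab t) rfl rfl).2 W'
    (by rw [h1, Word.erase_unit]) h2
  exact ⟨by rw [← h4, hs.1]; rfl, h5 hs.2.1, by rw [← h3, hs.2.2]⟩

/-- The closure of a tangle has a labeling with any labels `a`, `b` of its two strands at `x = 0`;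
these have to be equal if the closure has one component. -/
theorem Tang.exists_labeling {p : Bool} {V : Word Unit} (h : Tang p V) (hV : Word.InRange 2 V)
    (σ : Equiv.Perm X) {a b : X} (hab : p = true → a = b) :
    ∃ F, V.closure.IsLabeling σ F ∧ F (0, 0) = a ∧ F (0, 1) = b := by
  have H := Word.resolved hV h.gain_eq_zero
  let l : ℤ → X := fun i => if i = 0 then a else b
  obtain ⟨W, hW, hok⟩ := ((h.labels σ a b).choose_spec.2 l (by simp [l]) (by simp [l])).1
  have hr := ((h.labels σ a b).choose_spec.2 l (by simp [l]) (by simp [l])).2 W hW hok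
  have hev : Word.events W = Word.events V := by
    rw [← hW]; simp [Word.events, Word.erase, List.flatMap_map]
  have hWr : Word.InRange 2 W := by
    rw [← hW] at hV
    clear hr hok hW hev H
    revert hV
    generalize (2 : ℤ) = w
    induction W generalizing w with
    | nil => exact fun _ => trivial
    | cons e W ih =>
      rintro ⟨h1, h2⟩
      refine ⟨(Ev.inRange_map _ _ _).1 h1, ih _ ?_⟩
      cases e <;> exact h2
  obtain ⟨lab, h1, h2, h3⟩ := Word.exists_lines (σ := σ) (t := 0) (by rw [V.drop_closure, ← hev]) hWr l hok
  rw [zero_add] at h2 h3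
  rw [hev] at h2 h3
  have hc : lab (Word.events V).length = lab 0 := by
    rw [h2, hr.2.2, h1]
    funext i
    cases p with
    | false => rfl
    | true =>
      obtain rfl := hab rfl
      simp [l]
  obtain ⟨F, hF, hF0, hF1⟩ := H.exists_labeling hc fun e he => h3 e (Nat.zero_le _) he
  exact ⟨F, hF, by rw [hF0, h1]; simp [l], by rw [hF1, h1]; simp [l]⟩

end Labelings
end SolidTorus

namespace SolidTorus
open Diagram

/-! ### Linear algebra of the closure of a tangle -/

/-- The vertices are finite in number, being crossings of a finite list of events. -/
noncomputable instance (D : Diagram) : Fintype D.Vertex :=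
  have : Finite D.Vertex := Set.Finite.to_subtype ((Set.finite_lt_nat D.events.length).subset
    (by rintro e ⟨b, k, h⟩; exact (List.getElem?_eq_some_iff.1 h).1))
  Fintype.ofFinite _

namespace Diagram
variable {D : Diagram}

open Classical in

/-- The vertices at the given positions. -/
noncomputable def verticesIn (D : Diagram) (l : List ℕ) : Finset D.Vertex :=
  Finset.univ.filter fun v => v.1 ∈ l

theorem mem_verticesIn {l : List ℕ} {v : D.Vertex} : v ∈ D.verticesIn l ↔ v.1 ∈ l := by
  simp [verticesIn]

theorem sum_verticesIn {M : Type*} [AddCommMonoid M] {l : List ℕ} (hl : l.Nodup)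
    (hv : ∀ e ∈ l, ∃ b k, D.events[e]? = some (.cross b k)) (f : ℕ → M) :
    ∑ v ∈ D.verticesIn l, f v.1 = (l.map f).sum := by
  classical
  rw [← List.sum_toFinset f hl]
  refine Finset.sum_bij (fun v _ => v.1) (fun v h => ?_) (fun v _ v' _ h => Subtype.ext h)
    (fun e he => ?_) fun _ _ => rfl
  · exact List.mem_toFinset.2 (mem_verticesIn.1 h)
  · have he := List.mem_toFinset.1 he
    exact ⟨⟨e, hv e he⟩, mem_verticesIn.2 he, rfl⟩

theorem card_verticesIn {l : List ℕ} (hl : l.Nodup)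
    (hv : ∀ e ∈ l, ∃ b k, D.events[e]? = some (.cross b k)) : (D.verticesIn l).card = l.length := by
  have := sum_verticesIn hl hv fun _ => 1
  simpa using this

end Diagram

section TrivSqZero
variable {Q : Type*} [AddCommGroup Q] [Module (ZMod 2) Q] [Module (ZMod 2)ᵐᵒᵖ Q] [IsCentralScalar (ZMod 2) Q]

/-- In the dual numbers over `ℤ/2` every unit is its own inverse. -/
theorem eq_of_mul_eq_one (a b : TrivSqZeroExt (ZMod 2) Q) (h : a * b = 1) : a = b := by
  have h1 : a.fst * b.fst = 1 := by rw [← TrivSqZeroExt.fst_mul, h]; rfl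
  have h2 : ∀ x y : ZMod 2, x * y = 1 → x = 1 ∧ y = 1 := by decide
  obtain ⟨ha, hb⟩ := h2 _ _ h1
  have h3 : a.fst • b.snd + b.fst • a.snd = 0 := by
    have := congrArg TrivSqZeroExt.snd h
    rwa [TrivSqZeroExt.snd_mul, op_smul_eq_smul, TrivSqZeroExt.snd_one] at this
  rw [ha, hb, one_smul, one_smul] at h3
  ext
  · rw [ha, hb]
  · have h4 := congrArg TrivSqZeroExt.snd (two_eq_zero (TrivSqZeroExt.inr b.snd : TrivSqZeroExt (ZMod 2) Q))
    simp only [TrivSqZeroExt.snd_add, TrivSqZeroExt.snd_inr, TrivSqZeroExt.snd_zero] at h4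
    exact add_left_cancel (h3.trans h4.symm) |>.symm ▸ rfl

end TrivSqZero

section Closure

/-- The special crossing of the transition tangle. -/
def Word.specialVertex (V : Word Unit) : V.closure.Vertex :=
  ⟨(Word.events V).length + 1, true, 0, by rw [V.closure_events, List.getElem?_append_right (by omega)]; simp⟩

/-- The normal crossing of the transition tangle. -/
def Word.normalVertex (V : Word Unit) : V.closure.Vertex :=
  ⟨(Word.events V).length, false, 0, by rw [V.closure_events, List.getElem?_append_right (by omega)]; simp⟩

variable {V : Word Unit} (hV : Word.InRange 2 V) (hg : Word.gain V = 0)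

include hV in

/-- The vertices outside the transition tangle are the row crossings, the column crossings and the
crossings of the resolved right cusps. -/
theorem Word.vertex_cases (v : V.closure.Vertex) (hv : v.1 < (Word.events V).length) :
    ∃ k : ℕ, V.closure.events[v.1]? = some (.cross false k) ∧ (Ev.row (k : ℤ) v.1 ∈ Word.number 0 V ∨
      Ev.col (k : ℤ) v.1 ∈ Word.number 0 V ∨ Ev.cusp (k : ℤ) v.1 ∈ Word.number 0 V) := by
  obtain ⟨b, k, h⟩ := v.2
  obtain ⟨rfl, h'⟩ := (Word.exists_of_cross V.drop_closure hV (Nat.zero_le _) (by simpa using hv)).1 _ _ h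
  exact ⟨k, h, h'⟩

include hV in
theorem Word.event_of_mem {k : ℤ} {i : ℕ} (h : Ev.row k i ∈ Word.number 0 V ∨
      Ev.col k i ∈ Word.number 0 V ∨ Ev.cusp k i ∈ Word.number 0 V) :
    0 ≤ k ∧ i < (Word.events V).length ∧ V.closure.events[i]? = some (.cross false k.toNat) := by
  rcases h with h | h | h <;> have := Word.number_spec V.drop_closure hV h
  · exact ⟨this.2.1, by simpa [Ev.payload] using this.1, this.2.2⟩
  · exact ⟨this.2.1, by simpa [Ev.payload] using this.1, this.2.2⟩
  · exact ⟨this.2.1, by simpa [Ev.payload] using this.1, this.2.2.1⟩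

variable {R : Type*} [CommRing R] [Algebra (ZMod 2) R]

include hV hg in

/-- The differential of a crossing is the entry of the line matrix at the two strands that cross,
and the loop adds the term `1` for a right cusp. -/
theorem Word.map_bdry_vertex (ψ : V.closure.Alg →ₐ[ZMod 2] R) (v : V.closure.Vertex) {k : ℕ} :
    ((Ev.row (k : ℤ) v.1 ∈ Word.number 0 V ∨ Ev.col (k : ℤ) v.1 ∈ Word.number 0 V) →
      ψ v.bdry = lineMat V.closure.events (weight fun v => ψ (Vertex.gen v))
        (weight (fun v => ψ (Vertex.gen v)) ((Word.events V).length + 1)) v.1 k (k + 1)) ∧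
    (Ev.cusp (k : ℤ) v.1 ∈ Word.number 0 V →
      ψ v.bdry = lineMat V.closure.events (weight fun v => ψ (Vertex.gen v))
        (weight (fun v => ψ (Vertex.gen v)) ((Word.events V).length + 1)) v.1 k (k + 1) + 1) := by
  have H := Word.resolved hV hg
  constructor
  · intro h
    obtain ⟨-, h1, h2⟩ := Word.event_of_mem hV (h.imp_right Or.inl)
    have h3 : ¬ ∃ k, V.closure.events[v.1 + 1]? = some (.cap k) := by
      rintro ⟨k', hk'⟩
      have h4 : v.1 + 1 < (Word.events V).length := by
        by_contra h5
        obtain h6 : v.1 + 1 = (Word.events V).length := by omega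
        rw [h6, H.normalEnd] at hk'
        simp at hk'
      obtain ⟨i', hi, hi'⟩ := (Word.exists_of_cross V.drop_closure hV (Nat.zero_le _)
        (by simpa using h4)).2 _ hk'
      obtain rfl : v.1 = i' := by omega
      rcases h with h | h <;> simpa using Word.number_inj h hi' rfl
    rw [H.map_bdry_front ψ v h1, if_neg h3, (v.event h2).1]
    simp
  · intro h
    obtain ⟨-, h1, h2⟩ := Word.event_of_mem hV (.inr (.inr h))
    have h3 : ∃ k, V.closure.events[v.1 + 1]? = some (.cap k) :=
      ⟨_, (Word.number_spec V.drop_closure hV h).2.2.2⟩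
    rw [H.map_bdry_front ψ v h1, if_pos h3, (v.event h2).1]
    simp

include hV hg in

/-- An algebra map `ψ` that vanishes on the right cusps makes the tangle into a word with weights in
`R` and gives a matrix `N` of its left end, so that the condition on pivots says that `ψ ∂` vanishes
on the right cusps (the value is `1 + 1`, and `R` has characteristic two), the condition on entries
that it vanishes on the other crossings, and the entry at the right end gives `ψ ∂` of the normal
crossing of the transition tangle. -/
theorem Word.exists_run (ψ : V.closure.Alg →ₐ[ZMod 2] R)
    (hc : ∀ v : V.closure.Vertex, ∀ k : ℤ, Ev.cusp k v.1 ∈ Word.number 0 V → ψ v.gen = 0) :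
    ∃ (W : Word R) (N : Mat R), W.erase = V ∧ StrictUpper N ∧ N 0 1 = ψ (Word.specialVertex V).gen ∧
      (W.Pivots N ↔ ∀ v : V.closure.Vertex, ∀ k : ℤ, Ev.cusp k v.1 ∈ Word.number 0 V → ψ v.bdry = 1 + 1) ∧
      (W.Entries N ↔ ∀ v : V.closure.Vertex, ∀ k : ℤ,
        (Ev.row k v.1 ∈ Word.number 0 V ∨ Ev.col k v.1 ∈ Word.number 0 V) → ψ v.bdry = 0) ∧
      ψ (Word.normalVertex V).bdry = W.run N 0 1 + ψ (Word.specialVertex V).gen ∧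
      (∀ P : R → Prop, W.RowWeights P ↔ ∀ v : V.closure.Vertex, ∀ k : ℤ,
        Ev.row k v.1 ∈ Word.number 0 V → P (ψ v.gen)) ∧
      ∀ P : R → Prop, W.ColWeights P ↔ ∀ v : V.closure.Vertex, ∀ k : ℤ,
        Ev.col k v.1 ∈ Word.number 0 V → P (ψ v.gen) := by
  have H := Word.resolved hV hg
  set wt : ℕ → R := weight fun v => ψ (Vertex.gen v) with hwt
  have hw : ∀ v : V.closure.Vertex, wt v.1 = ψ v.gen := fun v => (weight_eq (fun v => ψ (Vertex.gen v)) v).symm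
  have hvert : ∀ {k : ℤ} {i : ℕ}, (Ev.row k i ∈ Word.number 0 V ∨ Ev.col k i ∈ Word.number 0 V ∨
      Ev.cusp k i ∈ Word.number 0 V) → ∃ v : V.closure.Vertex, v.1 = i := fun h =>
    ⟨⟨_, _, _, (Word.event_of_mem hV h).2.2⟩, rfl⟩
  obtain ⟨h1, h2, h3⟩ := Word.lineMat_word (wt := wt) (y := wt ((Word.events V).length + 1)) V.drop_closure hV
    (fun k i h => by
      obtain ⟨v, rfl⟩ := hvert (.inr (.inr h))
      rw [hw]; exact hc v k h)
  have hN : lineMat V.closure.events wt (wt ((Word.events V).length + 1)) 0 0 1 = ψ (Word.specialVertex V).gen := by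
    rw [← hw]; simp [lineMat, Word.specialVertex]
  refine ⟨(Word.number 0 V).map (Ev.map wt), lineMat V.closure.events wt (wt ((Word.events V).length + 1)) 0,
    ?_, lineMat_strictUpper _ _ _ _, hN, h2.trans ?_, h3.trans ?_, ?_, fun P => ?_, fun P => ?_⟩
  · rw [Word.erase_map, Word.erase_number, Word.erase_unit]
  · constructor
    · intro h v k hk
      obtain ⟨h0, -⟩ := Word.event_of_mem hV (.inr (.inr hk))
      have := h k v.1 hk
      lift k to ℕ using h0
      rw [(Word.map_bdry_vertex hV hg ψ v).2 hk, ← this]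
    · intro h k i hk
      obtain ⟨v, rfl⟩ := hvert (.inr (.inr hk))
      obtain ⟨h0, -⟩ := Word.event_of_mem hV (.inr (.inr hk))
      have := h v k hk
      lift k to ℕ using h0
      rw [(Word.map_bdry_vertex hV hg ψ v).2 hk] at this
      exact add_right_cancel this
  · constructor
    · intro h v k hk
      obtain ⟨h0, -⟩ := Word.event_of_mem hV (hk.imp_right .inl)
      have := h k v.1 hk
      lift k to ℕ using h0
      rw [(Word.map_bdry_vertex hV hg ψ v).1 hk, ← this]
    · intro h k i hk
      obtain ⟨v, rfl⟩ := hvert (hk.imp_right .inl)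
      obtain ⟨h0, -⟩ := Word.event_of_mem hV (hk.imp_right .inl)
      have := h v k hk
      lift k to ℕ using h0
      rwa [(Word.map_bdry_vertex hV hg ψ v).1 hk] at this
  · rw [zero_add] at h1
    rw [H.map_bdry_normalEnd ψ (Word.normalVertex V) rfl, ← hw, ← h1]
    rfl
  · constructor
    · intro h v k hk
      rw [← hw]
      exact h _ (List.mem_map_of_mem hk)
    · rintro h e he
      obtain ⟨f, hf, rfl⟩ := List.mem_map.1 he
      cases f with
      | row k i =>
        obtain ⟨v, rfl⟩ := hvert (.inl hf)
        have := h v k hf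
        rwa [← hw] at this
      | _ => trivial
  · constructor
    · intro h v k hk
      rw [← hw]
      exact h _ (List.mem_map_of_mem hk)
    · rintro h e he
      obtain ⟨f, hf, rfl⟩ := List.mem_map.1 he
      cases f with
      | col k i =>
        obtain ⟨v, rfl⟩ := hvert (.inr (.inl hf))
        have := h v k hf
        rwa [← hw] at this
      | _ => trivial

end Closure
end SolidTorus

namespace SolidTorus
open Diagram

/-! ### The standard augmentation -/

section Homology
variable {V : Word Unit} {p : Bool} (hV : Word.InRange 2 V) (h : Tang p V)

/-- The standard augmentation: `1` on the column crossings and `0` on all other vertices. -/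
noncomputable def Word.standardAug (V : Word Unit) : V.closure.Alg →ₐ[ZMod 2] ZMod 2 :=
  open Classical in
  FreeAlgebra.lift (ZMod 2) fun v : V.closure.Vertex =>
    if ∃ k, Ev.col k v.1 ∈ Word.number 0 V then 1 else 0

theorem Word.standardAug_gen (V : Word Unit) (v : V.closure.Vertex) [Decidable (∃ k, Ev.col k v.1 ∈ Word.number 0 V)] :
    V.standardAug v.gen = if ∃ k, Ev.col k v.1 ∈ Word.number 0 V then 1 else 0 := by
  rw [Word.standardAug, Vertex.gen, FreeAlgebra.lift_ι_apply]
  congr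

include hV h in

/-- The standard augmentation vanishes on the differentials, since the run of a standard word has
pivots one and vanishing entries. -/
theorem Word.standardAug_bdry (v : V.closure.Vertex) : V.standardAug v.bdry = 0 := by
  classical
  have hg := h.gain_eq_zero
  have H := Word.resolved hV hg
  have ne : ∀ {v : V.closure.Vertex} {e : Ev ℕ}, e ∈ Word.number 0 V → e.payload = v.1 → (∀ k i, e ≠ .col k i) →
      V.standardAug v.gen = 0 := by
    intro v e he hp hne
    rw [Word.standardAug_gen, if_neg]
    rintro ⟨k, hk⟩
    exact hne k v.1 (Word.number_inj he hk hp)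
  obtain ⟨W, N, h1, h2, h3, h4, h5, h6, h7, h8⟩ := Word.exists_run hV hg V.standardAug
    fun v k hk => ne hk rfl (by simp)
  have hs : V.standardAug (Word.specialVertex V).gen = 0 := by
    rw [Word.standardAug_gen, if_neg]
    rintro ⟨k, hk⟩
    have := (Word.event_of_mem hV (.inr (.inl hk))).2.1
    simp [Word.specialVertex] at this
  have hstd : W.Standard := by
    refine ⟨(h7 _).2 fun v k hk => ne hk rfl (by simp), (h8 _).2 fun v k hk => ?_⟩
    rw [Word.standardAug_gen, if_pos ⟨k, hk⟩]
  obtain ⟨a1, a2, -, A, B, C, D, a3, -⟩ := h.act (R := ZMod 2) (by decide) (by decide) ⊤ W h1 N h2 (h3.trans hs)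
    (fun e _ => by cases e <;> trivial) (.inl hstd)
  rcases H.le_of_vertex v with hv | hv | hv
  · obtain ⟨k, -, hk⟩ := Word.vertex_cases hV v hv
    rw [← or_assoc] at hk
    rcases hk with hk | hk
    · exact h5.1 a2 v k hk
    · exact (h4.1 a1 v k hk).trans (by decide)
  · obtain rfl : v = Word.normalVertex V := Subtype.ext hv
    rw [h6, hs, add_zero]
    exact a3.mid
  · exact H.map_bdry_specialEnd _ v hv

/-! ### The complex modulo the right cusps -/

/-- The substitution `a ↦ ε(a) + a`, up to first order and modulo the subspace `U`. -/
noncomputable def quotientLinearization {D : Diagram} (ε : D.Alg →ₐ[ZMod 2] ZMod 2)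
    (U : Submodule (ZMod 2) D.Space) : D.Alg →ₐ[ZMod 2] TrivSqZeroExt (ZMod 2) (D.Space ⧸ U) :=
  (TrivSqZeroExt.map U.mkQ).comp (linearization ε)

theorem quotientLinearization_gen {D : Diagram} (ε : D.Alg →ₐ[ZMod 2] ZMod 2)
    (U : Submodule (ZMod 2) D.Space) (v : D.Vertex) : quotientLinearization ε U v.gen =
      TrivSqZeroExt.inl (ε v.gen) + TrivSqZeroExt.inr (U.mkQ (Finsupp.single v 1)) := by
  simp [quotientLinearization, linearization_gen]

/-- The quotient linearization takes a differential to the linearized differential modulo `U`. -/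
theorem quotientLinearization_bdry {D : Diagram} {ε : D.Alg →ₐ[ZMod 2] ZMod 2}
    (hε : ∀ v : D.Vertex, ε v.bdry = 0) (U : Submodule (ZMod 2) D.Space) (v : D.Vertex) :
    quotientLinearization ε U v.bdry =
      TrivSqZeroExt.inr (U.mkQ (D.linDiff ε (Finsupp.single v 1))) := by
  rw [linDiff_single]
  ext
  · simp [quotientLinearization, fst_linearization, hε]
  · simp [quotientLinearization]

theorem quotientLinearization_bdry_eq_zero {D : Diagram} {ε : D.Alg →ₐ[ZMod 2] ZMod 2}
    (hε : ∀ v : D.Vertex, ε v.bdry = 0) {U : Submodule (ZMod 2) D.Space} {v : D.Vertex} :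
    quotientLinearization ε U v.bdry = 0 ↔ D.linDiff ε (Finsupp.single v 1) ∈ U := by
  rw [quotientLinearization_bdry hε]
  constructor
  · intro h
    have := congrArg TrivSqZeroExt.snd h
    simpa using this
  · intro h
    have : U.mkQ (D.linDiff ε (Finsupp.single v 1)) = 0 := by simpa using h
    rw [this]; rfl

/-- A row crossing stands before a tangle at the right end of `V`. -/
def Word.HasFinalRow (V : Word Unit) : Prop :=
  ∃ P Q q, Tang q Q ∧ V = P ++ .row 0 () :: Q

variable {ε : V.closure.Alg →ₐ[ZMod 2] ZMod 2} (hε : ∀ v : V.closure.Vertex, ε v.bdry = 0)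
  (hc : ∀ v : V.closure.Vertex, ∀ k : ℤ, Ev.cusp k v.1 ∈ Word.number 0 V → ε v.gen = 0)
  (hs : ε (Word.specialVertex V).gen = 0) {U : Submodule (ZMod 2) V.closure.Space}
  (hU : ∀ v : V.closure.Vertex, ∀ k : ℤ, Ev.cusp k v.1 ∈ Word.number 0 V → Finsupp.single v 1 ∈ U)
  (hU' : ∀ v : V.closure.Vertex, ∀ k : ℤ, Ev.cusp k v.1 ∈ Word.number 0 V →
    V.closure.linDiff ε (Finsupp.single v 1) ∈ U)

include hV h hε hc hU hU' in

/-- Let `U` contain the crossings of the right cusps and their linearized differentials. Modulo `U`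
these crossings have weight zero and pivot one, so that the run of the word computes the linearized
differential modulo `U`. -/
theorem Word.exists_quotient_run :
    ∃ (W : Word (TrivSqZeroExt (ZMod 2) (V.closure.Space ⧸ U)))
      (N : Mat (TrivSqZeroExt (ZMod 2) (V.closure.Space ⧸ U))), W.erase = V ∧ StrictUpper N ∧
      N 0 1 = quotientLinearization ε U (Word.specialVertex V).gen ∧ W.Pivots N ∧
      (W.Entries N → ∀ v : V.closure.Vertex, v.1 < (Word.events V).length →
        V.closure.linDiff ε (Finsupp.single v 1) ∈ U) ∧
      quotientLinearization ε U (Word.normalVertex V).bdry =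
        W.run N 0 1 + quotientLinearization ε U (Word.specialVertex V).gen ∧
      (∀ P : TrivSqZeroExt (ZMod 2) (V.closure.Space ⧸ U) → Prop,
        W.RowWeights P ↔ ∀ v : V.closure.Vertex, ∀ k : ℤ,
        Ev.row k v.1 ∈ Word.number 0 V → P (quotientLinearization ε U v.gen)) ∧
      ∀ P : TrivSqZeroExt (ZMod 2) (V.closure.Space ⧸ U) → Prop,
        W.ColWeights P ↔ ∀ v : V.closure.Vertex, ∀ k : ℤ,
        Ev.col k v.1 ∈ Word.number 0 V → P (quotientLinearization ε U v.gen) := by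
  obtain ⟨W, N, h1, h2, h3, h4, h5, h6, h7, h8⟩ := Word.exists_run hV h.gain_eq_zero
    (quotientLinearization ε U) fun v k hk => by
      have : U.mkQ (Finsupp.single v 1) = 0 := by simpa using hU v k hk
      rw [quotientLinearization_gen, this, hc v k hk]; simp
  refine ⟨W, N, h1, h2, h3, h4.2 fun v k hk => ?_, fun hW v hv => ?_, h6, h7, h8⟩
  · rw [two_eq_zero, quotientLinearization_bdry_eq_zero hε]
    exact hU' v k hk
  · obtain ⟨k, -, hk⟩ := Word.vertex_cases hV v hv
    rw [← or_assoc] at hk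
    rcases hk with hk | hk
    · exact (quotientLinearization_bdry_eq_zero hε).1 (h5.1 hW v k hk)
    · exact hU' v k hk

include hs in
theorem Word.specialVertex_mem (hsU : Finsupp.single (Word.specialVertex V) 1 ∈ U) :
    quotientLinearization ε U (Word.specialVertex V).gen = 0 := by
  have : U.mkQ (Finsupp.single (Word.specialVertex V) 1) = 0 := by simpa using hsU
  rw [quotientLinearization_gen, hs, this]; simp

include hV h hε hc hs hU hU' in

/-- If `U` contains the special crossing as well, then all linearized differentials of the crossings
of the tangle lie in `U`, because the entries vanish. -/
theorem Word.linDiff_mem (hsU : Finsupp.single (Word.specialVertex V) 1 ∈ U) (v : V.closure.Vertex)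
    (hv : v.1 < (Word.events V).length) : V.closure.linDiff ε (Finsupp.single v 1) ∈ U := by
  obtain ⟨W, N, h1, h2, h3, h4, h5, h6, h7, h8⟩ := Word.exists_quotient_run hV h hε hc hU hU'
  exact h5 (h.act two_eq_zero eq_of_mul_eq_one ⊤ W h1 N h2 (h3.trans (Word.specialVertex_mem hs hsU))
    (fun e _ => by cases e <;> trivial) (.inr h4)).2.1 v hv

include hV h hε hc hs hU hU' in

/-- If `U` contains the special crossing and the row crossings as well, then it contains all
crossings of the tangle, because the weights of the columns are determined by those of the rows. -/
theorem Word.single_mem (hsU : Finsupp.single (Word.specialVertex V) 1 ∈ U)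
    (hr : ∀ v : V.closure.Vertex, ∀ k : ℤ, Ev.row k v.1 ∈ Word.number 0 V → Finsupp.single v 1 ∈ U)
    (v : V.closure.Vertex) (hv : v.1 < (Word.events V).length) : Finsupp.single v 1 ∈ U := by
  obtain ⟨W, N, h1, h2, h3, h4, h5, h6, h7, h8⟩ := Word.exists_quotient_run hV h hε hc hU hU'
  have key := (h.act two_eq_zero eq_of_mul_eq_one (TrivSqZeroExt.inlHom (ZMod 2) (V.closure.Space ⧸ U)).range
    W h1 N h2 (h3.trans (Word.specialVertex_mem hs hsU)) ((h7 _).2 fun v k hk => ?_) (.inr h4)).2.2.1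
  · obtain ⟨k, -, hk⟩ := Word.vertex_cases hV v hv
    rcases hk with hk | hk | hk
    · exact hr v k hk
    · obtain ⟨x, hx⟩ := (h8 _).1 key v k hk
      rw [quotientLinearization_gen] at hx
      have := congrArg TrivSqZeroExt.snd hx
      simp only [TrivSqZeroExt.inlHom_apply, TrivSqZeroExt.snd_inl, TrivSqZeroExt.snd_add,
        TrivSqZeroExt.snd_inr, zero_add] at this
      simpa using this.symm
    · exact hU v k hk
  · have : U.mkQ (Finsupp.single v 1) = 0 := by simpa using hr v k hk
    rw [quotientLinearization_gen, this]
    exact ⟨ε v.gen, by simp⟩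

include hV h hε hc hs hU hU' in

/-- After a row crossing the entry between the two strands is zero, and the tangle on its right
keeps it so. Modulo `U`, the linearized differential of the normal crossing of the transition tangle
is therefore the special crossing. -/
theorem Word.special_of_normal (hK : V.HasFinalRow)
    (ht : V.closure.linDiff ε (Finsupp.single (Word.normalVertex V) 1) ∈ U) :
    Finsupp.single (Word.specialVertex V) 1 ∈ U := by
  obtain ⟨W, N, h1, h2, h3, h4, h5, h6, h7, h8⟩ := Word.exists_quotient_run hV h hε hc hU hU'
  obtain ⟨P, Q, q, hQ, rfl⟩ := hK
  obtain ⟨P', W', rfl, hP, hW'⟩ := Word.erase_eq_append h1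
  obtain ⟨e, Q', rfl, he, hQ'⟩ := Word.erase_eq_cons hW'
  obtain ⟨x, rfl⟩ := Ev.map_eq_row he
  rw [Word.pivots_append] at h4
  -- the crossing step moves the lower left entry, which is zero, to the upper right
  have hN : StrictUpper (crossStep 0 x (P'.run N)) := StrictUpper.crossStep _ _
  have h01 : crossStep 0 x (P'.run N) 0 1 = 0 := by
    simp [crossStep, swapZ, Word.run_strictUpper h2 P' 1 0 (by norm_num)]
  obtain ⟨-, -, -, A, B, C, D, ha, -⟩ := hQ.act two_eq_zero eq_of_mul_eq_one ⊤ Q' hQ' _ hN h01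
    (fun e _ => by cases e <;> trivial) (.inr h4.2.2)
  have : Word.run (P' ++ .row 0 x :: Q') N 0 1 = 0 := by
    rw [Word.run_append]; exact ha.mid
  rw [this, zero_add, (quotientLinearization_bdry_eq_zero hε).2 ht, quotientLinearization_gen, hs] at h6
  have := congrArg TrivSqZeroExt.snd h6
  simp only [TrivSqZeroExt.snd_zero, TrivSqZeroExt.snd_inl, TrivSqZeroExt.snd_add,
        TrivSqZeroExt.snd_inr, zero_add] at this
  simpa using this.symm

include hV h hε hc hU hU' in

/-- If the tangle is trivial or ends with a vertical crossing, then the entry between the two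
strands is the same at its two ends. All linearized differentials of the crossings of the tangle,
and that of the normal crossing of the transition tangle, then lie in `U`. -/
theorem Word.linDiff_mem_vertical (hK : V = [] ∨ ∃ T, Tang false T ∧ Relation.ReflTransGen Slide (vertSum T) V) :
    (∀ v : V.closure.Vertex, v.1 < (Word.events V).length → V.closure.linDiff ε (Finsupp.single v 1) ∈ U) ∧
      V.closure.linDiff ε (Finsupp.single (Word.normalVertex V) 1) ∈ U := by
  obtain ⟨W, N, h1, h2, h3, h4, h5, h6, h7, h8⟩ := Word.exists_quotient_run hV h hε hc hU hU'
  have key : W.Entries N ∧ W.run N 0 1 = N 0 1 := by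
    rcases hK with rfl | ⟨T, hT, hTV⟩
    · obtain rfl := Word.erase_eq_nil h1
      exact ⟨trivial, rfl⟩
    · exact hT.act_vertSum two_eq_zero eq_of_mul_eq_one hTV h1 h2 h4
  refine ⟨h5 key.1, (quotientLinearization_bdry_eq_zero hε).1 ?_⟩
  rw [h6, key.2, h3, two_eq_zero]

end Homology
end SolidTorus

namespace SolidTorus
open Diagram LaurentPolynomial
open scoped LaurentPolynomial

/-! ### The polynomials of a closure -/

section Polynomials
variable {D : Diagram} {μ : Seg → ℤ} {ε : D.Alg →ₐ[ZMod 2] ZMod 2} {A B : Set Seg}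

/-- The effect of the differential on the degree and on the parts: the degree goes down by one,
while overstrand and understrand stay in their components. -/
def degreeShift : Equiv.Perm (ℤ × Prop × Prop) :=
  (Equiv.subRight (1 : ℤ)).prodCongr (Equiv.refl _)

open Classical in
/-- The contribution of a vertex to the polynomial of the part `(A, B)`, if it represents a homology
class. -/
noncomputable def vertexTerm (μ : Seg → ℤ) (A B : Set Seg) (v : D.Vertex) : ℤ[T;T⁻¹] :=
  if v.over ∈ A ∧ v.under ∈ B then T (v.deg μ) else 0

/-- If `W`, `∂ W` and `M` span the space as in `quotientDim_graded`, then the polynomial is the sum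
over the vertices in `M` of the powers given by their degrees. -/
theorem Diagram.chekanovPoly_eq_sum {n : ℕ} {wd : ℕ → ℕ} (H : D.Resolved n wd) (hμ : D.IsMaslov μ)
    (hε : D.IsAugmentation μ ε)
    (hA : D.IsColoring fun s => s ∈ A) (hB : D.IsColoring fun s => s ∈ B) (W M : Finset D.Vertex)
    (hcard : 2 * W.card + M.card ≤ Fintype.card D.Vertex)
    (hspan : ∀ b : D.Vertex, (Finsupp.single b 1 : D.Space) ∈
      Submodule.span (ZMod 2) ((fun b => Finsupp.single b 1) '' (W : Set D.Vertex)) ⊔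
      (Submodule.span (ZMod 2) ((fun b => Finsupp.single b 1) '' (W : Set D.Vertex))).map (D.linDiff ε) ⊔
      Submodule.span (ZMod 2) ((fun b => Finsupp.single b 1) '' (M : Set D.Vertex)))
    (hM : ∀ m ∈ M, D.linDiff ε (Finsupp.single m 1) ∈
      Submodule.span (ZMod 2) ((fun b => Finsupp.single b 1) '' (W : Set D.Vertex)) ⊔
      (Submodule.span (ZMod 2) ((fun b => Finsupp.single b 1) '' (W : Set D.Vertex))).map (D.linDiff ε)) :
    D.chekanovPoly μ ε A B = ∑ m ∈ M, vertexTerm μ A B m := by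
  classical
  have hbd := (comp_differential_iff ε).1 hε.comp_differential
  let g : D.Vertex → ℤ × Prop × Prop := fun v => (v.deg μ, v.over ∈ A, v.under ∈ B)
  have hcol : D.IsColoring fun s => (s ∈ A, s ∈ B) := fun s s' c hs => by
    simp only [hA s s' c hs, hB s s' c hs]
  have hd : ∀ b, D.linDiff ε (Finsupp.single b 1) ∈ gradedPiece g (degreeShift (g b)) := by
    intro b
    refine Submodule.span_mono ?_ (H.linDiff_mem_coloredPiece hμ hε hcol b)
    refine Set.image_mono ?_
    rintro a ⟨h1, h2, h3⟩
    simp only [Prod.mk.injEq] at h2 h3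
    simp [g, degreeShift, h1, h2.2, h3.1]
  have hpiece : ∀ k, D.piece μ A B k = gradedPiece g (k, True, True) := by
    intro k
    refine congrArg (Submodule.span (ZMod 2)) (congrArg _ ?_)
    ext a
    simp [g]
  have hbetti : ∀ k, D.betti μ ε A B k = ∑ m ∈ M, if g m = (k, True, True) then 1 else 0 := by
    intro k
    have hk : degreeShift (k + 1, True, True) = (k, True, True) := by simp [degreeShift]
    have := quotientDim_graded hd (H.linDiff_linDiff hbd) W M hcard hspan hM (k + 1, True, True)
    rw [hk] at this
    rw [betti, hpiece, hpiece, this, Nat.card_eq_fintype_card, Fintype.card_subtype, Finset.card_filter]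
    exact Finset.sum_coe_sort M fun m => if g m = (k, True, True) then 1 else 0
  have hterm : ∀ k, (D.betti μ ε A B k : ℤ[T;T⁻¹]) * T k =
      ∑ m ∈ M, if g m = (k, True, True) then T (m.deg μ) else 0 := by
    intro k
    rw [hbetti, Nat.cast_sum, Finset.sum_mul]
    refine Finset.sum_congr rfl fun m _ => ?_
    split_ifs with h
    · have : m.deg μ = k := congrArg Prod.fst h
      simp [this]
    · simp
  rw [chekanovPoly]
  simp only [hterm]
  rw [finsum_sum_comm]
  · refine Finset.sum_congr rfl fun m _ => ?_
    rw [finsum_eq_single _ (m.deg μ)]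
    · refine (if_congr ?_ rfl rfl).trans (by rw [vertexTerm])
      simp [g]
    · intro k hk
      rw [if_neg]
      exact fun h => hk (congrArg Prod.fst h).symm
  · intro m _
    refine (Set.finite_singleton (m.deg μ)).subset fun k hk => ?_
    by_contra h
    refine hk (if_neg fun h' => h (Set.mem_singleton_iff.2 (congrArg Prod.fst h').symm))

end Polynomials

section Closure
variable {V : Word Unit} {p : Bool} (hV : Word.InRange 2 V) (h : Tang p V)

/-- The positions of the row crossings. -/
def Word.rowIndices (V : Word Unit) : List ℕ := (Word.rows (Word.number 0 V)).map Prod.snd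

/-- The positions of the crossings of the resolved right cusps. -/
def Word.cuspIndices (V : Word Unit) : List ℕ := (Word.cusps (Word.number 0 V)).map Prod.snd

theorem Word.mem_rowIndices {i : ℕ} : i ∈ V.rowIndices ↔ ∃ k, Ev.row k i ∈ Word.number 0 V := by
  simp only [rowIndices, List.mem_map]
  constructor
  · rintro ⟨r, hr, rfl⟩; exact ⟨r.1, mem_rows.1 hr⟩
  · rintro ⟨k, hk⟩; exact ⟨(k, i), mem_rows.2 hk, rfl⟩

theorem Word.mem_cuspIndices {i : ℕ} : i ∈ V.cuspIndices ↔ ∃ k, Ev.cusp k i ∈ Word.number 0 V := by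
  simp only [cuspIndices, List.mem_map]
  constructor
  · rintro ⟨r, hr, rfl⟩; exact ⟨r.1, mem_cusps.1 hr⟩
  · rintro ⟨k, hk⟩; exact ⟨(k, i), mem_cusps.2 hk, rfl⟩

include hV in
theorem Word.mem_indices {i : ℕ} (hi : i ∈ Word.indices (Word.number 0 V)) :
    i < (Word.events V).length ∧ ∃ b k, V.closure.events[i]? = some (.cross b k) := by
  have : ∃ k, Ev.row k i ∈ Word.number 0 V ∨ Ev.col k i ∈ Word.number 0 V ∨ Ev.cusp k i ∈ Word.number 0 V := by
    simp only [indices, List.mem_append, List.mem_map] at hi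
    rcases hi with ⟨r, hr, rfl⟩ | ⟨r, hr, rfl⟩ | ⟨r, hr, rfl⟩
    · exact ⟨r.1, .inl (mem_rows.1 hr)⟩
    · exact ⟨r.1, .inr (.inl (mem_cols.1 hr))⟩
    · exact ⟨r.1, .inr (.inr (mem_cusps.1 hr))⟩
  obtain ⟨k, hk⟩ := this
  have := Word.event_of_mem hV hk
  exact ⟨this.2.1, _, _, this.2.2⟩

include hV in

/-- The two crossings of the transition tangle and any of the crossings of the tangle are distinct
vertices. -/
theorem Word.nodup_ends {l : List ℕ} (hl : l.Sublist (Word.indices (Word.number 0 V))) :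
    ((Word.events V).length :: ((Word.events V).length + 1) :: l).Nodup ∧
    ∀ e ∈ (Word.events V).length :: ((Word.events V).length + 1) :: l,
      ∃ b k, V.closure.events[e]? = some (.cross b k) := by
  have h1 := (Word.nodup_indices 0 V).sublist hl
  have h2 : ∀ i ∈ l, i < (Word.events V).length ∧ ∃ b k, V.closure.events[i]? = some (.cross b k) :=
    fun i hi => Word.mem_indices hV (hl.subset hi)
  constructor
  · refine List.nodup_cons.2 ⟨fun hm => ?_, List.nodup_cons.2 ⟨fun hm => ?_, h1⟩⟩
    · rcases List.mem_cons.1 hm with hm | hm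
      · omega
      · have := (h2 _ hm).1; omega
    · have := (h2 _ hm).1; omega
  · intro e he
    rcases List.mem_cons.1 he with rfl | he
    · exact (Word.normalVertex V).2
    · rcases List.mem_cons.1 he with rfl | he
      · exact (Word.specialVertex V).2
      · exact (h2 e he).2

include hV h in

/-- There are as many column crossings as right cusps, and the transition tangle has two crossings.
-/
theorem Word.card_vertices : 2 * V.cuspIndices.length + V.rowIndices.length + 2 ≤
    Fintype.card V.closure.Vertex := by
  have h1 := Word.nodup_ends hV (List.Sublist.refl _)
  have h2 := card_verticesIn h1.1 h1.2
  have h3 := Finset.card_le_univ (V.closure.verticesIn ((Word.events V).length ::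
    ((Word.events V).length + 1) :: Word.indices (Word.number 0 V)))
  rw [h2] at h3
  have h4 := Word.length_cols_eq h
  have h5 : ∀ W : Word ℕ, W.erase = V → W.cols.length = W.cusps.length := fun W hW => by
    rw [← Word.length_cols_erase, ← Word.length_cusps_erase, hW, h4]
  have h6 := h5 (Word.number 0 V) (by rw [Word.erase_number, Word.erase_unit])
  simp only [Word.indices, List.length_cons, List.length_append, List.length_map] at h3
  simp only [Word.cuspIndices, Word.rowIndices, List.length_map]
  omega

theorem Word.sublist_rowIndices (V : Word Unit) : V.rowIndices.Sublist (Word.indices (Word.number 0 V)) :=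
  List.sublist_append_left _ _

theorem Word.sublist_cuspIndices (V : Word Unit) : V.cuspIndices.Sublist (Word.indices (Word.number 0 V)) :=
  (List.sublist_append_right _ _).trans (List.sublist_append_right _ _)

variable {μ : Seg → ℤ} {ε : V.closure.Alg →ₐ[ZMod 2] ZMod 2} {A B : Set Seg}

include hV h in

/-- An augmentation vanishes on the right cusps, because these have degree one. -/
theorem Word.aug_cusp (hμ : V.closure.IsMaslov μ) (hε : V.closure.IsAugmentation μ ε) (v : V.closure.Vertex) (k : ℤ)
    (hk : Ev.cusp k v.1 ∈ Word.number 0 V) : ε v.gen = 0 := by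
  have H := Word.resolved hV h.gain_eq_zero
  obtain ⟨h0, h1, h2⟩ := Word.event_of_mem hV (.inr (.inr hk))
  have h3 := (Word.number_spec V.drop_closure hV hk).2.2.2
  refine hε.degree v ?_
  rw [(v.normal μ h2).2.2]
  have j0 := hμ _ _ _ (.cross k.toNat h2)
  have j1 := hμ _ _ _ (.cross (k.toNat + 1) h2)
  have j2 := hμ _ _ _ (.rightCusp h3)
  rw [H.lineAfter_of_le h1.le] at j0 j1
  simp only [swap, if_true] at j0 j1
  rw [if_neg (by omega)] at j1
  omega

open Classical in
/-- The contribution `vertexTerm` of a row crossing `(k, t)`, at which the strands `k` and `k + 1` of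
the line `t` cross. -/
noncomputable def Word.rowTerm (μ : Seg → ℤ) (A B : Set Seg) (r : ℤ × ℕ) : ℤ[T;T⁻¹] :=
  if (r.2, r.1.toNat + 1) ∈ A ∧ (r.2, r.1.toNat) ∈ B then
    T (μ (r.2, r.1.toNat + 1) - μ (r.2, r.1.toNat)) else 0

include hV in
theorem Word.sum_rows (μ : Seg → ℤ) (A B : Set Seg) :
    (V.rowIndices.map (weight fun m : V.closure.Vertex => vertexTerm μ A B m)).sum =
      ((Word.rows (Word.number 0 V)).map (Word.rowTerm μ A B)).sum := by
  rw [Word.rowIndices, List.map_map]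
  congr 1
  refine List.map_congr_left fun r hr => ?_
  obtain ⟨-, -, h2⟩ := Word.event_of_mem hV (.inl (Word.mem_rows.1 hr))
  obtain ⟨v, hv⟩ : ∃ v : V.closure.Vertex, v.1 = r.2 := ⟨⟨_, _, _, h2⟩, rfl⟩
  rw [← hv] at h2
  obtain ⟨h3, h4, h5⟩ := v.normal μ h2
  rw [Function.comp_apply, ← hv, ← weight_eq, vertexTerm, h3, h4, h5, Word.rowTerm, hv]

include hV h in

/-- After a final row crossing, the differential of the normal crossing of the transition tangle is
the special crossing, and only the row crossings contribute to the polynomial. -/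
theorem Word.chekanovPoly_of_row (hK : V.HasFinalRow) (hμ : V.closure.IsMaslov μ) (h01 : μ (0, 0) = μ (0, 1))
    (hε : V.closure.IsAugmentation μ ε)
    (hA : V.closure.IsColoring fun s => s ∈ A) (hB : V.closure.IsColoring fun s => s ∈ B) :
    V.closure.chekanovPoly μ ε A B = ((Word.rows (Word.number 0 V)).map (Word.rowTerm μ A B)).sum := by
  classical
  have H := Word.resolved hV h.gain_eq_zero
  have hbd := (comp_differential_iff ε).1 hε.comp_differential
  have hc := Word.aug_cusp hV h hμ hε
  have hs : ε (Word.specialVertex V).gen = 0 :=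
    hε.degree _ (by rw [(H.specialEnd_vertex hμ hA _ rfl).1]; omega)
  have n1 := Word.nodup_ends hV V.sublist_cuspIndices
  have n2 := Word.nodup_ends hV V.sublist_rowIndices
  have n1' : ((Word.events V).length :: V.cuspIndices).Nodup :=
    n1.1.sublist ((List.sublist_cons_self _ _).cons_cons _)
  have n2' : (V.rowIndices).Nodup := n2.1.sublist ((List.sublist_cons_self _ _).trans (List.sublist_cons_self _ _))
  -- a basis is formed by the right cusps and the normal crossing of the transition tangle, their
  -- differentials, and the row crossings
  set W := V.closure.verticesIn ((Word.events V).length :: V.cuspIndices) with hW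
  set M := V.closure.verticesIn V.rowIndices with hM
  set U := Submodule.span (ZMod 2) ((fun b => Finsupp.single b 1) '' (W : Set V.closure.Vertex)) ⊔
      (Submodule.span (ZMod 2) ((fun b => Finsupp.single b 1) '' (W : Set V.closure.Vertex))).map
        (V.closure.linDiff ε) with hU
  have hWU : ∀ v ∈ W, Finsupp.single v 1 ∈ U ∧ V.closure.linDiff ε (Finsupp.single v 1) ∈ U := by
    intro v hv
    have : Finsupp.single v 1 ∈ Submodule.span (ZMod 2)
        ((fun b : V.closure.Vertex => Finsupp.single b (1 : ZMod 2)) '' (W : Set V.closure.Vertex)) :=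
      Submodule.subset_span ⟨v, hv, rfl⟩
    exact ⟨Submodule.mem_sup_left this, Submodule.mem_sup_right (Submodule.mem_map_of_mem this)⟩
  have hU1 : ∀ v : V.closure.Vertex, ∀ k : ℤ, Ev.cusp k v.1 ∈ Word.number 0 V → v ∈ W := fun v k hk =>
    mem_verticesIn.2 (List.mem_cons_of_mem _ (Word.mem_cuspIndices.2 ⟨k, hk⟩))
  have hnW : Word.normalVertex V ∈ W := mem_verticesIn.2 List.mem_cons_self
  have hMU : ∀ m ∈ M, Finsupp.single m 1 ∈ U ⊔ Submodule.span (ZMod 2)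
        ((fun b : V.closure.Vertex => Finsupp.single b (1 : ZMod 2)) '' (M : Set V.closure.Vertex)) := fun m hm =>
    Submodule.mem_sup_right (Submodule.subset_span ⟨m, hm, rfl⟩)
  have hsU := Word.special_of_normal hV h hbd hc hs (fun v k hk => (hWU v (hU1 v k hk)).1)
    (fun v k hk => (hWU v (hU1 v k hk)).2) hK (hWU _ hnW).2
  rw [chekanovPoly_eq_sum H hμ hε hA hB W M ?_ ?_ ?_, ← Word.sum_rows hV,
    ← sum_verticesIn n2' (fun e he => n2.2 e (by simp [he]))]
  · exact Finset.sum_congr rfl fun m _ => weight_eq (fun m => vertexTerm μ A B m) m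
  · rw [card_verticesIn n1' (fun e he => n1.2 e (by
      rcases List.mem_cons.1 he with he | he <;> simp [he])), card_verticesIn n2' (fun e he => n2.2 e (by simp [he]))]
    have := Word.card_vertices hV h
    simp only [List.length_cons]; omega
  · intro v
    rcases H.le_of_vertex v with hv | hv | hv
    · refine Word.single_mem hV h hbd hc hs (fun v k hk => Submodule.mem_sup_left (hWU v (hU1 v k hk)).1)
        (fun v k hk => Submodule.mem_sup_left (hWU v (hU1 v k hk)).2) (Submodule.mem_sup_left hsU)
        (fun v k hk => hMU v (mem_verticesIn.2 (Word.mem_rowIndices.2 ⟨k, hk⟩))) v hv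
    · obtain rfl : v = Word.normalVertex V := Subtype.ext hv
      exact Submodule.mem_sup_left (hWU _ hnW).1
    · obtain rfl : v = Word.specialVertex V := Subtype.ext hv
      exact Submodule.mem_sup_left hsU
  · intro m hm
    obtain ⟨k, hk⟩ := Word.mem_rowIndices.1 (mem_verticesIn.1 hm)
    exact Word.linDiff_mem hV h hbd hc hs (fun v k hk => (hWU v (hU1 v k hk)).1)
      (fun v k hk => (hWU v (hU1 v k hk)).2) hsU m (Word.event_of_mem hV (.inl hk)).2.1

open Classical in
include hV h in
/-- If the tangle is trivial or ends with a vertical crossing, the two crossings of the transition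
tangle survive to the homology. -/
theorem Word.chekanovPoly_of_vertical (hK : V = [] ∨ ∃ T, Tang false T ∧ Relation.ReflTransGen Slide (vertSum T) V)
    (hμ : V.closure.IsMaslov μ) (h01 : μ (0, 0) = μ (0, 1))
    (hε : V.closure.IsAugmentation μ ε)
    (hA : V.closure.IsColoring fun s => s ∈ A) (hB : V.closure.IsColoring fun s => s ∈ B) :
    V.closure.chekanovPoly μ ε A B = (if (0, 1) ∈ A ∧ (0, 0) ∈ B then T (-1) + 1 else 0) +
      ((Word.rows (Word.number 0 V)).map (Word.rowTerm μ A B)).sum := by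
  have H := Word.resolved hV h.gain_eq_zero
  have hbd := (comp_differential_iff ε).1 hε.comp_differential
  have hc := Word.aug_cusp hV h hμ hε
  obtain ⟨s1, s2, s3⟩ := H.specialEnd_vertex hμ hA (Word.specialVertex V) rfl
  obtain ⟨s1', s2', s3'⟩ := H.specialEnd_vertex hμ hB (Word.specialVertex V) rfl
  obtain ⟨t1, t2, t3⟩ := H.normalEnd_vertex hμ hA (Word.normalVertex V) rfl
  obtain ⟨t1', t2', t3'⟩ := H.normalEnd_vertex hμ hB (Word.normalVertex V) rfl
  have hs : ε (Word.specialVertex V).gen = 0 := hε.degree _ (by rw [s1]; omega)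
  have n1 := Word.nodup_ends hV V.sublist_cuspIndices
  have n2 := Word.nodup_ends hV V.sublist_rowIndices
  have n1' : (V.cuspIndices).Nodup := n1.1.sublist ((List.sublist_cons_self _ _).trans (List.sublist_cons_self _ _))
  -- a basis is formed by the right cusps, their differentials, the two crossings of the transition
  -- tangle, and the row crossings
  set W := V.closure.verticesIn V.cuspIndices with hW
  set M := V.closure.verticesIn ((Word.events V).length :: ((Word.events V).length + 1) :: V.rowIndices) with hM
  set U := Submodule.span (ZMod 2) ((fun b => Finsupp.single b 1) '' (W : Set V.closure.Vertex)) ⊔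
      (Submodule.span (ZMod 2) ((fun b => Finsupp.single b 1) '' (W : Set V.closure.Vertex))).map
        (V.closure.linDiff ε) with hU
  have hWU : ∀ v ∈ W, Finsupp.single v 1 ∈ U ∧ V.closure.linDiff ε (Finsupp.single v 1) ∈ U := by
    intro v hv
    have : Finsupp.single v 1 ∈ Submodule.span (ZMod 2)
        ((fun b : V.closure.Vertex => Finsupp.single b (1 : ZMod 2)) '' (W : Set V.closure.Vertex)) :=
      Submodule.subset_span ⟨v, hv, rfl⟩
    exact ⟨Submodule.mem_sup_left this, Submodule.mem_sup_right (Submodule.mem_map_of_mem this)⟩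
  have hU1 : ∀ v : V.closure.Vertex, ∀ k : ℤ, Ev.cusp k v.1 ∈ Word.number 0 V → v ∈ W := fun v k hk =>
    mem_verticesIn.2 (Word.mem_cuspIndices.2 ⟨k, hk⟩)
  have hdU := Word.linDiff_mem_vertical hV h hbd hc (fun v k hk => (hWU v (hU1 v k hk)).1)
    (fun v k hk => (hWU v (hU1 v k hk)).2) hK
  have hMU : ∀ m ∈ M, Finsupp.single m 1 ∈ U ⊔ Submodule.span (ZMod 2)
        ((fun b : V.closure.Vertex => Finsupp.single b (1 : ZMod 2)) '' (M : Set V.closure.Vertex)) := fun m hm =>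
    Submodule.mem_sup_right (Submodule.subset_span ⟨m, hm, rfl⟩)
  have hnM : Word.normalVertex V ∈ M := mem_verticesIn.2 List.mem_cons_self
  have hsM : Word.specialVertex V ∈ M := mem_verticesIn.2 (List.mem_cons_of_mem _ List.mem_cons_self)
  rw [chekanovPoly_eq_sum H hμ hε hA hB W M ?_ ?_ ?_, ← Word.sum_rows hV]
  · have := sum_verticesIn n2.1 n2.2 (weight fun m : V.closure.Vertex => vertexTerm μ A B m)
    rw [List.map_cons, List.map_cons, List.sum_cons, List.sum_cons] at this
    rw [Finset.sum_congr rfl fun m _ => weight_eq (fun m => vertexTerm μ A B m) m, this, ← add_assoc]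
    congr 1
    have e1 := weight_eq (fun m : V.closure.Vertex => vertexTerm μ A B m) (Word.normalVertex V)
    have e2 := weight_eq (fun m : V.closure.Vertex => vertexTerm μ A B m) (Word.specialVertex V)
    simp only [Word.normalVertex] at e1
    simp only [Word.specialVertex] at e2
    rw [← e1, ← e2]
    change vertexTerm μ A B (Word.normalVertex V) + vertexTerm μ A B (Word.specialVertex V) = _
    rw [vertexTerm, vertexTerm, s1, t1, ← h01, sub_self, zero_sub, T_zero]
    simp only [s2, t2, s3', t3']
    split_ifs
    · rw [add_comm]
    · rw [add_zero]
  · rw [card_verticesIn n1' (fun e he => n1.2 e (by simp [he])), card_verticesIn n2.1 n2.2]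
    have := Word.card_vertices hV h
    simp only [List.length_cons]; omega
  · intro v
    rcases H.le_of_vertex v with hv | hv | hv
    · refine Word.single_mem hV h hbd hc hs (fun v k hk => Submodule.mem_sup_left (hWU v (hU1 v k hk)).1)
        (fun v k hk => Submodule.mem_sup_left (hWU v (hU1 v k hk)).2) (hMU _ hsM)
        (fun v k hk => hMU _ (mem_verticesIn.2 (List.mem_cons_of_mem _ (List.mem_cons_of_mem _
          (Word.mem_rowIndices.2 ⟨k, hk⟩))))) v hv
    · obtain rfl : v = Word.normalVertex V := Subtype.ext hv
      exact hMU _ hnM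
    · obtain rfl : v = Word.specialVertex V := Subtype.ext hv
      exact hMU _ hsM
  · intro m hm
    rcases H.le_of_vertex m with hv | hv | hv
    · exact hdU.1 m hv
    · obtain rfl : m = Word.normalVertex V := Subtype.ext hv
      exact hdU.2
    · rw [linDiff_single, H.map_bdry_specialEnd _ m hv]
      exact Submodule.zero_mem _

end Closure
end SolidTorus

namespace SolidTorus
open Diagram LaurentPolynomial
open scoped LaurentPolynomial

/-! ### Potentials, colorings and the polynomials -/

section Labels
variable {D : Diagram} {μ : Seg → ℤ}

theorem addRight_one_zpow (c m : ℤ) : (Equiv.addRight (1 : ℤ) ^ c) m = m + c := by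
  induction c using Int.induction_on generalizing m with
  | zero => simp
  | succ i ih => rw [zpow_add_one, Equiv.Perm.mul_apply, ih, Equiv.coe_addRight]; ring
  | pred i ih =>
    rw [zpow_sub_one, Equiv.Perm.mul_apply, ih]
    change m - 1 + -(i : ℤ) = _
    ring

theorem Diagram.isMaslov_iff : D.IsMaslov μ ↔ D.IsLabeling (Equiv.addRight (1 : ℤ)) μ := by
  refine forall_congr' fun s => forall_congr' fun s' => forall_congr' fun c => imp_congr_right fun _ => ?_
  rw [addRight_one_zpow]

theorem Diagram.isColoring_iff {κ : Type} {col : Seg → κ} : D.IsColoring col ↔ D.IsLabeling 1 col := by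
  refine forall_congr' fun s => forall_congr' fun s' => forall_congr' fun c => imp_congr_right fun _ => ?_
  rw [one_zpow]
  exact eq_comm

/-- The component through a segment. -/
def Diagram.componentOf (D : Diagram) (s : Seg) : Set Seg := {s' | D.SameComponent s s'}

theorem Diagram.componentOf_eq_iff {s s' : Seg} : D.componentOf s = D.componentOf s' ↔ D.SameComponent s s' := by
  constructor
  · intro h
    have : s' ∈ D.componentOf s' := Relation.EqvGen.refl _
    rwa [← h] at this
  · intro h
    ext x
    exact ⟨fun hx => (h.symm).trans _ _ _ hx, fun hx => h.trans _ _ _ hx⟩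

theorem Diagram.isColoring_componentOf : D.IsColoring D.componentOf := fun _ _ c h =>
  componentOf_eq_iff.2 (.rel _ _ ⟨c, h⟩)

variable {X : Type} {σ : Equiv.Perm X} {V : Word Unit} {p : Bool}

/-- The labels along a part of a diagram that is a tangle, in terms of the labels of its two strands
at the left end. -/
theorem Tang.labels_rows (h : Tang p V) (hV : Word.InRange 2 V) {F : Seg → X} (hF : D.IsLabeling σ F)
    {t : ℕ} {E' : List Event} (hE : D.events.drop t = Word.events V ++ E')
    (hl : ∀ e < t + (Word.events V).length, D.lineAfter e = e + 1) :
    (Word.rows (Word.number t V)).map (fun r => (F (r.2, r.1.toNat), F (r.2, r.1.toNat + 1))) =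
      h.record σ (F (t, 0)) (F (t, 1)) ∧
    (∀ k i, Ev.col k i ∈ Word.number t V → F (i, k.toNat) = F (i, k.toNat + 1)) ∧
    F (t + (Word.events V).length, 0) = F (t, if p then 1 else 0) ∧
    F (t + (Word.events V).length, 1) = F (t, if p then 0 else 1) := by
  obtain ⟨h1, h2, h3⟩ := h.line_labels hV (σ := σ) hE (lab := lineLabels F)
    fun e _ he A hA => hF.labelStep hA (hl e he)
  have hk : ∀ (i : ℕ) {k : ℤ}, 0 ≤ k →
      lineLabels F i k = F (i, k.toNat) ∧ lineLabels F i (k + 1) = F (i, k.toNat + 1) := by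
    intro i k hk
    lift k to ℕ using hk
    exact ⟨lineLabels_natCast F i k, lineLabels_natCast_succ F i k⟩
  refine ⟨?_, fun k i hi => ?_, ?_, ?_⟩
  · rw [lineLabels_zero, lineLabels_one] at h1
    rw [← h1]
    refine List.map_congr_left fun r hr => ?_
    have := hk r.2 (Word.number_spec hE hV (Word.mem_rows.1 hr)).2.1
    rw [this.1, this.2]
  · have h0 := hk i (Word.number_spec hE hV hi).2.1
    rw [← h0.1, ← h0.2, h2 k i hi]
  · rw [← lineLabels_zero F, h3]
    cases p
    · simp [lineLabels_zero]
    · simp [swapZ, lineLabels_one]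
  · rw [← lineLabels_one F, h3]
    cases p
    · simp [lineLabels_one]
    · simp [swapZ, lineLabels_zero]

/-- The labels along the closure of a tangle. If the parity is odd, the two strands at `x = 0` have
the same label. -/
theorem Tang.labels_closure (h : Tang p V) (hV : Word.InRange 2 V) {F : Seg → X} (hF : V.closure.IsLabeling σ F) :
    (Word.rows (Word.number 0 V)).map (fun r => (F (r.2, r.1.toNat), F (r.2, r.1.toNat + 1))) =
      h.record σ (F (0, 0)) (F (0, 1)) ∧
    (∀ k i, Ev.col k i ∈ Word.number 0 V → F (i, k.toNat) = F (i, k.toNat + 1)) ∧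
    (p = true → F (0, 0) = F (0, 1)) := by
  have H := Word.resolved hV h.gain_eq_zero
  obtain ⟨h1, h2, h3, -⟩ := h.labels_rows hV hF V.drop_closure fun e he => H.lineAfter_of_le (by omega)
  refine ⟨h1, h2, ?_⟩
  rintro rfl
  rw [zero_add, H.labeling_closed hF] at h3
  simpa using h3

/-- The sum of the powers given by the degrees of the row crossings, for a potential that is equal
on the two strands at the left end. It depends on the tangle alone. -/
noncomputable def Tang.rowPoly (h : Tang p V) : ℤ[T;T⁻¹] :=
  ((h.record (Equiv.addRight (1 : ℤ)) 0 0).map fun r => T (r.2 - r.1)).sum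

/-- The sum over the row crossings of a tangle is `Tang.rowPoly`, in any diagram that contains the
tangle and for any potential that is equal on its two strands at the left end. -/
theorem Tang.sum_rowTerm (h : Tang p V) (hV : Word.InRange 2 V) (hμ : D.IsMaslov μ)
    {t : ℕ} {E' : List Event} (hE : D.events.drop t = Word.events V ++ E')
    (hl : ∀ e < t + (Word.events V).length, D.lineAfter e = e + 1) (h01 : μ (t, 0) = μ (t, 1)) :
    ((Word.rows (Word.number t V)).map (Word.rowTerm μ Set.univ Set.univ)).sum = h.rowPoly := by
  have hF : D.IsLabeling (Equiv.addRight (1 : ℤ)) fun s => μ s - μ (t, 0) := isMaslov_iff.1 fun s s' c hs => by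
    rw [hμ s s' c hs]; ring
  have h1 := (h.labels_rows hV hF hE hl).1
  rw [← h01, sub_self] at h1
  rw [Tang.rowPoly, ← h1, List.map_map]
  congr 1
  refine List.map_congr_left fun r _ => ?_
  simp [Word.rowTerm]

end Labels

section Polynomials
variable {V : Word Unit} {p : Bool} (hV : Word.InRange 2 V) (h : Tang p V)

include hV h in
theorem Word.exists_isMaslov : ∃ μ, V.closure.IsMaslov μ ∧ μ (0, 0) = 0 ∧ μ (0, 1) = 0 := by
  obtain ⟨F, hF, h0, h1⟩ := h.exists_labeling hV (Equiv.addRight (1 : ℤ)) (a := 0) (b := 0) fun _ => rfl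
  exact ⟨F, isMaslov_iff.2 hF, h0, h1⟩

include hV h in

/-- The column crossings have degree zero, and their two strands lie on one component. -/
theorem Word.isAugmentation_standardAug {μ : Seg → ℤ} (hμ : V.closure.IsMaslov μ) :
    V.closure.IsAugmentation μ V.standardAug := by
  classical
  have key : ∀ v : V.closure.Vertex, V.standardAug v.gen ≠ 0 →
      ∃ k, Ev.col k v.1 ∈ Word.number 0 V := by
    intro v hv
    by_contra hk
    rw [Word.standardAug_gen, if_neg hk] at hv
    exact hv rfl
  refine ⟨(comp_differential_iff _).2 (Word.standardAug_bdry hV h), fun v hv => ?_, fun v hv => ?_⟩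
  · by_contra hne
    obtain ⟨k, hk⟩ := key v hne
    have h1 := (h.labels_closure hV (isMaslov_iff.1 hμ)).2.1 k v.1 hk
    rw [(v.normal μ (Word.event_of_mem hV (.inr (.inl hk))).2.2).2.2, h1, sub_self] at hv
    exact hv rfl
  · by_contra hne
    obtain ⟨k, hk⟩ := key v hne
    have h1 := (h.labels_closure hV (isColoring_iff.1 isColoring_componentOf)).2.1 k v.1 hk
    obtain ⟨h2, h3, -⟩ := v.normal 0 (Word.event_of_mem hV (.inr (.inl hk))).2.2
    rw [h2, h3] at hv
    exact hv (componentOf_eq_iff.1 h1.symm)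

theorem Diagram.isColoring_univ (D : Diagram) : D.IsColoring fun s => s ∈ (Set.univ : Set Seg) :=
  fun _ _ _ _ => rfl

/-- The polynomial of a knot is the sum over its row crossings. -/
theorem Word.knotPolys_closure (hV : Word.InRange 2 V) (h : Tang true V) (hK : V.HasFinalRow) {P : ℤ[T;T⁻¹]}
    (hP : ∀ μ, V.closure.IsMaslov μ → μ (0, 0) = μ (0, 1) →
      ((Word.rows (Word.number 0 V)).map (Word.rowTerm μ Set.univ Set.univ)).sum = P) :
    V.closure.knotPolys = {P} := by
  have h01 : ∀ {μ : Seg → ℤ}, V.closure.IsMaslov μ → μ (0, 0) = μ (0, 1) := fun hμ =>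
    (h.labels_closure hV (isMaslov_iff.1 hμ)).2.2 rfl
  have hpoly : ∀ {μ ε}, V.closure.IsMaslov μ → V.closure.IsAugmentation μ ε →
      V.closure.chekanovPoly μ ε Set.univ Set.univ = P := fun {μ ε} hμ hε => by
    rw [Word.chekanovPoly_of_row hV h hK hμ (h01 hμ) hε (isColoring_univ _) (isColoring_univ _),
      hP μ hμ (h01 hμ)]
  refine Set.eq_singleton_iff_unique_mem.2 ⟨?_, ?_⟩
  · obtain ⟨μ, hμ, -⟩ := Word.exists_isMaslov hV h
    have hε := Word.isAugmentation_standardAug hV h hμ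
    exact ⟨μ, _, hμ, hε, (hpoly hμ hε).symm⟩
  · rintro _ ⟨μ, ε, hμ, hε, rfl⟩
    exact hpoly hμ hε

open Classical in

/-- For a link of two components, all row crossings are mixed, so that each of them contributes to
one of the two split polynomials. The term `δ` of the crossings of the transition tangle belongs to
`χ⁻`. -/
theorem Word.chi_closure (hV : Word.InRange 2 V) (h : Tang false V) {δ : ℤ[T;T⁻¹]}
    (hpoly : ∀ (μ : Seg → ℤ) (ε : V.closure.Alg →ₐ[ZMod 2] ZMod 2) (A B : Set Seg), V.closure.IsMaslov μ →
      μ (0, 0) = μ (0, 1) → V.closure.IsAugmentation μ ε →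
      V.closure.IsColoring (fun s => s ∈ A) → V.closure.IsColoring (fun s => s ∈ B) →
      V.closure.chekanovPoly μ ε A B = (if (0, 1) ∈ A ∧ (0, 0) ∈ B then δ else 0) +
      ((Word.rows (Word.number 0 V)).map (Word.rowTerm μ A B)).sum) :
    ∃ chiP chiM : ℤ[T;T⁻¹], chiPlus V.closure = {chiP} ∧ chiMinus V.closure = {chiM} ∧
      chiP + chiM = δ + h.rowPoly := by
  have H := Word.resolved hV h.gain_eq_zero
  obtain ⟨μ, hμ, h0, h1⟩ := Word.exists_isMaslov hV h
  -- the two strands at `x = 0` can be given different colors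
  have hne : ¬ V.closure.SameComponent (0, 0) (0, 1) := by
    intro hs
    obtain ⟨F, hF, hF0, hF1⟩ := h.exists_labeling hV (1 : Equiv.Perm Bool) (a := false) (b := true) (by simp)
    have := (isColoring_iff.2 hF).eq hs
    rw [hF0, hF1] at this
    exact Bool.false_ne_true this
  have hsplit : ∀ i j, V.closure.splitPolys i j =
      {(if (0, 1) ∈ V.closure.component i ∧ (0, 0) ∈ V.closure.component j then δ else 0) +
        ((Word.rows (Word.number 0 V)).map
          (Word.rowTerm μ (V.closure.component i) (V.closure.component j))).sum} := by
    intro i j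
    refine Set.eq_singleton_iff_unique_mem.2 ⟨?_, ?_⟩
    · refine ⟨μ, V.standardAug, hμ, fun l hl => ?_, Word.isAugmentation_standardAug hV h hμ, ?_⟩
      · have hl : l < 2 := hl
        interval_cases l
        · exact h0
        · exact h1
      · exact (hpoly _ _ _ _ hμ (h0.trans h1.symm) (Word.isAugmentation_standardAug hV h hμ)
          (isColoring_component i) (isColoring_component j)).symm
    · rintro _ ⟨μ', ε, hμ', h', hε, rfl⟩
      have h0' : μ' (0, 0) = 0 := h' 0 (show 0 < 2 by norm_num)
      have h1' : μ' (0, 1) = 0 := h' 1 (show 1 < 2 by norm_num)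
      rw [hpoly _ _ _ _ hμ' (h0'.trans h1'.symm) hε (isColoring_component i) (isColoring_component j)]
      congr 2
      refine List.map_congr_left fun r hr => ?_
      have e1 := (h.labels_closure hV (isMaslov_iff.1 hμ)).1
      have e2 := (h.labels_closure hV (isMaslov_iff.1 hμ')).1
      rw [h0, h1] at e1
      rw [h0', h1', ← e1] at e2
      have := List.map_inj_left.1 e2 r hr
      simp only [Prod.mk.injEq] at this
      rw [Word.rowTerm, Word.rowTerm, this.1, this.2]
  refine ⟨_, _, hsplit 0 1, hsplit 1 0, ?_⟩
  have m00 : ((0, 0) : Seg) ∈ V.closure.component 0 := Relation.EqvGen.refl _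
  have m11 : ((0, 1) : Seg) ∈ V.closure.component 1 := Relation.EqvGen.refl _
  have m10 : ((0, 1) : Seg) ∉ V.closure.component 0 := hne
  rw [if_neg (fun hh => m10 hh.1), if_pos ⟨m11, m00⟩, zero_add, add_left_comm,
    ← h.sum_rowTerm hV hμ V.drop_closure (fun e he => H.lineAfter_of_le (by omega)) (h0.trans h1.symm)]
  congr 1
  rw [← List.sum_map_add]
  congr 1
  refine List.map_congr_left fun r hr => ?_
  have hcol := isColoring_iff.1 (isColoring_componentOf (D := V.closure))
  -- the strands of a row crossing are colored by the two components, in one order or the other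
  have htr := h.record_translates (1 : Equiv.Perm (Set Seg)) _ _ _ (by
    rw [← (h.labels_closure hV hcol).1]
    exact List.mem_map_of_mem hr)
  have hcomp : ∀ (s : Seg) (i : ℕ), s ∈ V.closure.component i ↔
      V.closure.componentOf s = V.closure.componentOf (0, i) := fun s i =>
    ⟨fun hs => (componentOf_eq_iff.2 hs).symm, fun hs => componentOf_eq_iff.1 hs.symm⟩
  have hne' : V.closure.componentOf (0, 0) ≠ V.closure.componentOf (0, 1) := fun hh => hne (componentOf_eq_iff.1 hh)
  simp only [Word.rowTerm, hcomp]
  obtain ⟨a, b, hab | hab⟩ := htr <;> simp only [one_zpow, Equiv.Perm.coe_one, id_eq, Prod.mk.injEq] at hab <;>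
    rw [hab.1, hab.2] <;> simp [hne', hne'.symm]

end Polynomials

namespace Word

theorem hasFinalRow_append (P : Word Unit) {V : Word Unit} (h : V.HasFinalRow) : HasFinalRow (P ++ V) := by
  obtain ⟨P', Q, q, hQ, rfl⟩ := h
  exact ⟨P ++ P', Q, q, hQ, by simp⟩

/-- The last level of the tangle has a row crossing if its entry is not zero. -/
theorem hasFinalRow_tangleWord {a v p : ℕ → ℕ} {i l : ℕ} (hi : 1 ≤ a i)
    (ha : ∀ j, i < j → j ≤ i + l → a j % 2 = 0)
    (hp : ∀ j, i ≤ j → j < i + l → p j ≤ a j) : HasFinalRow (tangleWord a v p i l) := by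
  have hrow : ∀ b, 1 ≤ b → horizontalWord b = .row 0 () :: horizontalWord (b - 1) := fun b hb => by
    obtain ⟨b, rfl⟩ := Nat.exists_eq_add_of_le' hb
    rfl
  cases l with
  | zero => exact ⟨[], _, _, Tang.horizontal (a i - 1), hrow _ hi⟩
  | succ l =>
    have h1 := tang_tangleWord (a := a) (v := v) (p := p) (i := i + 1) (l := l)
      (fun j h h' => ha j (by omega) (by omega)) (fun j h h' => hp j (by omega) (by omega))
    rw [ha (i + 1) (by omega) (by omega)] at h1
    rw [tangleWord, addLevelWord]
    rcases Nat.eq_zero_or_pos (p i) with h0 | h0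
    · rw [h0]
      exact ⟨_, _, _, Tang.horizontal (a i - 0 - 1), by rw [hrow (a i - 0) hi]⟩
    · have h2 := (Tang.vertical h1 (v i)).iterate_reflect (p i)
      refine ⟨[], _, _, ((Tang.horizontal (p i - 1)).append h2).append (Tang.horizontal (a i - p i)), ?_⟩
      rw [hrow _ h0]; simp

end Word
end SolidTorus

open SolidTorus LaurentPolynomial in
theorem mainTheorem9 (n m : ℕ) (h v p k u w : ℕ → ℕ) (hn : 1 ≤ n) (hm : 1 ≤ m)
    -- the entries of the link
    (hh : ∀ i, 2 ≤ i → i ≤ n → 1 ≤ h i) (hv : ∀ i, 1 ≤ i → i < n → 1 ≤ v i)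
    (hp : ∀ i, 1 ≤ i → i < n → p i ≤ 2 * h i)
    -- the entries of the knot
    (hk : ∀ i, 1 ≤ i → i ≤ m → 1 ≤ k i) (hu : ∀ i, 1 ≤ i → i < m → 1 ≤ u i)
    (hw : ∀ i, 1 ≤ i → i < m → w i ≤ if i = 1 then 2 * k 1 - 1 else 2 * k i) :
    ∃ chiP chiM chiK : LaurentPolynomial ℤ,
      SolidTorus.chiPlus (SolidTorus.rational n (fun i => 2 * h i) v p) = {chiP} ∧
      SolidTorus.chiMinus (SolidTorus.rational n (fun i => 2 * h i) v p) = {chiM} ∧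
      (SolidTorus.rational m (fun i => if i = 1 then 2 * k 1 - 1 else 2 * k i) u w).knotPolys = {chiK} ∧
      (SolidTorus.connectSum (SolidTorus.rationalTangle n (fun i => 2 * h i) v p)
        (SolidTorus.rationalTangle m (fun i => if i = 1 then 2 * k 1 - 1 else 2 * k i) u w)).knotPolys =
        {if 1 ≤ h 1 then chiP + chiM + chiK else chiP + chiM - (LaurentPolynomial.T (-1) + 1) + chiK} := by
  set a : ℕ → ℕ := fun i => 2 * h i with ha
  set b : ℕ → ℕ := fun i => if i = 1 then 2 * k 1 - 1 else 2 * k i with hb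
  have hk1 := hk 1 le_rfl hm
  have ha2 : ∀ j, a j % 2 = 0 := fun j => by simp [ha]
  have hb2 : ∀ j, 1 < j → b j % 2 = 0 := fun j hj => by simp [hb, hj.ne']
  have hb1 : b 1 = 2 * k 1 - 1 := by simp [hb]
  set V₁ := Word.tangleWord a v p 1 (n - 1) with hV₁
  set V₂ := Word.tangleWord b u w 1 (m - 1) with hV₂
  have r₁ : Word.InRange 2 V₁ := Word.inRange_tangleWord ..
  have r₂ : Word.InRange 2 V₂ := Word.inRange_tangleWord ..
  have t₁ : Tang false V₁ := by
    have := tang_tangleWord (a := a) (v := v) (p := p) (i := 1) (l := n - 1) (fun j _ _ => ha2 j)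
      fun j h1 h2 => hp j h1 (by omega)
    rwa [ha2] at this
  have t₂ : Tang true V₂ := by
    have := tang_tangleWord (a := b) (v := u) (p := w) (i := 1) (l := m - 1) (fun j h1 _ => hb2 j h1)
      fun j h1 h2 => hw j h1 (by omega)
    rwa [show b 1 % 2 = 1 by omega] at this
  have k₂ : V₂.HasFinalRow := Word.hasFinalRow_tangleWord (by omega) (fun j h1 _ => hb2 j h1)
      fun j h1 h2 => hw j h1 (by omega)
  have e₁ : rational n a v p = V₁.closure := by
    rw [rational, rationalTangle, ← Word.map_toFront_tangleWord]; rfl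
  have e₂ : rational m b u w = V₂.closure := by
    rw [rational, rationalTangle, ← Word.map_toFront_tangleWord]; rfl
  have e₃ : connectSum (rationalTangle n a v p) (rationalTangle m b u w) = Word.closure (V₁ ++ V₂) := by
    rw [connectSum, rationalTangle, rationalTangle, ← Word.map_toFront_tangleWord,
      ← Word.map_toFront_tangleWord, Word.closure, List.map_append]
  have r₃ : Word.InRange 2 (V₁ ++ V₂) := by
    rw [Word.inRange_append, t₁.gain_eq_zero]; exact ⟨r₁, r₂⟩
  have t₃ : Tang true (V₁ ++ V₂) := t₁.append t₂
  have knot : V₂.closure.knotPolys = {t₂.rowPoly} := by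
    have H := Word.resolved r₂ t₂.gain_eq_zero
    exact Word.knotPolys_closure r₂ t₂ k₂ fun μ hμ h01 =>
      t₂.sum_rowTerm r₂ hμ V₂.drop_closure (fun e he => H.lineAfter_of_le (by omega)) h01
  have sum : (Word.closure (V₁ ++ V₂)).knotPolys = {t₁.rowPoly + t₂.rowPoly} := by
    have H := Word.resolved r₃ t₃.gain_eq_zero
    have hlen : (Word.events (V₁ ++ V₂)).length = (Word.events V₁).length + (Word.events V₂).length := by
      rw [Word.events_append, List.length_append]
    refine Word.knotPolys_closure r₃ t₃ (Word.hasFinalRow_append V₁ k₂) fun μ hμ h01 => ?_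
    have d₁ : (Word.closure (V₁ ++ V₂)).events.drop 0 =
        Word.events V₁ ++ (Word.events V₂ ++ [.cross false 0, .cross true 0]) := by
      rw [Word.drop_closure, Word.events_append, List.append_assoc]
    have d₂ : (Word.closure (V₁ ++ V₂)).events.drop (0 + (Word.events V₁).length) =
        Word.events V₂ ++ [.cross false 0, .cross true 0] := by
      rw [← List.drop_drop, d₁, List.drop_left]
    -- at the left end of the second tangle the potential is again equal on the two strands
    have l₁ := t₁.labels_rows r₁ (Diagram.isMaslov_iff.1 hμ) d₁ fun e he => H.lineAfter_of_le (by omega)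
    rw [Word.number_append, Word.rows, List.filterMap_append, List.map_append, List.sum_append]
    refine congrArg₂ _ (t₁.sum_rowTerm r₁ hμ d₁ (fun e he => H.lineAfter_of_le (by omega)) h01)
      (t₂.sum_rowTerm r₂ hμ d₂ (fun e he => H.lineAfter_of_le (by omega)) ?_)
    rw [l₁.2.2.1, l₁.2.2.2]
    exact h01
  rw [e₁, e₂, e₃, knot, sum]
  -- the last level of the link has a row crossing exactly if `h 1` is positive
  by_cases h1 : 1 ≤ h 1
  · have k₁ : V₁.HasFinalRow := Word.hasFinalRow_tangleWord (by simp only [ha]; omega) (fun j _ _ => ha2 j)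
      fun j h1 h2 => hp j h1 (by omega)
    obtain ⟨P, M, hP, hM, hPM⟩ := Word.chi_closure (δ := 0) r₁ t₁ fun μ ε A B hμ h01 hε hA hB => by
      rw [Word.chekanovPoly_of_row r₁ t₁ k₁ hμ h01 hε hA hB]; simp
    exact ⟨P, M, _, hP, hM, rfl, by rw [if_pos h1, hPM, zero_add]⟩
  · have k₁ : V₁ = [] ∨ ∃ T, Tang false T ∧ Relation.ReflTransGen Slide (vertSum T) V₁ := by
      have a1 : a 1 = 0 := by simp only [ha]; omega
      obtain hn1 | hn1 : n = 1 ∨ 1 < n := by omega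
      · left
        rw [hV₁, hn1, Nat.sub_self, Word.tangleWord, a1]; rfl
      · right
        obtain ⟨l, hl⟩ : ∃ l, n - 1 = l + 1 := ⟨n - 2, by omega⟩
        obtain ⟨v', hv'⟩ := Nat.exists_eq_add_of_le' (hv 1 le_rfl hn1)
        have p1 : p 1 = 0 := by have := hp 1 le_rfl hn1; omega
        have tt := tang_tangleWord (a := a) (v := v) (p := p) (i := 1 + 1) (l := l) (fun j _ _ => ha2 j)
          fun j h1 h2 => hp j (by omega) (by omega)
        rw [ha2] at tt
        refine ⟨_, Tang.vertical tt v', ?_⟩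
        rw [hV₁, hl, Word.tangleWord, Word.addLevelWord, a1, p1, hv']
        simpa [Word.horizontalWord] using Word.slides_vertical v' _
    obtain ⟨P, M, hP, hM, hPM⟩ := Word.chi_closure (δ := T (-1) + 1) r₁ t₁ fun μ ε A B hμ h01 hε hA hB =>
      Word.chekanovPoly_of_vertical r₁ t₁ k₁ hμ h01 hε hA hB
    exact ⟨P, M, _, hP, hM, rfl, by rw [if_neg h1, hPM]; congr 1; ring⟩
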